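/- Let $N$ be a positive integer and let $V$ be the space of trace zero matrices in $\mathrm{Mat}_2(\mathbb Q)$ with quadratic form $Q(X)=-N\det X$, bilinear form $(X,Y)=N\,\mathrm{tr}(XY)$, and the action $g.X=gXg^{-1}$ of $\mathrm{SL}_2(\mathbb Q)$. Let $L\subset V$ be an even lattice of full rank with dual lattice $L'$, and let $\Gamma\subset \mathrm{SL}_2(\mathbb Z)$ be a congruence subgroup which takes $L$ to itself and acts trivially on $L'/L$. Write $\mathrm{Iso}(V)$ for the set of isotropic lines in $V$, $u_0=\begin{pmatrix}0&1\\0&0\end{pmatrix}$ and $\ell_0=\mathbb Q u_0$. For each class in $\Gamma\backslash\mathrm{Iso}(V)$ choose a representative $\ell$ and $\sigma_\ell\in \mathrm{SL}_2(\mathbb Z)$ with $\sigma_\ell\ell_0=\ell$; let $\alpha_\ell$ be the width of the cusp $\ell$ (the least $a\in\mathbb Z_{>0}$ with $\pm\sigma_\ell\begin{pmatrix}1&a\\0&1\end{pmatrix}\sigma_\ell^{-1}\in\Gamma$ for some choice of sign), let $\beta_\ell>0$ be the rational number such that $\beta_\ell\,\sigma_\ell.u_0$ is a primitive vector of $\ell\cap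 L$, and put $\varepsilon_\ell=\alpha_\ell/\beta_\ell$. For $z=x+iy$ and $\tau=u+iv$ in the upper half plane $\mathbb H$ put $X(z)=\frac1{\sqrt N y}\begin{pmatrix}-x&|z|^2\\-1&x\end{pmatrix}$, $(X,X)_z=(X,X)+(X,X(z))^2$, $$\varphi_0(X,\tau,z)=\sqrt v\,e^{\pi i(u(X,X)+iv(X,X)_z)},\qquad \theta_h(\tau,z)=\sum_{X\in h+L}\varphi_0(X,\tau,z)\quad(h\in L'/L),$$ and $\Theta_L=\sum_{h\in L'/L}\theta_h\mathfrak e_h$, where $(\mathfrak e_h)$ is the standard basis of $\mathbb C[L'/L]$. For $\ell\in\mathrm{Iso}(V)$ let $K_\ell=(L\cap\ell^\perp)/(L\cap\ell)\subset\ell^\perp/\ell$, with the quadratic form induced by $Q$, and let $$\tilde\Theta_{K_\ell}(\tau)=\sum_{h\in L'/L,\ h\perp\ell}\ \Big(\sum_{\lambda\in\bar h+K_\ell}e^{2\pi iQ(\lambda)\tau}\Big)\mathfrak e_h ,$$ where $h\perp\ell$ means that $h+L$ meets $\ell^\perp$, and $\bar h$ is the image in $\ell^\perp/\ell$ of an element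 of $(h+L)\cap\ell^\perp$. Let $\Delta_k=-v^2\left(\partial_u^2+\partial_v^2\right)+ikv\left(\partial_u+i\partial_v\right)$. A weak Maass form of weight $0$ for $\Gamma$ with eigenvalue $\lambda$ is a $\Gamma$-invariant $C^\infty$ function $f:\mathbb H\to\mathbb C$ with $\Delta_0f=\lambda f$ for which there is a $C>0$ such that for every $\delta\in \mathrm{SL}_2(\mathbb Z)$ one has $f(\delta z)=O(e^{Cy})$ as $y\to\infty$, uniformly in $x$. Let $\mathcal F=\{z\in\mathbb H: |x|\le\frac12,\ |z|\ge1\}$, and for $a\in\mathbb Z_{>0}$, $T>0$ let $\mathcal F^a_T=\{z\in\bigcup_{j=0}^{a-1}(\mathcal F+j): y\le T\}$. The regularized theta lift $I^{reg}(\tau,f)$ is the constant term in the Laurent expansion at $s=0$ of the meromorphic continuation in $s$ (from a right half plane to $\mathbb C$) of $$I^{reg}(\tau,s,f)=\sum_{\ell\in\Gamma\backslash\mathrm{Iso}(V)}\lim_{T\to\infty}\int_{\mathcal F_T^{\alpha_\ell}}f(\sigma_\ell z)\,\Theta_L(\tau,\sigma_\ell z)\,y^{-s}\,\frac{dx\,dy}{y^2}.$$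 **Theorem.** Let $f$ be a weak Maass form of weight $0$ for $\Gamma$ with eigenvalue $\lambda=s'(1-s')$, $s'\in\mathbb C$, whose Fourier expansion at each cusp $\ell$ (that is, the expansion of $f(\sigma_\ell z)$ in $e^{2\pi i n x/\alpha_\ell}$) has constant term $A_\ell y^{s'}+B_\ell y^{1-s'}$ with constants $A_\ell,B_\ell\in\mathbb C$. Then $I^{reg}(\tau,f)$ is well defined for every $\tau\in\mathbb H$ (the limits exist for all $s$ in some right half plane and the continuation exists), it is a $C^\infty$ function of $\tau$, and with $\Delta_\tau=\Delta_{1/2}$ acting on the variable $\tau$, $$4\Delta_\tau I^{reg}(\tau,f)=\begin{cases}\lambda\, I^{reg}(\tau,f),&\text{if }s'\ne0,1,\\[1ex] -\sum_{\ell\in\Gamma\backslash\mathrm{Iso}(V)}\dfrac{A_\ell\varepsilon_\ell}{\sqrt N}\tilde\Theta_{K_\ell}(\tau),&\text{if }s'=0,\\[1ex] -\sum_{\ell\in\Gamma\backslash\mathrm{Iso}(V)}\dfrac{B_\ell\varepsilon_\ell}{\sqrt N}\tilde\Theta_{K_\ell}(\tau),&\text{if }s'=1.\end{cases}$$ -/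

import Mathlib

open Filter Topology MeasureTheory
open scoped UpperHalfPlane MatrixGroups ContDiff Real Polynomial

noncomputable section

namespace ThetaLift

/-! ### The quadratic space and the action of `SL(2, ℤ)` -/

/-- The space of trace zero rational `2 × 2` matrices. -/
def V : Type := LinearMap.ker (Matrix.traceLinearMap (Fin 2) ℚ ℚ)

instance : AddCommGroup V :=
  inferInstanceAs (AddCommGroup (LinearMap.ker (Matrix.traceLinearMap (Fin 2) ℚ ℚ)))

instance : Module ℚ V :=
  inferInstanceAs (Module ℚ (LinearMap.ker (Matrix.traceLinearMap (Fin 2) ℚ ℚ)))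

/-- The underlying matrix of an element of `V`. -/
def V.mat (X : V) : Matrix (Fin 2) (Fin 2) ℚ := Subtype.val X

lemma V.ext {X Y : V} (h : X.mat = Y.mat) : X = Y := Subtype.ext h

lemma V.trace_mat (X : V) : X.mat.trace = 0 := X.2

@[simp] lemma V.mat_zero : (0 : V).mat = 0 := rfl

@[simp] lemma V.mat_add (X Y : V) : (X + Y).mat = X.mat + Y.mat := rfl

@[simp] lemma V.mat_smul (c : ℚ) (X : V) : (c • X).mat = c • X.mat := rfl

/-- The quadratic form `Q(X) = -N det X`. -/
def quad (N : ℕ) (X : V) : ℚ := -(N : ℚ) * X.mat.det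

/-- The bilinear form `(X, Y) = N tr(XY)`; it satisfies `(X, X) = 2 Q(X)`. -/
def bil (N : ℕ) (X Y : V) : ℚ :=
  (N : ℚ) * (X.mat * Y.mat).trace

/-- The image of an integral matrix in the rational matrices. -/
def toRat (g : SL(2, ℤ)) : Matrix (Fin 2) (Fin 2) ℚ :=
  (g : Matrix (Fin 2) (Fin 2) ℤ).map (Int.castRingHom ℚ)

lemma toRat_one : toRat 1 = 1 := by
  simp [toRat]

lemma toRat_mul (g h : SL(2, ℤ)) : toRat (g * h) = toRat g * toRat h := by
  simp only [toRat, Matrix.SpecialLinearGroup.coe_mul, Matrix.map_mul]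

lemma toRat_inv_mul (g : SL(2, ℤ)) : toRat g⁻¹ * toRat g = 1 := by
  rw [← toRat_mul, inv_mul_cancel, toRat_one]

lemma toRat_mul_inv (g : SL(2, ℤ)) : toRat g * toRat g⁻¹ = 1 := by
  rw [← toRat_mul, mul_inv_cancel, toRat_one]

/-- The action `g.X = g X g⁻¹` on `V`. -/
def act (g : SL(2, ℤ)) : V →ₗ[ℚ] V where
  toFun X := ⟨toRat g * X.mat * toRat g⁻¹, by
    have hX : X.mat.trace = 0 := X.trace_mat
    rw [LinearMap.mem_ker, Matrix.traceLinearMap_apply, Matrix.trace_mul_comm, ← mul_assoc,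
      toRat_inv_mul, one_mul, hX]⟩
  map_add' X Y := by
    apply V.ext
    change _ * (X + Y).mat * _ = _ * X.mat * _ + _ * Y.mat * _
    simp [mul_add, add_mul]
  map_smul' c X := by
    apply V.ext
    change _ * (c • X).mat * _ = c • (_ * X.mat * _)
    simp

lemma coe_act (g : SL(2, ℤ)) (X : V) : (act g X).mat =
    toRat g * X.mat * toRat g⁻¹ := rfl

lemma act_one : act 1 = LinearMap.id := by
  ext1 X
  apply V.ext
  simp [coe_act, toRat_one]

lemma act_mul (g h : SL(2, ℤ)) : act (g * h) = act g ∘ₗ act h := by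
  ext1 X
  apply V.ext
  simp [coe_act, toRat_mul, mul_assoc]

lemma quad_act (N : ℕ) (g : SL(2, ℤ)) (X : V) : quad N (act g X) = quad N X := by
  have h : (toRat g).det * (toRat g⁻¹).det = 1 := by
    rw [← Matrix.det_mul, toRat_mul_inv, Matrix.det_one]
  rw [quad, quad, coe_act, Matrix.det_mul, Matrix.det_mul, mul_right_comm _ _ (toRat g⁻¹).det, h,
    one_mul]

/-! ### Isotropic lines and cusps -/

/-- The isotropic lines of `V`. -/
abbrev IsoLine (N : ℕ) : Type :=
  {l : Submodule ℚ V // Module.finrank ℚ l = 1 ∧ ∀ X ∈ l, quad N X = 0}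

/-- Two isotropic lines are equivalent when an element of `Γ` maps one to the other. -/
def cuspSetoid (N : ℕ) (Γ : Subgroup SL(2, ℤ)) : Setoid (IsoLine N) where
  r l m := ∃ γ ∈ Γ, l.1.map (act γ) = m.1
  iseqv :=
    { refl := fun l => ⟨1, Γ.one_mem, by rw [act_one, Submodule.map_id]⟩
      symm := by
        rintro l m ⟨γ, hγ, h⟩
        refine ⟨γ⁻¹, Γ.inv_mem hγ, ?_⟩
        rw [← h, ← Submodule.map_comp, ← act_mul, inv_mul_cancel, act_one, Submodule.map_id]
      trans := by
        rintro l m n ⟨γ, hγ, h⟩ ⟨δ, hδ, h'⟩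
        refine ⟨δ * γ, Γ.mul_mem hδ hγ, ?_⟩
        rw [act_mul, Submodule.map_comp, h, h'] }

/-- The cusps of `Γ`: the set `Γ \ Iso(V)` of classes of isotropic lines. -/
abbrev Cusp (N : ℕ) (Γ : Subgroup SL(2, ℤ)) : Type := Quotient (cuspSetoid N Γ)

/-- The vector `u₀ = (0, 1; 0, 0)`. -/
def u₀ : V := ⟨!![0, 1; 0, 0], by simp [Matrix.trace, Fin.sum_univ_two]⟩

lemma u₀_mat : u₀.mat = !![0, 1; 0, 0] := rfl

lemma u₀_ne_zero : u₀ ≠ 0 := by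
  intro h
  have := congrArg (fun X : V => X.mat 0 1) h
  simp [u₀_mat] at this

/-- The isotropic line `σ ℓ₀`, spanned by `σ.u₀`. -/
def lineOf (N : ℕ) (σ : SL(2, ℤ)) : IsoLine N :=
  ⟨Submodule.span ℚ {act σ u₀}, by
    refine ⟨finrank_span_singleton fun h => u₀_ne_zero ?_, ?_⟩
    · have := congrArg (act σ⁻¹) h
      rwa [← LinearMap.comp_apply, ← act_mul, inv_mul_cancel, act_one, map_zero] at this
    · intro X hX
      obtain ⟨c, rfl⟩ := Submodule.mem_span_singleton.mp hX
      rw [← map_smul, quad_act]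
      simp [quad, u₀_mat, Matrix.det_fin_two]⟩

/-! ### Lattices, dual lattices and discriminant groups -/

/-- `L` is an even lattice of full rank in `V`. -/
structure IsEvenLattice (N : ℕ) (L : AddSubgroup V) : Prop where
  fg : L.FG
  span_eq_top : Submodule.span ℚ (L : Set V) = ⊤
  even : ∀ X ∈ L, ∃ n : ℤ, quad N X = n

lemma bil_add_left (N : ℕ) (X Y Z : V) : bil N (X + Y) Z = bil N X Z + bil N Y Z := by
  simp [bil, add_mul, mul_add, Matrix.trace_add]

lemma bil_comm (N : ℕ) (X Y : V) : bil N X Y = bil N Y X := by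
  rw [bil, bil, Matrix.trace_mul_comm]

lemma bil_smul_left (N : ℕ) (c : ℚ) (X Y : V) : bil N (c • X) Y = c * bil N X Y := by
  simp [bil, Matrix.trace_smul]; ring

lemma bil_neg_left (N : ℕ) (X Y : V) : bil N (-X) Y = -bil N X Y := by
  rw [← neg_one_smul ℚ X, bil_smul_left, neg_one_mul]

lemma bil_zero_left (N : ℕ) (Y : V) : bil N 0 Y = 0 := by
  rw [← zero_smul ℚ (0 : V), bil_smul_left, zero_mul]

lemma quad_add (N : ℕ) (X Y : V) : quad N (X + Y) = quad N X + bil N X Y + quad N Y := by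
  have hX : X.mat.trace = 0 := X.trace_mat
  have hY : Y.mat.trace = 0 := Y.trace_mat
  rw [Matrix.trace_fin_two] at hX hY
  simp only [quad, bil, Matrix.det_fin_two, Matrix.trace_fin_two, Matrix.mul_apply,
    Fin.sum_univ_two, V.mat_add, Matrix.add_apply]
  rw [eq_neg_of_add_eq_zero_right hX, eq_neg_of_add_eq_zero_right hY]
  ring

/-- The dual lattice `L'`. -/
def dual (N : ℕ) (L : AddSubgroup V) : AddSubgroup V where
  carrier := {X | ∀ Y ∈ L, ∃ n : ℤ, bil N X Y = n}
  zero_mem' := fun Y _ => ⟨0, by simp [bil_zero_left]⟩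
  add_mem' := by
    intro X X' hX hX' Y hY
    obtain ⟨n, hn⟩ := hX Y hY
    obtain ⟨m, hm⟩ := hX' Y hY
    exact ⟨n + m, by rw [bil_add_left, hn, hm, Int.cast_add]⟩
  neg_mem' := by
    intro X hX Y hY
    obtain ⟨n, hn⟩ := hX Y hY
    exact ⟨-n, by rw [bil_neg_left, hn, Int.cast_neg]⟩

/-- The discriminant group `L' / L`. -/
abbrev Disc (N : ℕ) (L : AddSubgroup V) : Type := dual N L ⧸ L.addSubgroupOf (dual N L)

/-- The coset `h + L` of `h ∈ L' / L`, as a subset of `V`. -/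
def coset (N : ℕ) (L : AddSubgroup V) (h : Disc N L) : Set V :=
  {X | ∃ hX : X ∈ dual N L, (QuotientAddGroup.mk (⟨X, hX⟩ : dual N L) : Disc N L) = h}

/-- `Γ` takes `L` to itself and acts trivially on `L' / L`. -/
structure ActsTriviallyOnDisc (N : ℕ) (L : AddSubgroup V) (Γ : Subgroup SL(2, ℤ)) : Prop where
  map_eq : ∀ γ ∈ Γ, L.map (act γ).toAddMonoidHom = L
  sub_mem : ∀ γ ∈ Γ, ∀ X ∈ dual N L, act γ X - X ∈ L

/-! ### The Siegel theta function -/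

/-- The vector `X(z) = (1 / (√N y)) (-x, |z|²; -1, x)`, which spans the negative line of `z`. -/
def vecAt (N : ℕ) (z : ℍ) : Matrix (Fin 2) (Fin 2) ℝ :=
  (1 / (√(N : ℝ) * z.im)) • !![-z.re, Complex.normSq (z : ℂ); -1, z.re]

/-- The pairing `(X, X(z))`. -/
def pairAt (N : ℕ) (X : V) (z : ℍ) : ℝ :=
  (N : ℝ) * (X.mat.map (Rat.castHom ℝ) * vecAt N z).trace

/-- The majorant `(X, X)_z = (X, X) + (X, X(z))²`. -/
def majorant (N : ℕ) (X : V) (z : ℍ) : ℝ := ((bil N X X : ℚ) : ℝ) + pairAt N X z ^ 2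

/-- The Gaussian `φ₀(X, τ, z) = √v exp(π i (u (X, X) + i v (X, X)_z))`, where `τ = u + i v`. -/
def phi0 (N : ℕ) (X : V) (τ z : ℍ) : ℂ :=
  (√τ.im : ℂ) * Complex.exp (π * Complex.I *
    (τ.re * ((bil N X X : ℚ) : ℂ) + Complex.I * τ.im * (majorant N X z : ℂ)))

/-- The component `θ_h(τ, z, φ₀)` of the theta function of `L`. -/
def theta (N : ℕ) (L : AddSubgroup V) (h : Disc N L) (τ z : ℍ) : ℂ :=
  ∑' X : coset N L h, phi0 N X τ z

/-! ### The unary theta functions attached to isotropic lines -/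

/-- The orthogonal complement of an isotropic line. -/
def perp (N : ℕ) (l : IsoLine N) : Submodule ℚ V where
  carrier := {X | ∀ Y ∈ l.1, bil N X Y = 0}
  zero_mem' := fun Y _ => bil_zero_left N Y
  add_mem' := by
    intro X X' hX hX' Y hY
    rw [bil_add_left, hX Y hY, hX' Y hY, add_zero]
  smul_mem' := by
    intro c X hX Y hY
    rw [bil_smul_left, hX Y hY, mul_zero]

/-- The space `W = ℓ^⊥ / ℓ`. -/
abbrev W (N : ℕ) (l : IsoLine N) : Type := perp N l ⧸ l.1.submoduleOf (perp N l)

/-- The quadratic form on `W` induced by `Q`. -/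
def quadW (N : ℕ) (l : IsoLine N) (w : W N l) : ℚ :=
  Quotient.liftOn' w (fun X => quad N X) (by
    intro X Y h
    have h' : ((X : V) - (Y : V)) ∈ l.1 := (Submodule.quotientRel_def (l.1.submoduleOf (perp N l))).mp h
    have e : quad N ((Y : V) + ((X : V) - (Y : V))) = quad N Y := by
      rw [quad_add, Y.2 _ h', l.2.2 _ h', add_zero, add_zero]
    simpa using e)

/-- The lattice `K_ℓ = (L ∩ ℓ^⊥) / (L ∩ ℓ)`, as a subgroup of `W`. -/
def latticeK (N : ℕ) (L : AddSubgroup V) (l : IsoLine N) : AddSubgroup (W N l) :=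
  (L.comap (perp N l).subtype.toAddMonoidHom).map
    (l.1.submoduleOf (perp N l)).mkQ.toAddMonoidHom

/-- The theta function `∑ e(Q(λ) τ)` of the coset `μ` of `K_ℓ`, the sum being over `λ ∈ μ`. -/
def thetaK (N : ℕ) (L : AddSubgroup V) (l : IsoLine N) (μ : W N l ⧸ latticeK N L l) (τ : ℍ) : ℂ :=
  ∑' w : {w : W N l // (QuotientAddGroup.mk w : W N l ⧸ latticeK N L l) = μ},
    Complex.exp (2 * π * Complex.I * ((quadW N l w : ℚ) : ℂ) * (τ : ℂ))

/-- The coset of `K_ℓ` in `W` determined by a vector of `ℓ^⊥`. -/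
def cosetK (N : ℕ) (L : AddSubgroup V) (l : IsoLine N) (X : perp N l) : W N l ⧸ latticeK N L l :=
  QuotientAddGroup.mk (Submodule.Quotient.mk X : W N l)

open Classical in
/-- The component of index `h` of the lift of the theta function of `K_ℓ` to `L`. It is zero
unless `h ⟂ ℓ`, that is, unless `h + L` meets `ℓ^⊥`; in that case it is the theta function of the
coset which a representative of `h` in `ℓ^⊥` determines. -/
def tildeTheta (N : ℕ) (L : AddSubgroup V) (l : IsoLine N) (h : Disc N L) (τ : ℍ) : ℂ :=
  if hX : ∃ X : perp N l, (X : V) ∈ coset N L h then thetaK N L l (cosetK N L l hX.choose) τ else 0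

/-- The value of `tildeTheta` does not depend on the representative. -/
lemma tildeTheta_eq (N : ℕ) (L : AddSubgroup V) (l : IsoLine N) (h : Disc N L) (τ : ℍ)
    (X : perp N l) (hX : (X : V) ∈ coset N L h) :
    tildeTheta N L l h τ = thetaK N L l (cosetK N L l X) τ := by
  have hex : ∃ X : perp N l, (X : V) ∈ coset N L h := ⟨X, hX⟩
  rw [tildeTheta, dif_pos hex]
  congr 1
  obtain ⟨h1, e1⟩ := hex.choose_spec
  obtain ⟨h2, e2⟩ := hX
  have h3 := QuotientAddGroup.eq.mp (e1.trans e2.symm)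
  refine QuotientAddGroup.eq.mpr ⟨-hex.choose + X, ?_, rfl⟩
  simpa [AddSubgroup.mem_addSubgroupOf] using h3

/-! ### Cusp widths -/

/-- The width of the cusp `σ ∞`: the least `a > 0` such that `± σ (1, a; 0, 1) σ⁻¹ ∈ Γ`. -/
def cuspWidth (Γ : Subgroup SL(2, ℤ)) (σ : SL(2, ℤ)) : ℕ :=
  sInf {a : ℕ | 0 < a ∧
    (σ * ModularGroup.T ^ a * σ⁻¹ ∈ Γ ∨ -(σ * ModularGroup.T ^ a * σ⁻¹) ∈ Γ)}

/-- The number `β > 0` such that `β (σ.u₀)` is a primitive vector of `L ∩ σ ℓ₀`: the least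
positive `b` with `b (σ.u₀) ∈ L`. -/
def cuspBeta (L : AddSubgroup V) (σ : SL(2, ℤ)) : ℝ :=
  sInf {b : ℝ | 0 < b ∧ ∃ q : ℚ, (q : ℝ) = b ∧ q • act σ u₀ ∈ L}

/-- The quotient `ε = α / β`. -/
def cuspEps (L : AddSubgroup V) (Γ : Subgroup SL(2, ℤ)) (σ : SL(2, ℤ)) : ℝ :=
  cuspWidth Γ σ / cuspBeta L σ

/-! ### Weak Maass forms -/

/-- Derivative in the direction of the real part, of a function on the upper half plane
extended to `ℂ`. -/
def dRe (F : ℂ → ℂ) (z : ℂ) : ℂ := lineDeriv ℝ F z 1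

/-- Derivative in the direction of the imaginary part. -/
def dIm (F : ℂ → ℂ) (z : ℂ) : ℂ := lineDeriv ℝ F z Complex.I

/-- The hyperbolic Laplacian of weight `k`,
`Δ_k = -v² (∂²/∂u² + ∂²/∂v²) + i k v (∂/∂u + i ∂/∂v)`. -/
def hypLaplacian (k : ℝ) (F : ℍ → ℂ) (τ : ℍ) : ℂ :=
  -(τ.im : ℂ) ^ 2 * (dRe (dRe (F ∘ UpperHalfPlane.ofComplex)) τ +
      dIm (dIm (F ∘ UpperHalfPlane.ofComplex)) τ) +
    Complex.I * k * τ.im * (dRe (F ∘ UpperHalfPlane.ofComplex) τ +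
      Complex.I * dIm (F ∘ UpperHalfPlane.ofComplex) τ)

/-- `F` is `C^∞` (in the real sense) on the upper half plane. -/
def IsSmooth (F : ℍ → ℂ) : Prop :=
  ContDiffOn ℝ ∞ (F ∘ UpperHalfPlane.ofComplex) {z : ℂ | 0 < z.im}

/-- `f` is a weak Maass form of weight `0` for `Γ` with eigenvalue `lam`. -/
structure IsWeakMaassForm (Γ : Subgroup SL(2, ℤ)) (lam : ℂ) (f : ℍ → ℂ) : Prop where
  smooth : IsSmooth f
  invariant : ∀ γ ∈ Γ, ∀ z : ℍ, f (γ • z) = f z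
  eigen : ∀ z : ℍ, hypLaplacian 0 f z = lam * f z
  growth : ∃ C : ℝ, 0 < C ∧ ∀ δ : SL(2, ℤ), ∃ K Y : ℝ, ∀ z : ℍ, Y ≤ z.im →
    ‖f (δ • z)‖ ≤ K * Real.exp (C * z.im)

/-- The constant term at height `y` of the Fourier expansion of `f` at the cusp `σ ∞`. -/
def constTerm (Γ : Subgroup SL(2, ℤ)) (σ : SL(2, ℤ)) (f : ℍ → ℂ) (y : ℝ) : ℂ :=
  (1 / (cuspWidth Γ σ : ℂ)) * ∫ x in (0 : ℝ)..(cuspWidth Γ σ : ℝ),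
    f (σ • UpperHalfPlane.ofComplex (x + y * Complex.I))

/-! ### The regularized theta lift -/

/-- The truncated domain `𝓕^a_T`: the points `z` with `Im z ≤ T` in the union of the translates
by `0, …, a - 1` of the standard fundamental domain of `SL(2, ℤ)`. -/
def truncDomain (a : ℕ) (T : ℝ) : Set ℍ :=
  {z | (∃ j ∈ Finset.range a, ∃ w ∈ ModularGroup.fd, z = (j : ℝ) +ᵥ w) ∧ z.im ≤ T}

/-- The integral of `f(σ z) θ_h(τ, σ z, φ₀) y^{-s}` over the truncated domain with respect to the
measure `dx dy / y²`. -/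
def truncIntegral (N : ℕ) (L : AddSubgroup V) (Γ : Subgroup SL(2, ℤ)) (σ : SL(2, ℤ)) (f : ℍ → ℂ)
    (h : Disc N L) (τ : ℍ) (s : ℂ) (T : ℝ) : ℂ :=
  ∫ z in truncDomain (cuspWidth Γ σ) T, f (σ • z) * theta N L h τ (σ • z) * (z.im : ℂ) ^ (-s)

/-- `c` is the constant term of the Laurent expansion of `H` at `s₀`: near `s₀`, `H` is the sum of
a polynomial without constant term in `(s - s₀)⁻¹` and an analytic function with value `c`. -/
def HasLaurentConstTerm (H : ℂ → ℂ) (s₀ c : ℂ) : Prop :=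
  ∃ P : ℂ[X], P.coeff 0 = 0 ∧ ∃ g : ℂ → ℂ, AnalyticAt ℂ g s₀ ∧ g s₀ = c ∧
    ∀ᶠ s in 𝓝[≠] s₀, H s = P.eval (s - s₀)⁻¹ + g s

/-- `H` is a meromorphic continuation to `ℂ` of the component of index `h` of `I^{reg}(τ, s, f)`:
on some right half plane, for each cusp the truncated integrals converge as `T → ∞`, and `H(s)` is
the sum of their limits over the cusps. Here `σ` picks a matrix for each cusp. -/
def IsContinuation (N : ℕ) (L : AddSubgroup V) (Γ : Subgroup SL(2, ℤ)) (σ : Cusp N Γ → SL(2, ℤ))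
    (f : ℍ → ℂ) (h : Disc N L) (τ : ℍ) (H : ℂ → ℂ) : Prop :=
  Meromorphic H ∧ ∃ r : ℝ, ∀ s : ℂ, r < s.re → ∃ J : Cusp N Γ → ℂ,
    (∀ c, Tendsto (truncIntegral N L Γ (σ c) f h τ s) atTop (𝓝 (J c))) ∧ H s = ∑ᶠ c, J c

/-- `b` is the value at `τ` of the component of index `h` of the regularized theta lift of `f`. -/
def IsRegLiftValue (N : ℕ) (L : AddSubgroup V) (Γ : Subgroup SL(2, ℤ)) (σ : Cusp N Γ → SL(2, ℤ))
    (f : ℍ → ℂ) (h : Disc N L) (τ : ℍ) (b : ℂ) : Prop :=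
  ∃ H : ℂ → ℂ, IsContinuation N L Γ σ f h τ H ∧ HasLaurentConstTerm H 0 b

open Classical in
/-- The component of index `h` of the regularized theta lift `I^{reg}(τ, f)`: the constant term at
`s = 0` of the meromorphic continuation of `I^{reg}(τ, s, f)` (and `0` if there is none). -/
def regLift (N : ℕ) (L : AddSubgroup V) (Γ : Subgroup SL(2, ℤ)) (σ : Cusp N Γ → SL(2, ℤ))
    (f : ℍ → ℂ) (h : Disc N L) (τ : ℍ) : ℂ :=
  if hb : ∃ b, IsRegLiftValue N L Γ σ f h τ b then hb.choose else 0

lemma HasLaurentConstTerm.unique {H H' : ℂ → ℂ} {s₀ c c' : ℂ} (h : HasLaurentConstTerm H s₀ c)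
    (h' : HasLaurentConstTerm H' s₀ c') (hH : H =ᶠ[𝓝[≠] s₀] H') : c = c' := by
  obtain ⟨P, hP, g, hg, rfl, e⟩ := h
  obtain ⟨P', hP', g', hg', rfl, e'⟩ := h'
  have key : ∀ᶠ s in 𝓝[≠] s₀, (P - P').eval (s - s₀)⁻¹ = g' s - g s := by
    filter_upwards [e, e', hH] with s h1 h2 h3
    rw [Polynomial.eval_sub]
    linear_combination h3 - h1 + h2
  have hlim : Tendsto (fun s => (P - P').eval (s - s₀)⁻¹) (𝓝[≠] s₀) (𝓝 (g' s₀ - g s₀)) :=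
    ((hg'.continuousAt.sub hg.continuousAt).tendsto.mono_left nhdsWithin_le_nhds).congr'
      (key.mono fun s hs => hs.symm)
  have hinv : Tendsto (fun s : ℂ => ‖(s - s₀)⁻¹‖) (𝓝[≠] s₀) atTop := by
    have h1 : Tendsto (fun s : ℂ => s - s₀) (𝓝[≠] s₀) (𝓝[≠] 0) := by
      refine tendsto_nhdsWithin_iff.mpr ⟨?_, ?_⟩
      · have : ContinuousAt (fun s : ℂ => s - s₀) s₀ := by fun_prop
        simpa using this.tendsto.mono_left nhdsWithin_le_nhds
      · filter_upwards [self_mem_nhdsWithin] with s hs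
        exact sub_ne_zero.mpr hs
    exact tendsto_norm_cobounded_atTop.comp (tendsto_inv₀_nhdsNE_zero.comp h1)
  have hz : P - P' = 0 := by
    by_cases hd : 0 < (P - P').degree
    · exact absurd hlim.norm (not_tendsto_nhds_of_tendsto_atTop
        ((P - P').tendsto_norm_atTop hd hinv) _)
    · rw [Polynomial.eq_C_of_degree_le_zero (not_lt.mp hd), Polynomial.coeff_sub, hP, hP', sub_zero,
        map_zero]
  have h0 : Tendsto (fun _ : ℂ => (0 : ℂ)) (𝓝[≠] s₀) (𝓝 (g' s₀ - g s₀)) := by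
    simpa [hz] using hlim
  have := tendsto_nhds_unique h0 tendsto_const_nhds
  exact (sub_eq_zero.mp this).symm

/-- The regularized lift is well defined: its value does not depend on the continuation. -/
lemma IsRegLiftValue.unique {N : ℕ} {L : AddSubgroup V} {Γ : Subgroup SL(2, ℤ)}
    {σ : Cusp N Γ → SL(2, ℤ)} {f : ℍ → ℂ} {h : Disc N L} {τ : ℍ} {b b' : ℂ}
    (hb : IsRegLiftValue N L Γ σ f h τ b) (hb' : IsRegLiftValue N L Γ σ f h τ b') : b = b' := by
  obtain ⟨H, ⟨hm, r, hr⟩, hc⟩ := hb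
  obtain ⟨H', ⟨hm', r', hr'⟩, hc'⟩ := hb'
  refine hc.unique hc' ?_
  have hD : MeromorphicOn (H - H') Set.univ := fun s _ => (hm s).sub (hm' s)
  have hEq : ∀ s : ℂ, max r r' < s.re → H s = H' s := by
    intro s hs
    obtain ⟨J, hJ, e⟩ := hr s ((le_max_left _ _).trans_lt hs)
    obtain ⟨J', hJ', e'⟩ := hr' s ((le_max_right _ _).trans_lt hs)
    rw [e, e', funext fun c => tendsto_nhds_unique (hJ c) (hJ' c)]
  by_contra hne
  have h0 : meromorphicOrderAt (H - H') 0 ≠ ⊤ := by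
    intro ht
    refine hne ((meromorphicOrderAt_eq_top_iff.mp ht).mono fun s hs => ?_)
    exact sub_eq_zero.mp hs
  refine hD.meromorphicOrderAt_ne_top_of_isPreconnected (y := ((max r r' + 1 : ℝ) : ℂ))
    isPreconnected_univ (Set.mem_univ _) (Set.mem_univ _) h0 ?_
  refine meromorphicOrderAt_eq_top_iff.mpr (Filter.Eventually.filter_mono nhdsWithin_le_nhds ?_)
  have ho : IsOpen {s : ℂ | max r r' < s.re} := isOpen_lt continuous_const Complex.continuous_re
  filter_upwards [ho.mem_nhds (by
      rw [Set.mem_ofPred_eq, Complex.ofReal_re]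
      exact lt_add_one _ : ((max r r' + 1 : ℝ) : ℂ) ∈ {s : ℂ | max r r' < s.re})]
    with s hs
  exact sub_eq_zero.mpr (hEq s hs)

lemma regLift_eq {N : ℕ} {L : AddSubgroup V} {Γ : Subgroup SL(2, ℤ)} {σ : Cusp N Γ → SL(2, ℤ)}
    {f : ℍ → ℂ} {h : Disc N L} {τ : ℍ} {b : ℂ} (hb : IsRegLiftValue N L Γ σ f h τ b) :
    regLift N L Γ σ f h τ = b := by
  have hex : ∃ b, IsRegLiftValue N L Γ σ f h τ b := ⟨b, hb⟩
  rw [regLift, dif_pos hex]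
  exact hex.choose_spec.unique hb

end ThetaLift

end

/-! Let `F` be the standard fundamental domain of `SL(2, ℤ)`. The domains of integration at the
cusps are unions of translates of truncations of `F`, so the lift is a finite sum, over the tiles `g
= σ_c T^j` with `0 ≤ j < α_c`, of integrals over `F` of `f(gz) θ_h(τ, gz) y^{-s}`. These `g`
represent the cosets `±Γ \ SL(2, ℤ)` (`tile_bijective`).

Poisson summation in the coordinate along the isotropic line (`tsum_gauss`, `exists_thetaSeries`)
turns `θ_h(τ, gz)` into `1 / (β √N)` times a series of terms `y exp(...)` indexed by `ℤ³`. The terms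
whose last two indices vanish add up to `y` times the component of the unary theta function of
`K_ℓ`; the others decay like `exp(-κ y²)` (`thetaSeries_decay`), which beats the exponential growth
of `f`. Removing the multiple of `y` above height `1` therefore leaves an integral that converges
for all `s` and is entire in `s`. The removed part sees only the constant term of `f` and
contributes `ε / √N` times the unary theta function times `A / (s - s') + B / (s - (1 - s'))`. This
gives the continuation, and its constant term at `0` is `J` minus the sum over the cusps of `ε / √N`
times the unary theta function times `A / s' + B / (1 - s')`, where `J` is the sum of the convergent
integrals and a fraction with denominator `0` counts as `0` (`isRegLiftValue`).

Every term of the series satisfies `4 Δ_{1/2, τ} = Δ_{0, z}` (`four_mul_symbolT`), and `Δ_{0, z}`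
kills `y`. Hence the unary theta functions are annihilated by `Δ_τ`, and `4 Δ_τ J` is the sum over
the tiles of the integrals of `f Δ_z θ`. Green's formula moves the Laplacian to `f`. The
contributions of the vertical sides and of the arc cancel after summation over the tiles, because
right translation by `T` and `S` permutes the cosets (`sum_tile_mul`). The upper boundary leaves
`-((1 - s') A + s' B)`, where `A` and `B` now stand for the sums over the cusps weighted by `ε / √N`
and the unary theta functions (`TileData.identity`). So `4 Δ_τ` of the lift is `λ J - ((1 - s') A +
s' B)`. If `s' ≠ 0, 1`, the boundary term is `λ` times the correction that distinguishes the lift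
from `J`; if `s'` is `0` or `1`, then `λ = 0` and only the sum of the `A` or of the `B` survives.

All differentiation under sums and integrals goes through one device, integrals of `g(a) exp(∑
k_i(a) ψ_i(p))` (`expInt`). Derivatives in `p` only multiply the integrand by polynomials in the
`k_i`, which Gaussian decay absorbs. It is applied in `z`, in `τ` and in `s`. -/

noncomputable section

namespace ThetaLift

/-! ### Integrals of exponential families -/

section ExpFamily

variable {𝕜 E Ω ι : Type*} [RCLike 𝕜] [NormedAlgebra 𝕜 ℂ] [NormedAddCommGroup E] [NormedSpace 𝕜 E]
  [MeasurableSpace Ω] [Fintype ι]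

/-- The integral of `g a * exp (∑ i, k i a * ψ i p)` over `a`. -/
def expInt (μ : Measure Ω) (k : ι → Ω → ℂ) (ψ : ι → E → ℂ) (g : Ω → ℂ) (p : E) : ℂ :=
  ∫ a, g a * Complex.exp (∑ i, k i a * ψ i p) ∂μ

/-- Locally uniformly on `U`, the integrand of `expInt` is dominated by an integrable function,
also after multiplication by polynomials in the coefficients `k`. -/
structure ExpDominated (U : Set E) (μ : Measure Ω) (k : ι → Ω → ℂ) (ψ : ι → E → ℂ)
    (g : Ω → ℂ) : Prop where
  meas : AEStronglyMeasurable g μ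
  bound : ∀ p ∈ U, ∃ s ∈ 𝓝 p, ∀ n : ℕ, ∃ B : Ω → ℝ, Integrable B μ ∧ ∀ᵐ a ∂μ, ∀ q ∈ s,
    ‖g a‖ * (1 + ∑ i, ‖k i a‖) ^ n * ‖Complex.exp (∑ i, k i a * ψ i q)‖ ≤ B a

variable {U : Set E} {μ : Measure Ω} {k : ι → Ω → ℂ} {ψ : ι → E → ℂ} {g : Ω → ℂ}

/-- A factor `k i` costs one power of `1 + ∑ ‖k i‖`. Every differentiation produces one such factor,
which is why domination is demanded for all exponents `n` at once. -/
lemma ExpDominated.mul (h : ExpDominated U μ k ψ g) (hk : ∀ i, AEStronglyMeasurable (k i) μ)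
    (i : ι) : ExpDominated U μ k ψ (fun a => k i a * g a) where
  meas := (hk i).mul h.meas
  bound p hp := by
    obtain ⟨s, hs, hb⟩ := h.bound p hp
    refine ⟨s, hs, fun n => ?_⟩
    obtain ⟨B, hB, hle⟩ := hb (n + 1)
    refine ⟨B, hB, hle.mono fun a ha q hq => (le_trans ?_ (ha q hq))⟩
    have h1 : ‖k i a‖ ≤ 1 + ∑ i, ‖k i a‖ := by
      have := Finset.single_le_sum (f := fun i => ‖k i a‖) (fun i _ => norm_nonneg _)
        (Finset.mem_univ i)
      linarith
    have h0 : 0 ≤ 1 + ∑ i, ‖k i a‖ := le_trans (norm_nonneg _) h1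
    rw [norm_mul, pow_succ, mul_comm ‖k i a‖, mul_assoc ‖g a‖, mul_comm ‖k i a‖]
    gcongr

omit [NormedAddCommGroup E] in
lemma aestronglyMeasurable_expInt (hg : AEStronglyMeasurable g μ)
    (hk : ∀ i, AEStronglyMeasurable (k i) μ) (p : E) :
    AEStronglyMeasurable (fun a => g a * Complex.exp (∑ i, k i a * ψ i p)) μ := by
  refine hg.mul (Complex.continuous_exp.comp_aestronglyMeasurable ?_)
  exact Finset.aestronglyMeasurable_fun_sum _ fun i _ => (hk i).mul_const _

lemma ExpDominated.integrable (h : ExpDominated U μ k ψ g)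
    (hk : ∀ i, AEStronglyMeasurable (k i) μ) {p : E} (hp : p ∈ U) :
    Integrable (fun a => g a * Complex.exp (∑ i, k i a * ψ i p)) μ := by
  obtain ⟨s, hs, hb⟩ := h.bound p hp
  obtain ⟨B, hB, hle⟩ := hb 0
  refine hB.mono' (aestronglyMeasurable_expInt h.meas hk p) (hle.mono fun a ha => ?_)
  simpa using ha p (mem_of_mem_nhds hs)

/-- The derivative is again a combination of integrals of the same shape, with `k i * g` in place of
`g`, so the lemma can be iterated. The bound with `n = 1` dominates the differentiated integrand. -/
lemma ExpDominated.hasFDerivAt (h : ExpDominated U μ k ψ g)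
    (hk : ∀ i, AEStronglyMeasurable (k i) μ) (hU : IsOpen U)
    (hψ : ∀ i, ContDiffOn 𝕜 1 (ψ i) U) {p : E} (hp : p ∈ U) :
    HasFDerivAt (expInt μ k ψ g)
      (∑ i, expInt μ k ψ (fun a => k i a * g a) p • fderiv 𝕜 (ψ i) p) p := by
  obtain ⟨s, hs, hb⟩ := h.bound p hp
  obtain ⟨B, hB, hle⟩ := hb 1
  have hcont : ∀ i, ContinuousAt (fderiv 𝕜 (ψ i)) p := fun i =>
    ((hψ i).continuousOn_fderiv_of_isOpen hU le_rfl).continuousAt (hU.mem_nhds hp)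
  have hM : ∀ i, ∀ᶠ q in 𝓝 p, ‖fderiv 𝕜 (ψ i) q‖ ≤ ‖fderiv 𝕜 (ψ i) p‖ + 1 := fun i =>
    ((hcont i).norm.eventually (gt_mem_nhds (lt_add_one _))).mono fun q hq => hq.le
  -- A common bound near `p` for the derivatives of all `ψ i`; it enters the dominating function as
  -- a constant factor.
  set M : ℝ := ∑ i, (‖fderiv 𝕜 (ψ i) p‖ + 1) with hMdef
  have hM0 : 0 ≤ M := Finset.sum_nonneg fun i _ => by positivity
  have hev : {q | q ∈ s ∧ q ∈ U ∧ ∀ i, ‖fderiv 𝕜 (ψ i) q‖ ≤ M} ∈ 𝓝 p := by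
    filter_upwards [hs, hU.mem_nhds hp, eventually_all.mpr hM] with q h1 h2 h3
    refine ⟨h1, h2, fun i => (h3 i).trans ?_⟩
    exact Finset.single_le_sum (f := fun i => ‖fderiv 𝕜 (ψ i) p‖ + 1)
      (fun i _ => by positivity) (Finset.mem_univ i)
  have hd : ∀ a, ∀ q ∈ U, HasFDerivAt (fun q => g a * Complex.exp (∑ i, k i a * ψ i q))
      (∑ i, (k i a * g a * Complex.exp (∑ i, k i a * ψ i q)) • fderiv 𝕜 (ψ i) q) q := by
    intro a q hq
    have h1 : ∀ i, HasFDerivAt (ψ i) (fderiv 𝕜 (ψ i) q) q := fun i =>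
      (((hψ i).differentiableOn one_ne_zero).differentiableAt (hU.mem_nhds hq)).hasFDerivAt
    have h2 : HasFDerivAt (fun q => ∑ i, k i a * ψ i q) (∑ i, k i a • fderiv 𝕜 (ψ i) q) q := by
      refine HasFDerivAt.fun_sum fun i _ => (h1 i).const_mul _
    refine (h2.cexp.const_mul (g a)).congr_fderiv ?_
    rw [Finset.smul_sum, Finset.smul_sum]
    refine Finset.sum_congr rfl fun i _ => ?_
    rw [smul_smul, smul_smul]
    congr 1
    ring
  have hint : ∀ i, Integrable (fun a => k i a * g a * Complex.exp (∑ i, k i a * ψ i p)) μ :=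
    fun i => (h.mul hk i).integrable hk hp
  have key := hasFDerivAt_integral_of_dominated_of_fderiv_le (𝕜 := 𝕜) (μ := μ)
    (F := fun q a => g a * Complex.exp (∑ i, k i a * ψ i q))
    (F' := fun q a => ∑ i, (k i a * g a * Complex.exp (∑ i, k i a * ψ i q)) • fderiv 𝕜 (ψ i) q)
    (bound := fun a => M * B a) hev
    (Eventually.of_forall fun q => aestronglyMeasurable_expInt h.meas hk q) (h.integrable hk hp)
    (Finset.aestronglyMeasurable_fun_sum _ fun i _ =>
      (hint i).aestronglyMeasurable.smul_const _)
    (hle.mono fun a ha q hq => ?_) (hB.const_mul M)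
    (Eventually.of_forall fun a q hq => hd a q hq.2.1)
  · refine key.congr_fderiv ?_
    rw [integral_finsetSum _ fun i _ => (hint i).smul_const _]
    refine Finset.sum_congr rfl fun i _ => ?_
    rw [integral_smul_const]
    rfl
  · refine (norm_sum_le _ _).trans ?_
    calc ∑ i, ‖(k i a * g a * Complex.exp (∑ i, k i a * ψ i q)) • fderiv 𝕜 (ψ i) q‖
        ≤ ∑ i, ‖k i a‖ * (‖g a‖ * ‖Complex.exp (∑ i, k i a * ψ i q)‖ * M) := by
          refine Finset.sum_le_sum fun i _ => ?_
          rw [norm_smul, norm_mul, norm_mul]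
          have := hq.2.2 i
          calc _ ≤ ‖k i a‖ * ‖g a‖ * ‖Complex.exp (∑ i, k i a * ψ i q)‖ * M := by gcongr
            _ = _ := by ring
      _ = M * (‖g a‖ * (∑ i, ‖k i a‖) * ‖Complex.exp (∑ i, k i a * ψ i q)‖) := by
          rw [← Finset.sum_mul]; ring
      _ ≤ M * B a := by
          refine mul_le_mul_of_nonneg_left (le_trans ?_ (ha q hq.1)) hM0
          rw [pow_one]
          gcongr
          linarith

/-- Induction on the order; `g` has to vary, since differentiation replaces it by `k i * g`. -/
lemma ExpDominated.contDiffOn_nat (hk : ∀ i, AEStronglyMeasurable (k i) μ) (hU : IsOpen U)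
    (hψ : ∀ i, ContDiffOn 𝕜 ∞ (ψ i) U) (n : ℕ) :
    ∀ g : Ω → ℂ, ExpDominated U μ k ψ g → ContDiffOn 𝕜 n (expInt μ k ψ g) U := by
  have h1 : ∀ i, ContDiffOn 𝕜 1 (ψ i) U := fun i => (hψ i).of_le (by simp)
  induction n with
  | zero =>
    intro g h
    refine contDiffOn_zero.mpr fun p hp => ?_
    exact (h.hasFDerivAt hk hU h1 hp).continuousAt.continuousWithinAt
  | succ n ih =>
    intro g h
    rw [Nat.cast_add, Nat.cast_one, contDiffOn_succ_iff_fderiv_of_isOpen hU]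
    refine ⟨fun p hp => (h.hasFDerivAt hk hU h1 hp).differentiableAt.differentiableWithinAt,
      fun h => by simp at h, ?_⟩
    refine ContDiffOn.congr (f := fun p => ∑ i, expInt μ k ψ (fun a => k i a * g a) p •
      fderiv 𝕜 (ψ i) p) ?_ fun p hp => (h.hasFDerivAt hk hU h1 hp).fderiv
    refine ContDiffOn.sum fun i _ => ?_
    refine (ih _ (h.mul hk i)).smul ?_
    exact (hψ i).fderiv_of_isOpen hU (by exact_mod_cast le_top)

lemma ExpDominated.contDiffOn (h : ExpDominated U μ k ψ g)
    (hk : ∀ i, AEStronglyMeasurable (k i) μ) (hU : IsOpen U)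
    (hψ : ∀ i, ContDiffOn 𝕜 ∞ (ψ i) U) : ContDiffOn 𝕜 ∞ (expInt μ k ψ g) U :=
  contDiffOn_infty.mpr fun n => ExpDominated.contDiffOn_nat hk hU hψ n g h

lemma ExpDominated.lineDeriv_eq (h : ExpDominated U μ k ψ g)
    (hk : ∀ i, AEStronglyMeasurable (k i) μ) (hU : IsOpen U)
    (hψ : ∀ i, ContDiffOn 𝕜 ∞ (ψ i) U) (e : E) {ψ' : ι → E → ℂ}
    (hψ' : ∀ i, ∀ q ∈ U, HasLineDerivAt 𝕜 (ψ i) (ψ' i q) q e) {p : E} (hp : p ∈ U) :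
    lineDeriv 𝕜 (expInt μ k ψ g) p e = ∑ i, ψ' i p * expInt μ k ψ (fun a => k i a * g a) p := by
  have h1 : ∀ i, ContDiffOn 𝕜 1 (ψ i) U := fun i => (hψ i).of_le (by simp)
  have h2 := (h.hasFDerivAt hk hU h1 hp).hasLineDerivAt e
  rw [h2.lineDeriv, _root_.sum_apply]
  refine Finset.sum_congr rfl fun i _ => ?_
  have h3 : HasFDerivAt (ψ i) (fderiv 𝕜 (ψ i) p) p :=
    (((h1 i).differentiableOn one_ne_zero).differentiableAt (hU.mem_nhds hp)).hasFDerivAt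
  rw [_root_.smul_apply, (h3.hasLineDerivAt e).unique (hψ' i p hp), smul_eq_mul,
    mul_comm]

lemma ExpDominated.lineDeriv_lineDeriv_eq (h : ExpDominated U μ k ψ g)
    (hk : ∀ i, AEStronglyMeasurable (k i) μ) (hU : IsOpen U)
    (hψ : ∀ i, ContDiffOn 𝕜 ∞ (ψ i) U) (e : E) {ψ' ψ'' : ι → E → ℂ}
    (hψ' : ∀ i, ∀ q ∈ U, HasLineDerivAt 𝕜 (ψ i) (ψ' i q) q e)
    (hψ'' : ∀ i, ∀ q ∈ U, HasLineDerivAt 𝕜 (ψ' i) (ψ'' i q) q e) {p : E} (hp : p ∈ U) :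
    lineDeriv 𝕜 (fun q => lineDeriv 𝕜 (expInt μ k ψ g) q e) p e =
      ∑ i, (ψ'' i p * expInt μ k ψ (fun a => k i a * g a) p +
        ψ' i p * ∑ j, ψ' j p * expInt μ k ψ (fun a => k j a * (k i a * g a)) p) := by
  have h1 : ∀ i, ContDiffOn 𝕜 1 (ψ i) U := fun i => (hψ i).of_le (by simp)
  have hev : (fun q => lineDeriv 𝕜 (expInt μ k ψ g) q e) =ᶠ[𝓝 p]
      fun q => ∑ i, ψ' i q * expInt μ k ψ (fun a => k i a * g a) q := by
    filter_upwards [hU.mem_nhds hp] with q hq using h.lineDeriv_eq hk hU hψ e hψ' hq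
  rw [hev.lineDeriv_eq]
  refine HasLineDerivAt.lineDeriv ?_
  have h3 : ∀ i, HasDerivAt (fun t : 𝕜 => expInt μ k ψ (fun a => k i a * g a) (p + t • e))
      (∑ j, ψ' j p * expInt μ k ψ (fun a => k j a * (k i a * g a)) p) 0 := by
    intro i
    have h4 := ((h.mul hk i).hasFDerivAt hk hU h1 hp).hasLineDerivAt e
    have h5 := (h.mul hk i).lineDeriv_eq hk hU hψ e hψ' hp
    rw [← h5]
    exact h4.lineDeriv ▸ h4
  have h6 : HasDerivAt (fun t : 𝕜 => ∑ i, ψ' i (p + t • e) *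
      expInt μ k ψ (fun a => k i a * g a) (p + t • e)) _ 0 :=
    HasDerivAt.fun_sum fun i _ => HasDerivAt.mul (hψ'' i p hp : HasDerivAt _ _ _) (h3 i)
  unfold HasLineDerivAt
  simpa using h6

/-- Derivatives of `expInt` along a line, under the integral sign. -/
lemma ExpDominated.lineDeriv_eq_integral (h : ExpDominated U μ k ψ g)
    (hk : ∀ i, AEStronglyMeasurable (k i) μ) (hU : IsOpen U)
    (hψ : ∀ i, ContDiffOn 𝕜 ∞ (ψ i) U) (e : E) {ψ' : ι → E → ℂ}
    (hψ' : ∀ i, ∀ q ∈ U, HasLineDerivAt 𝕜 (ψ i) (ψ' i q) q e) {p : E} (hp : p ∈ U) :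
    Integrable (fun a => g a * (∑ i, k i a * ψ' i p) * Complex.exp (∑ i, k i a * ψ i p)) μ ∧
    lineDeriv 𝕜 (expInt μ k ψ g) p e =
      ∫ a, g a * (∑ i, k i a * ψ' i p) * Complex.exp (∑ i, k i a * ψ i p) ∂μ := by
  have hi : ∀ i, Integrable (fun a => ψ' i p *
      (k i a * g a * Complex.exp (∑ i, k i a * ψ i p))) μ :=
    fun i => ((h.mul hk i).integrable hk hp).const_mul _
  have e1 : (fun a => g a * (∑ i, k i a * ψ' i p) * Complex.exp (∑ i, k i a * ψ i p)) =
      fun a => ∑ i, ψ' i p * (k i a * g a * Complex.exp (∑ i, k i a * ψ i p)) := by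
    funext a
    rw [Finset.mul_sum, Finset.sum_mul]
    exact Finset.sum_congr rfl fun i _ => by ring
  rw [e1]
  refine ⟨integrable_finsetSum _ fun i _ => hi i, ?_⟩
  rw [h.lineDeriv_eq hk hU hψ e hψ' hp, integral_finsetSum _ fun i _ => hi i]
  exact Finset.sum_congr rfl fun i _ => (integral_const_mul _ _).symm

/-- With `φ = ∑ k i ψ i`, the second derivative of `exp φ` is `(φ'' + φ'^2) exp φ`; the double sum
is the expanded square. -/
lemma ExpDominated.lineDeriv_lineDeriv_eq_integral (h : ExpDominated U μ k ψ g)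
    (hk : ∀ i, AEStronglyMeasurable (k i) μ) (hU : IsOpen U)
    (hψ : ∀ i, ContDiffOn 𝕜 ∞ (ψ i) U) (e : E) {ψ' ψ'' : ι → E → ℂ}
    (hψ' : ∀ i, ∀ q ∈ U, HasLineDerivAt 𝕜 (ψ i) (ψ' i q) q e)
    (hψ'' : ∀ i, ∀ q ∈ U, HasLineDerivAt 𝕜 (ψ' i) (ψ'' i q) q e) {p : E} (hp : p ∈ U) :
    Integrable (fun a => g a * ((∑ i, k i a * ψ'' i p) + (∑ i, k i a * ψ' i p) ^ 2) *
      Complex.exp (∑ i, k i a * ψ i p)) μ ∧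
    lineDeriv 𝕜 (fun q => lineDeriv 𝕜 (expInt μ k ψ g) q e) p e =
      ∫ a, g a * ((∑ i, k i a * ψ'' i p) + (∑ i, k i a * ψ' i p) ^ 2) *
        Complex.exp (∑ i, k i a * ψ i p) ∂μ := by
  have hi : ∀ i, Integrable (fun a => ψ'' i p *
      (k i a * g a * Complex.exp (∑ i, k i a * ψ i p))) μ :=
    fun i => ((h.mul hk i).integrable hk hp).const_mul _
  have hij : ∀ i j, Integrable (fun a => ψ' j p *
      (k j a * (k i a * g a) * Complex.exp (∑ i, k i a * ψ i p))) μ :=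
    fun i j => (((h.mul hk i).mul hk j).integrable hk hp).const_mul _
  have hij' : ∀ i, Integrable (fun a => ψ' i p * ∑ j, ψ' j p *
      (k j a * (k i a * g a) * Complex.exp (∑ i, k i a * ψ i p))) μ :=
    fun i => (integrable_finsetSum _ fun j _ => hij i j).const_mul _
  have e1 : (fun a => g a * ((∑ i, k i a * ψ'' i p) + (∑ i, k i a * ψ' i p) ^ 2) *
      Complex.exp (∑ i, k i a * ψ i p)) =
      fun a => ∑ i, (ψ'' i p * (k i a * g a * Complex.exp (∑ i, k i a * ψ i p)) +
        ψ' i p * ∑ j, ψ' j p * (k j a * (k i a * g a) * Complex.exp (∑ i, k i a * ψ i p))) := by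
    funext a
    rw [Finset.sum_add_distrib, mul_add, add_mul, sq, Finset.sum_mul_sum, Finset.mul_sum,
      Finset.mul_sum, Finset.sum_mul, Finset.sum_mul]
    congr 1
    · exact Finset.sum_congr rfl fun i _ => by ring
    · refine Finset.sum_congr rfl fun i _ => ?_
      rw [Finset.mul_sum, Finset.mul_sum, Finset.sum_mul]
      exact Finset.sum_congr rfl fun j _ => by ring
  have hs : ∀ i, Integrable (fun a => ψ'' i p * (k i a * g a * Complex.exp (∑ i, k i a * ψ i p)) +
      ψ' i p * ∑ j, ψ' j p * (k j a * (k i a * g a) * Complex.exp (∑ i, k i a * ψ i p))) μ :=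
    fun i => (hi i).add (hij' i)
  rw [e1]
  refine ⟨integrable_finsetSum _ fun i _ => hs i, ?_⟩
  rw [h.lineDeriv_lineDeriv_eq hk hU hψ e hψ' hψ'' hp, integral_finsetSum _ fun i _ => hs i]
  refine Finset.sum_congr rfl fun i _ => ?_
  rw [integral_add (hi i) (hij' i), integral_const_mul, integral_const_mul,
    integral_finsetSum _ fun j _ => hij i j]
  congr 2
  exact Finset.sum_congr rfl fun j _ => (integral_const_mul _ _).symm

end ExpFamily

end ThetaLift

end

noncomputable section

namespace ThetaLift

/-! ### Gaussian bounds -/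

lemma summable_exp_neg_sq {κ : ℝ} (hκ : 0 < κ) : Summable fun n : ℤ => Real.exp (-κ * n ^ 2) := by
  have h : Summable fun n : ℕ => Real.exp (-κ * (n : ℝ) ^ 2) := by
    refine Summable.of_nonneg_of_le (fun _ => (Real.exp_pos _).le) (fun n => ?_)
      (Real.summable_exp_nat_mul_iff.mpr (neg_lt_zero.mpr hκ))
    refine Real.exp_le_exp.mpr ?_
    have h1 : (n : ℝ) ≤ (n : ℝ) ^ 2 := by exact_mod_cast Nat.le_self_pow two_ne_zero n
    nlinarith
  refine Summable.of_nat_of_neg (by simpa using h) (by simpa using h)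

/-- The Euclidean norm squared on `ℤ³`. -/
def idxSq (m : ℤ × ℤ × ℤ) : ℝ := (m.1 : ℝ) ^ 2 + ((m.2.1 : ℝ) ^ 2 + (m.2.2 : ℝ) ^ 2)

lemma idxSq_nonneg (m : ℤ × ℤ × ℤ) : 0 ≤ idxSq m := by unfold idxSq; positivity

lemma summable_exp_neg_idxSq {κ : ℝ} (hκ : 0 < κ) :
    Summable fun m : ℤ × ℤ × ℤ => Real.exp (-κ * idxSq m) := by
  have h := summable_exp_neg_sq hκ
  have h2 := h.mul_of_nonneg h (fun _ => (Real.exp_pos _).le) (fun _ => (Real.exp_pos _).le)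
  have h3 := h.mul_of_nonneg h2 (fun _ => (Real.exp_pos _).le)
    (fun _ => (mul_pos (Real.exp_pos _) (Real.exp_pos _)).le)
  refine h3.congr fun m => ?_
  rw [← Real.exp_add, ← Real.exp_add, idxSq]
  congr 1
  ring

/-- The quadratic form `i² + (j² + n²) y²`. -/
def idxForm (m : ℤ × ℤ × ℤ) (y : ℝ) : ℝ :=
  (m.1 : ℝ) ^ 2 + ((m.2.1 : ℝ) ^ 2 + (m.2.2 : ℝ) ^ 2) * y ^ 2

lemma idxForm_nonneg (m : ℤ × ℤ × ℤ) (y : ℝ) : 0 ≤ idxForm m y := by unfold idxForm; positivity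

lemma idxSq_le_idxForm {y₁ : ℝ} (hy₁ : 0 < y₁) (m : ℤ × ℤ × ℤ) {y : ℝ} (hy : y₁ ≤ y) :
    min 1 (y₁ ^ 2) * idxSq m ≤ idxForm m y := by
  have h1 : y₁ ^ 2 ≤ y ^ 2 := by gcongr
  have h2 := min_le_left 1 (y₁ ^ 2)
  have h3 := min_le_right 1 (y₁ ^ 2)
  have h4 : min 1 (y₁ ^ 2) * (m.1 : ℝ) ^ 2 ≤ 1 * (m.1 : ℝ) ^ 2 := by gcongr
  have h5 : min 1 (y₁ ^ 2) * ((m.2.1 : ℝ) ^ 2 + (m.2.2 : ℝ) ^ 2) ≤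
    y ^ 2 * ((m.2.1 : ℝ) ^ 2 + (m.2.2 : ℝ) ^ 2) := by gcongr; exact h3.trans h1
  unfold idxSq idxForm
  linarith

lemma pow_mul_exp_neg_le {κ : ℝ} (hκ : 0 < κ) (n : ℕ) :
    ∃ K : ℝ, 0 < K ∧ ∀ t : ℝ, 0 ≤ t → (1 + t) ^ n * Real.exp (-(2 * κ) * t) ≤ K * Real.exp (-κ * t) := by
  -- The constant comes from `x ^ n / n! ≤ exp x` at `x = κ (1 + t)`.
  refine ⟨n.factorial / κ ^ n * Real.exp κ, by positivity, fun t ht => ?_⟩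
  have h1 := Real.pow_div_factorial_le_exp (κ * (1 + t)) (by positivity) n
  rw [div_le_iff₀ (by positivity), mul_pow] at h1
  have h2 : (1 + t) ^ n ≤ n.factorial / κ ^ n * Real.exp (κ * (1 + t)) := by
    rw [div_mul_eq_mul_div, le_div_iff₀ (by positivity)]
    linarith
  calc (1 + t) ^ n * Real.exp (-(2 * κ) * t)
      ≤ n.factorial / κ ^ n * Real.exp (κ * (1 + t)) * Real.exp (-(2 * κ) * t) := by gcongr
    _ = n.factorial / κ ^ n * Real.exp κ * Real.exp (-κ * t) := by
      rw [mul_assoc, ← Real.exp_add, mul_assoc, ← Real.exp_add]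
      congr 2
      ring

/-- Polynomial multiples of `exp (-κ (i² + (j² + n²) y²))` decay in the index and, away from the
indices with `j = n = 0`, in `y`. -/
lemma idxForm_decay {κ y₁ : ℝ} (hκ : 0 < κ) (hy₁ : 0 < y₁) (n : ℕ) :
    ∃ K κ' : ℝ, 0 < K ∧ 0 < κ' ∧ ∀ (m : ℤ × ℤ × ℤ) (y : ℝ), y₁ ≤ y →
      (1 + idxForm m y) ^ n * Real.exp (-κ * idxForm m y) ≤ K * Real.exp (-κ' * idxSq m) ∧
      (y ≤ 1 ∨ m.2 ≠ 0 → (1 + idxForm m y) ^ n * Real.exp (-κ * idxForm m y) ≤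
        K * (Real.exp (-κ' * idxSq m) * Real.exp (-κ' * y ^ 2))) := by
  obtain ⟨K, hK, hb⟩ := pow_mul_exp_neg_le (half_pos hκ) n
  set c := min 1 (y₁ ^ 2) with hc
  have hc0 : 0 < c := by positivity
  have hc1 : c ≤ 1 := min_le_left _ _
  have hκ' : 0 < κ / 4 * c := by positivity
  refine ⟨K * Real.exp κ, κ / 4 * c, by positivity, hκ', fun m y hy => ?_⟩
  have h1 := hb _ (idxForm_nonneg m y)
  have e : -(2 * (κ / 2)) * idxForm m y = -κ * idxForm m y := by ring
  rw [e] at h1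
  have h2 := idxSq_le_idxForm hy₁ m hy
  rw [← hc] at h2
  have h3 := idxForm_nonneg m y
  constructor
  · refine h1.trans ?_
    rw [mul_assoc, ← Real.exp_add]
    gcongr
    nlinarith
  · intro hm
    refine h1.trans ?_
    rw [mul_assoc, ← Real.exp_add, ← Real.exp_add]
    have h4 : y ^ 2 ≤ idxForm m y + 1 := by
      rcases hm with hm | hm
      · have : y ^ 2 ≤ 1 := by nlinarith
        linarith
      · have h5 : (1 : ℝ) ≤ (m.2.1 : ℝ) ^ 2 + (m.2.2 : ℝ) ^ 2 := by
          have : 0 < m.2.1 ^ 2 + m.2.2 ^ 2 := by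
            by_contra h
            have h6 : m.2.1 = 0 := by nlinarith [sq_nonneg m.2.1, sq_nonneg m.2.2]
            have h7 : m.2.2 = 0 := by nlinarith [sq_nonneg m.2.1, sq_nonneg m.2.2]
            exact hm (Prod.ext h6 h7)
          exact_mod_cast this
        unfold idxForm
        nlinarith [sq_nonneg y, sq_nonneg (m.1 : ℝ)]
    gcongr
    have h8 : κ / 4 * c * y ^ 2 ≤ κ / 4 * 1 * (idxForm m y + 1) := by gcongr
    nlinarith

/-- Completing the square: the exponents differ by `(C - κ y)² / (2 κ)`. This is how Gaussian decay
in `y` absorbs a form of exponential growth. -/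
lemma exp_mul_exp_neg_sq_le (C : ℝ) {κ : ℝ} (hκ : 0 < κ) (y : ℝ) :
    Real.exp (C * y) * Real.exp (-κ * y ^ 2) ≤
      Real.exp (C ^ 2 / (2 * κ)) * Real.exp (-(κ / 2) * y ^ 2) := by
  rw [← Real.exp_add, ← Real.exp_add]
  refine Real.exp_le_exp.mpr ?_
  have h : 0 ≤ (C - κ * y) ^ 2 / (2 * κ) := by positivity
  have e : (C - κ * y) ^ 2 / (2 * κ) =
      C ^ 2 / (2 * κ) + -(κ / 2) * y ^ 2 - (C * y + -κ * y ^ 2) := by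
    field_simp
    ring
  linarith

/-! ### The terms of the theta function after Poisson summation -/

/-- The exponent of a term of the theta function after Poisson summation in one variable. -/
def thetaExponent (ν δ β : ℝ) (m : ℤ × ℤ × ℤ) (t z : ℂ) : ℂ :=
  2 * π * Complex.I * ν * (m.1 / δ - m.2.1 / δ * z.re) ^ 2 * t
    - 2 * π * Complex.I * (m.2.2 / β) * (m.2.1 / δ * z.re ^ 2 - 2 * (m.1 / δ) * z.re)
    - π * z.im ^ 2 * ((ν * (m.2.1 / δ) * t.re - m.2.2 / β) ^ 2 + (ν * (m.2.1 / δ) * t.im) ^ 2) /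
      (ν * t.im)

/-- A term of the theta function after Poisson summation in one variable. -/
def thetaTerm (ν δ β : ℝ) (m : ℤ × ℤ × ℤ) (t z : ℂ) : ℂ :=
  z.im * Complex.exp (thetaExponent ν δ β m t z)

lemma norm_exp_thetaExponent (ν δ β : ℝ) (m : ℤ × ℤ × ℤ) (t z : ℂ) :
    ‖Complex.exp (thetaExponent ν δ β m t z)‖ =
      Real.exp (-(π * (2 * ν * t.im * (m.1 / δ - m.2.1 / δ * z.re) ^ 2 +
        z.im ^ 2 * ((ν * (m.2.1 / δ) * t.re - m.2.2 / β) ^ 2 + (ν * (m.2.1 / δ) * t.im) ^ 2) /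
      (ν * t.im)))) := by
  rw [Complex.norm_exp]
  congr 1
  have e : thetaExponent ν δ β m t z =
      ((2 * π * ν * (m.1 / δ - m.2.1 / δ * z.re) ^ 2 : ℝ) : ℂ) * (Complex.I * t)
      - ((2 * π * (m.2.2 / β) * (m.2.1 / δ * z.re ^ 2 - 2 * (m.1 / δ) * z.re) : ℝ) : ℂ) * Complex.I
      - ((π * z.im ^ 2 * ((ν * (m.2.1 / δ) * t.re - m.2.2 / β) ^ 2 +
        (ν * (m.2.1 / δ) * t.im) ^ 2) / (ν * t.im) : ℝ) : ℂ) := by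
    unfold thetaExponent
    push_cast
    ring
  rw [e, Complex.sub_re, Complex.sub_re, Complex.re_ofReal_mul, Complex.re_ofReal_mul,
    Complex.ofReal_re, Complex.I_re, Complex.I_mul_re]
  ring

/-- The coordinates are recovered one after another: `c` from `(ν c v)²`, then `r` from `(ν c u -
r)²` and `c`, and `a` from `(a - c x)²` and `c`. The constants `K₁`, `K₂`, `K₃` belong to `c² y²`,
`r² y²` and `a²`. They depend only on the bounds for `u`, `v`, `x` and on the lower bound for `y`,
which gives uniformity up to the cusp. -/
lemma quadForm_lower_bound {ν v₀ v₁ u₁ y₁ X : ℝ} (hν : 0 < ν) (hv₀ : 0 < v₀) (hv₁ : 0 < v₁)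
    (hy₁ : 0 < y₁) : ∃ K : ℝ, 0 < K ∧ ∀ a c r u v x y : ℝ, v₀ ≤ v → v ≤ v₁ → |u| ≤ u₁ → y₁ ≤ y →
      |x| ≤ X → a ^ 2 + (c ^ 2 + r ^ 2) * y ^ 2 ≤ K * (2 * ν * v * (a - c * x) ^ 2 +
        y ^ 2 * ((ν * c * u - r) ^ 2 + (ν * c * v) ^ 2) / (ν * v)) := by
  set K₁ := v₁ / (ν * v₀ ^ 2)
  set K₂ := 2 * ν * v₁ + 2 * ν ^ 2 * u₁ ^ 2 * K₁
  set K₃ := 1 / (ν * v₀) + 2 * X ^ 2 * (K₁ / y₁ ^ 2)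
  refine ⟨K₃ + K₁ + K₂, by positivity, fun a c r u v x y h0 h1 hu hy hx => ?_⟩
  have hv : 0 < v := hv₀.trans_le h0
  have hy0 : 0 < y := hy₁.trans_le hy
  set Q₁ := (a - c * x) ^ 2
  set Q₂ := y ^ 2 * ((ν * c * u - r) ^ 2 + (ν * c * v) ^ 2) / (ν * v) with hQ₂
  have hQ₁0 : 0 ≤ Q₁ := sq_nonneg _
  have hQ₂0 : 0 ≤ Q₂ := by positivity
  set Q := 2 * ν * v * Q₁ + Q₂ with hQ
  have hQ1 : 2 * ν * v₀ * Q₁ ≤ Q := by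
    have : 2 * ν * v₀ * Q₁ ≤ 2 * ν * v * Q₁ := by gcongr
    linarith
  have hQ2 : Q₂ ≤ Q := by
    have : 0 ≤ 2 * ν * v * Q₁ := by positivity
    linarith
  have hQ0 : 0 ≤ Q := hQ₂0.trans hQ2
  have hQ₂' : y ^ 2 * ((ν * c * u - r) ^ 2 + (ν * c * v) ^ 2) ≤ ν * v₁ * Q := by
    have : y ^ 2 * ((ν * c * u - r) ^ 2 + (ν * c * v) ^ 2) = ν * v * Q₂ := by
      rw [hQ₂]; field_simp
    rw [this]
    gcongr
  have hc : c ^ 2 * y ^ 2 ≤ K₁ * Q := by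
    have h2 : (ν * v₀) ^ 2 * (c ^ 2 * y ^ 2) ≤ (ν * v) ^ 2 * (c ^ 2 * y ^ 2) := by gcongr
    have h3 : (ν * v) ^ 2 * (c ^ 2 * y ^ 2) ≤ ν * v₁ * Q := by
      nlinarith [mul_nonneg (sq_nonneg y) (sq_nonneg (ν * c * u - r))]
    have h4 : K₁ * Q = (ν * v₁ * Q) / (ν * v₀) ^ 2 := by
      simp only [K₁]; field_simp
    rw [h4, le_div_iff₀ (by positivity)]
    linarith
  have hu2 : u ^ 2 ≤ u₁ ^ 2 := sq_le_sq' (by linarith [neg_abs_le u]) (by linarith [le_abs_self u])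
  have hx2 : x ^ 2 ≤ X ^ 2 := sq_le_sq' (by linarith [neg_abs_le x]) (by linarith [le_abs_self x])
  have hr : r ^ 2 * y ^ 2 ≤ K₂ * Q := by
    have h2 : r ^ 2 ≤ 2 * (ν * c * u - r) ^ 2 + 2 * ν ^ 2 * u ^ 2 * c ^ 2 := by
      nlinarith [sq_nonneg (2 * (ν * c * u) - r)]
    have h3 : r ^ 2 * y ^ 2 ≤ (2 * (ν * c * u - r) ^ 2 + 2 * ν ^ 2 * u ^ 2 * c ^ 2) * y ^ 2 := by
      gcongr
    have h4 : 2 * ν ^ 2 * u ^ 2 * (c ^ 2 * y ^ 2) ≤ 2 * ν ^ 2 * u₁ ^ 2 * (K₁ * Q) := by gcongr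
    have h5 : 0 ≤ y ^ 2 * (ν * c * v) ^ 2 := by positivity
    have e : K₂ * Q = 2 * (ν * v₁ * Q) + 2 * ν ^ 2 * u₁ ^ 2 * (K₁ * Q) := by
      simp only [K₂]; ring
    linarith
  have ha : a ^ 2 ≤ K₃ * Q := by
    have h2 : a ^ 2 ≤ 2 * Q₁ + 2 * x ^ 2 * c ^ 2 := by
      simp only [Q₁]
      nlinarith [sq_nonneg (a - 2 * (c * x))]
    have h3 : c ^ 2 ≤ K₁ / y₁ ^ 2 * Q := by
      have h4 : c ^ 2 * y₁ ^ 2 ≤ c ^ 2 * y ^ 2 := by gcongr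
      rw [div_mul_eq_mul_div, le_div_iff₀ (by positivity)]
      linarith
    have h5 : 2 * x ^ 2 * c ^ 2 ≤ 2 * X ^ 2 * (K₁ / y₁ ^ 2 * Q) := by gcongr
    have h6 : 2 * Q₁ ≤ 1 / (ν * v₀) * Q := by
      rw [div_mul_eq_mul_div, le_div_iff₀ (by positivity)]
      linarith
    have e : K₃ * Q = 1 / (ν * v₀) * Q + 2 * X ^ 2 * (K₁ / y₁ ^ 2 * Q) := by simp only [K₃]; ring
    linarith
  linarith

/-- The exponentials in the theta function decay uniformly on products of a compact set and a
vertical strip. -/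
lemma norm_exp_thetaExponent_le {ν δ β v₀ v₁ y₁ : ℝ} (u₁ X : ℝ) (hν : 0 < ν) (hδ : 0 < δ)
    (hβ : 0 < β) (hv₀ : 0 < v₀) (hv₁ : 0 < v₁) (hy₁ : 0 < y₁) :
    ∃ κ : ℝ, 0 < κ ∧ ∀ (m : ℤ × ℤ × ℤ) (t z : ℂ), v₀ ≤ t.im → t.im ≤ v₁ → |t.re| ≤ u₁ →
      y₁ ≤ z.im → |z.re| ≤ X →
      ‖Complex.exp (thetaExponent ν δ β m t z)‖ ≤ Real.exp (-κ * idxForm m z.im) := by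
  obtain ⟨K, hK, hb⟩ := quadForm_lower_bound (u₁ := u₁) (X := X) hν hv₀ hv₁ hy₁
  refine ⟨π / (K * (δ ^ 2 + β ^ 2)), by positivity, fun m t z h1 h2 h3 h4 h5 => ?_⟩
  rw [norm_exp_thetaExponent]
  refine Real.exp_le_exp.mpr ?_
  have h := hb (m.1 / δ) (m.2.1 / δ) (m.2.2 / β) t.re t.im z.re z.im h1 h2 h3 h4 h5
  set Q := 2 * ν * t.im * (m.1 / δ - m.2.1 / δ * z.re) ^ 2 +
    z.im ^ 2 * ((ν * (m.2.1 / δ) * t.re - m.2.2 / β) ^ 2 + (ν * (m.2.1 / δ) * t.im) ^ 2) /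
      (ν * t.im)
  have h6 : idxForm m z.im ≤ (δ ^ 2 + β ^ 2) *
      ((m.1 / δ) ^ 2 + ((m.2.1 / δ) ^ 2 + (m.2.2 / β) ^ 2) * z.im ^ 2) := by
    have e : idxForm m z.im = δ ^ 2 * (m.1 / δ) ^ 2 + (δ ^ 2 * (m.2.1 / δ) ^ 2 +
        β ^ 2 * (m.2.2 / β) ^ 2) * z.im ^ 2 := by
      unfold idxForm; field_simp
    rw [e]
    have p1 : 0 ≤ β ^ 2 * (m.1 / δ) ^ 2 := by positivity
    have p2 : 0 ≤ β ^ 2 * (m.2.1 / δ) ^ 2 * z.im ^ 2 := by positivity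
    have p3 : 0 ≤ δ ^ 2 * (m.2.2 / β) ^ 2 * z.im ^ 2 := by positivity
    linarith
  have h7 : idxForm m z.im ≤ (δ ^ 2 + β ^ 2) * (K * Q) := h6.trans (by gcongr)
  have h8 : π / (K * (δ ^ 2 + β ^ 2)) * idxForm m z.im ≤ π * Q := by
    rw [div_mul_eq_mul_div, div_le_iff₀ (by positivity)]
    calc π * idxForm m z.im ≤ π * ((δ ^ 2 + β ^ 2) * (K * Q)) := by gcongr
      _ = _ := by ring
  linarith

end ThetaLift

end

noncomputable section

namespace ThetaLift

/-! ### Laplacians of exponential families -/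

/-- The hyperbolic Laplacian of weight `k` for functions on `ℂ`. -/
def lap (k : ℝ) (F : ℂ → ℂ) (t : ℂ) : ℂ :=
  -(t.im : ℂ) ^ 2 * (dRe (dRe F) t + dIm (dIm F) t) +
    Complex.I * k * t.im * (dRe F t + Complex.I * dIm F t)

lemma hypLaplacian_eq_lap (k : ℝ) (F : ℍ → ℂ) (τ : ℍ) :
    hypLaplacian k F τ = lap k (F ∘ UpperHalfPlane.ofComplex) τ := rfl

lemma isOpen_im_pos : IsOpen {z : ℂ | 0 < z.im} := isOpen_lt continuous_const Complex.continuous_im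

lemma lineDeriv_congr_of_eqOn {F G : ℂ → ℂ} {U : Set ℂ} (hU : IsOpen U) (h : Set.EqOn F G U) (e : ℂ) :
    Set.EqOn (fun z => lineDeriv ℝ F z e) (fun z => lineDeriv ℝ G z e) U := fun _ hz =>
  (h.eventuallyEq_of_mem (hU.mem_nhds hz)).lineDeriv_eq

lemma dRe_congr {F G : ℂ → ℂ} {U : Set ℂ} (hU : IsOpen U) (h : Set.EqOn F G U) :
    Set.EqOn (dRe F) (dRe G) U := lineDeriv_congr_of_eqOn hU h 1

lemma dIm_congr {F G : ℂ → ℂ} {U : Set ℂ} (hU : IsOpen U) (h : Set.EqOn F G U) :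
    Set.EqOn (dIm F) (dIm G) U := lineDeriv_congr_of_eqOn hU h Complex.I

lemma lap_congr (k : ℝ) {F G : ℂ → ℂ} (h : Set.EqOn F G {z | 0 < z.im}) {t : ℂ} (ht : 0 < t.im) :
    lap k F t = lap k G t := by
  have h1 := dRe_congr isOpen_im_pos h
  have h2 := dIm_congr isOpen_im_pos h
  rw [lap, lap, h1 ht, h2 ht, dRe_congr isOpen_im_pos h1 ht, dIm_congr isOpen_im_pos h2 ht]

lemma hasLineDerivAt_one {h : ℝ → ℝ → ℂ} {d : ℂ} {z : ℂ}
    (H : HasDerivAt (fun x => h x z.im) d z.re) :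
    HasLineDerivAt ℝ (fun z : ℂ => h z.re z.im) d z 1 := by
  unfold HasLineDerivAt
  have h1 : HasDerivAt (fun t : ℝ => z.re + t) 1 0 := (hasDerivAt_id 0).const_add _
  have h2 := HasDerivAt.scomp (h := fun t : ℝ => z.re + t) (0 : ℝ) (by simpa using H) h1
  simpa [Function.comp_def] using h2

lemma hasLineDerivAt_I {h : ℝ → ℝ → ℂ} {d : ℂ} {z : ℂ}
    (H : HasDerivAt (fun y => h z.re y) d z.im) :
    HasLineDerivAt ℝ (fun z : ℂ => h z.re z.im) d z Complex.I := by
  unfold HasLineDerivAt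
  have h1 : HasDerivAt (fun t : ℝ => z.im + t) 1 0 := (hasDerivAt_id 0).const_add _
  have h2 := HasDerivAt.scomp (h := fun t : ℝ => z.im + t) (0 : ℝ) (by simpa using H) h1
  simpa [Function.comp_def] using h2

section

variable {Ω ι : Type*} [MeasurableSpace Ω] [Fintype ι] {μ : Measure Ω} {k : ι → Ω → ℂ}
  {ψ ψx ψxx ψy ψyy : ι → ℂ → ℂ} {g : Ω → ℂ}

/-- The function by which `lap` multiplies `exp φ`, in terms of the derivatives of `φ`. -/
def lapSymbol (wt : ℝ) (t : ℂ) (φx φxx φy φyy : ℂ) : ℂ :=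
  -(t.im : ℂ) ^ 2 * ((φxx + φx ^ 2) + (φyy + φy ^ 2)) +
    Complex.I * wt * t.im * (φx + Complex.I * φy)

/-- On `exp φ` the Laplacian acts as multiplication by `lapSymbol`, a polynomial in the derivatives
of `φ`; domination allows this under the integral. -/
lemma ExpDominated.lap_eq (h : ExpDominated {z : ℂ | 0 < z.im} μ k ψ g)
    (hk : ∀ i, AEStronglyMeasurable (k i) μ) (hψ : ∀ i, ContDiffOn ℝ ∞ (ψ i) {z : ℂ | 0 < z.im})
    (hx : ∀ i, ∀ q ∈ {z : ℂ | 0 < z.im}, HasLineDerivAt ℝ (ψ i) (ψx i q) q 1)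
    (hxx : ∀ i, ∀ q ∈ {z : ℂ | 0 < z.im}, HasLineDerivAt ℝ (ψx i) (ψxx i q) q 1)
    (hy : ∀ i, ∀ q ∈ {z : ℂ | 0 < z.im}, HasLineDerivAt ℝ (ψ i) (ψy i q) q Complex.I)
    (hyy : ∀ i, ∀ q ∈ {z : ℂ | 0 < z.im}, HasLineDerivAt ℝ (ψy i) (ψyy i q) q Complex.I)
    (wt : ℝ) {t : ℂ} (ht : 0 < t.im) :
    Integrable (fun a => g a * lapSymbol wt t (∑ i, k i a * ψx i t) (∑ i, k i a * ψxx i t)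
      (∑ i, k i a * ψy i t) (∑ i, k i a * ψyy i t) * Complex.exp (∑ i, k i a * ψ i t)) μ ∧
    lap wt (expInt μ k ψ g) t =
      ∫ a, g a * lapSymbol wt t (∑ i, k i a * ψx i t) (∑ i, k i a * ψxx i t)
        (∑ i, k i a * ψy i t) (∑ i, k i a * ψyy i t) * Complex.exp (∑ i, k i a * ψ i t) ∂μ := by
  obtain ⟨i1, e1⟩ := h.lineDeriv_eq_integral hk isOpen_im_pos hψ 1 hx ht
  obtain ⟨i2, e2⟩ := h.lineDeriv_eq_integral hk isOpen_im_pos hψ Complex.I hy ht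
  obtain ⟨i3, e3⟩ := h.lineDeriv_lineDeriv_eq_integral hk isOpen_im_pos hψ 1 hx hxx ht
  obtain ⟨i4, e4⟩ := h.lineDeriv_lineDeriv_eq_integral hk isOpen_im_pos hψ Complex.I hy hyy ht
  have e : (fun a => g a * lapSymbol wt t (∑ i, k i a * ψx i t) (∑ i, k i a * ψxx i t)
      (∑ i, k i a * ψy i t) (∑ i, k i a * ψyy i t) * Complex.exp (∑ i, k i a * ψ i t)) =
      fun a => -(t.im : ℂ) ^ 2 *
        (g a * ((∑ i, k i a * ψxx i t) + (∑ i, k i a * ψx i t) ^ 2) *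
            Complex.exp (∑ i, k i a * ψ i t) +
          g a * ((∑ i, k i a * ψyy i t) + (∑ i, k i a * ψy i t) ^ 2) *
            Complex.exp (∑ i, k i a * ψ i t)) +
        Complex.I * wt * t.im * (g a * (∑ i, k i a * ψx i t) * Complex.exp (∑ i, k i a * ψ i t) +
          Complex.I * (g a * (∑ i, k i a * ψy i t) * Complex.exp (∑ i, k i a * ψ i t))) := by
    funext a
    unfold lapSymbol
    ring
  rw [e]
  have j1 := (i3.fun_add i4).const_mul (-(t.im : ℂ) ^ 2)
  have j2 := (i1.fun_add (i2.const_mul Complex.I)).const_mul (Complex.I * wt * t.im)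
  refine ⟨j1.fun_add j2, ?_⟩
  rw [integral_add j1 j2, integral_const_mul, integral_const_mul, integral_add i3 i4,
    integral_add i1 (i2.const_mul _), integral_const_mul, ← e1, ← e2, ← e3, ← e4]
  rfl

end

/-! ### The theta function in the variable `z` -/

/-- The coefficients of `thetaExponent` as a function of `z`. -/
def coeffZ (ν δ β : ℝ) (t : ℂ) : Fin 4 → ℤ × ℤ × ℤ → ℂ :=
  ![fun m => 4 * π * Complex.I * (m.2.2 / β * (m.1 / δ) - ν * t * (m.1 / δ) * (m.2.1 / δ)),
    fun m => 2 * π * Complex.I * (ν * t * (m.2.1 / δ) ^ 2 - m.2.2 / β * (m.2.1 / δ)),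
    fun m => -(π * ((ν * (m.2.1 / δ) * t.re - m.2.2 / β) ^ 2 + (ν * (m.2.1 / δ) * t.im) ^ 2) /
      (ν * t.im)),
    fun _ => 1]

/-- The functions of `z` of which `thetaExponent` is a linear combination. -/
def basisZ : Fin 4 → ℂ → ℂ :=
  ![fun z => z.re, fun z => (z.re : ℂ) ^ 2, fun z => (z.im : ℂ) ^ 2, fun z => (Real.log z.im : ℝ)]

/-- Derivatives of `basisZ`. -/
def basisZx : Fin 4 → ℂ → ℂ := ![fun _ => 1, fun z => 2 * (z.re : ℂ), fun _ => 0, fun _ => 0]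

/-- Derivatives of `basisZx`. -/
def basisZxx : Fin 4 → ℂ → ℂ := ![fun _ => 0, fun _ => 2, fun _ => 0, fun _ => 0]

/-- Derivatives of `basisZ`. -/
def basisZy : Fin 4 → ℂ → ℂ :=
  ![fun _ => 0, fun _ => 0, fun z => 2 * (z.im : ℂ), fun z => ((z.im)⁻¹ : ℝ)]

/-- Derivatives of `basisZy`. -/
def basisZyy : Fin 4 → ℂ → ℂ :=
  ![fun _ => 0, fun _ => 0, fun _ => 2, fun z => (-(z.im ^ 2)⁻¹ : ℝ)]

/-- The part of `thetaExponent` which does not depend on `z`. -/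
def constZ (ν δ : ℝ) (t : ℂ) (m : ℤ × ℤ × ℤ) : ℂ :=
  Complex.exp (2 * π * Complex.I * ν * (m.1 / δ) ^ 2 * t)

/-- The prefactor `y` is absorbed as `exp (log y)`. It accounts for the fourth basis function, with
coefficient `1`. -/
lemma thetaTerm_eq_expZ (ν δ β : ℝ) (t : ℂ) (m : ℤ × ℤ × ℤ) {z : ℂ} (hz : 0 < z.im) :
    thetaTerm ν δ β m t z =
      constZ ν δ t m * Complex.exp (∑ i, coeffZ ν δ β t i m * basisZ i z) := by
  have e : (z.im : ℂ) = Complex.exp (Real.log z.im : ℝ) := by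
    rw [← Complex.ofReal_exp, Real.exp_log hz]
  rw [thetaTerm]
  nth_rewrite 1 [e]
  rw [constZ, ← Complex.exp_add, ← Complex.exp_add]
  congr 1
  simp only [thetaExponent, coeffZ, basisZ, Fin.sum_univ_four, Matrix.cons_val]
  ring

lemma contDiff_ofReal_re : ContDiff ℝ ∞ fun z : ℂ => (z.re : ℂ) :=
  Complex.ofRealCLM.contDiff.comp Complex.reCLM.contDiff

lemma contDiff_ofReal_im : ContDiff ℝ ∞ fun z : ℂ => (z.im : ℂ) :=
  Complex.ofRealCLM.contDiff.comp Complex.imCLM.contDiff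

lemma contDiffOn_basisZ (i : Fin 4) : ContDiffOn ℝ ∞ (basisZ i) {z : ℂ | 0 < z.im} := by
  fin_cases i
  · exact contDiff_ofReal_re.contDiffOn
  · exact (contDiff_ofReal_re.pow 2).contDiffOn
  · exact (contDiff_ofReal_im.pow 2).contDiffOn
  · refine Complex.ofRealCLM.contDiff.comp_contDiffOn ?_
    exact Complex.imCLM.contDiff.contDiffOn.log fun z hz => (ne_of_gt hz : z.im ≠ 0)

lemma hasDerivAt_ofReal_sq (x : ℝ) : HasDerivAt (fun x : ℝ => (x : ℂ) ^ 2) (2 * (x : ℂ)) x := by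
  have h : HasDerivAt (fun x : ℝ => ((x ^ 2 : ℝ) : ℂ)) ((2 * x : ℝ) : ℂ) x := by
    simpa using (hasDerivAt_pow 2 x).ofReal_comp
  simpa using h

lemma hasDerivAt_two_mul_ofReal (x : ℝ) : HasDerivAt (fun x : ℝ => 2 * (x : ℂ)) 2 x := by
  have h : HasDerivAt (fun x : ℝ => ((2 * x : ℝ) : ℂ)) ((2 : ℝ) : ℂ) x := by
    simpa using ((hasDerivAt_id x).const_mul 2).ofReal_comp
  simpa using h

lemma hasLineDerivAt_basisZ_one (i : Fin 4) (q : ℂ) :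
    HasLineDerivAt ℝ (basisZ i) (basisZx i q) q 1 := by
  fin_cases i
  · exact hasLineDerivAt_one (h := fun x _ => (x : ℂ)) (hasDerivAt_id q.re).ofReal_comp
  · exact hasLineDerivAt_one (h := fun x _ => (x : ℂ) ^ 2) (hasDerivAt_ofReal_sq _)
  · exact hasLineDerivAt_one (h := fun _ y => (y : ℂ) ^ 2) (hasDerivAt_const _ _)
  · exact hasLineDerivAt_one (h := fun _ y => (Real.log y : ℂ)) (hasDerivAt_const _ _)

lemma hasLineDerivAt_basisZx (i : Fin 4) (q : ℂ) :
    HasLineDerivAt ℝ (basisZx i) (basisZxx i q) q 1 := by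
  fin_cases i
  · exact hasLineDerivAt_one (h := fun _ _ => 1) (hasDerivAt_const _ _)
  · exact hasLineDerivAt_one (h := fun x _ => 2 * (x : ℂ)) (hasDerivAt_two_mul_ofReal _)
  · exact hasLineDerivAt_one (h := fun _ _ => 0) (hasDerivAt_const _ _)
  · exact hasLineDerivAt_one (h := fun _ _ => 0) (hasDerivAt_const _ _)

lemma hasLineDerivAt_basisZ_I (i : Fin 4) {q : ℂ} (hq : 0 < q.im) :
    HasLineDerivAt ℝ (basisZ i) (basisZy i q) q Complex.I := by
  fin_cases i
  · exact hasLineDerivAt_I (h := fun x _ => (x : ℂ)) (hasDerivAt_const _ _)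
  · exact hasLineDerivAt_I (h := fun x _ => (x : ℂ) ^ 2) (hasDerivAt_const _ _)
  · exact hasLineDerivAt_I (h := fun _ y => (y : ℂ) ^ 2) (hasDerivAt_ofReal_sq _)
  · exact hasLineDerivAt_I (h := fun _ y => (Real.log y : ℂ))
      (Real.hasDerivAt_log hq.ne').ofReal_comp

lemma hasLineDerivAt_basisZy (i : Fin 4) {q : ℂ} (hq : 0 < q.im) :
    HasLineDerivAt ℝ (basisZy i) (basisZyy i q) q Complex.I := by
  fin_cases i
  · exact hasLineDerivAt_I (h := fun _ _ => 0) (hasDerivAt_const _ _)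
  · exact hasLineDerivAt_I (h := fun _ _ => 0) (hasDerivAt_const _ _)
  · exact hasLineDerivAt_I (h := fun _ y => 2 * (y : ℂ)) (hasDerivAt_two_mul_ofReal _)
  · exact hasLineDerivAt_I (h := fun _ y => ((y⁻¹ : ℝ) : ℂ)) (hasDerivAt_inv hq.ne').ofReal_comp

end ThetaLift

end

noncomputable section

namespace ThetaLift

/-! ### The theta series as a function of `z` -/

section

variable {ν δ β : ℝ} {t : ℂ} {w : ℤ × ℤ × ℤ → ℂ}

-- The coefficients are of degree at most two in the index, and each entry of the index is bounded
-- by a multiple of `√(1 + idxSq)`. With the filter `⊤` the relation is a bound for every index, not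
-- only an asymptotic one.
open Asymptotics in
lemma coeffZ_isBigO (ν δ β : ℝ) (t : ℂ) (i : Fin 4) :
    coeffZ ν δ β t i =O[⊤] fun m => 1 + idxSq m := by
  set h : ℤ × ℤ × ℤ → ℝ := fun m => √(1 + idxSq m)
  have hh : (fun m => h m * h m) = fun m => 1 + idxSq m := by
    funext m
    exact Real.mul_self_sqrt (by have := idxSq_nonneg m; positivity)
  have key : ∀ p : ℤ × ℤ × ℤ → ℤ, (∀ m, (p m : ℝ) ^ 2 ≤ 1 + idxSq m) →
      (fun m => (p m : ℂ)) =O[⊤] h := fun p hp => by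
    refine IsBigO.of_bound 1 (Eventually.of_forall fun m => ?_)
    rw [one_mul, Real.norm_of_nonneg (Real.sqrt_nonneg _), Complex.norm_intCast]
    exact Real.abs_le_sqrt (hp m)
  have h1 : (fun m : ℤ × ℤ × ℤ => (m.1 : ℂ)) =O[⊤] h :=
    key (fun m => m.1) fun m => by unfold idxSq; nlinarith [sq_nonneg (m.2.1 : ℝ), sq_nonneg (m.2.2 : ℝ)]
  have h2 : (fun m : ℤ × ℤ × ℤ => (m.2.1 : ℂ)) =O[⊤] h :=
    key (fun m => m.2.1) fun m => by unfold idxSq; nlinarith [sq_nonneg (m.1 : ℝ), sq_nonneg (m.2.2 : ℝ)]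
  have h3 : (fun m : ℤ × ℤ × ℤ => (m.2.2 : ℂ)) =O[⊤] h :=
    key (fun m => m.2.2) fun m => by unfold idxSq; nlinarith [sq_nonneg (m.2.1 : ℝ), sq_nonneg (m.1 : ℝ)]
  rw [← hh]
  fin_cases i
  · have e : coeffZ ν δ β t 0 = fun m : ℤ × ℤ × ℤ => 4 * π * Complex.I / (β * δ) * ((m.2.2 : ℂ) * m.1) +
        -(4 * π * Complex.I * ν * t / (δ * δ)) * ((m.1 : ℂ) * m.2.1) := by
      funext m; simp only [coeffZ, Matrix.cons_val]; ring
    exact e ▸ ((h3.mul h1).const_mul_left _).add ((h1.mul h2).const_mul_left _)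
  · have e : coeffZ ν δ β t 1 = fun m : ℤ × ℤ × ℤ => 2 * π * Complex.I * ν * t / (δ * δ) * ((m.2.1 : ℂ) * m.2.1) +
        -(2 * π * Complex.I / (β * δ)) * ((m.2.2 : ℂ) * m.2.1) := by
      funext m; simp only [coeffZ, Matrix.cons_val]; ring
    exact e ▸ ((h2.mul h2).const_mul_left _).add ((h3.mul h2).const_mul_left _)
  · have e : coeffZ ν δ β t 2 = fun m : ℤ × ℤ × ℤ => (-(π / (ν * t.im)) : ℂ) *
        ((ν / δ * t.re * m.2.1 + -1 / β * m.2.2) * (ν / δ * t.re * m.2.1 + -1 / β * m.2.2) +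
          (ν / δ * t.im * m.2.1) * (ν / δ * t.im * m.2.1) : ℂ) := by
      funext m; simp only [coeffZ, Matrix.cons_val]; ring
    have h4 := (h2.const_mul_left (ν / δ * t.re : ℂ)).add (h3.const_mul_left (-1 / β : ℂ))
    have h5 := h2.const_mul_left (ν / δ * t.im : ℂ)
    exact e ▸ ((h4.mul h4).add (h5.mul h5)).const_mul_left _
  · rw [hh]
    refine IsBigO.of_bound 1 (Eventually.of_forall fun m => ?_)
    have := idxSq_nonneg m
    rw [Real.norm_of_nonneg (by positivity)]
    simp [coeffZ, this]

lemma coeffZ_bound (ν δ β : ℝ) (t : ℂ) :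
    ∃ A : ℝ, 0 < A ∧ ∀ m, 1 + ∑ i, ‖coeffZ ν δ β t i m‖ ≤ A * (1 + idxSq m) := by
  choose A hA using fun i => Asymptotics.isBigO_top.mp (coeffZ_isBigO ν δ β t i)
  refine ⟨1 + ∑ i, |A i|, by positivity, fun m => ?_⟩
  have h0 := idxSq_nonneg m
  have h1 : ∑ i, ‖coeffZ ν δ β t i m‖ ≤ ∑ i, |A i| * (1 + idxSq m) := by
    refine Finset.sum_le_sum fun i _ => (hA i m).trans ?_
    rw [Real.norm_of_nonneg (by positivity)]
    gcongr
    exact le_abs_self _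
  rw [← Finset.sum_mul] at h1
  linarith

/-- The bookkeeping shared by the dominations in `z` and in `τ`: `S` stands for the sum of the
coefficients, `ρ` for the quadratic form controlling it, `e` for the Gaussian, and `d` for the decay
left after the polynomial has been absorbed. -/
lemma dominated_le {g S E A B K ρ e d : ℝ} (n : ℕ) (hS0 : 0 ≤ S) (hA : 0 ≤ A) (hρ : 0 ≤ ρ)
    (hB : 0 ≤ B) (hgE0 : 0 ≤ g * E) (hS : S ≤ A * (1 + ρ)) (hgE : g * E ≤ B * e)
    (hd : (1 + ρ) ^ n * e ≤ K * d) : g * S ^ n * E ≤ A ^ n * B * K * d :=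
  calc g * S ^ n * E = S ^ n * (g * E) := by ring
    _ ≤ (A * (1 + ρ)) ^ n * (B * e) := by gcongr
    _ = A ^ n * B * ((1 + ρ) ^ n * e) := by rw [mul_pow]; ring
    _ ≤ A ^ n * B * (K * d) := by gcongr
    _ = _ := by ring

lemma isOpen_box (a b c : ℝ) : IsOpen {q : ℂ | a < q.im ∧ q.im < b ∧ |q.re| < c} :=
  (isOpen_lt continuous_const Complex.continuous_im).inter
    ((isOpen_lt Complex.continuous_im continuous_const).inter
      (isOpen_lt Complex.continuous_re.abs continuous_const))

lemma box_mem_nhds {p : ℂ} (hp : 0 < p.im) :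
    {q : ℂ | p.im / 2 < q.im ∧ q.im < 2 * p.im ∧ |q.re| < |p.re| + 1} ∈ 𝓝 p :=
  (isOpen_box _ _ _).mem_nhds ⟨half_lt_self hp, lt_mul_of_one_lt_left hp one_lt_two, lt_add_one _⟩

lemma norm_summand_le (hw : ∀ m, ‖w m‖ ≤ 1) (m : ℤ × ℤ × ℤ) {q : ℂ} (hq : 0 < q.im) {Y E : ℝ}
    (hY : q.im ≤ Y) (hE : ‖Complex.exp (thetaExponent ν δ β m t q)‖ ≤ E) :
    ‖w m * constZ ν δ t m‖ * ‖Complex.exp (∑ i, coeffZ ν δ β t i m * basisZ i q)‖ ≤ Y * E := by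
  have e1 := thetaTerm_eq_expZ ν δ β t m hq
  rw [norm_mul, mul_assoc, ← norm_mul, ← e1, thetaTerm, norm_mul, Complex.norm_real,
    Real.norm_of_nonneg hq.le]
  have h1 : q.im * ‖Complex.exp (thetaExponent ν δ β m t q)‖ ≤ Y * E := by
    gcongr
    exact hq.le.trans hY
  have h2 : 0 ≤ q.im * ‖Complex.exp (thetaExponent ν δ β m t q)‖ := by positivity
  exact (mul_le_of_le_one_left h2 (hw m)).trans h1

lemma coeffZ_bound_idxForm (ν δ β : ℝ) (t : ℂ) {y₁ : ℝ} (hy₁ : 0 < y₁) :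
    ∃ A : ℝ, 0 < A ∧ ∀ m y, y₁ ≤ y → 1 + ∑ i, ‖coeffZ ν δ β t i m‖ ≤ A * (1 + idxForm m y) := by
  obtain ⟨A, hA, hAm⟩ := coeffZ_bound ν δ β t
  set c := min 1 (y₁ ^ 2) with hc
  have hc0 : 0 < c := by positivity
  have hc1 : c ≤ 1 := min_le_left _ _
  refine ⟨A / c, by positivity, fun m y hy => (hAm m).trans ?_⟩
  have := idxSq_le_idxForm hy₁ m hy
  rw [← hc] at this
  rw [div_mul_eq_mul_div, le_div_iff₀ hc0, mul_assoc]
  gcongr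
  linarith

/-- The theta series is an exponential family for counting measure. On a box around `p` the Gaussian
decay in the index is uniform and absorbs every power of the coefficients, so boundedness of the
weights suffices. -/
lemma expDominated_Z (hν : 0 < ν) (hδ : 0 < δ) (hβ : 0 < β) (ht : 0 < t.im)
    (hw : ∀ m, ‖w m‖ ≤ 1) :
    ExpDominated {z : ℂ | 0 < z.im} Measure.count (coeffZ ν δ β t) basisZ
      (fun m => w m * constZ ν δ t m) where
  meas := (measurable_of_countable _).aestronglyMeasurable
  bound p hp := by
    have hp : 0 < p.im := hp
    obtain ⟨κ, hκ, hb⟩ := norm_exp_thetaExponent_le (v₀ := t.im) (v₁ := t.im) (y₁ := p.im / 2)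
      |t.re| (|p.re| + 1) hν hδ hβ ht ht (half_pos hp)
    obtain ⟨A, hA, hAm⟩ := coeffZ_bound_idxForm ν δ β t (half_pos hp)
    refine ⟨_, box_mem_nhds hp, fun n => ?_⟩
    obtain ⟨K, κ', hK, hκ', hd⟩ := idxForm_decay hκ (half_pos hp) n
    refine ⟨fun m => A ^ n * (2 * p.im) * K * Real.exp (-κ' * idxSq m), ?_,
      Eventually.of_forall fun m q hq => ?_⟩
    · exact (integrable_count_iff.mpr (summable_exp_neg_idxSq hκ').norm).const_mul _
    · obtain ⟨h1, h2, h3⟩ := hq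
      have hq0 : 0 < q.im := (half_pos hp).trans h1
      exact dominated_le n (add_nonneg zero_le_one (Finset.sum_nonneg fun i _ => norm_nonneg _))
        hA.le (idxForm_nonneg m q.im) (by positivity) (by positivity) (hAm m q.im h1.le)
        (norm_summand_le hw m hq0 h2.le (hb m t q le_rfl le_rfl le_rfl h1.le h3.le))
        (hd m q.im h1.le).1

/-- The theta series with weights `w`. -/
def thetaSeries (ν δ β : ℝ) (w : ℤ × ℤ × ℤ → ℂ) (t z : ℂ) : ℂ :=
  ∑' m, w m * thetaTerm ν δ β m t z

lemma integral_count_eq_tsum {α : Type*} [MeasurableSpace α] [MeasurableSingletonClass α]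
    [Countable α] {F : α → ℂ} (h : Integrable F Measure.count) : ∫ m, F m ∂Measure.count = ∑' m, F m := by
  rw [integral_countable h]
  simp [Measure.real]

lemma thetaSeries_summand (ν δ β : ℝ) (w : ℤ × ℤ × ℤ → ℂ) (t : ℂ) (m : ℤ × ℤ × ℤ) {z : ℂ}
    (hz : 0 < z.im) : w m * thetaTerm ν δ β m t z =
      w m * constZ ν δ t m * Complex.exp (∑ i, coeffZ ν δ β t i m * basisZ i z) := by
  rw [thetaTerm_eq_expZ ν δ β t m hz, mul_assoc]

lemma aestronglyMeasurable_coeffZ (i : Fin 4) :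
    AEStronglyMeasurable (coeffZ ν δ β t i) Measure.count :=
  (measurable_of_countable _).aestronglyMeasurable

lemma summable_thetaSeries (hν : 0 < ν) (hδ : 0 < δ) (hβ : 0 < β) (ht : 0 < t.im)
    (hw : ∀ m, ‖w m‖ ≤ 1) {z : ℂ} (hz : 0 < z.im) :
    Summable fun m => w m * thetaTerm ν δ β m t z := by
  have h := (expDominated_Z hν hδ hβ ht hw).integrable aestronglyMeasurable_coeffZ hz
  refine ((integrable_count_iff.mp h).of_norm).congr fun m => ?_
  exact (thetaSeries_summand ν δ β w t m hz).symm

lemma thetaSeries_eqOn_expInt (hν : 0 < ν) (hδ : 0 < δ) (hβ : 0 < β) (ht : 0 < t.im)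
    (hw : ∀ m, ‖w m‖ ≤ 1) : Set.EqOn (thetaSeries ν δ β w t)
      (expInt Measure.count (coeffZ ν δ β t) basisZ (fun m => w m * constZ ν δ t m))
      {z : ℂ | 0 < z.im} := fun z hz => by
  have h := (expDominated_Z hν hδ hβ ht hw).integrable aestronglyMeasurable_coeffZ hz
  rw [expInt, integral_count_eq_tsum h, thetaSeries]
  exact tsum_congr fun m => thetaSeries_summand ν δ β w t m hz

lemma contDiffOn_thetaSeries (hν : 0 < ν) (hδ : 0 < δ) (hβ : 0 < β) (ht : 0 < t.im)
    (hw : ∀ m, ‖w m‖ ≤ 1) : ContDiffOn ℝ ∞ (thetaSeries ν δ β w t) {z : ℂ | 0 < z.im} :=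
  ((expDominated_Z hν hδ hβ ht hw).contDiffOn aestronglyMeasurable_coeffZ isOpen_im_pos
    contDiffOn_basisZ).congr (thetaSeries_eqOn_expInt hν hδ hβ ht hw)

/-- The factor by which the derivative with respect to `y` multiplies a term. -/
def symbolZy (ν δ β : ℝ) (t : ℂ) (m : ℤ × ℤ × ℤ) (z : ℂ) : ℂ :=
  ∑ i, coeffZ ν δ β t i m * basisZy i z

/-- The factor by which the Laplacian of weight `0` in `z` multiplies a term. -/
def symbolZ (ν δ β : ℝ) (t : ℂ) (m : ℤ × ℤ × ℤ) (z : ℂ) : ℂ :=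
  lapSymbol 0 z (∑ i, coeffZ ν δ β t i m * basisZx i z) (∑ i, coeffZ ν δ β t i m * basisZxx i z)
    (∑ i, coeffZ ν δ β t i m * basisZy i z) (∑ i, coeffZ ν δ β t i m * basisZyy i z)

lemma dIm_thetaSeries (hν : 0 < ν) (hδ : 0 < δ) (hβ : 0 < β) (ht : 0 < t.im)
    (hw : ∀ m, ‖w m‖ ≤ 1) {z : ℂ} (hz : 0 < z.im) :
    (Summable fun m => w m * (symbolZy ν δ β t m z * thetaTerm ν δ β m t z)) ∧
    dIm (thetaSeries ν δ β w t) z =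
      ∑' m, w m * (symbolZy ν δ β t m z * thetaTerm ν δ β m t z) := by
  have h := (expDominated_Z hν hδ hβ ht hw).lineDeriv_eq_integral aestronglyMeasurable_coeffZ
    isOpen_im_pos contDiffOn_basisZ Complex.I (fun i q hq => hasLineDerivAt_basisZ_I i hq) hz
  have e : (fun m => w m * constZ ν δ t m * (∑ i, coeffZ ν δ β t i m * basisZy i z) *
      Complex.exp (∑ i, coeffZ ν δ β t i m * basisZ i z)) =
      fun m => w m * (symbolZy ν δ β t m z * thetaTerm ν δ β m t z) := by
    funext m
    rw [thetaTerm_eq_expZ ν δ β t m hz, symbolZy]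
    ring
  rw [e] at h
  refine ⟨(integrable_count_iff.mp h.1).of_norm, ?_⟩
  rw [dIm_congr isOpen_im_pos (thetaSeries_eqOn_expInt hν hδ hβ ht hw) hz,
    ← integral_count_eq_tsum h.1, ← h.2]
  rfl

lemma lap_thetaSeries (hν : 0 < ν) (hδ : 0 < δ) (hβ : 0 < β) (ht : 0 < t.im)
    (hw : ∀ m, ‖w m‖ ≤ 1) {z : ℂ} (hz : 0 < z.im) :
    (Summable fun m => w m * (symbolZ ν δ β t m z * thetaTerm ν δ β m t z)) ∧
    lap 0 (thetaSeries ν δ β w t) z =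
      ∑' m, w m * (symbolZ ν δ β t m z * thetaTerm ν δ β m t z) := by
  have h := (expDominated_Z hν hδ hβ ht hw).lap_eq aestronglyMeasurable_coeffZ
    contDiffOn_basisZ (fun i q _ => hasLineDerivAt_basisZ_one i q)
    (fun i q _ => hasLineDerivAt_basisZx i q) (fun i q hq => hasLineDerivAt_basisZ_I i hq)
    (fun i q hq => hasLineDerivAt_basisZy i hq) 0 hz
  have e : (fun m => w m * constZ ν δ t m * lapSymbol 0 z (∑ i, coeffZ ν δ β t i m * basisZx i z)
      (∑ i, coeffZ ν δ β t i m * basisZxx i z) (∑ i, coeffZ ν δ β t i m * basisZy i z)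
      (∑ i, coeffZ ν δ β t i m * basisZyy i z) *
      Complex.exp (∑ i, coeffZ ν δ β t i m * basisZ i z)) =
      fun m => w m * (symbolZ ν δ β t m z * thetaTerm ν δ β m t z) := by
    funext m
    rw [thetaTerm_eq_expZ ν δ β t m hz, symbolZ]
    ring
  rw [e] at h
  refine ⟨(integrable_count_iff.mp h.1).of_norm, ?_⟩
  rw [lap_congr 0 (thetaSeries_eqOn_expInt hν hδ hβ ht hw) hz,
    ← integral_count_eq_tsum h.1, ← h.2]

end

end ThetaLift

end

noncomputable section

namespace ThetaLift

/-! ### The theta function in the variable `τ` -/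

/-- The coefficients of `thetaExponent` as a function of `τ`. -/
def coeffT (ν δ β : ℝ) : Fin 4 → (ℤ × ℤ × ℤ) × ℍ → ℂ :=
  ![fun a => 2 * π * Complex.I * ν * (a.1.1 / δ - a.1.2.1 / δ * a.2.re) ^ 2,
    fun a => -(π * ν * (a.1.2.1 / δ) ^ 2 * a.2.im ^ 2),
    fun a => 2 * π * (a.1.2.1 / δ) * (a.1.2.2 / β) * a.2.im ^ 2,
    fun a => -(π * (a.1.2.2 / β) ^ 2 * a.2.im ^ 2 / ν)]

/-- The functions of `τ` of which `thetaExponent` is a linear combination. -/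
def basisT : Fin 4 → ℂ → ℂ :=
  ![fun t => t.re + t.im * Complex.I, fun t => ((t.re ^ 2 + t.im ^ 2) / t.im : ℝ),
    fun t => (t.re / t.im : ℝ), fun t => (t.im⁻¹ : ℝ)]

/-- Derivatives of `basisT`. -/
def basisTx : Fin 4 → ℂ → ℂ :=
  ![fun _ => 1, fun t => (2 * t.re / t.im : ℝ), fun t => (1 / t.im : ℝ), fun _ => 0]

/-- Derivatives of `basisTx`. -/
def basisTxx : Fin 4 → ℂ → ℂ := ![fun _ => 0, fun t => (2 / t.im : ℝ), fun _ => 0, fun _ => 0]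

/-- Derivatives of `basisT`. -/
def basisTy : Fin 4 → ℂ → ℂ :=
  ![fun _ => Complex.I, fun t => (1 - t.re ^ 2 / t.im ^ 2 : ℝ), fun t => (-(t.re / t.im ^ 2) : ℝ),
    fun t => (-(t.im ^ 2)⁻¹ : ℝ)]

/-- Derivatives of `basisTy`. -/
def basisTyy : Fin 4 → ℂ → ℂ :=
  ![fun _ => 0, fun t => (2 * t.re ^ 2 / t.im ^ 3 : ℝ), fun t => (2 * t.re / t.im ^ 3 : ℝ),
    fun t => (2 / t.im ^ 3 : ℝ)]

/-- The part of `thetaExponent` which does not depend on `τ`. -/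
def constT (δ β : ℝ) (a : (ℤ × ℤ × ℤ) × ℍ) : ℂ :=
  Complex.exp (-(2 * π * Complex.I * (a.1.2.2 / β) *
    (a.1.2.1 / δ * a.2.re ^ 2 - 2 * (a.1.1 / δ) * a.2.re)))

/-- With `c = j / δ` and `r = n / β`, the separation of variables is `|ν c t - r|² / (ν v) = ν c²
|t|² / v - 2 c r u / v + r² / (ν v)` for `t = u + i v`; this yields the last three basis functions,
and the holomorphic part of the exponent yields the first. -/
lemma thetaTerm_eq_expT {ν : ℝ} (hν : 0 < ν) (δ β : ℝ) {t : ℂ} (ht : 0 < t.im) (m : ℤ × ℤ × ℤ)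
    (z : ℍ) : thetaTerm ν δ β m t z =
      z.im * constT δ β (m, z) * Complex.exp (∑ i, coeffT ν δ β i (m, z) * basisT i t) := by
  rw [thetaTerm, constT, mul_assoc, ← Complex.exp_add]
  congr 2
  have h1 : (t.im : ℂ) ≠ 0 := Complex.ofReal_ne_zero.mpr ht.ne'
  have h2 : (ν : ℂ) ≠ 0 := Complex.ofReal_ne_zero.mpr hν.ne'
  simp only [thetaExponent, coeffT, basisT, Fin.sum_univ_four, Matrix.cons_val,
    UpperHalfPlane.coe_re, UpperHalfPlane.coe_im]
  rw [Complex.re_add_im]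
  generalize (m.1 : ℂ) / δ = a
  generalize (m.2.1 : ℂ) / δ = c
  generalize (m.2.2 : ℂ) / β = r
  push_cast
  field_simp
  ring

lemma contDiffOn_basisT (i : Fin 4) : ContDiffOn ℝ ∞ (basisT i) {t : ℂ | 0 < t.im} := by
  have h0 : ∀ t ∈ {t : ℂ | 0 < t.im}, t.im ≠ 0 := fun t ht => ne_of_gt ht
  have hre : ContDiffOn ℝ ∞ (fun t : ℂ => t.re) {t : ℂ | 0 < t.im} :=
    Complex.reCLM.contDiff.contDiffOn
  have him : ContDiffOn ℝ ∞ (fun t : ℂ => t.im) {t : ℂ | 0 < t.im} :=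
    Complex.imCLM.contDiff.contDiffOn
  fin_cases i
  · exact (contDiff_ofReal_re.add (contDiff_ofReal_im.mul contDiff_const)).contDiffOn
  · exact Complex.ofRealCLM.contDiff.comp_contDiffOn (((hre.pow 2).add (him.pow 2)).div him h0)
  · exact Complex.ofRealCLM.contDiff.comp_contDiffOn (hre.div him h0)
  · exact Complex.ofRealCLM.contDiff.comp_contDiffOn (him.inv h0)

lemma hasLineDerivAt_basisT_one (i : Fin 4) {q : ℂ} :
    HasLineDerivAt ℝ (basisT i) (basisTx i q) q 1 := by
  fin_cases i
  · exact hasLineDerivAt_one (h := fun x y => (x : ℂ) + y * Complex.I)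
      ((hasDerivAt_id q.re).ofReal_comp.add_const _)
  · refine hasLineDerivAt_one (h := fun x y => (((x ^ 2 + y ^ 2) / y : ℝ) : ℂ))
      (HasDerivAt.ofReal_comp ?_)
    simpa using ((hasDerivAt_pow 2 q.re).add_const (q.im ^ 2)).div_const q.im
  · exact hasLineDerivAt_one (h := fun x y => ((x / y : ℝ) : ℂ))
      ((hasDerivAt_id q.re).div_const q.im).ofReal_comp
  · exact hasLineDerivAt_one (h := fun _ y => ((y⁻¹ : ℝ) : ℂ)) (hasDerivAt_const _ _)

lemma hasLineDerivAt_basisTx (i : Fin 4) {q : ℂ} :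
    HasLineDerivAt ℝ (basisTx i) (basisTxx i q) q 1 := by
  fin_cases i
  · exact hasLineDerivAt_one (h := fun _ _ => 1) (hasDerivAt_const _ _)
  · refine hasLineDerivAt_one (h := fun x y => ((2 * x / y : ℝ) : ℂ)) (HasDerivAt.ofReal_comp ?_)
    simpa using ((hasDerivAt_id q.re).const_mul 2).div_const q.im
  · exact hasLineDerivAt_one (h := fun _ y => ((1 / y : ℝ) : ℂ)) (hasDerivAt_const _ _)
  · exact hasLineDerivAt_one (h := fun _ _ => 0) (hasDerivAt_const _ _)

lemma hasLineDerivAt_basisT_I (i : Fin 4) {q : ℂ} (hq : 0 < q.im) :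
    HasLineDerivAt ℝ (basisT i) (basisTy i q) q Complex.I := by
  fin_cases i
  · refine hasLineDerivAt_I (h := fun x y => (x : ℂ) + y * Complex.I) ?_
    have h : HasDerivAt (fun y : ℝ => (y : ℂ)) 1 q.im := (hasDerivAt_id q.im).ofReal_comp
    simpa [basisTy] using (h.mul_const Complex.I).const_add (q.re : ℂ)
  · refine hasLineDerivAt_I (h := fun x y => (((x ^ 2 + y ^ 2) / y : ℝ) : ℂ))
      (HasDerivAt.ofReal_comp ?_)
    refine (((hasDerivAt_pow 2 q.im).const_add (q.re ^ 2)).div (hasDerivAt_id q.im)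
      hq.ne').congr_deriv ?_
    simp only [id]
    field_simp
    ring
  · refine hasLineDerivAt_I (h := fun x y => ((x / y : ℝ) : ℂ)) (HasDerivAt.ofReal_comp ?_)
    refine ((hasDerivAt_const q.im q.re).div (hasDerivAt_id q.im) hq.ne').congr_deriv ?_
    simp only [id]
    field_simp
    ring
  · exact hasLineDerivAt_I (h := fun _ y => ((y⁻¹ : ℝ) : ℂ)) (hasDerivAt_inv hq.ne').ofReal_comp

lemma hasLineDerivAt_basisTy (i : Fin 4) {q : ℂ} (hq : 0 < q.im) :
    HasLineDerivAt ℝ (basisTy i) (basisTyy i q) q Complex.I := by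
  have h2 : q.im ^ 2 ≠ 0 := pow_ne_zero 2 hq.ne'
  fin_cases i
  · exact hasLineDerivAt_I (h := fun _ _ => Complex.I) (hasDerivAt_const _ _)
  · refine hasLineDerivAt_I (h := fun x y => ((1 - x ^ 2 / y ^ 2 : ℝ) : ℂ))
      (HasDerivAt.ofReal_comp ?_)
    refine (((hasDerivAt_const q.im (q.re ^ 2)).div (hasDerivAt_pow 2 q.im) h2).const_sub
      1).congr_deriv ?_
    field_simp
    ring
  · refine hasLineDerivAt_I (h := fun x y => ((-(x / y ^ 2) : ℝ) : ℂ))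
      (HasDerivAt.ofReal_comp ?_)
    refine ((hasDerivAt_const q.im q.re).div (hasDerivAt_pow 2 q.im) h2).neg.congr_deriv ?_
    field_simp
    ring
  · refine hasLineDerivAt_I (h := fun _ y => ((-(y ^ 2)⁻¹ : ℝ) : ℂ))
      (HasDerivAt.ofReal_comp ?_)
    refine ((hasDerivAt_pow 2 q.im).inv h2).neg.congr_deriv ?_
    field_simp
    ring

/-- The factor by which the Laplacian of weight `1 / 2` in `τ` multiplies a term. -/
def symbolT (ν δ β : ℝ) (t : ℂ) (a : (ℤ × ℤ × ℤ) × ℍ) : ℂ :=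
  lapSymbol (1 / 2) t (∑ i, coeffT ν δ β i a * basisTx i t) (∑ i, coeffT ν δ β i a * basisTxx i t)
    (∑ i, coeffT ν δ β i a * basisTy i t) (∑ i, coeffT ν δ β i a * basisTyy i t)

/-- The terms satisfy `4 Δ_{1/2, τ} = Δ_{0, z}`. -/
lemma four_mul_symbolT {ν : ℝ} (hν : 0 < ν) (δ β : ℝ) {t : ℂ} (ht : 0 < t.im) (m : ℤ × ℤ × ℤ)
    (z : ℍ) : 4 * symbolT ν δ β t (m, z) = symbolZ ν δ β t m z := by
  have h1 : (t.im : ℂ) ≠ 0 := Complex.ofReal_ne_zero.mpr ht.ne'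
  have h2 : (ν : ℂ) ≠ 0 := Complex.ofReal_ne_zero.mpr hν.ne'
  have h3 : (z.im : ℂ) ≠ 0 := Complex.ofReal_ne_zero.mpr z.im_pos.ne'
  have ht' : t = t.re + t.im * Complex.I := (Complex.re_add_im t).symm
  simp only [symbolT, symbolZ, lapSymbol, coeffT, coeffZ, basisTx, basisTxx, basisTy, basisTyy,
    basisZx, basisZxx, basisZy, basisZyy, Fin.sum_univ_four, Matrix.cons_val,
    UpperHalfPlane.coe_re, UpperHalfPlane.coe_im]
  -- Once indices and coordinates are abstracted, the claim is an identity of rational functions, to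
  -- be read modulo `I ^ 2 = -1`.
  generalize (m.1 : ℂ) / δ = a
  generalize (m.2.1 : ℂ) / δ = c
  generalize (m.2.2 : ℂ) / β = r
  have e : ν * t = (ν : ℂ) * (t.re + t.im * Complex.I) := by rw [← ht']
  rw [e]
  push_cast
  generalize (t.re : ℂ) = u at *
  generalize (t.im : ℂ) = v at *
  generalize (z.re : ℂ) = x at *
  generalize (z.im : ℂ) = y at *
  generalize (π : ℂ) = p
  have hI : Complex.I ^ 2 = -1 := Complex.I_sq
  have hI3 : Complex.I ^ 3 = -Complex.I := by rw [pow_succ, hI]; ring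
  have hI4 : Complex.I ^ 4 = 1 := Complex.I_pow_four
  field_simp
  ring_nf
  simp only [hI, hI3, hI4]
  ring

/-- A term with `j = n = 0` depends on `z` only through the factor `y`, which is harmonic. -/
lemma symbolZ_eq_zero (ν δ β : ℝ) (t : ℂ) (i : ℤ) {z : ℂ} (hz : 0 < z.im) :
    symbolZ ν δ β t (i, 0, 0) z = 0 := by
  have h3 : (z.im : ℂ) ≠ 0 := Complex.ofReal_ne_zero.mpr hz.ne'
  simp only [symbolZ, lapSymbol, coeffZ, basisZx, basisZxx, basisZy, basisZyy, Fin.sum_univ_four,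
    Matrix.cons_val]
  push_cast
  field_simp
  ring

end ThetaLift

end

noncomputable section

namespace ThetaLift

/-! ### Integrals of theta functions -/

section

variable {ν δ β : ℝ}

-- Here `z` varies too, so the bounds must be uniform in `y`. The second and third index entries are
-- measured after multiplication by `y`; the one occurrence without `y` is written as `(j y)(x /
-- y)`, with `x / y` bounded on the strip.
open Asymptotics in
lemma coeffT_isBigO (ν δ β : ℝ) {y₁ X : ℝ} (hy₁ : 0 < y₁) (i : Fin 4) :
    coeffT ν δ β i =O[𝓟 {a | y₁ ≤ a.2.im ∧ |a.2.re| ≤ X}] fun a => 1 + idxForm a.1 a.2.im := by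
  set l : Filter ((ℤ × ℤ × ℤ) × ℍ) := 𝓟 {a | y₁ ≤ a.2.im ∧ |a.2.re| ≤ X}
  set h : (ℤ × ℤ × ℤ) × ℍ → ℝ := fun a => √(1 + idxForm a.1 a.2.im)
  have hh : (fun a => h a * h a) = fun a => 1 + idxForm a.1 a.2.im := by
    funext a
    exact Real.mul_self_sqrt (by have := idxForm_nonneg a.1 a.2.im; positivity)
  have key : ∀ p : (ℤ × ℤ × ℤ) × ℍ → ℝ, (∀ a, p a ^ 2 ≤ 1 + idxForm a.1 a.2.im) →
      (fun a => (p a : ℂ)) =O[l] h := fun p hp => by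
    refine IsBigO.of_bound 1 (Eventually.of_forall fun a => ?_)
    rw [one_mul, Real.norm_of_nonneg (Real.sqrt_nonneg _), Complex.norm_real]
    exact Real.abs_le_sqrt (hp a)
  have h1 : (fun a : (ℤ × ℤ × ℤ) × ℍ => ((a.1.1 : ℝ) : ℂ)) =O[l] h :=
    key (fun a => a.1.1) fun a => by
      have : 0 ≤ ((a.1.2.1 : ℝ) ^ 2 + (a.1.2.2 : ℝ) ^ 2) * a.2.im ^ 2 := by positivity
      unfold idxForm; linarith
  have h2 : (fun a : (ℤ × ℤ × ℤ) × ℍ => ((a.1.2.1 * a.2.im : ℝ) : ℂ)) =O[l] h :=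
    key (fun a => a.1.2.1 * a.2.im) fun a => by
      have : 0 ≤ (a.1.2.2 : ℝ) ^ 2 * a.2.im ^ 2 := by positivity
      unfold idxForm; nlinarith [sq_nonneg (a.1.1 : ℝ)]
  have h3 : (fun a : (ℤ × ℤ × ℤ) × ℍ => ((a.1.2.2 * a.2.im : ℝ) : ℂ)) =O[l] h :=
    key (fun a => a.1.2.2 * a.2.im) fun a => by
      have : 0 ≤ (a.1.2.1 : ℝ) ^ 2 * a.2.im ^ 2 := by positivity
      unfold idxForm; nlinarith [sq_nonneg (a.1.1 : ℝ)]
  have hx : (fun a : (ℤ × ℤ × ℤ) × ℍ => ((a.2.re / a.2.im : ℝ) : ℂ)) =O[l] fun _ => (1 : ℝ) := by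
    refine IsBigO.of_bound (X / y₁) (eventually_principal.mpr fun a ha => ?_)
    rw [Complex.norm_real, norm_one, mul_one, Real.norm_eq_abs, abs_div, abs_of_pos a.2.im_pos]
    exact div_le_div₀ ((abs_nonneg _).trans ha.2) ha.2 hy₁ ha.1
  rw [← hh]
  fin_cases i
  · have e : coeffT ν δ β 0 = fun a : (ℤ × ℤ × ℤ) × ℍ => (2 * π * Complex.I * ν / δ ^ 2 : ℂ) *
        (((a.1.1 : ℝ) + -1 * (((a.1.2.1 * a.2.im : ℝ) : ℂ) * ((a.2.re / a.2.im : ℝ) : ℂ))) *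
          ((a.1.1 : ℝ) + -1 * (((a.1.2.1 * a.2.im : ℝ) : ℂ) * ((a.2.re / a.2.im : ℝ) : ℂ)))) := by
      funext a
      have h3 : (a.2.im : ℂ) ≠ 0 := Complex.ofReal_ne_zero.mpr a.2.im_pos.ne'
      simp only [coeffT, Matrix.cons_val]
      push_cast
      field_simp
      ring
    have h4 := h1.add ((h2.mul hx).const_mul_left (-1 : ℂ)
      |>.trans (by simpa using isBigO_refl h l))
    exact e ▸ (h4.mul h4).const_mul_left _
  · have e : coeffT ν δ β 1 = fun a : (ℤ × ℤ × ℤ) × ℍ => (-(π * ν / δ ^ 2) : ℂ) *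
        (((a.1.2.1 * a.2.im : ℝ) : ℂ) * ((a.1.2.1 * a.2.im : ℝ) : ℂ)) := by
      funext a; simp only [coeffT, Matrix.cons_val]; push_cast; ring
    exact e ▸ (h2.mul h2).const_mul_left _
  · have e : coeffT ν δ β 2 = fun a : (ℤ × ℤ × ℤ) × ℍ => (2 * π / (δ * β) : ℂ) *
        (((a.1.2.1 * a.2.im : ℝ) : ℂ) * ((a.1.2.2 * a.2.im : ℝ) : ℂ)) := by
      funext a; simp only [coeffT, Matrix.cons_val]; push_cast; ring
    exact e ▸ (h2.mul h3).const_mul_left _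
  · have e : coeffT ν δ β 3 = fun a : (ℤ × ℤ × ℤ) × ℍ => (-(π / (ν * β ^ 2)) : ℂ) *
        (((a.1.2.2 * a.2.im : ℝ) : ℂ) * ((a.1.2.2 * a.2.im : ℝ) : ℂ)) := by
      funext a; simp only [coeffT, Matrix.cons_val]; push_cast; ring
    exact e ▸ (h3.mul h3).const_mul_left _

lemma coeffT_bound (ν δ β : ℝ) {y₁ X : ℝ} (hy₁ : 0 < y₁) :
    ∃ A : ℝ, 0 < A ∧ ∀ m (z : ℍ), y₁ ≤ z.im → |z.re| ≤ X →
      1 + ∑ i, ‖coeffT ν δ β i (m, z)‖ ≤ A * (1 + idxForm m z.im) := by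
  choose A hA using fun i => (coeffT_isBigO ν δ β (X := X) hy₁ i).bound
  refine ⟨1 + ∑ i, |A i|, by positivity, fun m z hz hx => ?_⟩
  have h0 := idxForm_nonneg m z.im
  have h1 : ∑ i, ‖coeffT ν δ β i (m, z)‖ ≤ ∑ i, |A i| * (1 + idxForm m z.im) := by
    refine Finset.sum_le_sum fun i _ => (eventually_principal.mp (hA i) (m, z) ⟨hz, hx⟩).trans ?_
    rw [Real.norm_of_nonneg (by positivity)]
    gcongr
    exact le_abs_self _
  rw [← Finset.sum_mul] at h1
  linarith

lemma aestronglyMeasurable_coeffT (ν δ β : ℝ) (μ : Measure ℍ) (i : Fin 4) :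
    AEStronglyMeasurable (coeffT ν δ β i) (Measure.count.prod μ) := by
  refine (measurable_from_prod_countable_right fun m => ?_).aestronglyMeasurable
  have hre : Measurable fun z : ℍ => (z.re : ℂ) :=
    (Complex.continuous_ofReal.comp UpperHalfPlane.continuous_re).measurable
  have him : Measurable fun z : ℍ => (z.im : ℂ) :=
    (Complex.continuous_ofReal.comp UpperHalfPlane.continuous_im).measurable
  fin_cases i <;> simp only [coeffT, Fin.zero_eta, Fin.mk_one, Fin.reduceFinMk, Matrix.cons_val] <;>
    fun_prop

lemma measurable_constT (δ β : ℝ) : Measurable (constT δ β) := by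
  refine measurable_from_prod_countable_right fun m => ?_
  have hre : Measurable fun z : ℍ => (z.re : ℂ) :=
    (Complex.continuous_ofReal.comp UpperHalfPlane.continuous_re).measurable
  unfold constT
  fun_prop

lemma norm_summandT_le (hν : 0 < ν) {f W : ℂ} {m : ℤ × ℤ × ℤ} {z : ℍ} {t : ℂ} {E : ℝ}
    (ht : 0 < t.im) (hW : ‖W‖ ≤ 1) (hE : ‖Complex.exp (thetaExponent ν δ β m t z)‖ ≤ E) :
    ‖f * (W * (z.im * constT δ β (m, z)))‖ *
      ‖Complex.exp (∑ i, coeffT ν δ β i (m, z) * basisT i t)‖ ≤ ‖f‖ * z.im * E := by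
  have e1 := thetaTerm_eq_expT hν δ β ht m z
  have e2 : ‖f * (W * (z.im * constT δ β (m, z)))‖ *
      ‖Complex.exp (∑ i, coeffT ν δ β i (m, z) * basisT i t)‖ =
      ‖W‖ * (‖f‖ * z.im * ‖Complex.exp (thetaExponent ν δ β m t z)‖) := by
    have h : ‖thetaTerm ν δ β m t z‖ = z.im * ‖Complex.exp (thetaExponent ν δ β m t z)‖ := by
      rw [thetaTerm, norm_mul, Complex.norm_real, UpperHalfPlane.coe_im,
        Real.norm_of_nonneg z.im_pos.le]
    rw [mul_assoc ‖f‖, ← h, e1]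
    simp only [norm_mul]
    ring
  rw [e2]
  have := z.im_pos
  calc _ ≤ 1 * (‖f‖ * z.im * E) := by gcongr
    _ = _ := one_mul _

variable {μ : Measure ℍ} {f : ℍ → ℂ} {W : ℤ × ℤ × ℤ → ℍ → ℂ} {y₁ X Kf C : ℝ}

/-- A measure on a vertical strip, a function of at most exponential growth, and weights which
vanish high in the strip on the indices with `j = n = 0`. -/
structure ThetaData (μ : Measure ℍ) (f : ℍ → ℂ) (W : ℤ × ℤ × ℤ → ℍ → ℂ) (y₁ X Kf C : ℝ) : Prop where
  y_pos : 0 < y₁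
  meas : AEStronglyMeasurable f μ
  weight_meas : ∀ m, Measurable (W m)
  weight_le : ∀ m z, ‖W m z‖ ≤ 1
  support : ∀ m z, W m z ≠ 0 → z.im ≤ 1 ∨ m.2 ≠ 0
  strip : ∀ᵐ z ∂μ, y₁ ≤ z.im ∧ |z.re| ≤ X ∧ ‖f z‖ ≤ Kf * Real.exp (C * z.im)

/-- The support condition ensures that every term present carries a factor `exp (-κ' y²)`, by
`idxForm_decay`; it absorbs `f` and the prefactor `y`. What remains is summable in the index and
constant in `z`, hence integrable because `μ` is finite. -/
lemma ThetaData.expDominated [IsFiniteMeasure μ] (h : ThetaData μ f W y₁ X Kf C) (hν : 0 < ν)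
    (hδ : 0 < δ) (hβ : 0 < β) :
    ExpDominated {t : ℂ | 0 < t.im} (Measure.count.prod μ) (coeffT ν δ β) basisT
      (fun a => f a.2 * (W a.1 a.2 * (a.2.im * constT δ β a))) where
  meas := by
    refine h.meas.comp_snd.mul (Measurable.aestronglyMeasurable ?_)
    refine Measurable.mul (measurable_from_prod_countable_right fun m => h.weight_meas m) ?_
    refine Measurable.mul ?_ (measurable_constT δ β)
    exact (Complex.continuous_ofReal.comp UpperHalfPlane.continuous_im).measurable.comp
      measurable_snd
  bound p hp := by
    have hp : 0 < p.im := hp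
    obtain ⟨κ, hκ, hb⟩ := norm_exp_thetaExponent_le (v₀ := p.im / 2) (v₁ := 2 * p.im) (y₁ := y₁)
      (|p.re| + 1) X hν hδ hβ (half_pos hp) (by positivity) h.y_pos
    obtain ⟨A, hA, hAm⟩ := coeffT_bound ν δ β (X := X) h.y_pos
    refine ⟨_, box_mem_nhds hp, fun n => ?_⟩
    obtain ⟨K, κ', hK, hκ', hd⟩ := idxForm_decay hκ h.y_pos n
    refine ⟨fun a => A ^ n * (|Kf| * Real.exp ((C + 1) ^ 2 / (2 * κ'))) * K *
      Real.exp (-κ' * idxSq a.1), ?_, ?_⟩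
    · have h1 : Integrable (fun m : ℤ × ℤ × ℤ => Real.exp (-κ' * idxSq m)) Measure.count :=
        integrable_count_iff.mpr (summable_exp_neg_idxSq hκ').norm
      exact (h1.comp_fst μ).const_mul _
    · filter_upwards [Measure.quasiMeasurePreserving_snd.ae h.strip] with a ha q hq
      obtain ⟨m, z⟩ := a
      obtain ⟨ha1, ha2, ha3⟩ := ha
      obtain ⟨hq1, hq2, hq3⟩ := hq
      have hq0 : 0 < q.im := (half_pos hp).trans hq1
      have hz := z.im_pos
      dsimp only at ha1 ha2 ha3 ⊢
      by_cases hW : W m z = 0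
      · rw [hW, zero_mul, mul_zero, norm_zero, zero_mul, zero_mul]
        positivity
      · have h1 := dominated_le n
          (add_nonneg zero_le_one (Finset.sum_nonneg fun i _ => norm_nonneg _))
          hA.le (idxForm_nonneg m z.im) (by positivity : 0 ≤ ‖f z‖ * z.im) (by positivity)
          (hAm m z ha1 ha2)
          (norm_summandT_le hν hq0 (h.weight_le m z) (hb m q z hq1.le hq2.le hq3.le ha1 ha2))
          ((hd m z.im ha1).2 (h.support m z hW))
        refine h1.trans ?_
        -- By `y ≤ exp y` the prefactor `y` counts as growth of rate one, whence `C + 1`.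
        have h2 : ‖f z‖ * z.im * Real.exp (-κ' * z.im ^ 2) ≤
            |Kf| * Real.exp ((C + 1) ^ 2 / (2 * κ')) := by
          have h3 : z.im ≤ Real.exp z.im := by linarith [Real.add_one_le_exp z.im]
          have h4 := exp_mul_exp_neg_sq_le (C + 1) hκ' z.im
          have h5 : Real.exp (-(κ' / 2) * z.im ^ 2) ≤ 1 := by
            rw [Real.exp_le_one_iff]
            nlinarith [sq_nonneg z.im]
          calc ‖f z‖ * z.im * Real.exp (-κ' * z.im ^ 2)
              ≤ |Kf| * Real.exp (C * z.im) * Real.exp z.im * Real.exp (-κ' * z.im ^ 2) := by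
                gcongr
                exact ha3.trans (by gcongr; exact le_abs_self _)
            _ = |Kf| * (Real.exp ((C + 1) * z.im) * Real.exp (-κ' * z.im ^ 2)) := by
                rw [add_mul, one_mul, Real.exp_add]; ring
            _ ≤ |Kf| * (Real.exp ((C + 1) ^ 2 / (2 * κ')) * 1) := by
                exact mul_le_mul_of_nonneg_left
                  (h4.trans (mul_le_mul_of_nonneg_left h5 (Real.exp_pos _).le)) (abs_nonneg _)
            _ = _ := by rw [mul_one]
        calc A ^ n * (‖f z‖ * z.im) * K * (Real.exp (-κ' * idxSq m) * Real.exp (-κ' * z.im ^ 2))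
            = A ^ n * (‖f z‖ * z.im * Real.exp (-κ' * z.im ^ 2)) * K *
              Real.exp (-κ' * idxSq m) := by ring
          _ ≤ _ := by gcongr

/-- Fubini with counting measure in the first factor; it lets sum and integral be differentiated in
a single step. -/
lemma integral_count_prod [IsFiniteMeasure μ] {F : (ℤ × ℤ × ℤ) × ℍ → ℂ}
    (h : Integrable F (Measure.count.prod μ)) :
    Integrable (fun z => ∑' m, F (m, z)) μ ∧ (∀ᵐ z ∂μ, Summable fun m => F (m, z)) ∧
      ∫ a, F a ∂(Measure.count.prod μ) = ∫ z, ∑' m, F (m, z) ∂μ := by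
  have e : (fun z => ∫ m, F (m, z) ∂Measure.count) =ᵐ[μ] fun z => ∑' m, F (m, z) :=
    h.prod_left_ae.mono fun z hz => integral_count_eq_tsum hz
  refine ⟨h.integral_prod_right.congr e, h.prod_left_ae.mono fun z hz =>
    (integrable_count_iff.mp hz).of_norm, ?_⟩
  rw [integral_prod_symm _ h]
  exact integral_congr_ae e

/-- The integral of `f` against the theta series with weights `W`. -/
def thetaIntegral (ν δ β : ℝ) (μ : Measure ℍ) (f : ℍ → ℂ) (W : ℤ × ℤ × ℤ → ℍ → ℂ) (t : ℂ) : ℂ :=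
  ∫ z, f z * ∑' m, W m z * thetaTerm ν δ β m t z ∂μ

variable [IsFiniteMeasure μ] (h : ThetaData μ f W y₁ X Kf C) (hν : 0 < ν) (hδ : 0 < δ) (hβ : 0 < β)

include h hν hδ hβ

lemma ThetaData.thetaIntegral_eq {t : ℂ} (ht : 0 < t.im) :
    Integrable (fun z : ℍ => f z * ∑' m, W m z * thetaTerm ν δ β m t z) μ ∧
    thetaIntegral ν δ β μ f W t = expInt (Measure.count.prod μ) (coeffT ν δ β) basisT
      (fun a => f a.2 * (W a.1 a.2 * (a.2.im * constT δ β a))) t := by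
  have h1 := (h.expDominated hν hδ hβ).integrable (aestronglyMeasurable_coeffT ν δ β μ) ht
  obtain ⟨h2, -, h3⟩ := integral_count_prod h1
  have e : (fun z : ℍ => ∑' m, f z * (W m z * (z.im * constT δ β (m, z))) *
      Complex.exp (∑ i, coeffT ν δ β i (m, z) * basisT i t)) =
      fun z => f z * ∑' m, W m z * thetaTerm ν δ β m t z := by
    funext z
    rw [← tsum_mul_left]
    refine tsum_congr fun m => ?_
    rw [thetaTerm_eq_expT hν δ β ht]
    ring
  rw [e] at h2 h3
  exact ⟨h2, h3.symm⟩

lemma ThetaData.contDiffOn :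
    ContDiffOn ℝ ∞ (thetaIntegral ν δ β μ f W) {t : ℂ | 0 < t.im} :=
  ((h.expDominated hν hδ hβ).contDiffOn (aestronglyMeasurable_coeffT ν δ β μ) isOpen_im_pos
    contDiffOn_basisT).congr fun _ ht => (h.thetaIntegral_eq hν hδ hβ ht).2

/-- Differentiation in `τ` passes under sum and integral together; then `four_mul_symbolT` trades
the symbol in `τ` for the symbol in `z`, term by term. -/
lemma ThetaData.lap_eq {t : ℂ} (ht : 0 < t.im) :
    Integrable (fun z : ℍ => f z * ∑' m, W m z * (symbolZ ν δ β t m z * thetaTerm ν δ β m t z)) μ ∧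
    4 * lap (1 / 2) (thetaIntegral ν δ β μ f W) t =
      ∫ z, f z * ∑' m, W m z * (symbolZ ν δ β t m z * thetaTerm ν δ β m t z) ∂μ := by
  have h1 := (h.expDominated hν hδ hβ).lap_eq (aestronglyMeasurable_coeffT ν δ β μ)
    contDiffOn_basisT (fun i q _ => hasLineDerivAt_basisT_one i)
    (fun i q _ => hasLineDerivAt_basisTx i) (fun i q hq => hasLineDerivAt_basisT_I i hq)
    (fun i q hq => hasLineDerivAt_basisTy i hq) (1 / 2) ht
  obtain ⟨h2, -, h3⟩ := integral_count_prod (h1.1.const_mul 4)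
  have e : (fun z : ℍ => ∑' m, 4 * (f z * (W m z * (z.im * constT δ β (m, z))) *
      lapSymbol (1 / 2) t (∑ i, coeffT ν δ β i (m, z) * basisTx i t)
        (∑ i, coeffT ν δ β i (m, z) * basisTxx i t) (∑ i, coeffT ν δ β i (m, z) * basisTy i t)
        (∑ i, coeffT ν δ β i (m, z) * basisTyy i t) *
      Complex.exp (∑ i, coeffT ν δ β i (m, z) * basisT i t))) =
      fun z => f z * ∑' m, W m z * (symbolZ ν δ β t m z * thetaTerm ν δ β m t z) := by
    funext z
    rw [← tsum_mul_left]
    refine tsum_congr fun m => ?_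
    rw [thetaTerm_eq_expT hν δ β ht, ← four_mul_symbolT hν δ β ht, symbolT]
    ring
  rw [e] at h2 h3
  refine ⟨h2, ?_⟩
  rw [← h3, integral_const_mul, lap_congr (1 / 2)
    (fun t ht => (h.thetaIntegral_eq hν hδ hβ ht).2) ht, h1.2]

end

end ThetaLift

end

noncomputable section

namespace ThetaLift

/-! ### The constant term of the theta series -/

section

variable {ν δ β : ℝ} {t : ℂ} {w : ℤ × ℤ × ℤ → ℂ}

/-- The weights restricted to the indices with `j = n = 0`. -/
def constWeight (w : ℤ × ℤ × ℤ → ℂ) (m : ℤ × ℤ × ℤ) : ℂ := if m.2 = 0 then w m else 0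

/-- The weights restricted to the other indices. -/
def remWeight (w : ℤ × ℤ × ℤ → ℂ) (m : ℤ × ℤ × ℤ) : ℂ := if m.2 = 0 then 0 else w m

lemma norm_constWeight_le (hw : ∀ m, ‖w m‖ ≤ 1) (m : ℤ × ℤ × ℤ) : ‖constWeight w m‖ ≤ 1 := by
  unfold constWeight; split_ifs <;> simp [hw m]

lemma norm_remWeight_le (hw : ∀ m, ‖w m‖ ≤ 1) (m : ℤ × ℤ × ℤ) : ‖remWeight w m‖ ≤ 1 := by
  unfold remWeight; split_ifs <;> simp [hw m]

/-- The constant term of the theta series, up to the factor `y`. -/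
def thetaConst (ν δ β : ℝ) (w : ℤ × ℤ × ℤ → ℂ) (t : ℂ) : ℂ :=
  thetaSeries ν δ β (constWeight w) t Complex.I

lemma thetaTerm_const (ν δ β : ℝ) (i : ℤ) (t z : ℂ) :
    thetaTerm ν δ β (i, 0, 0) t z =
      z.im * Complex.exp (2 * π * Complex.I * ν * (i / δ) ^ 2 * t) := by
  simp [thetaTerm, thetaExponent]

/-- For `j = n = 0` the exponent does not contain `z`. The base point `I` in `thetaConst` serves
because its imaginary part is `1`. -/
lemma thetaSeries_constWeight (ν δ β : ℝ) (w : ℤ × ℤ × ℤ → ℂ) (t z : ℂ) :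
    thetaSeries ν δ β (constWeight w) t z = z.im * thetaConst ν δ β w t := by
  rw [thetaConst, thetaSeries, thetaSeries, ← tsum_mul_left]
  refine tsum_congr fun m => ?_
  unfold constWeight
  split_ifs with hm
  · have e : m = (m.1, 0, 0) := Prod.ext rfl hm
    rw [e, thetaTerm_const, thetaTerm_const, Complex.I_im]
    push_cast
    ring
  · simp

lemma thetaConst_eq (ν δ β : ℝ) (w : ℤ × ℤ × ℤ → ℂ) (t : ℂ) : thetaConst ν δ β w t =
    ∑' i : ℤ, w (i, 0, 0) * Complex.exp (2 * π * Complex.I * ν * (i / δ) ^ 2 * t) := by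
  have hinj : Function.Injective fun i : ℤ => ((i, 0, 0) : ℤ × ℤ × ℤ) := fun i j h => by
    simpa using h
  rw [thetaConst, thetaSeries, ← hinj.tsum_eq]
  · refine tsum_congr fun i => ?_
    rw [thetaTerm_const, Complex.I_im, Complex.ofReal_one, one_mul, constWeight]
    simp
  · intro m hm
    by_contra h
    apply hm
    have h2 : m.2 ≠ 0 := fun h2 => h ⟨m.1, Prod.ext rfl h2.symm⟩
    simp [constWeight, h2]

variable (hν : 0 < ν) (hδ : 0 < δ) (hβ : 0 < β) (ht : 0 < t.im) (hw : ∀ m, ‖w m‖ ≤ 1)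

include hν hδ hβ ht hw

lemma thetaSeries_eq_add {z : ℂ} (hz : 0 < z.im) :
    thetaSeries ν δ β w t z = z.im * thetaConst ν δ β w t + thetaSeries ν δ β (remWeight w) t z := by
  rw [← thetaSeries_constWeight]
  unfold thetaSeries
  rw [← (summable_thetaSeries hν hδ hβ ht (norm_constWeight_le hw) hz).tsum_add
    (summable_thetaSeries hν hδ hβ ht (norm_remWeight_le hw) hz)]
  refine tsum_congr fun m => ?_
  unfold constWeight remWeight
  split_ifs <;> simp

/-- Unless `j = n = 0`, the form `idxForm` is at least `y²`, so each term has Gaussian decay in `y`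
as well as in the index. The derivative in `y` is included because it appears in the boundary terms
of Green's formula. -/
lemma thetaSeries_decay (X : ℝ) {y₁ : ℝ} (hy₁ : 0 < y₁) :
    ∃ K κ : ℝ, 0 < K ∧ 0 < κ ∧ ∀ z : ℂ, y₁ ≤ z.im → |z.re| ≤ X →
      ‖thetaSeries ν δ β (remWeight w) t z‖ ≤ K * Real.exp (-κ * z.im ^ 2) ∧
      ‖dIm (thetaSeries ν δ β (remWeight w) t) z‖ ≤ K * Real.exp (-κ * z.im ^ 2) := by
  obtain ⟨κ, hκ, hb⟩ := norm_exp_thetaExponent_le (v₀ := t.im) (v₁ := t.im)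
      |t.re| X hν hδ hβ ht ht hy₁
  obtain ⟨A, hA, hAm⟩ := coeffZ_bound_idxForm ν δ β t hy₁
  obtain ⟨K, κ', hK, hκ', hd⟩ := idxForm_decay hκ hy₁ 1
  set S := ∑' m : ℤ × ℤ × ℤ, Real.exp (-κ' * idxSq m) with hS
  have hS0 : 0 ≤ S := tsum_nonneg fun _ => (Real.exp_pos _).le
  set B := (1 + A * (2 + 1 / y₁)) * K * S * Real.exp (2 ^ 2 / (2 * κ')) with hB
  refine ⟨B + 1, κ' / 2, by positivity, half_pos hκ', fun z hz hx => ?_⟩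
  have hz0 : 0 < z.im := hy₁.trans_le hz
  -- The extra factor `1 + idxForm` is reserved for `symbolZy`, which is of this order in the index.
  have hterm : ∀ m, ‖remWeight w m * thetaTerm ν δ β m t z‖ * (1 + idxForm m z.im) ≤
      z.im * K * Real.exp (-κ' * z.im ^ 2) * Real.exp (-κ' * idxSq m) := by
    intro m
    by_cases hm : m.2 = 0
    · rw [remWeight, if_pos hm, zero_mul, norm_zero, zero_mul]
      positivity
    · have h1 := hb m t z le_rfl le_rfl le_rfl hz hx
      have h2 := (hd m z.im hz).2 (Or.inr hm)
      rw [pow_one] at h2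
      have h3 := norm_remWeight_le hw m
      have h4 := idxForm_nonneg m z.im
      rw [norm_mul, thetaTerm, norm_mul, Complex.norm_real, Real.norm_of_nonneg hz0.le]
      calc ‖remWeight w m‖ * (z.im * ‖Complex.exp (thetaExponent ν δ β m t z)‖) *
            (1 + idxForm m z.im)
          ≤ 1 * (z.im * Real.exp (-κ * idxForm m z.im)) * (1 + idxForm m z.im) := by gcongr
        _ = z.im * ((1 + idxForm m z.im) * Real.exp (-κ * idxForm m z.im)) := by ring
        _ ≤ z.im * (K * (Real.exp (-κ' * idxSq m) * Real.exp (-κ' * z.im ^ 2))) := by gcongr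
        _ = _ := by ring
  have hsum : HasSum (fun m => z.im * K * Real.exp (-κ' * z.im ^ 2) * Real.exp (-κ' * idxSq m))
      (z.im * K * Real.exp (-κ' * z.im ^ 2) * S) :=
    (summable_exp_neg_idxSq hκ').hasSum.mul_left _
  have hy : z.im ≤ Real.exp (1 * z.im) := by linarith [Real.add_one_le_exp (1 * z.im)]
  have hy2 : 1 ≤ Real.exp (1 * z.im) := Real.one_le_exp (by linarith)
  have he : Real.exp (2 * z.im) = Real.exp (1 * z.im) * Real.exp (1 * z.im) := by
    rw [← Real.exp_add]; congr 1; ring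
  -- The factor `c` is `1` for the series and `A (2 y + 1 / y₁)` for its derivative. Both `c` and
  -- the prefactor `y` are at most constants times `exp y`, so a growth of rate `2` has to be
  -- absorbed.
  have hfin : ∀ c : ℝ, 0 ≤ c → c ≤ (1 + A * (2 + 1 / y₁)) * Real.exp (1 * z.im) →
      c * (z.im * K * Real.exp (-κ' * z.im ^ 2) * S) ≤ (B + 1) * Real.exp (-(κ' / 2) * z.im ^ 2) := by
    intro c hc0 hc
    have h1 := exp_mul_exp_neg_sq_le 2 hκ' z.im
    calc c * (z.im * K * Real.exp (-κ' * z.im ^ 2) * S)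
        ≤ ((1 + A * (2 + 1 / y₁)) * Real.exp (1 * z.im)) *
          (Real.exp (1 * z.im) * K * Real.exp (-κ' * z.im ^ 2) * S) := by gcongr
      _ = (1 + A * (2 + 1 / y₁)) * K * S * (Real.exp (2 * z.im) * Real.exp (-κ' * z.im ^ 2)) := by
          rw [he]; ring
      _ ≤ (1 + A * (2 + 1 / y₁)) * K * S *
          (Real.exp (2 ^ 2 / (2 * κ')) * Real.exp (-(κ' / 2) * z.im ^ 2)) := by gcongr
      _ = B * Real.exp (-(κ' / 2) * z.im ^ 2) := by rw [hB]; ring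
      _ ≤ _ := by gcongr; linarith
  constructor
  · refine (tsum_of_norm_bounded hsum fun m => ?_).trans ?_
    · refine le_trans ?_ (hterm m)
      exact le_mul_of_one_le_right (norm_nonneg _) (by linarith [idxForm_nonneg m z.im])
    · have := hfin 1 zero_le_one (by
        have : 0 ≤ A * (2 + 1 / y₁) := by positivity
        nlinarith)
      linarith
  · rw [(dIm_thetaSeries hν hδ hβ ht (norm_remWeight_le hw) hz0).2]
    refine (tsum_of_norm_bounded (hsum.mul_left (A * (2 * z.im + 1 / y₁))) fun m => ?_).trans ?_
    · have h1 : ‖symbolZy ν δ β t m z‖ ≤ A * (2 * z.im + 1 / y₁) * (1 + idxForm m z.im) := by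
        have h2 : ∀ i, ‖basisZy i z‖ ≤ 2 * z.im + 1 / y₁ := by
          have h5 : 0 ≤ 1 / y₁ := by positivity
          have h6 : |z.im|⁻¹ ≤ 1 / y₁ := by
            rw [abs_of_pos hz0, one_div]
            exact inv_anti₀ hy₁ hz
          intro i
          fin_cases i
          · simp [basisZy]; positivity
          · simp [basisZy]; positivity
          · simp [basisZy, abs_of_pos hz0]; positivity
          · simp only [basisZy, Fin.reduceFinMk, Matrix.cons_val, Complex.norm_real, norm_inv, Real.norm_eq_abs]
            linarith
        have h7 := hAm m z.im hz
        calc ‖symbolZy ν δ β t m z‖ ≤ ∑ i, ‖coeffZ ν δ β t i m‖ * (2 * z.im + 1 / y₁) := by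
              refine (norm_sum_le _ _).trans (Finset.sum_le_sum fun i _ => ?_)
              rw [norm_mul]
              exact mul_le_mul_of_nonneg_left (h2 i) (norm_nonneg _)
          _ = (∑ i, ‖coeffZ ν δ β t i m‖) * (2 * z.im + 1 / y₁) := by rw [Finset.sum_mul]
          _ ≤ (A * (1 + idxForm m z.im)) * (2 * z.im + 1 / y₁) := by
              gcongr
              linarith
          _ = _ := by ring
      calc ‖remWeight w m * (symbolZy ν δ β t m z * thetaTerm ν δ β m t z)‖
          = ‖symbolZy ν δ β t m z‖ * ‖remWeight w m * thetaTerm ν δ β m t z‖ := by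
            rw [norm_mul, norm_mul, norm_mul]; ring
        _ ≤ A * (2 * z.im + 1 / y₁) * (1 + idxForm m z.im) *
            ‖remWeight w m * thetaTerm ν δ β m t z‖ :=
            mul_le_mul_of_nonneg_right h1 (norm_nonneg _)
        _ = A * (2 * z.im + 1 / y₁) * (‖remWeight w m * thetaTerm ν δ β m t z‖ *
            (1 + idxForm m z.im)) := by ring
        _ ≤ _ := mul_le_mul_of_nonneg_left (hterm m) (by positivity)
    · refine hfin _ (by positivity) ?_
      have h1 : 2 * z.im + 1 / y₁ ≤ (2 + 1 / y₁) * Real.exp (1 * z.im) := by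
        have : 1 / y₁ * 1 ≤ 1 / y₁ * Real.exp (1 * z.im) := by gcongr
        linarith
      calc A * (2 * z.im + 1 / y₁) ≤ A * ((2 + 1 / y₁) * Real.exp (1 * z.im)) := by gcongr
        _ ≤ _ := by nlinarith [Real.exp_pos (1 * z.im)]

end

/-- `thetaConst` is smooth, and the Laplacian of weight `1 / 2` annihilates it. -/
lemma thetaConst_lap {ν δ β : ℝ} {w : ℤ × ℤ × ℤ → ℂ} (hν : 0 < ν) (hδ : 0 < δ) (hβ : 0 < β)
    (hw : ∀ m, ‖w m‖ ≤ 1) : ContDiffOn ℝ ∞ (thetaConst ν δ β w) {t : ℂ | 0 < t.im} ∧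
      ∀ t : ℂ, 0 < t.im → lap (1 / 2) (thetaConst ν δ β w) t = 0 := by
  have hI : ∀ᵐ z ∂(Measure.dirac UpperHalfPlane.I), z = UpperHalfPlane.I :=
    (ae_dirac_iff (measurableSet_singleton _)).mpr rfl
  -- `thetaConst` is an integral against the point mass at `I`, so the general results on integrals
  -- apply. The cut-off at height `1` does not affect `I`, and it makes the support condition hold.
  have h : ThetaData (Measure.dirac UpperHalfPlane.I) (fun _ => 1)
      (fun m z => if z.im ≤ 1 then constWeight w m else 0) 1 0 1 0 :=
    { y_pos := one_pos
      meas := aestronglyMeasurable_const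
      weight_meas := fun _ => Measurable.ite
        (measurableSet_le UpperHalfPlane.continuous_im.measurable measurable_const)
        measurable_const measurable_const
      weight_le := fun m z => by
        split_ifs
        exacts [norm_constWeight_le hw m, by simp]
      support := fun m z hz => by
        by_contra hc
        rw [not_or] at hc
        exact hz (if_neg hc.1)
      strip := hI.mono fun z hz => by simp [hz] }
  have e : thetaIntegral ν δ β (Measure.dirac UpperHalfPlane.I) (fun _ => 1)
      (fun m z => if z.im ≤ 1 then constWeight w m else 0) = thetaConst ν δ β w := by
    funext t
    rw [thetaIntegral, integral_dirac]
    simp [thetaConst, thetaSeries]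
  refine ⟨e ▸ h.contDiffOn hν hδ hβ, fun t ht => ?_⟩
  have h1 := (h.lap_eq hν hδ hβ ht).2
  rw [e] at h1
  -- The weights leave only indices with `j = n = 0`, and there the symbol in `z` vanishes; by `4
  -- Δ_τ = Δ_z` the Laplacian in `τ` is zero.
  have h2 : ∀ z : ℍ, ∑' m, (if z.im ≤ 1 then constWeight w m else 0) *
      (symbolZ ν δ β t m z * thetaTerm ν δ β m t z) = 0 := by
    intro z
    refine (tsum_congr fun m => ?_).trans tsum_zero
    by_cases hm : m.2 = 0
    · have e : m = (m.1, 0, 0) := Prod.ext rfl hm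
      rw [e, symbolZ_eq_zero _ _ _ _ _ z.im_pos, zero_mul, mul_zero]
    · simp [constWeight, hm]
  simp only [h2, mul_zero, integral_zero] at h1
  simpa using h1

end ThetaLift

end

noncomputable section

namespace ThetaLift

/-! ### Coordinates on `V` -/

/-- The matrix `(a, b; c, -a)`. -/
def vec (a b c : ℚ) : V := ⟨!![a, b; c, -a], by simp [Matrix.trace, Fin.sum_univ_two]⟩

lemma vec_mat (a b c : ℚ) : (vec a b c).mat = !![a, b; c, -a] := rfl

lemma vec_eq (X : V) : vec (X.mat 0 0) (X.mat 0 1) (X.mat 1 0) = X := by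
  apply V.ext
  have h := X.trace_mat
  rw [Matrix.trace_fin_two] at h
  ext i j
  fin_cases i <;> fin_cases j <;> simp [vec_mat]
  linarith

lemma vec_add (a b c a' b' c' : ℚ) : vec a b c + vec a' b' c' = vec (a + a') (b + b') (c + c') := by
  apply V.ext
  ext i j
  fin_cases i <;> fin_cases j <;> simp [vec_mat]
  ring

lemma vec_sub (a b c a' b' c' : ℚ) : vec a b c - vec a' b' c' = vec (a - a') (b - b') (c - c') := by
  rw [sub_eq_iff_eq_add, vec_add]
  simp

lemma smul_u₀ (q : ℚ) : q • u₀ = vec 0 q 0 := by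
  apply V.ext
  ext i j
  fin_cases i <;> fin_cases j <;> simp [vec_mat, u₀_mat]

lemma quad_vec (N : ℕ) (a b c : ℚ) : quad N (vec a b c) = N * (a ^ 2 + b * c) := by
  rw [quad, vec_mat, Matrix.det_fin_two_of]
  ring

lemma bil_vec (N : ℕ) (a b c a' b' c' : ℚ) :
    bil N (vec a b c) (vec a' b' c') = N * (2 * a * a' + b * c' + c * b') := by
  rw [bil, vec_mat, vec_mat, Matrix.trace_fin_two]
  simp only [Matrix.mul_apply, Fin.sum_univ_two, Matrix.of_apply, Matrix.cons_val]
  ring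

lemma bil_self (N : ℕ) (X : V) : bil N X X = 2 * quad N X := by
  rw [← vec_eq X, bil_vec, quad_vec]
  ring

lemma bil_act (N : ℕ) (g : SL(2, ℤ)) (X Y : V) : bil N (act g X) (act g Y) = bil N X Y := by
  have h1 := quad_add N (act g X) (act g Y)
  have h2 := quad_add N X Y
  rw [← map_add, quad_act, quad_act, quad_act] at h1
  linarith

lemma act_act_inv (g : SL(2, ℤ)) (X : V) : act g (act g⁻¹ X) = X := by
  rw [← LinearMap.comp_apply, ← act_mul, mul_inv_cancel, act_one, LinearMap.id_apply]

lemma act_inv_act (g : SL(2, ℤ)) (X : V) : act g⁻¹ (act g X) = X := by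
  rw [← LinearMap.comp_apply, ← act_mul, inv_mul_cancel, act_one, LinearMap.id_apply]

lemma act_injective (g : SL(2, ℤ)) : Function.Injective (act g) :=
  Function.LeftInverse.injective (act_inv_act g)

lemma exists_act_vec (g : SL(2, ℤ)) (X : V) : ∃ a b c, X = act g (vec a b c) :=
  ⟨_, _, _, by rw [vec_eq (act g⁻¹ X), act_act_inv]⟩

lemma act_vec (g : SL(2, ℤ)) (a b c : ℚ) : act g (vec a b c) =
    vec (a * (g 0 0 * g 1 1 + g 0 1 * g 1 0) - b * g 0 0 * g 1 0 + c * g 0 1 * g 1 1)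
      (-2 * a * g 0 0 * g 0 1 + b * g 0 0 ^ 2 - c * g 0 1 ^ 2)
      (2 * a * g 1 0 * g 1 1 - b * g 1 0 ^ 2 + c * g 1 1 ^ 2) := by
  apply V.ext
  rw [coe_act, vec_mat, vec_mat, toRat, toRat, Matrix.SpecialLinearGroup.coe_inv,
    Matrix.adjugate_fin_two]
  ext i j
  fin_cases i <;> fin_cases j <;>
    simp [Matrix.mul_apply, Fin.sum_univ_two, Matrix.map_apply] <;> ring

lemma mem_perp_lineOf (N : ℕ) (hN : 0 < N) (σ : SL(2, ℤ)) (a b c : ℚ) :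
    act σ (vec a b c) ∈ perp N (lineOf N σ) ↔ c = 0 := by
  have hN' : (N : ℚ) ≠ 0 := Nat.cast_ne_zero.mpr hN.ne'
  have h0 : u₀ = vec 0 1 0 := by rw [← smul_u₀, one_smul]
  constructor
  · intro h
    have h1 := h (act σ u₀) (Submodule.mem_span_singleton_self _)
    rw [bil_act, h0, bil_vec] at h1
    simpa [hN'] using h1
  · rintro rfl Y hY
    obtain ⟨q, rfl⟩ := Submodule.mem_span_singleton.mp hY
    rw [← map_smul, smul_u₀, bil_act, bil_vec]
    simp

lemma mem_lineOf (N : ℕ) (σ : SL(2, ℤ)) (a b c : ℚ) :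
    act σ (vec a b c) ∈ (lineOf N σ).1 ↔ a = 0 ∧ c = 0 := by
  constructor
  · intro h
    obtain ⟨q, hq⟩ := Submodule.mem_span_singleton.mp h
    rw [← map_smul, smul_u₀] at hq
    have := congrArg V.mat (act_injective σ hq)
    rw [vec_mat, vec_mat] at this
    exact ⟨by simpa using (congrFun (congrFun this 0) 0).symm,
      by simpa using (congrFun (congrFun this 1) 0).symm⟩
  · rintro ⟨rfl, rfl⟩
    rw [← smul_u₀, map_smul]
    exact Submodule.mem_span_singleton.mpr ⟨b, rfl⟩

lemma vec_injective {a b c a' b' c' : ℚ} (h : vec a b c = vec a' b' c') :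
    a = a' ∧ b = b' ∧ c = c' := by
  have := congrArg V.mat h
  rw [vec_mat, vec_mat] at this
  exact ⟨by simpa using congrFun (congrFun this 0) 0, by simpa using congrFun (congrFun this 0) 1,
    by simpa using congrFun (congrFun this 1) 0⟩

lemma neg_act (g : SL(2, ℤ)) : act (-g) = act g := by
  ext1 X
  rw [← vec_eq X, act_vec, act_vec]
  simp

/-! ### Equivariance of the Gaussian -/

lemma pairAt_vec (N : ℕ) (a b c : ℚ) (z : ℍ) : pairAt N (vec a b c) z =
    √N / z.im * (c * (z.re ^ 2 + z.im ^ 2) - 2 * a * z.re - b) := by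
  have hy := z.im_pos.ne'
  rw [pairAt, vecAt, vec_mat, Matrix.trace_fin_two]
  have e : ((N : ℝ) : ℝ) = √N * √N := (Real.mul_self_sqrt (Nat.cast_nonneg N)).symm
  rcases Nat.eq_zero_or_pos N with rfl | hN
  · simp
  have hs : √(N : ℝ) ≠ 0 := (Real.sqrt_pos.mpr (Nat.cast_pos.mpr hN)).ne'
  simp only [Matrix.mul_apply, Fin.sum_univ_two, Matrix.smul_apply, Matrix.map_apply,
    Complex.normSq_apply, smul_eq_mul, Matrix.of_apply, Matrix.cons_val, UpperHalfPlane.coe_re,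
    UpperHalfPlane.coe_im, eq_ratCast, Rat.cast_neg]
  nth_rewrite 1 [e]
  field_simp
  ring

/-- This expresses `X(gz) = g.X(z)`. Both `Im gz` and the numerator `c |z|² - 2 a x - b`, taken for
the transformed vector at `gz`, acquire the same factor `|r z + s|⁻²`, where `(r, s)` is the lower
row of `g`; the factors cancel in the quotient. -/
lemma pairAt_act (N : ℕ) (g : SL(2, ℤ)) (X : V) (z : ℍ) :
    pairAt N (act g X) (g • z) = pairAt N X z := by
  rw [← vec_eq X]
  generalize X.mat 0 0 = a
  generalize X.mat 0 1 = b
  generalize X.mat 1 0 = c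
  rw [act_vec, pairAt_vec, pairAt_vec]
  have hz := z.im_pos
  have hz' := (g • z).im_pos
  have hden : (g 1 0 : ℂ) * z + g 1 1 ≠ 0 := by
    simpa [UpperHalfPlane.denom] using UpperHalfPlane.denom_ne_zero (g : GL (Fin 2) ℝ) z
  have hg : ((g • z : ℍ) : ℂ) * ((g 1 0 : ℂ) * z + g 1 1) = g 0 0 * z + g 0 1 := by
    rw [UpperHalfPlane.coe_specialLinearGroup_apply]
    simp only [algebraMap_int_eq, eq_intCast, Complex.ofReal_intCast]
    exact div_mul_cancel₀ _ hden
  have hdet : (g 0 0 : ℝ) * g 1 1 - g 0 1 * g 1 0 = 1 := by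
    have := g.det_coe
    rw [Matrix.det_fin_two] at this
    exact_mod_cast this
  have hre := congrArg Complex.re hg
  have him := congrArg Complex.im hg
  simp only [Complex.mul_re, Complex.add_re, Complex.mul_im, Complex.add_im, Complex.intCast_re,
    Complex.intCast_im, UpperHalfPlane.coe_re, UpperHalfPlane.coe_im] at hre him
  push_cast
  generalize (g • z).re = X at *
  generalize (g • z).im = Y at *
  generalize z.re = x at *
  generalize z.im = y at *
  generalize ((g 0 0 : ℤ) : ℝ) = p at *
  generalize ((g 0 1 : ℤ) : ℝ) = q at *
  generalize ((g 1 0 : ℤ) : ℝ) = r at *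
  generalize ((g 1 1 : ℤ) : ℝ) = s at *
  have hd : 0 < (r * x + s) ^ 2 + (r * y) ^ 2 := by
    by_contra h
    have h1 : (r * x + s) = 0 := by nlinarith [sq_nonneg (r * x + s), sq_nonneg (r * y)]
    have h2 : (r * y) = 0 := by nlinarith [sq_nonneg (r * x + s), sq_nonneg (r * y)]
    have h3 : r = 0 := (mul_eq_zero.mp h2).resolve_right hz.ne'
    have h4 : s = 0 := by simpa [h3] using h1
    simp [h3, h4] at hdet
  have hX : X * ((r * x + s) ^ 2 + (r * y) ^ 2) = (p * x + q) * (r * x + s) + p * r * y ^ 2 := by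
    linear_combination (r * x + s) * hre + r * y * him
  have hY : Y * ((r * x + s) ^ 2 + (r * y) ^ 2) = y := by
    linear_combination (r * x + s) * him - r * y * hre + y * hdet
  have hXY : (X ^ 2 + Y ^ 2) * ((r * x + s) ^ 2 + (r * y) ^ 2) = (p * x + q) ^ 2 + (p * y) ^ 2 := by
    linear_combination (X * (r * x + s) - Y * (r * y) + (p * x + q)) * hre +
      (X * (r * y) + Y * (r * x + s) + p * y) * him
  set T := (c : ℝ) * (x ^ 2 + y ^ 2) - 2 * a * x - b
  set a' := (a : ℝ) * (p * s + q * r) - b * p * r + c * q * s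
  set b' := -(2 * a) * p * q + (b : ℝ) * p ^ 2 - c * q ^ 2
  set c' := 2 * a * r * s - (b : ℝ) * r ^ 2 + c * s ^ 2
  have key : (c' * (X ^ 2 + Y ^ 2) - 2 * a' * X - b') * y = T * Y := by
    refine mul_right_cancel₀ hd.ne' ?_
    have e : (c' * ((p * x + q) ^ 2 + (p * y) ^ 2) -
        2 * a' * ((p * x + q) * (r * x + s) + p * r * y ^ 2) -
        b' * ((r * x + s) ^ 2 + (r * y) ^ 2)) = T * (p * s - q * r) ^ 2 := by
      simp only [T, a', b', c']; ring
    linear_combination y * (c' * hXY - 2 * a' * hX + e) - T * hY + y * T * (p * s - q * r + 1) * hdet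
  rw [div_mul_eq_mul_div, div_mul_eq_mul_div, div_eq_div_iff hz'.ne' hz.ne']
  linear_combination √N * key

lemma majorant_act (N : ℕ) (g : SL(2, ℤ)) (X : V) (z : ℍ) :
    majorant N (act g X) (g • z) = majorant N X z := by
  rw [majorant, majorant, pairAt_act, bil_act]

lemma phi0_act (N : ℕ) (g : SL(2, ℤ)) (X : V) (τ z : ℍ) :
    phi0 N (act g X) τ (g • z) = phi0 N X τ z := by
  rw [phi0, phi0, majorant_act, bil_act]

/-! ### Lattices in coordinates -/

variable {N : ℕ} {L : AddSubgroup V}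

lemma exists_nsmul_mem (h : IsEvenLattice N L) (X : V) : ∃ n : ℕ, 0 < n ∧ (n : ℚ) • X ∈ L := by
  have hX : X ∈ Submodule.span ℚ (L : Set V) := by rw [h.span_eq_top]; trivial
  induction hX using Submodule.span_induction with
  | mem X hX => exact ⟨1, one_pos, by simpa using hX⟩
  | zero => exact ⟨1, one_pos, by simp⟩
  | add X Y _ _ hX hY =>
    obtain ⟨n, hn, hX⟩ := hX
    obtain ⟨m, hm, hY⟩ := hY
    refine ⟨n * m, Nat.mul_pos hn hm, ?_⟩
    have h1 := L.nsmul_mem hX m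
    have h2 := L.nsmul_mem hY n
    rw [← Nat.cast_smul_eq_nsmul ℚ, smul_smul] at h1 h2
    rw [smul_add, Nat.cast_mul]
    refine L.add_mem ?_ h2
    rwa [mul_comm]
  | smul q X _ hX =>
    obtain ⟨n, hn, hX⟩ := hX
    refine ⟨n * q.den, Nat.mul_pos hn q.pos, ?_⟩
    have h1 := L.zsmul_mem hX q.num
    rw [← Int.cast_smul_eq_zsmul ℚ, smul_smul] at h1
    rw [smul_smul]
    have e : ((n * q.den : ℕ) : ℚ) * q = q.num * n := by
      push_cast
      rw [mul_assoc, Rat.den_mul_eq_num, mul_comm]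
    rwa [e]

/-- Polarization: `(X, Y) = Q(X + Y) - Q(X) - Q(Y)`, and `Q` is integral on `L`. -/
lemma le_dual (h : IsEvenLattice N L) : L ≤ dual N L := by
  intro X hX Y hY
  obtain ⟨n, hn⟩ := h.even _ (L.add_mem hX hY)
  obtain ⟨m, hm⟩ := h.even _ hX
  obtain ⟨k, hk⟩ := h.even _ hY
  refine ⟨n - m - k, ?_⟩
  have := quad_add N X Y
  push_cast
  linarith

lemma mem_coset_iff (h : IsEvenLattice N L) {d : Disc N L} {X Y : V} (hX : X ∈ coset N L d) :
    Y ∈ coset N L d ↔ Y - X ∈ L := by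
  obtain ⟨hX1, hX2⟩ := hX
  constructor
  · rintro ⟨hY1, hY2⟩
    have := QuotientAddGroup.eq.mp (hX2.trans hY2.symm)
    rw [AddSubgroup.mem_addSubgroupOf] at this
    simpa [neg_add_eq_sub] using this
  · intro hYX
    have hY1 : Y ∈ dual N L := by
      have := (dual N L).add_mem (le_dual h hYX) hX1
      simpa using this
    refine ⟨hY1, ?_⟩
    rw [← hX2]
    refine (QuotientAddGroup.eq.mpr ?_).symm
    rw [AddSubgroup.mem_addSubgroupOf]
    simpa [neg_add_eq_sub] using hYX

/-- The coordinates of the vectors of the dual lattice have bounded denominators. -/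
lemma exists_denominator (hN : 0 < N) (h : IsEvenLattice N L) (σ : SL(2, ℤ)) :
    ∃ D : ℕ, 0 < D ∧ ∀ a b c : ℚ, act σ (vec a b c) ∈ dual N L →
      (∃ i : ℤ, a = i / D) ∧ (∃ j : ℤ, b = j / D) ∧ (∃ k : ℤ, c = k / D) := by
  -- Pairing with the three coordinate vectors gives `2 N a`, `N c` and `N b`, in this order;
  -- multiples of these vectors lie in `L`, so the product of all the factors clears every
  -- denominator.
  obtain ⟨n₁, h₁, m₁⟩ := exists_nsmul_mem h (act σ (vec 1 0 0))
  obtain ⟨n₂, h₂, m₂⟩ := exists_nsmul_mem h (act σ (vec 0 1 0))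
  obtain ⟨n₃, h₃, m₃⟩ := exists_nsmul_mem h (act σ (vec 0 0 1))
  have key : ∀ x : ℚ, ∀ n : ℤ, ∀ k D : ℕ, 0 < D → (∃ l : ℕ, D = k * l) → k * x = n →
      ∃ i : ℤ, x = i / D := by
    rintro x n k D hD ⟨l, rfl⟩ hx
    refine ⟨n * l, ?_⟩
    have hD' : ((k * l : ℕ) : ℚ) ≠ 0 := Nat.cast_ne_zero.mpr hD.ne'
    rw [eq_div_iff hD']
    push_cast
    rw [← hx]
    ring
  have hD : 0 < 2 * N * n₁ * n₂ * n₃ := by positivity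
  refine ⟨2 * N * n₁ * n₂ * n₃, hD, fun a b c hX => ⟨?_, ?_, ?_⟩⟩
  · obtain ⟨n, hn⟩ := hX _ m₁
    rw [bil_comm, bil_smul_left, bil_act, bil_vec] at hn
    refine key a n (2 * N * n₁) _ hD ⟨n₂ * n₃, by ring⟩ ?_
    rw [← hn]; push_cast; ring
  · obtain ⟨n, hn⟩ := hX _ m₃
    rw [bil_comm, bil_smul_left, bil_act, bil_vec] at hn
    refine key b n (N * n₃) _ hD ⟨2 * n₁ * n₂, by ring⟩ ?_
    rw [← hn]; push_cast; ring
  · obtain ⟨n, hn⟩ := hX _ m₂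
    rw [bil_comm, bil_smul_left, bil_act, bil_vec] at hn
    refine key c n (N * n₂) _ hD ⟨2 * n₁ * n₃, by ring⟩ ?_
    rw [← hn]; push_cast; ring

/-- The vectors of `L` on the line `σ ℓ₀` are the multiples of `β σ.u₀`. -/
lemma exists_cuspBeta (hN : 0 < N) (h : IsEvenLattice N L) (σ : SL(2, ℤ)) :
    ∃ q : ℚ, 0 < q ∧ (q : ℝ) = cuspBeta L σ ∧
      ∀ b : ℚ, act σ (vec 0 b 0) ∈ L ↔ ∃ k : ℤ, b = k * q := by
  obtain ⟨D, hD, hden⟩ := exists_denominator hN h σ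
  let H : AddSubgroup ℚ :=
    { carrier := {b | act σ (vec 0 b 0) ∈ L}
      zero_mem' := by
        have : vec 0 0 0 = 0 := by rw [← smul_u₀, zero_smul]
        simp [this, L.zero_mem]
      add_mem' := fun {a b} ha hb => by
        have := L.add_mem ha hb
        rw [← map_add, vec_add] at this
        simpa using this
      neg_mem' := fun {a} ha => by
        have := L.neg_mem ha
        rw [← map_neg, ← zero_sub, ← zero_smul ℚ u₀, smul_u₀, vec_sub] at this
        simpa using this }
  have hH : ∀ b, b ∈ H ↔ act σ (vec 0 b 0) ∈ L := fun b => Iff.rfl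
  obtain ⟨n, hn, hmem⟩ := exists_nsmul_mem h (act σ u₀)
  rw [← map_smul, smul_u₀] at hmem
  have hbot : H ≠ ⊥ := by
    intro hb
    have : (n : ℚ) ∈ H := hmem
    rw [hb, AddSubgroup.mem_bot, Nat.cast_eq_zero] at this
    exact hn.ne' this
  -- Bounded denominators keep the nonzero elements of `H` away from `0`; hence `H` is generated by
  -- its least positive element.
  have hdis : Disjoint (H : Set ℚ) (Set.Ioo 0 (1 / (D : ℚ))) := by
    rw [Set.disjoint_left]
    rintro b hb ⟨h1, h2⟩
    obtain ⟨j, rfl⟩ := (hden 0 b 0 (le_dual h hb)).2.1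
    have hD' : (0 : ℚ) < D := Nat.cast_pos.mpr hD
    rw [div_lt_div_iff_of_pos_right hD'] at h2
    have h3 : (0 : ℚ) < j := by
      by_contra hj
      exact absurd h1 (not_lt.mpr (div_nonpos_of_nonpos_of_nonneg (not_lt.mp hj) hD'.le))
    have h4 : j < 1 := by exact_mod_cast h2
    have h5 : 0 < j := by exact_mod_cast h3
    omega
  obtain ⟨q, hq⟩ := AddSubgroup.exists_isLeast_pos hbot (by positivity) hdis
  refine ⟨q, hq.1.2, ?_, fun b => ?_⟩
  · have hl : IsLeast {b : ℝ | 0 < b ∧ ∃ q : ℚ, (q : ℝ) = b ∧ q • act σ u₀ ∈ L} (q : ℝ) := by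
      have e : ∀ r : ℚ, r • act σ u₀ = act σ (vec 0 r 0) := fun r => by
        rw [← map_smul, smul_u₀]
      refine ⟨⟨by exact_mod_cast hq.1.2, q, rfl, by rw [e]; exact hq.1.1⟩, ?_⟩
      rintro _ ⟨h1, r, rfl, hr⟩
      rw [e] at hr
      exact_mod_cast hq.2 ⟨hr, by exact_mod_cast h1⟩
    exact hl.csInf_eq.symm
  · rw [← hH, AddSubgroup.cyclic_of_min hq, AddSubgroup.mem_closure_singleton]
    exact ⟨fun ⟨k, hk⟩ => ⟨k, by rw [← hk, zsmul_eq_mul]⟩, fun ⟨k, hk⟩ => ⟨k, by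
      rw [hk, zsmul_eq_mul]⟩⟩

end ThetaLift

end

noncomputable section

namespace ThetaLift

/-! ### Poisson summation -/

/-- The exponent of `phi0` on `(a, b; c, -a)`. -/
def gaussExponent (ν a b c : ℝ) (t z : ℂ) : ℂ :=
  2 * π * Complex.I * ν * (a ^ 2 + b * c) * t -
    π * ν * t.im / z.im ^ 2 * (c * (z.re ^ 2 + z.im ^ 2) - 2 * a * z.re - b) ^ 2

lemma phi0_vec (N : ℕ) (a b c : ℚ) (τ z : ℍ) :
    phi0 N (vec a b c) τ z = √τ.im * Complex.exp (gaussExponent N a b c τ z) := by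
  have hN2 : (√(N : ℝ) : ℂ) ^ 2 = N := by
    rw [← Complex.ofReal_pow, Real.sq_sqrt (Nat.cast_nonneg N), Complex.ofReal_natCast]
  have ht : (τ : ℂ) = τ.re + τ.im * Complex.I := (Complex.re_add_im (τ : ℂ)).symm
  have hz : (z.im : ℂ) ≠ 0 := Complex.ofReal_ne_zero.mpr z.im_pos.ne'
  rw [phi0, gaussExponent, majorant, pairAt_vec, bil_self, quad_vec]
  congr 2
  simp only [UpperHalfPlane.coe_re, UpperHalfPlane.coe_im]
  rw [ht]
  push_cast
  rw [mul_pow, div_pow, hN2]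
  field_simp
  ring_nf
  simp only [Complex.I_sq]
  ring

/-- Poisson summation in the variable `b`. -/
lemma tsum_gauss {ν β : ℝ} (hν : 0 < ν) (hβ : 0 < β) (a b c : ℝ) {t z : ℂ} (ht : 0 < t.im)
    (hz : 0 < z.im) :
    ∑' m : ℤ, √t.im * Complex.exp (gaussExponent ν a (b + m * β) c t z) =
      1 / (β * √ν) * ∑' n : ℤ, Complex.exp (2 * π * Complex.I * (n * b / β)) *
        (z.im * Complex.exp (2 * π * Complex.I * ν * (a - c * z.re) ^ 2 * t
          - 2 * π * Complex.I * (n / β) * (c * z.re ^ 2 - 2 * a * z.re)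
          - π * z.im ^ 2 * ((ν * c * t.re - n / β) ^ 2 + (ν * c * t.im) ^ 2) / (ν * t.im))) := by
  -- The exponent is `k - π A m² + 2 π B m`, a quadratic polynomial in the summation variable with
  -- value `k` at `m = 0`.
  set A : ℝ := ν * t.im * β ^ 2 / z.im ^ 2 with hA
  have hA0 : 0 < A := by positivity
  set s₀ : ℂ := b - (c * (z.re ^ 2 + z.im ^ 2) - 2 * a * z.re) with hs₀
  set B : ℂ := Complex.I * ν * c * t * β - ν * t.im / z.im ^ 2 * s₀ * β with hB
  set k : ℂ := 2 * π * Complex.I * ν * (a ^ 2 + b * c) * t - π * ν * t.im / z.im ^ 2 * s₀ ^ 2 with hk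
  have h1 := Complex.tsum_exp_neg_quadratic (a := A) (by simpa using hA0) B
  have hz' : (z.im : ℂ) ≠ 0 := Complex.ofReal_ne_zero.mpr hz.ne'
  have ht' : (t.im : ℂ) ≠ 0 := Complex.ofReal_ne_zero.mpr ht.ne'
  have hν' : (ν : ℂ) ≠ 0 := Complex.ofReal_ne_zero.mpr hν.ne'
  have hβ' : (β : ℂ) ≠ 0 := Complex.ofReal_ne_zero.mpr hβ.ne'
  have e1 : ∀ m : ℤ, √t.im * Complex.exp (gaussExponent ν a (b + m * β) c t z) =
      √t.im * Complex.exp k * Complex.exp (-π * A * m ^ 2 + 2 * π * B * m) := by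
    intro m
    rw [mul_assoc, ← Complex.exp_add]
    congr 2
    rw [gaussExponent, hk, hB, hs₀, hA]
    push_cast
    field_simp
    ring
  simp only [e1]
  rw [tsum_mul_left, h1, ← tsum_mul_left, ← tsum_mul_left, ← tsum_mul_left]
  refine tsum_congr fun n => ?_
  -- The Gaussian factor `A ^ (-1/2)` provides the `y` of `thetaTerm`, and its `1 / √v` cancels the
  -- `√v` of the kernel.
  have hsq : (1 : ℂ) / (A : ℂ) ^ (1 / 2 : ℂ) = z.im / (β * √ν * √t.im) := by
    have h2 : (A : ℂ) ^ (1 / 2 : ℂ) = ((√A : ℝ) : ℂ) := by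
      rw [Real.sqrt_eq_rpow, Complex.ofReal_cpow hA0.le]
      norm_num
    have h3 : √A = β * √ν * √t.im / z.im := by
      rw [Real.sqrt_eq_iff_mul_self_eq_of_pos (by positivity)]
      have h4 := Real.mul_self_sqrt hν.le
      have h5 := Real.mul_self_sqrt ht.le
      rw [hA]
      field_simp
      rw [Real.sq_sqrt hν.le, Real.sq_sqrt ht.le]
    rw [h2, h3]
    push_cast
    rw [one_div_div]
  rw [hsq]
  have hsν : (√ν : ℂ) ≠ 0 := Complex.ofReal_ne_zero.mpr (Real.sqrt_pos.mpr hν).ne'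
  have hst : (√t.im : ℂ) ≠ 0 := Complex.ofReal_ne_zero.mpr (Real.sqrt_pos.mpr ht).ne'
  have e2 : Complex.exp k * Complex.exp (-π / A * (n + Complex.I * B) ^ 2) =
      Complex.exp (2 * π * Complex.I * (n * b / β)) *
        Complex.exp (2 * π * Complex.I * ν * (a - c * z.re) ^ 2 * t
          - 2 * π * Complex.I * (n / β) * (c * z.re ^ 2 - 2 * a * z.re)
          - π * z.im ^ 2 * ((ν * c * t.re - n / β) ^ 2 + (ν * c * t.im) ^ 2) / (ν * t.im)) := by
    rw [← Complex.exp_add, ← Complex.exp_add]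
    congr 1
    have e3 : t = t.re + t.im * Complex.I := (Complex.re_add_im t).symm
    rw [hk, hB, hs₀, hA]
    generalize hu : (t.re : ℂ) = u at *
    generalize hv : t.im = v at *
    rw [e3]
    push_cast
    generalize (v : ℂ) = v at *
    have hI5 : Complex.I ^ 5 = Complex.I := by rw [pow_succ, Complex.I_pow_four, one_mul]
    have hI6 : Complex.I ^ 6 = -1 := by rw [pow_succ, hI5, Complex.I_mul_I]
    field_simp
    ring_nf
    simp only [Complex.I_sq, Complex.I_pow_three, Complex.I_pow_four, hI5, hI6]
    ring
  calc √t.im * Complex.exp k * (z.im / (β * √ν * √t.im) *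
        Complex.exp (-π / A * (n + Complex.I * B) ^ 2))
      = 1 / (β * √ν) * (z.im * (Complex.exp k *
        Complex.exp (-π / A * (n + Complex.I * B) ^ 2))) := by field_simp
    _ = _ := by rw [e2]; ring

lemma norm_exp_gaussExponent (ν a b c : ℝ) (t z : ℂ) :
    ‖Complex.exp (gaussExponent ν a b c t z)‖ = Real.exp (-(π * ν * t.im *
      (2 * (a ^ 2 + b * c) + (c * (z.re ^ 2 + z.im ^ 2) - 2 * a * z.re - b) ^ 2 / z.im ^ 2))) := by
  rw [Complex.norm_exp]
  congr 1
  have e : gaussExponent ν a b c t z = ((2 * π * ν * (a ^ 2 + b * c) : ℝ) : ℂ) * (Complex.I * t) -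
      ((π * ν * t.im / z.im ^ 2 * (c * (z.re ^ 2 + z.im ^ 2) - 2 * a * z.re - b) ^ 2 : ℝ) : ℂ) := by
    unfold gaussExponent
    push_cast
    ring
  rw [e, Complex.sub_re, Complex.re_ofReal_mul, Complex.ofReal_re, Complex.I_mul_re]
  ring

/-- The majorant is positive definite: with `s = c (x² + y²) - 2 a x - b` it equals `2 (a - c x)² +
c² y² + (c y - s / y)²`, up to the factor `ν`. From this `c`, `s`, `a`, `b` are bounded in turn.
Since `z` is fixed, the estimate serves absolute convergence before Poisson summation only. -/
lemma majorant_lower_bound {y : ℝ} (hy : 0 < y) (x : ℝ) :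
    ∃ K : ℝ, 0 < K ∧ ∀ a b c : ℝ, a ^ 2 + (b ^ 2 + c ^ 2) ≤
      K * (2 * (a ^ 2 + b * c) + (c * (x ^ 2 + y ^ 2) - 2 * a * x - b) ^ 2 / y ^ 2) := by
  set Ka := 1 + 2 * x ^ 2 / y ^ 2
  set Kb := 3 * ((x ^ 2 + y ^ 2) ^ 2 / y ^ 2 + 4 * x ^ 2 * Ka + 4 * y ^ 2)
  refine ⟨Ka + Kb + 1 / y ^ 2, by positivity, fun a b c => ?_⟩
  set s := c * (x ^ 2 + y ^ 2) - 2 * a * x - b with hs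
  set Q := 2 * (a ^ 2 + b * c) + s ^ 2 / y ^ 2 with hQ
  have e : Q = 2 * (a - c * x) ^ 2 + (c ^ 2 * y ^ 2 + (c * y - s / y) ^ 2) := by
    rw [hQ]
    have : b = c * (x ^ 2 + y ^ 2) - 2 * a * x - s := by rw [hs]; ring
    rw [this]
    field_simp
    ring
  have h1 : c ^ 2 * y ^ 2 ≤ Q := by
    linarith [sq_nonneg (a - c * x), sq_nonneg (c * y - s / y)]
  have h2 : 2 * (a - c * x) ^ 2 ≤ Q := by
    linarith [mul_nonneg (sq_nonneg c) (sq_nonneg y), sq_nonneg (c * y - s / y)]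
  have h3 : (c * y - s / y) ^ 2 ≤ Q := by
    linarith [mul_nonneg (sq_nonneg c) (sq_nonneg y), sq_nonneg (a - c * x)]
  have hc : c ^ 2 ≤ 1 / y ^ 2 * Q := by
    rw [div_mul_eq_mul_div, le_div_iff₀ (by positivity), one_mul]
    exact h1
  have hs2 : s ^ 2 ≤ 4 * y ^ 2 * Q := by
    have h4 : (s / y) ^ 2 ≤ 4 * Q := by
      nlinarith [sq_nonneg (2 * (c * y) - s / y)]
    rw [div_pow, div_le_iff₀ (by positivity)] at h4
    linarith
  have ha : a ^ 2 ≤ Ka * Q := by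
    have h4 : a ^ 2 ≤ 2 * (a - c * x) ^ 2 + 2 * x ^ 2 * c ^ 2 := by
      nlinarith [sq_nonneg (a - 2 * (c * x))]
    have h5 : 2 * x ^ 2 * c ^ 2 ≤ 2 * x ^ 2 * (1 / y ^ 2 * Q) := by gcongr
    have e2 : Ka * Q = Q + 2 * x ^ 2 * (1 / y ^ 2 * Q) := by simp only [Ka]; ring
    linarith
  have hb : b ^ 2 ≤ Kb * Q := by
    have h4 : b ^ 2 ≤ 3 * ((x ^ 2 + y ^ 2) ^ 2 * c ^ 2 + 4 * x ^ 2 * a ^ 2 + s ^ 2) := by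
      have : b = c * (x ^ 2 + y ^ 2) + -(2 * a * x) + -s := by rw [hs]; ring
      rw [this]
      nlinarith [sq_nonneg (c * (x ^ 2 + y ^ 2) + 2 * a * x), sq_nonneg (c * (x ^ 2 + y ^ 2) + s),
        sq_nonneg (2 * a * x - s)]
    have h5 : (x ^ 2 + y ^ 2) ^ 2 * c ^ 2 ≤ (x ^ 2 + y ^ 2) ^ 2 * (1 / y ^ 2 * Q) := by gcongr
    have h6 : 4 * x ^ 2 * a ^ 2 ≤ 4 * x ^ 2 * (Ka * Q) := by gcongr
    have e2 : Kb * Q = 3 * ((x ^ 2 + y ^ 2) ^ 2 * (1 / y ^ 2 * Q) + 4 * x ^ 2 * (Ka * Q) +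
        4 * y ^ 2 * Q) := by simp only [Kb]; ring
    linarith
  linarith

end ThetaLift

end

noncomputable section

namespace ThetaLift

/-! ### The expansion of the theta function at a cusp -/

section

variable {N : ℕ} {L : AddSubgroup V} {σ : SL(2, ℤ)} {d : Disc N L} {D : ℕ} {q : ℚ}

/-- The pairs `(i, j)` such that some `σ.(i / D, b; j / D, -i / D)` lies in the coset `d`. -/
def IsIndex (N : ℕ) (L : AddSubgroup V) (σ : SL(2, ℤ)) (d : Disc N L) (D : ℕ) (p : ℤ × ℤ) : Prop :=
  ∃ b : ℚ, act σ (vec (p.1 / D) b (p.2 / D)) ∈ coset N L d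

/-- An entry `b` as in `IsIndex`. -/
def baseEntry (p : {p : ℤ × ℤ // IsIndex N L σ d D p}) : ℚ := p.2.choose

lemma baseEntry_spec (p : {p : ℤ × ℤ // IsIndex N L σ d D p}) :
    act σ (vec (p.1.1 / D) (baseEntry p) (p.1.2 / D)) ∈ coset N L d := p.2.choose_spec

open Classical in
/-- The weights in the expansion of the theta function at a cusp. -/
def cuspWeight (N : ℕ) (L : AddSubgroup V) (σ : SL(2, ℤ)) (d : Disc N L) (D : ℕ) (q : ℚ)
    (m : ℤ × ℤ × ℤ) : ℂ :=
  if hp : IsIndex N L σ d D (m.1, m.2.1) then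
    Complex.exp (2 * π * Complex.I * (m.2.2 * (baseEntry ⟨_, hp⟩ : ℝ) / (q : ℝ))) else 0

lemma norm_cuspWeight_le (m : ℤ × ℤ × ℤ) : ‖cuspWeight N L σ d D q m‖ ≤ 1 := by
  unfold cuspWeight
  split_ifs with hp
  · have e : 2 * π * Complex.I * (m.2.2 * (baseEntry ⟨_, hp⟩ : ℝ) / (q : ℝ)) =
        ((2 * π * (m.2.2 * (baseEntry ⟨_, hp⟩ : ℝ) / (q : ℝ)) : ℝ) : ℂ) * Complex.I := by
      push_cast; ring
    rw [e, Complex.norm_exp_ofReal_mul_I]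
  · simp

variable (hL : IsEvenLattice N L)
  (hq : ∀ b : ℚ, act σ (vec 0 b 0) ∈ L ↔ ∃ k : ℤ, b = k * q)

include hL hq in
lemma mem_coset_shift {a b c : ℚ} (h : act σ (vec a b c) ∈ coset N L d) (b' : ℚ) :
    act σ (vec a b' c) ∈ coset N L d ↔ ∃ k : ℤ, b' = b + k * q := by
  rw [mem_coset_iff hL h, ← map_sub, vec_sub, sub_self, sub_self, hq]
  simp only [sub_eq_iff_eq_add, add_comm b]

/-- The vectors of a coset, indexed by the classes modulo the isotropic line and an integer. -/
def cosetMap (hL : IsEvenLattice N L)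
    (hq : ∀ b : ℚ, act σ (vec 0 b 0) ∈ L ↔ ∃ k : ℤ, b = k * q)
    (x : {p : ℤ × ℤ // IsIndex N L σ d D p} × ℤ) : coset N L d :=
  ⟨act σ (vec (x.1.1.1 / D) (baseEntry x.1 + x.2 * q) (x.1.1.2 / D)),
    (mem_coset_shift hL hq (baseEntry_spec x.1) _).mpr ⟨x.2, rfl⟩⟩

/-- The entries `a` and `c` of a vector in the coset lie in `ℤ / D`; once they are fixed, the entry
`b` runs through one class modulo `q`, because two choices differ by a vector of `L` on the
isotropic line. -/
lemma cosetMap_bijective (hD : 0 < D) (hq0 : 0 < q)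
    (hden : ∀ a b c : ℚ, act σ (vec a b c) ∈ dual N L →
      (∃ i : ℤ, a = i / D) ∧ (∃ j : ℤ, b = j / D) ∧ (∃ k : ℤ, c = k / D)) :
    Function.Bijective (cosetMap (d := d) (D := D) hL hq) := by
  have hD' : (D : ℚ) ≠ 0 := Nat.cast_ne_zero.mpr hD.ne'
  constructor
  · rintro ⟨p, k⟩ ⟨p', k'⟩ h
    obtain ⟨h1, h2, h3⟩ := vec_injective (act_injective σ (congrArg Subtype.val h))
    dsimp only at h1 h2 h3
    rw [div_left_inj' hD', Int.cast_inj] at h1 h3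
    obtain rfl : p = p' := Subtype.ext (Prod.ext h1 h3)
    rw [add_right_inj, mul_left_inj' hq0.ne', Int.cast_inj] at h2
    rw [h2]
  · rintro ⟨X, hX⟩
    obtain ⟨a, b, c, rfl⟩ := exists_act_vec σ X
    obtain ⟨⟨i, rfl⟩, -, ⟨j, rfl⟩⟩ := hden a b c hX.1
    let p : {p : ℤ × ℤ // IsIndex N L σ d D p} := ⟨(i, j), b, hX⟩
    obtain ⟨k, hk⟩ := (mem_coset_shift hL hq (baseEntry_spec p) b).mp hX
    refine ⟨(p, k), Subtype.ext ?_⟩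
    simp only [cosetMap, p, hk]

-- Absolute convergence permits summing over the multiples of `q` first, which is where Poisson
-- summation applies.
include hL hq in
lemma summable_cosetMap (hN : 0 < N) (hD : 0 < D) (hq0 : 0 < q)
    (hden : ∀ a b c : ℚ, act σ (vec a b c) ∈ dual N L →
      (∃ i : ℤ, a = i / D) ∧ (∃ j : ℤ, b = j / D) ∧ (∃ k : ℤ, c = k / D)) (τ z : ℍ) :
    Summable fun x : {p : ℤ × ℤ // IsIndex N L σ d D p} × ℤ =>
      phi0 N (vec (x.1.1.1 / D) (baseEntry x.1 + x.2 * q) (x.1.1.2 / D)) τ z := by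
  have hD' : (0 : ℝ) < D := Nat.cast_pos.mpr hD
  have hN' : (0 : ℝ) < N := Nat.cast_pos.mpr hN
  have hτ := τ.im_pos
  obtain ⟨K, hK, hb⟩ := majorant_lower_bound z.im_pos z.re
  -- The middle entries also have denominator `D`, so the vectors embed into `ℤ³` and a Gaussian sum
  -- over `ℤ³` dominates.
  choose k hk using fun x => (hden _ _ _ (cosetMap (d := d) (D := D) hL hq x).2.1).2.1
  have hinj : Function.Injective fun x : {p : ℤ × ℤ // IsIndex N L σ d D p} × ℤ =>
      ((x.1.1.1, k x, x.1.1.2) : ℤ × ℤ × ℤ) := by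
    intro x x' h
    simp only [Prod.mk.injEq] at h
    refine (cosetMap_bijective (d := d) hL hq hD hq0 hden).1 (Subtype.ext ?_)
    simp only [cosetMap]
    rw [hk x, hk x', h.1, h.2.1, h.2.2]
  have hκ : 0 < π * N * τ.im / (K * D ^ 2) := by positivity
  refine Summable.of_norm_bounded (((summable_exp_neg_idxSq hκ).comp_injective hinj).mul_left
    √τ.im) fun x => ?_
  rw [phi0_vec, norm_mul, Complex.norm_real, Real.norm_of_nonneg (Real.sqrt_nonneg _),
    norm_exp_gaussExponent]
  refine mul_le_mul_of_nonneg_left (Real.exp_le_exp.mpr ?_) (Real.sqrt_nonneg _)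
  have h1 := hb (x.1.1.1 / D) (k x / D) (x.1.1.2 / D)
  have e1 : ((x.1.1.1 / D : ℝ) ^ 2 + ((k x / D : ℝ) ^ 2 + (x.1.1.2 / D : ℝ) ^ 2)) * D ^ 2 =
      idxSq (x.1.1.1, k x, x.1.1.2) := by
    unfold idxSq
    field_simp
  rw [hk x]
  simp only [UpperHalfPlane.coe_im, UpperHalfPlane.coe_re, Rat.cast_div,
    Rat.cast_intCast, Rat.cast_natCast]
  set Q := 2 * ((x.1.1.1 / D : ℝ) ^ 2 + (k x / D : ℝ) * (x.1.1.2 / D : ℝ)) +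
    ((x.1.1.2 / D : ℝ) * (z.re ^ 2 + z.im ^ 2) - 2 * (x.1.1.1 / D : ℝ) * z.re - (k x / D : ℝ)) ^ 2 /
      z.im ^ 2 with hQ
  have h2 : π * N * τ.im / (K * D ^ 2) * idxSq (x.1.1.1, k x, x.1.1.2) ≤ π * N * τ.im * Q := by
    rw [div_mul_eq_mul_div, div_le_iff₀ (by positivity), ← e1]
    calc π * N * τ.im * (((x.1.1.1 / D : ℝ) ^ 2 + ((k x / D : ℝ) ^ 2 + (x.1.1.2 / D : ℝ) ^ 2)) *
          D ^ 2) ≤ π * N * τ.im * (K * Q * D ^ 2) := by gcongr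
      _ = _ := by ring
  linarith

-- Equivariance moves `σ` from `z` to the lattice, and `tsum_gauss` is applied for each pair of
-- outer entries. The base point of the class of `b` survives as the phase `exp (2 π i n b / q)`;
-- this phase is the weight. Pairs that do not occur get weight zero, so the series can run over all
-- of `ℤ³`.
include hL hq in
theorem theta_eq_thetaSeries (hN : 0 < N) (hD : 0 < D) (hq0 : 0 < q)
    (hden : ∀ a b c : ℚ, act σ (vec a b c) ∈ dual N L →
      (∃ i : ℤ, a = i / D) ∧ (∃ j : ℤ, b = j / D) ∧ (∃ k : ℤ, c = k / D)) (τ z : ℍ) :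
    theta N L d τ (σ • z) =
      1 / ((q : ℝ) * √N) * thetaSeries N D (q : ℝ) (cuspWeight N L σ d D q) τ z := by
  have hD' : (0 : ℝ) < D := Nat.cast_pos.mpr hD
  have hN' : (0 : ℝ) < N := Nat.cast_pos.mpr hN
  have hq0' : (0 : ℝ) < q := by exact_mod_cast hq0
  have hτ := τ.im_pos
  have h1 : theta N L d τ (σ • z) = ∑' x : {p : ℤ × ℤ // IsIndex N L σ d D p} × ℤ,
      phi0 N (vec (x.1.1.1 / D) (baseEntry x.1 + x.2 * q) (x.1.1.2 / D)) τ z := by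
    rw [theta, ← (Equiv.ofBijective _ (cosetMap_bijective (d := d) hL hq hD hq0 hden)).tsum_eq]
    exact tsum_congr fun x => phi0_act _ _ _ _ _
  have hs := summable_thetaSeries (ν := N) (δ := D) (β := q) (t := τ) hN' hD' hq0' hτ
    (norm_cuspWeight_le (N := N) (L := L) (σ := σ) (d := d) (D := D) (q := q)) (z := z) z.im_pos
  have h2 : thetaSeries N D (q : ℝ) (cuspWeight N L σ d D q) τ z =
      ∑' p : ℤ × ℤ, ∑' n : ℤ, cuspWeight N L σ d D q (p.1, p.2, n) *
        thetaTerm N D (q : ℝ) (p.1, p.2, n) τ z := by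
    rw [thetaSeries, ← (Equiv.prodAssoc ℤ ℤ ℤ).tsum_eq]
    exact ((Equiv.prodAssoc ℤ ℤ ℤ).summable_iff.mpr hs).tsum_prod
  rw [h1, (summable_cosetMap hL hq hN hD hq0 hden τ z).tsum_prod, h2,
    ← tsum_subtype_eq_of_support_subset (s := {p | IsIndex N L σ d D p}), ← tsum_mul_left]
  · refine tsum_congr fun p => ?_
    have h3 := tsum_gauss hN' hq0' (p.1.1 / D) (baseEntry p) (p.1.2 / D) (t := τ) (z := z) hτ z.im_pos
    have e : ∀ m : ℤ, phi0 N (vec (p.1.1 / D) (baseEntry p + m * q) (p.1.2 / D)) τ z =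
        √τ.im * Complex.exp (gaussExponent N (p.1.1 / D) (baseEntry p + m * q) (p.1.2 / D) τ z) := by
      intro m
      rw [phi0_vec]
      push_cast
      rfl
    simp only [e]
    refine h3.trans ?_
    congr 1
    refine tsum_congr fun n => ?_
    have hp : IsIndex N L σ d D (p.1.1, p.1.2) := p.2
    rw [cuspWeight, dif_pos hp, thetaTerm, thetaExponent]
    push_cast
    rfl
  · intro p hp
    by_contra h
    refine hp ?_
    have : ∀ n, cuspWeight N L σ d D q (p.1, p.2, n) = 0 := fun n => dif_neg h
    simp [this]

/-- The class in `W` of the vectors `σ.(i / D, b; 0, -i / D)`. -/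
def classW (hN : 0 < N) (σ : SL(2, ℤ)) (D : ℕ) (i : ℤ) : W N (lineOf N σ) :=
  Submodule.Quotient.mk ⟨act σ (vec (i / D) 0 0), (mem_perp_lineOf N hN σ _ _ _).mpr rfl⟩

lemma mk_eq_classW (hN : 0 < N) (i : ℤ) (b : ℚ) (h : act σ (vec (i / D) b 0) ∈ perp N (lineOf N σ)) :
    (Submodule.Quotient.mk ⟨act σ (vec (i / D) b 0), h⟩ : W N (lineOf N σ)) = classW hN σ D i := by
  rw [classW, Submodule.Quotient.eq, Submodule.submoduleOf, Submodule.mem_comap]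
  change act σ (vec (i / D) b 0) - act σ (vec (i / D) 0 0) ∈ (lineOf N σ).1
  rw [← map_sub, vec_sub, mem_lineOf]
  simp

lemma classW_injective (hN : 0 < N) (hD : 0 < D) : Function.Injective (classW (D := D) hN σ) := by
  intro i j h
  rw [classW, classW, Submodule.Quotient.eq, Submodule.submoduleOf, Submodule.mem_comap] at h
  change act σ (vec (i / D) 0 0) - act σ (vec (j / D) 0 0) ∈ (lineOf N σ).1 at h
  rw [← map_sub, vec_sub, mem_lineOf] at h
  have hD' : (D : ℚ) ≠ 0 := Nat.cast_ne_zero.mpr hD.ne'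
  have := sub_eq_zero.mp h.1
  rwa [div_left_inj' hD', Int.cast_inj] at this

lemma quadW_classW (hN : 0 < N) (i : ℤ) : quadW N (lineOf N σ) (classW hN σ D i) = N * (i / D) ^ 2 := by
  change quad N (act σ (vec (i / D) 0 0)) = _
  rw [quad_act, quad_vec]
  ring

include hL in
lemma mem_cosetK_iff {l : IsoLine N} (X : perp N l) (hX : (X : V) ∈ coset N L d) (w : W N l) :
    (QuotientAddGroup.mk w : W N l ⧸ latticeK N L l) = cosetK N L l X ↔
      ∃ Y : perp N l, (Y : V) ∈ coset N L d ∧ Submodule.Quotient.mk Y = w := by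
  rw [cosetK, eq_comm, QuotientAddGroup.eq]
  constructor
  · rintro ⟨Z, hZ, e⟩
    refine ⟨X + Z, (mem_coset_iff hL hX).mpr ?_, ?_⟩
    · have : ((X + Z : perp N l) : V) - X = Z := by simp
      rw [this]
      exact hZ
    · rw [Submodule.Quotient.mk_add]
      have e' : (Submodule.Quotient.mk Z : W N l) = -Submodule.Quotient.mk X + w := e
      rw [e', add_neg_cancel_left]
  · rintro ⟨Y, hY, rfl⟩
    refine ⟨-X + Y, ?_, rfl⟩
    have := (mem_coset_iff hL hX).mp hY
    rw [← neg_add_eq_sub] at this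
    exact this

-- At `j = n = 0` the phase is `1`, so the weights are the indicator of those `i` for which the
-- coset contains a vector of `ℓ^⊥` with first coordinate `i / D`. Passing to `ℓ^⊥ / ℓ` forgets the
-- entry `b`, and the class has norm `N (i / D)²`. If the coset misses `ℓ^⊥`, both sides vanish.
include hL in
theorem tildeTheta_eq_thetaConst (hN : 0 < N) (hD : 0 < D)
    (hden : ∀ a b c : ℚ, act σ (vec a b c) ∈ dual N L →
      (∃ i : ℤ, a = i / D) ∧ (∃ j : ℤ, b = j / D) ∧ (∃ k : ℤ, c = k / D)) (τ : ℍ) :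
    tildeTheta N L (lineOf N σ) d τ = thetaConst N D (q : ℝ) (cuspWeight N L σ d D q) τ := by
  classical
  have hw : ∀ i : ℤ, cuspWeight N L σ d D q (i, 0, 0) = if IsIndex N L σ d D (i, 0) then 1 else 0 := by
    intro i
    unfold cuspWeight
    split_ifs <;> simp
  rw [thetaConst_eq]
  by_cases hex : ∃ X : perp N (lineOf N σ), (X : V) ∈ coset N L d
  · obtain ⟨X, hX⟩ := hex
    rw [tildeTheta_eq N L _ d τ X hX, thetaK]
    have hmem : ∀ i : ℤ, IsIndex N L σ d D (i, 0) →
        (QuotientAddGroup.mk (classW hN σ D i) : W N (lineOf N σ) ⧸ latticeK N L (lineOf N σ)) =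
          cosetK N L (lineOf N σ) X := by
      rintro i ⟨b, hb⟩
      rw [Int.cast_zero, zero_div] at hb
      rw [mem_cosetK_iff hL X hX]
      exact ⟨⟨_, (mem_perp_lineOf N hN σ _ _ _).mpr rfl⟩, hb, mk_eq_classW hN i b _⟩
    let F : {i : ℤ // IsIndex N L σ d D (i, 0)} → {w : W N (lineOf N σ) //
        (QuotientAddGroup.mk w : W N (lineOf N σ) ⧸ latticeK N L (lineOf N σ)) =
          cosetK N L (lineOf N σ) X} := fun i => ⟨classW hN σ D i, hmem i i.2⟩
    have hF : Function.Bijective F := by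
      constructor
      · intro i j h
        exact Subtype.ext (classW_injective hN hD (congrArg Subtype.val h))
      · rintro ⟨w, hwX⟩
        obtain ⟨⟨Y, hY⟩, hYc, rfl⟩ := (mem_cosetK_iff hL X hX w).mp hwX
        obtain ⟨a, b, c, rfl⟩ := exists_act_vec σ Y
        obtain rfl := (mem_perp_lineOf N hN σ _ _ _).mp hY
        obtain ⟨⟨i, rfl⟩, -, -⟩ := hden a b 0 hYc.1
        exact ⟨⟨i, b, by simpa using hYc⟩, Subtype.ext (mk_eq_classW hN i b hY).symm⟩
    rw [← (Equiv.ofBijective F hF).tsum_eq,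
      ← tsum_subtype_eq_of_support_subset (s := {i : ℤ | IsIndex N L σ d D (i, 0)})]
    · refine tsum_congr fun i => ?_
      have hi : IsIndex N L σ d D (i, 0) := i.2
      rw [hw, if_pos hi, one_mul]
      change Complex.exp (2 * π * Complex.I * ((quadW N (lineOf N σ) (classW hN σ D i) : ℚ) : ℂ) * τ) = _
      rw [quadW_classW]
      push_cast
      congr 1
      ring
    · intro i hi
      by_contra h
      exact hi (by beta_reduce; rw [hw, if_neg (show ¬ IsIndex N L σ d D (i, 0) from h), zero_mul])
  · rw [tildeTheta, dif_neg hex]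
    refine (tsum_congr fun i => ?_).trans tsum_zero |>.symm
    rw [hw, if_neg, zero_mul]
    rintro ⟨b, hb⟩
    rw [Int.cast_zero, zero_div] at hb
    exact hex ⟨⟨_, (mem_perp_lineOf N hN σ _ _ _).mpr rfl⟩, hb⟩

end

/-- The theta function at a cusp is a theta series in the variable of the cusp, whose constant
term is the theta function of the lattice `K_ℓ`. -/
theorem exists_thetaSeries {N : ℕ} (hN : 0 < N) {L : AddSubgroup V} (hL : IsEvenLattice N L)
    (σ : SL(2, ℤ)) (d : Disc N L) : 0 < cuspBeta L σ ∧ ∃ (δ : ℝ) (w : ℤ × ℤ × ℤ → ℂ), 0 < δ ∧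
      (∀ m, ‖w m‖ ≤ 1) ∧
      (∀ τ z : ℍ, theta N L d τ (σ • z) =
        1 / (cuspBeta L σ * √N) * thetaSeries N δ (cuspBeta L σ) w τ z) ∧
      ∀ τ : ℍ, tildeTheta N L (lineOf N σ) d τ = thetaConst N δ (cuspBeta L σ) w τ := by
  obtain ⟨D, hD, hden⟩ := exists_denominator hN hL σ
  obtain ⟨q, hq0, hqβ, hq⟩ := exists_cuspBeta hN hL σ
  rw [← hqβ]
  exact ⟨by exact_mod_cast hq0, D, cuspWeight N L σ d D q, Nat.cast_pos.mpr hD, norm_cuspWeight_le,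
    fun τ z => theta_eq_thetaSeries hL hq hN hD hq0 hden τ z,
    fun τ => tildeTheta_eq_thetaConst hL hN hD hden τ⟩

end ThetaLift

end

noncomputable section

namespace ThetaLift

/-! ### Tiles of a fundamental domain -/

section

open ModularGroup

variable {N : ℕ} {Γ : Subgroup SL(2, ℤ)}

/-- The subgroup `± Γ`. -/
def signed (Γ : Subgroup SL(2, ℤ)) : Subgroup SL(2, ℤ) where
  carrier := {g | g ∈ Γ ∨ -g ∈ Γ}
  one_mem' := Or.inl Γ.one_mem
  mul_mem' := by
    rintro a b (ha | ha) (hb | hb)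
    · exact Or.inl (Γ.mul_mem ha hb)
    · exact Or.inr (by simpa using Γ.mul_mem ha hb)
    · exact Or.inr (by simpa using Γ.mul_mem ha hb)
    · exact Or.inl (by simpa using Γ.mul_mem ha hb)
  inv_mem' := by
    rintro a (ha | ha)
    · exact Or.inl (Γ.inv_mem ha)
    · exact Or.inr (by simpa using Γ.inv_mem ha)

lemma le_signed : Γ ≤ signed Γ := fun _ h => Or.inl h

lemma neg_mem_signed {g : SL(2, ℤ)} (h : g ∈ signed Γ) : -g ∈ signed Γ := by
  rcases h with h | h
  · exact Or.inr (by simpa using h)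
  · exact Or.inl h

/-- A congruence subgroup has finite index, so some positive power of `σ T σ⁻¹` lies in `Γ` and the
infimum defining the width is attained. -/
lemma cuspWidth_mem (hΓ : CongruenceSubgroup.IsCongruenceSubgroup Γ) (σ : SL(2, ℤ)) :
    0 < cuspWidth Γ σ ∧ σ * T ^ cuspWidth Γ σ * σ⁻¹ ∈ signed Γ := by
  have := hΓ.finiteIndex
  have h : {a : ℕ | 0 < a ∧ (σ * T ^ a * σ⁻¹ ∈ Γ ∨ -(σ * T ^ a * σ⁻¹) ∈ Γ)}.Nonempty := by
    obtain ⟨n, hn, -, hm⟩ := Subgroup.exists_pow_mem_of_index_ne_zero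
      (H := Γ) this.index_ne_zero (σ * T * σ⁻¹)
    exact ⟨n, hn, Or.inl (by rwa [conj_pow] at hm)⟩
  exact Nat.sInf_mem h

lemma cuspWidth_dvd (hΓ : CongruenceSubgroup.IsCongruenceSubgroup Γ) (σ : SL(2, ℤ)) (m : ℤ) :
    σ * T ^ ((cuspWidth Γ σ : ℤ) * m) * σ⁻¹ ∈ signed Γ := by
  have h := (signed Γ).zpow_mem (cuspWidth_mem hΓ σ).2 m
  rwa [conj_zpow, ← zpow_natCast, ← zpow_mul] at h

lemma eq_zero_of_lt_cuspWidth {σ : SL(2, ℤ)} {a : ℕ} (ha : a < cuspWidth Γ σ)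
    (h : σ * T ^ a * σ⁻¹ ∈ signed Γ) : a = 0 := by
  by_contra h0
  exact ha.not_ge (Nat.sInf_le ⟨Nat.pos_of_ne_zero h0, h⟩)

lemma act_T_u₀ (n : ℤ) : act (T ^ n) u₀ = u₀ := by
  apply V.ext
  rw [coe_act, u₀_mat, ← zpow_neg]
  ext i j
  fin_cases i <;> fin_cases j <;>
    simp [toRat, coe_T_zpow, Matrix.mul_apply, Fin.sum_univ_two]

lemma lineOf_mul_T (σ : SL(2, ℤ)) (n : ℤ) : lineOf N (σ * T ^ n) = lineOf N σ := by
  apply Subtype.ext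
  simp only [lineOf, act_mul, LinearMap.comp_apply, act_T_u₀]

lemma cuspBeta_mul_T (L : AddSubgroup V) (σ : SL(2, ℤ)) (n : ℤ) :
    cuspBeta L (σ * T ^ n) = cuspBeta L σ := by
  simp only [cuspBeta, act_mul, LinearMap.comp_apply, act_T_u₀]

lemma map_lineOf (γ σ : SL(2, ℤ)) :
    (lineOf N σ).1.map (act γ) = (lineOf N (γ * σ)).1 := by
  simp only [lineOf, Submodule.map_span, Set.image_singleton, act_mul, LinearMap.comp_apply]

lemma eq_T_zpow_of_c_eq_zero {g : SL(2, ℤ)} (hc : g 1 0 = 0) : ∃ n : ℤ, g = T ^ n ∨ g = -T ^ n := by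
  have had := g.det_coe
  replace had : g 0 0 * g 1 1 = 1 := by rw [Matrix.det_fin_two, hc] at had; lia
  rcases Int.eq_one_or_neg_one_of_mul_eq_one' had with ⟨ha, hd⟩ | ⟨ha, hd⟩
  · refine ⟨g 0 1, Or.inl ?_⟩
    ext i j
    fin_cases i <;> fin_cases j <;> simp [ha, hc, hd, coe_T_zpow]
  · refine ⟨-g 0 1, Or.inr ?_⟩
    ext i j
    fin_cases i <;> fin_cases j <;> simp [ha, hc, hd, coe_T_zpow]

/-- `h⁻¹ g` preserves `ℓ₀`, so it is an upper triangular integral matrix of determinant one. -/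
lemma eq_of_lineOf_eq {g h : SL(2, ℤ)} (e : lineOf N g = lineOf N h) :
    ∃ n : ℤ, g = h * T ^ n ∨ g = -(h * T ^ n) := by
  have h1 : act g u₀ ∈ (lineOf N h).1 := by
    rw [← e]
    exact Submodule.mem_span_singleton_self _
  obtain ⟨c, hc⟩ := Submodule.mem_span_singleton.mp h1
  have h2 : act (h⁻¹ * g) u₀ = c • u₀ := by
    rw [act_mul, LinearMap.comp_apply, ← hc, map_smul, ← LinearMap.comp_apply, ← act_mul,
      inv_mul_cancel, act_one, LinearMap.id_apply]
  have h4 : (h⁻¹ * g) 1 0 = 0 := by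
    generalize h⁻¹ * g = k at h2 ⊢
    have h3 := congrArg (fun X : V => X.mat 1 0) h2
    simpa [coe_act, u₀_mat, toRat, Matrix.mul_apply, Fin.sum_univ_two,
      Matrix.SpecialLinearGroup.coe_inv, Matrix.adjugate_fin_two] using h3
  obtain ⟨n, hn | hn⟩ := eq_T_zpow_of_c_eq_zero h4
  · exact ⟨n, Or.inl (by rw [← hn, mul_inv_cancel_left])⟩
  · exact ⟨n, Or.inr (by rw [← mul_neg, ← hn, mul_inv_cancel_left])⟩

variable (N Γ) in
/-- The tiles: for each cusp, as many as its width. -/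
abbrev Tile (σ : Cusp N Γ → SL(2, ℤ)) : Type := (c : Cusp N Γ) × Fin (cuspWidth Γ (σ c))

/-- The matrix which maps the standard fundamental domain to a tile. -/
def tileMat (σ : Cusp N Γ → SL(2, ℤ)) (i : Tile N Γ σ) : SL(2, ℤ) := σ i.1 * T ^ (i.2 : ℤ)

/-- The tile matrices represent `±Γ \ SL(2, ℤ)`; inverses are taken to pass to left cosets. Two
tiles in one coset have equivalent lines, hence the same cusp, and their exponents differ by less
than the width, hence not at all. -/
lemma tile_bijective (hΓ : CongruenceSubgroup.IsCongruenceSubgroup Γ) (σ : Cusp N Γ → SL(2, ℤ))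
    (hσ : ∀ c, (Quotient.mk (cuspSetoid N Γ) (lineOf N (σ c)) : Cusp N Γ) = c) :
    Function.Bijective fun i : Tile N Γ σ => (((tileMat σ i)⁻¹ : SL(2, ℤ)) : SL(2, ℤ) ⧸ signed Γ) := by
  constructor
  · rintro ⟨c, j⟩ ⟨c', j'⟩ h
    replace h := QuotientGroup.eq.mp h
    rw [inv_inv] at h
    simp only [tileMat] at h
    obtain rfl : c = c' := by
      rw [← hσ c, ← hσ c']
      refine (Quotient.sound ?_ : Quotient.mk (cuspSetoid N Γ) _ = Quotient.mk _ _).symm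
      have e : ∀ γ, γ = σ c * T ^ (j : ℤ) * (σ c' * T ^ (j' : ℤ))⁻¹ →
          (lineOf N (σ c')).1.map (act γ) = (lineOf N (σ c)).1 := by
        rintro _ rfl
        rw [← lineOf_mul_T (σ c') (j' : ℤ), map_lineOf, inv_mul_cancel_right, lineOf_mul_T]
      rcases h with h | h
      · exact ⟨_, h, e _ rfl⟩
      · refine ⟨_, h, ?_⟩
        rw [neg_act]
        exact e _ rfl
    have key : ∀ a b : ℕ, b ≤ a → a < cuspWidth Γ (σ c) →
        σ c * T ^ (a : ℤ) * (σ c * T ^ (b : ℤ))⁻¹ ∈ signed Γ → a = b := by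
      intro a b hab ha hm
      have e : σ c * T ^ (a : ℤ) * (σ c * T ^ (b : ℤ))⁻¹ = σ c * T ^ (a - b) * (σ c)⁻¹ := by
        rw [← zpow_natCast T (a - b), Nat.cast_sub hab, zpow_sub]
        group
      rw [e] at hm
      have := eq_zero_of_lt_cuspWidth (by lia) hm
      lia
    have : (j : ℕ) = j' := by
      rcases le_total (j' : ℕ) j with h' | h'
      · exact key _ _ h' j.2 h
      · refine (key _ _ h' j'.2 ?_).symm
        simpa using (signed Γ).inv_mem h
    rw [Fin.ext this]
  · intro q
    obtain ⟨g, rfl⟩ := QuotientGroup.mk_surjective q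
    -- The line of `g⁻¹` is `Γ`-equivalent to the chosen line of its cusp, so `g⁻¹ = ± γ σ_c T^n`.
    -- The width translation is in `±Γ` after conjugation by `σ_c`, so `n` may be reduced modulo the
    -- width.
    obtain ⟨γ, hγ, e⟩ := Quotient.exact (hσ (Quotient.mk (cuspSetoid N Γ) (lineOf N g⁻¹)))
    set c : Cusp N Γ := Quotient.mk (cuspSetoid N Γ) (lineOf N g⁻¹)
    rw [map_lineOf] at e
    obtain ⟨n, hn⟩ := eq_of_lineOf_eq (Subtype.ext e.symm)
    have hα := (cuspWidth_mem hΓ (σ c)).1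
    set α := cuspWidth Γ (σ c)
    have hlt : n % (α : ℤ) < α := Int.emod_lt_of_pos _ (by exact_mod_cast hα)
    have hnn : 0 ≤ n % (α : ℤ) := Int.emod_nonneg _ (by exact_mod_cast hα.ne')
    refine ⟨⟨c, ⟨(n % (α : ℤ)).toNat, by omega⟩⟩, QuotientGroup.eq.mpr ?_⟩
    rw [inv_inv]
    simp only [tileMat, Int.toNat_of_nonneg hnn]
    have h1 : σ c * T ^ (α * (-(n / α))) * (σ c)⁻¹ * γ⁻¹ ∈ signed Γ :=
      (signed Γ).mul_mem (cuspWidth_dvd hΓ _ _) (le_signed (Γ.inv_mem hγ))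
    have h2 : T ^ (α * (-(n / α))) = T ^ (n % (α : ℤ)) * (T ^ n)⁻¹ := by
      rw [← zpow_neg, ← zpow_add]
      congr 1
      have := Int.emod_add_mul_ediv n α
      lia
    rw [h2] at h1
    have e2 : ∀ g', g'⁻¹ = γ * σ c * T ^ n →
        σ c * T ^ (n % (α : ℤ)) * g' = σ c * (T ^ (n % (α : ℤ)) * (T ^ n)⁻¹) * (σ c)⁻¹ * γ⁻¹ := by
      intro g' hg'
      rw [← inv_inv g', hg']
      group
    rcases hn with hn | hn
    · rw [e2 g hn]
      exact h1
    · have h3 := neg_mem_signed h1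
      have h4 : (-g)⁻¹ = γ * σ c * T ^ n := by
        rw [inv_eq_iff_mul_eq_one, neg_mul, ← mul_neg, ← hn, mul_inv_cancel]
      rw [← e2 _ h4, mul_neg, neg_neg] at h3
      exact h3

lemma tile_finite (hΓ : CongruenceSubgroup.IsCongruenceSubgroup Γ) (σ : Cusp N Γ → SL(2, ℤ))
    (hσ : ∀ c, (Quotient.mk (cuspSetoid N Γ) (lineOf N (σ c)) : Cusp N Γ) = c) :
    Finite (Tile N Γ σ) ∧ Finite (Cusp N Γ) := by
  have h0 := hΓ.finiteIndex
  have h1 := Subgroup.finiteIndex_of_le (le_signed (Γ := Γ))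
  have h2 : Finite (Tile N Γ σ) := Finite.of_injective _ (tile_bijective hΓ σ hσ).1
  exact ⟨h2, Finite.of_surjective (fun i : Tile N Γ σ => i.1)
    fun c => ⟨⟨c, ⟨0, (cuspWidth_mem hΓ _).1⟩⟩, rfl⟩⟩

/-- The sum over the tiles of a function which is invariant under `± Γ` does not change under
right translation. -/
theorem sum_tile_mul {E : Type*} [AddCommMonoid E] (hΓ : CongruenceSubgroup.IsCongruenceSubgroup Γ)
    (σ : Cusp N Γ → SL(2, ℤ))
    (hσ : ∀ c, (Quotient.mk (cuspSetoid N Γ) (lineOf N (σ c)) : Cusp N Γ) = c)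
    [Fintype (Tile N Γ σ)] {Ψ : SL(2, ℤ) → E} (hΨ : ∀ γ ∈ Γ, ∀ g, Ψ (γ * g) = Ψ g)
    (hneg : ∀ g, Ψ (-g) = Ψ g) (h : SL(2, ℤ)) :
    ∑ i, Ψ (tileMat σ i * h) = ∑ i, Ψ (tileMat σ i) := by
  have hs : ∀ γ ∈ signed Γ, ∀ g, Ψ (γ * g) = Ψ g := by
    rintro γ (hγ | hγ) g
    · exact hΨ γ hγ g
    · rw [← hneg, ← neg_mul, hΨ _ hγ]
  let Φ : SL(2, ℤ) ⧸ signed Γ → E := Quotient.lift (fun g => Ψ g⁻¹) (by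
    intro a b hab
    have := QuotientGroup.leftRel_apply.mp hab
    change Ψ a⁻¹ = Ψ b⁻¹
    rw [← hs _ this b⁻¹, mul_inv_cancel_right])
  have hΦ : ∀ g, Φ (g⁻¹ : SL(2, ℤ)) = Ψ g := fun g => by
    change Ψ (g⁻¹)⁻¹ = _
    rw [inv_inv]
  let e := Equiv.ofBijective _ (tile_bijective hΓ σ hσ)
  -- After inversion, right translation of the tiles by `h` is left multiplication of cosets by
  -- `h⁻¹`, which is a permutation.
  let p : Equiv.Perm (SL(2, ℤ) ⧸ signed Γ) := MulAction.toPerm h⁻¹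
  have h1 : ∀ i, Ψ (tileMat σ i) = Φ (e i) := fun i => (hΦ _).symm
  have h2 : ∀ i, Ψ (tileMat σ i * h) = Φ (e ((e.symm.permCongr p) i)) := by
    intro i
    rw [Equiv.permCongr_apply, Equiv.apply_symm_apply, Equiv.symm_symm, ← hΦ, mul_inv_rev]
    rfl
  rw [Finset.sum_congr rfl fun i _ => h2 i, Finset.sum_congr rfl fun i _ => h1 i]
  exact Equiv.sum_comp (e.symm.permCongr p) fun i => Φ (e i)

end

end ThetaLift

end

noncomputable section

namespace ThetaLift

/-! ### Conformal invariance of the Laplacian -/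

section

variable {F φ : ℂ → ℂ} {U W : Set ℂ}

lemma lineDeriv_eq_fderiv (hU : IsOpen U) (hF : ContDiffOn ℝ ∞ F U) (e : ℂ) :
    Set.EqOn (fun z => lineDeriv ℝ F z e) (fun z => fderiv ℝ F z e) U := fun _ hz =>
  ((hF.differentiableOn (by simp)).differentiableAt (hU.mem_nhds hz)).lineDeriv_eq_fderiv

lemma contDiffOn_fderiv (hU : IsOpen U) (hF : ContDiffOn ℝ ∞ F U) :
    ContDiffOn ℝ ∞ (fderiv ℝ F) U := hF.fderiv_of_isOpen hU (by simp)

lemma contDiffOn_dRe (hU : IsOpen U) (hF : ContDiffOn ℝ ∞ F U) : ContDiffOn ℝ ∞ (dRe F) U :=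
  ((contDiffOn_fderiv hU hF).clm_apply contDiffOn_const).congr (lineDeriv_eq_fderiv hU hF 1)

lemma contDiffOn_dIm (hU : IsOpen U) (hF : ContDiffOn ℝ ∞ F U) : ContDiffOn ℝ ∞ (dIm F) U :=
  ((contDiffOn_fderiv hU hF).clm_apply contDiffOn_const).congr (lineDeriv_eq_fderiv hU hF Complex.I)

/-- The second derivative of a composition with a holomorphic function along a line. -/
lemma lineDeriv_lineDeriv_comp (hU : IsOpen U) (hW : IsOpen W) (hF : ContDiffOn ℝ ∞ F W)
    (hφ : DifferentiableOn ℂ φ U) (hm : Set.MapsTo φ U W) (e : ℂ) {z : ℂ} (hz : z ∈ U) :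
    lineDeriv ℝ (fun w => lineDeriv ℝ (F ∘ φ) w e) z e =
      fderiv ℝ (fderiv ℝ F) (φ z) (deriv φ z * e) (deriv φ z * e) +
        fderiv ℝ F (φ z) (deriv (deriv φ) z * e * e) := by
  have hφd : ∀ w ∈ U, HasDerivAt φ (deriv φ w) w := fun w hw =>
    (hφ.differentiableAt (hU.mem_nhds hw)).hasDerivAt
  have hφ' : HasDerivAt (deriv φ) (deriv (deriv φ) z) z :=
    ((hφ.deriv hU).differentiableAt (hU.mem_nhds hz)).hasDerivAt
  have hFd : ∀ w ∈ W, HasFDerivAt F (fderiv ℝ F w) w := fun w hw =>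
    ((hF.differentiableOn (by simp)).differentiableAt (hW.mem_nhds hw)).hasFDerivAt
  have hF' : HasFDerivAt (fderiv ℝ F) (fderiv ℝ (fderiv ℝ F) (φ z)) (φ z) :=
    (((contDiffOn_fderiv hW hF).differentiableOn (by simp)).differentiableAt
      (hW.mem_nhds (hm hz))).hasFDerivAt
  have h1 : Set.EqOn (fun w => lineDeriv ℝ (F ∘ φ) w e)
      (fun w => fderiv ℝ F (φ w) (deriv φ w * e)) U := by
    intro w hw
    have h := (hFd _ (hm hw)).comp w ((hφd w hw).hasFDerivAt.restrictScalars ℝ)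
    refine (h.hasLineDerivAt e).lineDeriv.trans ?_
    simp [mul_comm]
  refine (lineDeriv_congr_of_eqOn hU h1 e hz).trans ?_
  have hc := (hφd z hz).hasFDerivAt.restrictScalars ℝ
  have h2 := (hF'.comp z hc).clm_apply ((hφ'.mul_const e).hasFDerivAt.restrictScalars ℝ)
  refine (h2.hasLineDerivAt e).lineDeriv.trans ?_
  simp [mul_comm, add_comm]

/-- With `p = φ'(z)`, the second derivative of `F` is evaluated on the pairs `(p, p)` and `(p i, p
i)`. The mixed terms cancel and the rest is `|p|²` times the trace; the terms with `φ''` cancel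
because `i² = -1`. -/
theorem laplacian_comp (hU : IsOpen U) (hW : IsOpen W) (hF : ContDiffOn ℝ ∞ F W)
    (hφ : DifferentiableOn ℂ φ U) (hm : Set.MapsTo φ U W) {z : ℂ} (hz : z ∈ U) :
    dRe (dRe (F ∘ φ)) z + dIm (dIm (F ∘ φ)) z =
      (‖deriv φ z‖ : ℂ) ^ 2 * (dRe (dRe F) (φ z) + dIm (dIm F) (φ z)) := by
  have h1 := lineDeriv_lineDeriv_comp hU hW hF hφ hm 1 hz
  have h2 := lineDeriv_lineDeriv_comp hU hW hF hφ hm Complex.I hz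
  have h3 := lineDeriv_lineDeriv_comp hW hW hF differentiableOn_id (Set.mapsTo_id W) 1 (hm hz)
  have h4 := lineDeriv_lineDeriv_comp hW hW hF differentiableOn_id (Set.mapsTo_id W) Complex.I (hm hz)
  simp only [Function.comp_id, deriv_id', id_eq, one_mul, deriv_const, zero_mul, map_zero,
    add_zero] at h3 h4
  unfold dRe dIm
  rw [h1, h2, h3, h4]
  set B := fderiv ℝ (fderiv ℝ F) (φ z)
  set p := deriv φ z
  have e1 : p * 1 = p.re • (1 : ℂ) + p.im • Complex.I := by
    simp [Complex.re_add_im]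
  have e2 : p * Complex.I = (-p.im) • (1 : ℂ) + p.re • Complex.I := by
    conv_lhs => rw [← Complex.re_add_im p]
    simp only [Complex.real_smul, Complex.ofReal_neg]
    linear_combination (p.im : ℂ) * Complex.I_mul_I
  have e3 : deriv (deriv φ) z * Complex.I * Complex.I = -(deriv (deriv φ) z * 1 * 1) := by
    linear_combination deriv (deriv φ) z * Complex.I_mul_I
  have e4 : (‖p‖ : ℂ) ^ 2 = (p.re : ℂ) ^ 2 + (p.im : ℂ) ^ 2 := by
    rw [← Complex.ofReal_pow, Complex.sq_norm, Complex.normSq_apply]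
    push_cast
    ring
  rw [e3, map_neg, e1, e2, e4]
  simp only [map_add, map_smul, add_apply, smul_apply]
  simp only [Complex.real_smul]
  push_cast
  ring

end

/-! ### Translates of functions on the upper half plane -/

section

open UpperHalfPlane

/-- The action of `g` on the upper half plane as a map on `ℂ`. -/
def mobius (g : SL(2, ℤ)) (z : ℂ) : ℂ := ((g • ofComplex z : ℍ) : ℂ)

lemma mobius_im_pos (g : SL(2, ℤ)) (z : ℂ) : 0 < (mobius g z).im := (g • ofComplex z).im_pos

lemma hasDerivAt_mobius (g : SL(2, ℤ)) {z : ℂ} (hz : 0 < z.im) :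
    HasDerivAt (mobius g) (1 / denom (g : GL (Fin 2) ℝ) z ^ 2) z := by
  have hd : (g : GL (Fin 2) ℝ).val.det = 1 :=
    (Matrix.SpecialLinearGroup.map (Int.castRingHom ℝ) g).det_coe
  have h := (hasStrictDerivAt_smul (g := (g : GL (Fin 2) ℝ)) (by rw [hd]; exact one_pos)
    ⟨z, hz⟩).hasDerivAt
  rw [hd, Complex.ofReal_one] at h
  exact h

lemma differentiableOn_mobius (g : SL(2, ℤ)) : DifferentiableOn ℂ (mobius g) {z | 0 < z.im} :=
  fun _ hz => (hasDerivAt_mobius g hz).differentiableAt.differentiableWithinAt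

lemma contDiffOn_mobius (g : SL(2, ℤ)) : ContDiffOn ℝ ∞ (mobius g) {z | 0 < z.im} :=
  ((differentiableOn_mobius g).contDiffOn isOpen_im_pos).restrict_scalars ℝ

/-- The factor `|g'|` here, squared, is the one in `laplacian_comp`; together they make `-y² (∂_x² +
∂_y²)` invariant. -/
lemma im_mobius (g : SL(2, ℤ)) {z : ℂ} (hz : 0 < z.im) :
    (mobius g z).im = z.im * ‖deriv (mobius g) z‖ := by
  have h := ModularGroup.im_smul_eq_div_normSq g ⟨z, hz⟩
  rw [(hasDerivAt_mobius g hz).deriv, mobius, ofComplex_apply_of_im_pos hz]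
  refine h.trans ?_
  rw [norm_div, norm_one, norm_pow, Complex.sq_norm, mul_one_div]
  rfl

/-- The translate of a function on the upper half plane, extended to `ℂ`. -/
def translate (f : ℍ → ℂ) (g : SL(2, ℤ)) (z : ℂ) : ℂ := f (g • ofComplex z)

lemma translate_eq (f : ℍ → ℂ) (g : SL(2, ℤ)) : translate f g = (f ∘ ofComplex) ∘ mobius g := by
  ext z
  simp [translate, mobius]

lemma translate_coe (f : ℍ → ℂ) (g : SL(2, ℤ)) (z : ℍ) : translate f g z = f (g • z) := by
  simp [translate]

lemma contDiffOn_translate {f : ℍ → ℂ} (hf : IsSmooth f) (g : SL(2, ℤ)) :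
    ContDiffOn ℝ ∞ (translate f g) {z | 0 < z.im} := by
  rw [translate_eq]
  exact ContDiffOn.comp hf (contDiffOn_mobius g) fun z _ => mobius_im_pos g z

lemma lap_translate {f : ℍ → ℂ} (hf : IsSmooth f) (g : SL(2, ℤ)) {z : ℂ} (hz : 0 < z.im) :
    lap 0 (translate f g) z = hypLaplacian 0 f (g • ofComplex z) := by
  rw [hypLaplacian_eq_lap, translate_eq, lap, lap, laplacian_comp isOpen_im_pos isOpen_im_pos hf
    (differentiableOn_mobius g) (fun z _ => mobius_im_pos g z) hz]
  have h := im_mobius g hz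
  rw [mobius] at h
  rw [h, mobius]
  push_cast
  ring

lemma translate_mul_T (f : ℍ → ℂ) (g : SL(2, ℤ)) (n : ℤ) {z : ℂ} (hz : 0 < z.im) :
    translate f (g * ModularGroup.T ^ n) z = translate f g (z + n) := by
  have hz' : 0 < (z + n).im := by simpa using hz
  rw [translate, translate, mul_smul]
  congr 2
  rw [ofComplex_apply_of_im_pos hz, ofComplex_apply_of_im_pos hz', modular_T_zpow_smul]
  ext1
  simp [add_comm]

lemma translate_mul_S (f : ℍ → ℂ) (g : SL(2, ℤ)) {z : ℂ} (hz : 0 < z.im) :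
    translate f (g * ModularGroup.S) z = translate f g (-z)⁻¹ := by
  have hz' : 0 < ((-z)⁻¹).im := (⟨z, hz⟩ : ℍ).im_inv_neg_coe_pos
  rw [translate, translate, mul_smul]
  congr 2
  rw [ofComplex_apply_of_im_pos hz, ofComplex_apply_of_im_pos hz', modular_S_smul]

lemma translate_neg (f : ℍ → ℂ) (g : SL(2, ℤ)) : translate f (-g) = translate f g := by
  ext z
  rw [translate, translate, ModularGroup.SL_neg_smul]

lemma translate_mul {f : ℍ → ℂ} {γ : SL(2, ℤ)} (h : ∀ z, f (γ • z) = f z) (g : SL(2, ℤ)) :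
    translate f (γ * g) = translate f g := by
  ext z
  rw [translate, translate, mul_smul, h]

variable {N : ℕ} {L : AddSubgroup V} {Γ : Subgroup SL(2, ℤ)}

/-- `Γ` acts trivially on `L' / L`, so it permutes each coset, and the Gaussian is equivariant. -/
theorem theta_smul (h : ActsTriviallyOnDisc N L Γ) (d : Disc N L) (τ z : ℍ) {γ : SL(2, ℤ)}
    (hγ : γ ∈ Γ) : theta N L d τ (γ • z) = theta N L d τ z := by
  have key : ∀ γ ∈ Γ, ∀ X ∈ coset N L d, act γ X ∈ coset N L d := by
    rintro γ hγ X ⟨hX, rfl⟩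
    have h1 := h.sub_mem γ hγ X hX
    have h2 : act γ X ∈ dual N L := by
      intro Y hY
      have h3 : act γ⁻¹ Y ∈ L := by
        rw [← h.map_eq γ⁻¹ (Γ.inv_mem hγ)]
        exact ⟨Y, hY, rfl⟩
      obtain ⟨n, hn⟩ := hX _ h3
      exact ⟨n, by rw [← hn, ← bil_act N γ X, act_act_inv]⟩
    refine ⟨h2, (QuotientAddGroup.eq.mpr ?_).symm⟩
    rw [AddSubgroup.mem_addSubgroupOf]
    simpa [← sub_eq_neg_add] using h1
  let e : coset N L d ≃ coset N L d :=
    { toFun := fun X => ⟨act γ X, key γ hγ X X.2⟩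
      invFun := fun X => ⟨act γ⁻¹ X, key _ (Γ.inv_mem hγ) X X.2⟩
      left_inv := fun X => Subtype.ext (act_inv_act γ X)
      right_inv := fun X => Subtype.ext (act_act_inv γ X) }
  rw [theta, ← e.tsum_eq]
  exact tsum_congr fun X => phi0_act N γ X τ z

end

end ThetaLift

end

noncomputable section

namespace ThetaLift

/-! ### Green's formula on the truncated fundamental domain -/

section

/-- The height of the unit circle over `x`. -/
def arc (x : ℝ) : ℝ := √(1 - x ^ 2)

lemma arc_pos {x : ℝ} (hx : x ^ 2 < 1) : 0 < arc x := Real.sqrt_pos.mpr (by linarith)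

lemma arc_le_one (x : ℝ) : arc x ≤ 1 := Real.sqrt_le_one.mpr (by nlinarith [sq_nonneg x])

lemma arc_neg (x : ℝ) : arc (-x) = arc x := by simp [arc]

lemma arc_sq {x : ℝ} (hx : x ^ 2 ≤ 1) : arc x ^ 2 = 1 - x ^ 2 := Real.sq_sqrt (by linarith)

lemma hasDerivAt_arc {x : ℝ} (hx : x ^ 2 < 1) : HasDerivAt arc (-x / arc x) x := by
  have h : HasDerivAt (fun x : ℝ => 1 - x ^ 2) (-(2 * x)) x := by
    simpa using (hasDerivAt_pow 2 x).const_sub 1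
  refine (h.sqrt (by linarith)).congr_deriv ?_
  have := (arc_pos hx).ne'
  change -(2 * x) / (2 * arc x) = -x / arc x
  field_simp

lemma contDiffOn_arc : ContDiffOn ℝ ∞ arc {x | x ^ 2 < 1} :=
  ContDiffOn.sqrt (by fun_prop) fun x hx => by
    have : x ^ 2 < 1 := hx
    linarith

lemma sq_lt_one_of_mem {x : ℝ} (hx : x ∈ Set.Icc (-1 / 2 : ℝ) (1 / 2)) : x ^ 2 < 1 := by
  nlinarith [hx.1, hx.2]

variable {P Q : ℂ → ℂ} {T : ℝ}

lemma hasDerivAt_comp_curve (hP : ContDiffOn ℝ ∞ P {z : ℂ | 0 < z.im}) {a b : ℝ → ℝ} {a' b' t : ℝ}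
    (ha : HasDerivAt a a' t) (hb : HasDerivAt b b' t) (h : 0 < b t) :
    HasDerivAt (fun t => P ⟨a t, b t⟩) (a' * dRe P ⟨a t, b t⟩ + b' * dIm P ⟨a t, b t⟩) t := by
  have h0 : HasDerivAt (fun t => (⟨a t, b t⟩ : ℂ)) ⟨a', b'⟩ t := by
    simp only [Complex.mk_eq_add_mul_I]
    exact ha.ofReal_comp.add (hb.ofReal_comp.mul_const _)
  have h1 : HasFDerivAt P (fderiv ℝ P ⟨a t, b t⟩) ⟨a t, b t⟩ :=
    ((hP.differentiableOn (by simp)).differentiableAt (isOpen_im_pos.mem_nhds h)).hasFDerivAt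
  refine (h1.comp_hasDerivAt t h0).congr_deriv ?_
  have e : (⟨a', b'⟩ : ℂ) = a' • (1 : ℂ) + b' • Complex.I := by
    simp [Complex.mk_eq_add_mul_I]
  rw [e, map_add, map_smul, map_smul, Complex.real_smul, Complex.real_smul]
  congr 2
  · exact (lineDeriv_eq_fderiv isOpen_im_pos hP 1 h).symm
  · exact (lineDeriv_eq_fderiv isOpen_im_pos hP Complex.I h).symm

/-- The domain of the coordinates which straighten the unit circle. -/
def arcDomain (T : ℝ) : Set (ℝ × ℝ) := {p | p.1 ^ 2 < 1 ∧ 0 < arc p.1 + p.2 * (T - arc p.1)}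

/-- The map which straightens the unit circle. -/
def arcMap (T : ℝ) (p : ℝ × ℝ) : ℂ := ⟨p.1, arc p.1 + p.2 * (T - arc p.1)⟩

lemma continuous_arc : Continuous arc := by unfold arc; fun_prop

lemma isOpen_arcDomain (T : ℝ) : IsOpen (arcDomain T) := by
  have := continuous_arc
  have h1 : Continuous fun p : ℝ × ℝ => p.1 ^ 2 := by fun_prop
  have h2 : Continuous fun p : ℝ × ℝ => arc p.1 + p.2 * (T - arc p.1) := by fun_prop
  exact (isOpen_lt h1 continuous_const).inter (isOpen_lt continuous_const h2)

lemma contDiffOn_arc_fst : ContDiffOn ℝ ∞ (fun p : ℝ × ℝ => arc p.1) (arcDomain T) :=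
  contDiffOn_arc.comp contDiff_fst.contDiffOn fun _ hp => hp.1

lemma contDiffOn_arcMap : ContDiffOn ℝ ∞ (arcMap T) (arcDomain T) := by
  have h := contDiffOn_arc_fst (T := T)
  have h1 : ContDiffOn ℝ ∞ (fun p : ℝ × ℝ => (p.1, arc p.1 + p.2 * (T - arc p.1))) (arcDomain T) :=
    contDiff_fst.contDiffOn.prodMk
      (h.add (contDiff_snd.contDiffOn.mul (contDiffOn_const.sub h)))
  exact Complex.equivRealProdCLM.symm.contDiff.comp_contDiffOn h1

lemma contDiffOn_comp_arcMap (hP : ContDiffOn ℝ ∞ P {z : ℂ | 0 < z.im}) :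
    ContDiffOn ℝ ∞ (fun p => P (arcMap T p)) (arcDomain T) :=
  hP.comp contDiffOn_arcMap fun _ hp => hp.2

lemma Icc_prod_subset_arcDomain (hT : 1 ≤ T) :
    Set.Icc (-1 / 2 : ℝ) (1 / 2) ×ˢ Set.Icc (0 : ℝ) 1 ⊆ arcDomain T := by
  rintro ⟨x, t⟩ ⟨hx, ht⟩
  have h := arc_pos (sq_lt_one_of_mem hx)
  have h1 := arc_le_one x
  refine ⟨sq_lt_one_of_mem hx, ?_⟩
  have : 0 ≤ t * (T - arc x) := mul_nonneg ht.1 (by linarith)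
  exact add_pos_of_pos_of_nonneg h this

lemma integral_straighten (F : ℝ → ℂ) (g : ℝ) :
    ∫ t in (0 : ℝ)..1, F (g + t * (T - g)) * ((T - g : ℝ) : ℂ) = ∫ y in g..T, F y := by
  have h := intervalIntegral.smul_integral_comp_add_mul (a := 0) (b := 1) F (T - g) g
  simp only [mul_zero, add_zero, mul_one, add_sub_cancel] at h
  rw [← h, intervalIntegral.integral_mul_const, Complex.real_smul, mul_comm]
  simp only [mul_comm]

/-- The coordinates `(x, t)` with `y = arc x + t (T - arc x)` map a rectangle onto the truncated
domain, and the divergence theorem on that rectangle is pulled back. The edge `t = 0` becomes the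
arc and produces the term with `x / arc x`. -/
theorem green_fd (hP : ContDiffOn ℝ ∞ P {z : ℂ | 0 < z.im})
    (hQ : ContDiffOn ℝ ∞ Q {z : ℂ | 0 < z.im}) (hT : 1 ≤ T) :
    ∫ x in (-1 / 2 : ℝ)..(1 / 2), ∫ y in (arc x)..T, (dRe P ⟨x, y⟩ + dIm Q ⟨x, y⟩) =
      (∫ x in (-1 / 2 : ℝ)..(1 / 2), Q ⟨x, T⟩) -
        (∫ x in (-1 / 2 : ℝ)..(1 / 2), (Q ⟨x, arc x⟩ + (x / arc x : ℝ) * P ⟨x, arc x⟩)) +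
      (∫ y in (arc (1 / 2))..T, P ⟨1 / 2, y⟩) - ∫ y in (arc (1 / 2))..T, P ⟨-1 / 2, y⟩ := by
  have hO := isOpen_arcDomain T
  have hsub := Icc_prod_subset_arcDomain hT
  have hg := contDiffOn_arc_fst (T := T)
  -- In these coordinates the form `P dy - Q dx` becomes `f dt - h dx`: the factor of `f` is
  -- `∂y/∂t`, and the extra term of `h` is `-P ∂y/∂x`.
  set f : ℝ × ℝ → ℂ := fun p => P (arcMap T p) * ((T - arc p.1 : ℝ) : ℂ) with hf
  set h : ℝ × ℝ → ℂ := fun p => Q (arcMap T p) +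
    (((1 - p.2) * (p.1 / arc p.1) : ℝ) : ℂ) * P (arcMap T p) with hh
  have hfc : ContDiffOn ℝ ∞ f (arcDomain T) := (contDiffOn_comp_arcMap hP).mul
    (Complex.ofRealCLM.contDiff.comp_contDiffOn (contDiffOn_const.sub hg))
  have hhc : ContDiffOn ℝ ∞ h (arcDomain T) := by
    refine (contDiffOn_comp_arcMap hQ).add (ContDiffOn.mul ?_ (contDiffOn_comp_arcMap hP))
    refine Complex.ofRealCLM.contDiff.comp_contDiffOn (ContDiffOn.mul (by fun_prop) ?_)
    exact contDiff_fst.contDiffOn.div hg fun p hp => (arc_pos hp.1).ne'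
  have hd : ∀ p ∈ arcDomain T, fderiv ℝ f p (1, 0) + fderiv ℝ h p (0, 1) =
      (dRe P (arcMap T p) + dIm Q (arcMap T p)) * ((T - arc p.1 : ℝ) : ℂ) := by
    rintro ⟨x, t⟩ hp
    have hx : x ^ 2 < 1 := hp.1
    have hga := hasDerivAt_arc hx
    have h1 : HasDerivAt (fun x => f (x, t)) (fderiv ℝ f (x, t) (1, 0)) x := by
      have hfd := ((hfc.differentiableOn (by simp)).differentiableAt (hO.mem_nhds hp)).hasFDerivAt
      exact hfd.comp_hasDerivAt x ((hasDerivAt_id x).prodMk (hasDerivAt_const x t))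
    have h2 : HasDerivAt (fun t => h (x, t)) (fderiv ℝ h (x, t) (0, 1)) t := by
      have hfd := ((hhc.differentiableOn (by simp)).differentiableAt (hO.mem_nhds hp)).hasFDerivAt
      exact hfd.comp_hasDerivAt t ((hasDerivAt_const t x).prodMk (hasDerivAt_id t))
    have hY : HasDerivAt (fun x => arc x + t * (T - arc x)) ((1 - t) * (-x / arc x)) x :=
      (hga.add ((hga.const_sub T).const_mul t)).congr_deriv (by ring)
    have h3 := (hasDerivAt_comp_curve hP (hasDerivAt_id x) hY hp.2).mul (hga.const_sub T).ofReal_comp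
    have hY2 : HasDerivAt (fun t => arc x + t * (T - arc x)) (T - arc x) t := by
      simpa using ((hasDerivAt_id t).mul_const (T - arc x)).const_add (arc x)
    have h5 : HasDerivAt (fun t => (1 - t) * (x / arc x)) (-(x / arc x)) t := by
      simpa using ((hasDerivAt_id t).const_sub 1).mul_const (x / arc x)
    have h4 := (hasDerivAt_comp_curve hQ (hasDerivAt_const t x) hY2 hp.2).add
      (h5.ofReal_comp.mul (hasDerivAt_comp_curve hP (hasDerivAt_const t x) hY2 hp.2))
    rw [h1.unique h3, h2.unique h4]
    simp only [arcMap, id]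
    push_cast
    ring
  have hIcc : ∀ x ∈ Set.Icc (-1 / 2 : ℝ) (1 / 2), ∀ t ∈ Set.Icc (0 : ℝ) 1, (x, t) ∈ arcDomain T :=
    fun x hx t ht => hsub ⟨hx, ht⟩
  have key := integral2_divergence_prod_of_hasFDerivAt f h (fderiv ℝ f) (fderiv ℝ h)
    (-1 / 2) 0 (1 / 2) 1
  rw [Set.uIcc_of_le (by norm_num : (-1 / 2 : ℝ) ≤ 1 / 2), Set.uIcc_of_le zero_le_one,
    min_eq_left (by norm_num : (-1 / 2 : ℝ) ≤ 1 / 2), max_eq_right (by norm_num : (-1 / 2 : ℝ) ≤ 1 / 2),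
    min_eq_left zero_le_one, max_eq_right zero_le_one] at key
  have hsub' : Set.Ioo (-1 / 2 : ℝ) (1 / 2) ×ˢ Set.Ioo (0 : ℝ) 1 ⊆ arcDomain T :=
    (Set.prod_mono Set.Ioo_subset_Icc_self Set.Ioo_subset_Icc_self).trans hsub
  specialize key (hfc.continuousOn.mono hsub) (hhc.continuousOn.mono hsub)
    (fun p hp => ((hfc.differentiableOn (by simp)).differentiableAt
      (hO.mem_nhds (hsub' hp))).hasFDerivAt)
    (fun p hp => ((hhc.differentiableOn (by simp)).differentiableAt
      (hO.mem_nhds (hsub' hp))).hasFDerivAt)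
    (by
      refine ContinuousOn.integrableOn_compact (isCompact_Icc.prod isCompact_Icc)
        (ContinuousOn.mono (s := arcDomain T) ?_ hsub)
      exact ((hfc.continuousOn_fderiv_of_isOpen hO (by simp)).clm_apply continuousOn_const).add
        ((hhc.continuousOn_fderiv_of_isOpen hO (by simp)).clm_apply continuousOn_const))
  have e1 : ∫ x in (-1 / 2 : ℝ)..(1 / 2), ∫ y in (arc x)..T, (dRe P ⟨x, y⟩ + dIm Q ⟨x, y⟩) =
      ∫ x in (-1 / 2 : ℝ)..(1 / 2), ∫ t in (0 : ℝ)..1,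
        fderiv ℝ f (x, t) (1, 0) + fderiv ℝ h (x, t) (0, 1) := by
    refine intervalIntegral.integral_congr fun x hx => ?_
    rw [Set.uIcc_of_le (by norm_num)] at hx
    rw [← integral_straighten]
    refine intervalIntegral.integral_congr fun t ht => ?_
    rw [Set.uIcc_of_le zero_le_one] at ht
    exact (hd _ (hIcc x hx t ht)).symm
  have e2 : ∀ x : ℝ, h (x, 1) = Q ⟨x, T⟩ := fun x => by simp [hh, arcMap]
  have e3 : ∀ x : ℝ, h (x, 0) = Q ⟨x, arc x⟩ + (x / arc x : ℝ) * P ⟨x, arc x⟩ := fun x => by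
    simp [hh, arcMap]
  have e4 : ∀ x : ℝ, ∫ t in (0 : ℝ)..1, f (x, t) = ∫ y in (arc x)..T, P ⟨x, y⟩ := fun x =>
    integral_straighten (fun y => P ⟨x, y⟩) (arc x)
  rw [e1, key, e4, e4, show arc (-1 / 2) = arc (1 / 2) by rw [← arc_neg]; norm_num]
  simp only [e2, e3]

/-- Green's formula for a vector field which is compatible with the side pairings of the
fundamental domain. -/
theorem green_fd_of_symm (hP : ContDiffOn ℝ ∞ P {z : ℂ | 0 < z.im})
    (hQ : ContDiffOn ℝ ∞ Q {z : ℂ | 0 < z.im}) (hT : 1 ≤ T)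
    (hper : ∀ y : ℝ, 0 < y → P ⟨1 / 2, y⟩ = P ⟨-1 / 2, y⟩)
    (hodd : ∀ x : ℝ, x ^ 2 < 1 → -x * P ⟨-x, arc x⟩ + arc x * Q ⟨-x, arc x⟩ =
      -(x * P ⟨x, arc x⟩ + arc x * Q ⟨x, arc x⟩)) :
    ∫ x in (-1 / 2 : ℝ)..(1 / 2), ∫ y in (arc x)..T, (dRe P ⟨x, y⟩ + dIm Q ⟨x, y⟩) =
      ∫ x in (-1 / 2 : ℝ)..(1 / 2), Q ⟨x, T⟩ := by
  have harc : 0 < arc (1 / 2) := arc_pos (by norm_num)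
  rw [green_fd hP hQ hT]
  have h1 : ∫ y in (arc (1 / 2))..T, P ⟨1 / 2, y⟩ = ∫ y in (arc (1 / 2))..T, P ⟨-1 / 2, y⟩ := by
    refine intervalIntegral.integral_congr fun y hy => hper y ?_
    rw [Set.uIcc_of_le ((arc_le_one _).trans hT)] at hy
    exact harc.trans_le hy.1
  set ρ : ℝ → ℂ := fun x => Q ⟨x, arc x⟩ + (x / arc x : ℝ) * P ⟨x, arc x⟩
  have h2 : ∀ x ∈ Set.Icc (-1 / 2 : ℝ) (1 / 2), ρ (-x) = -ρ x := by
    intro x hx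
    have hx2 := sq_lt_one_of_mem hx
    have ha : (arc x : ℂ) ≠ 0 := by exact_mod_cast (arc_pos hx2).ne'
    have := hodd x hx2
    simp only [ρ, arc_neg]
    push_cast
    field_simp
    linear_combination this
  -- The flux density through the arc is odd in `x`, so it integrates to zero over the symmetric
  -- interval.
  have h3 : ∫ x in (-1 / 2 : ℝ)..(1 / 2), ρ x = 0 := by
    have e : ∫ x in (-1 / 2 : ℝ)..(1 / 2), ρ (-x) = ∫ x in (-1 / 2 : ℝ)..(1 / 2), ρ x := by
      rw [intervalIntegral.integral_comp_neg]
      norm_num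
    have e' : ∫ x in (-1 / 2 : ℝ)..(1 / 2), ρ (-x) = -∫ x in (-1 / 2 : ℝ)..(1 / 2), ρ x := by
      rw [← intervalIntegral.integral_neg]
      refine intervalIntegral.integral_congr fun x hx => h2 x ?_
      rwa [Set.uIcc_of_le (by norm_num)] at hx
    exact self_eq_neg.mp (e.symm.trans e')
  rw [h1, h3, sub_zero, add_sub_cancel_right]

/-- Differentiation of the integral over a horizontal segment with respect to its height. -/
theorem hasDerivAt_integral_segment {F : ℂ → ℂ} (hF : ContDiffOn ℝ ∞ F {z : ℂ | 0 < z.im}) {y : ℝ}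
    (hy : 0 < y) : HasDerivAt (fun y : ℝ => ∫ x in (-1 / 2 : ℝ)..(1 / 2), F ⟨x, y⟩)
      (∫ x in (-1 / 2 : ℝ)..(1 / 2), dIm F ⟨x, y⟩) y := by
  have hc : ∀ {G : ℂ → ℂ}, ContDiffOn ℝ ∞ G {z : ℂ | 0 < z.im} →
      ContinuousOn (fun p : ℝ × ℝ => G ⟨p.1, p.2⟩) {p | 0 < p.2} := fun {G} hG =>
    hG.continuousOn.comp Complex.equivRealProdCLM.symm.continuous.continuousOn fun p hp => hp
  have hcx : ∀ {G : ℂ → ℂ}, ContDiffOn ℝ ∞ G {z : ℂ | 0 < z.im} → ∀ {t : ℝ}, 0 < t →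
      Continuous fun x : ℝ => G ⟨x, t⟩ := fun {G} hG t ht =>
    (hc hG).comp_continuous (f := fun x : ℝ => (x, t)) (by fun_prop) fun _ => ht
  have hF' := contDiffOn_dIm isOpen_im_pos hF
  have hK : IsCompact (Set.Icc (-1 / 2 : ℝ) (1 / 2) ×ˢ Set.Icc (y / 2) (2 * y)) :=
    isCompact_Icc.prod isCompact_Icc
  obtain ⟨B, hB⟩ := hK.exists_bound_of_continuousOn ((hc hF').mono fun p hp =>
    (by have := hp.2.1; simp only [Set.mem_ofPred_eq]; linarith))
  refine (intervalIntegral.hasDerivAt_integral_of_dominated_loc_of_deriv_le (bound := fun _ => B)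
    (F := fun y x => F ⟨x, y⟩) (F' := fun y x => dIm F ⟨x, y⟩)
    (Ioo_mem_nhds (by linarith : y / 2 < y) (by linarith : y < 2 * y)) ?_ ?_ ?_ ?_ ?_ ?_).2
  · filter_upwards [lt_mem_nhds hy] with t ht
    exact (hcx hF ht).aestronglyMeasurable
  · exact (hcx hF hy).intervalIntegrable _ _
  · exact (hcx hF' hy).aestronglyMeasurable
  · refine Eventually.of_forall fun x hx t ht => hB (x, t) ⟨?_, Set.Ioo_subset_Icc_self ht⟩
    rw [Set.uIoc_of_le (by norm_num)] at hx
    exact Set.Ioc_subset_Icc_self hx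
  · exact intervalIntegrable_const
  · refine Eventually.of_forall fun x _ t ht => ?_
    have ht' : 0 < t := by linarith [ht.1]
    simpa using hasDerivAt_comp_curve hF (hasDerivAt_const t x) (hasDerivAt_id t) ht'

end

end ThetaLift

end

noncomputable section

namespace ThetaLift

/-! ### Integration on the upper half plane -/

section

open UpperHalfPlane

/-- The real coordinates on the upper half plane. -/
def coord (z : ℍ) : ℝ × ℝ := (z.re, z.im)

lemma measurableEmbedding_coord : MeasurableEmbedding coord :=
  Complex.measurableEquivRealProd.measurableEmbedding.comp measurableEmbedding_coe

lemma range_coord : Set.range coord = {p | 0 < p.2} := by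
  ext p
  exact ⟨by rintro ⟨z, rfl⟩; exact z.im_pos, fun hp => ⟨⟨⟨p.1, p.2⟩, hp⟩, rfl⟩⟩

lemma measurePreserving_coord :
    MeasurePreserving coord (volume.comap UpperHalfPlane.coe) (volume.restrict {p | 0 < p.2}) := by
  have h1 : MeasurePreserving UpperHalfPlane.coe (volume.comap UpperHalfPlane.coe)
      (volume.restrict (.range UpperHalfPlane.coe)) :=
    ⟨measurable_coe, by rw [measurableEmbedding_coe.map_comap]⟩
  have h2 := Complex.volume_preserving_equiv_real_prod.restrict_image_emb
    Complex.measurableEquivRealProd.measurableEmbedding (Set.range UpperHalfPlane.coe)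
  rw [← Set.range_comp] at h2
  have e : Set.range (Complex.measurableEquivRealProd ∘ UpperHalfPlane.coe) = {p | 0 < p.2} :=
    range_coord
  rw [e] at h2
  exact h2.comp h1

lemma measurable_density :
    Measurable fun z : ℍ => (1 / NNReal.mk z.im z.im_pos.le) ^ 2 := by
  have : Measurable fun z : ℍ => NNReal.mk z.im z.im_pos.le :=
    (continuous_im.subtype_mk _).measurable
  fun_prop

lemma density_smul (z : ℍ) (c : ℂ) :
    (1 / NNReal.mk z.im z.im_pos.le) ^ 2 • c = ((coord z).2 ^ 2)⁻¹ • c := by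
  rw [NNReal.smul_def]
  congr 1
  simp [coord]

/-- The measure on `ℍ` is the invariant one, with density `y⁻²` against Lebesgue measure. -/
theorem setIntegral_coord {S : Set ℍ} (hS : MeasurableSet S) (h : ℝ × ℝ → ℂ) :
    ∫ z in S, h (coord z) = ∫ p in coord '' S, (p.2 ^ 2)⁻¹ • h p := by
  rw [volume_def, setIntegral_withDensity_eq_setIntegral_smul measurable_density _ hS]
  simp only [density_smul]
  rw [← measurePreserving_coord.setIntegral_image_emb measurableEmbedding_coord
    (fun p => (p.2 ^ 2)⁻¹ • h p), Measure.restrict_restrict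
    (measurableEmbedding_coord.measurableSet_image.mpr hS), ← range_coord,
    Set.inter_eq_self_of_subset_left (Set.image_subset_range _ _)]

theorem integrableOn_coord {S : Set ℍ} (hS : MeasurableSet S) (h : ℝ × ℝ → ℂ) :
    IntegrableOn (fun z => h (coord z)) S ↔
      IntegrableOn (fun p => (p.2 ^ 2)⁻¹ • h p) (coord '' S) := by
  rw [IntegrableOn, volume_def, restrict_withDensity hS,
    integrable_withDensity_iff_integrable_smul measurable_density]
  simp only [density_smul]
  have h1 := (measurePreserving_coord.restrict_image_emb measurableEmbedding_coord S).integrable_comp_emb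
    measurableEmbedding_coord (g := fun p => (p.2 ^ 2)⁻¹ • h p)
  rw [Measure.restrict_restrict (measurableEmbedding_coord.measurableSet_image.mpr hS),
    ← range_coord, Set.inter_eq_self_of_subset_left (Set.image_subset_range _ _)] at h1
  exact h1

lemma measurableSet_fd : MeasurableSet ModularGroup.fd := ModularGroup.isClosed_fd.measurableSet

/-- The truncated fundamental domain of the modular group. -/
abbrev fdT (T : ℝ) : Set ℍ := ModularGroup.truncatedFundamentalDomain T

lemma isCompact_fdT (T : ℝ) : IsCompact (fdT T) :=
  ModularGroup.isCompact_truncatedFundamentalDomain T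

lemma measurableSet_fdT (T : ℝ) : MeasurableSet (fdT T) := (isCompact_fdT T).isClosed.measurableSet

lemma half_lt_im {z : ℍ} (hz : z ∈ ModularGroup.fd) : 1 / 2 < z.im := by
  have := ModularGroup.three_le_four_mul_im_sq_of_mem_fd hz
  nlinarith [z.im_pos]

lemma mem_fd_iff {z : ℍ} :
    z ∈ ModularGroup.fd ↔ z.re ∈ Set.Icc (-1 / 2 : ℝ) (1 / 2) ∧ arc z.re ≤ z.im := by
  have e : z ∈ ModularGroup.fd ↔ 1 ≤ Complex.normSq (z : ℂ) ∧ |z.re| ≤ 1 / 2 := Iff.rfl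
  rw [e, Complex.normSq_apply, abs_le, and_comm, Set.mem_Icc, neg_div, arc,
    Real.sqrt_le_left z.im_pos.le, UpperHalfPlane.coe_re, UpperHalfPlane.coe_im]
  refine and_congr_right fun _ => ?_
  constructor <;> intro h <;> linarith

lemma coord_image_fdT {T : ℝ} : coord '' fdT T =
    {p | p.1 ∈ Set.Icc (-1 / 2 : ℝ) (1 / 2) ∧ p.2 ∈ Set.Icc (arc p.1) T} := by
  ext p
  constructor
  · rintro ⟨z, ⟨hz, hT⟩, rfl⟩
    exact ⟨(mem_fd_iff.mp hz).1, (mem_fd_iff.mp hz).2, hT⟩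
  · rintro ⟨h1, h2, h3⟩
    have hp : 0 < p.2 := (arc_pos (sq_lt_one_of_mem h1)).trans_le h2
    exact ⟨⟨⟨p.1, p.2⟩, hp⟩, ⟨mem_fd_iff.mpr ⟨h1, h2⟩, h3⟩, rfl⟩

theorem setIntegral_fdT {h : ℂ → ℂ} (hc : ContinuousOn h {z | 0 < z.im}) {T : ℝ} (hT : 1 ≤ T) :
    ∫ z in fdT T, h z =
      ∫ x in (-1 / 2 : ℝ)..(1 / 2), ∫ y in (arc x)..T, ((y ^ 2)⁻¹ : ℝ) * h ⟨x, y⟩ := by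
  have hcz : Continuous fun z : ℍ => h z := hc.comp_continuous continuous_coe fun z => z.im_pos
  have hi := (integrableOn_coord (measurableSet_fdT T) fun p => h ⟨p.1, p.2⟩).mp
    (hcz.continuousOn.integrableOn_compact (isCompact_fdT T))
  have hm := measurableEmbedding_coord.measurableSet_image.mpr (measurableSet_fdT T)
  refine (setIntegral_coord (measurableSet_fdT T) fun p => h ⟨p.1, p.2⟩).trans ?_
  rw [← integral_indicator hm, Measure.volume_eq_prod,
    integral_prod _ (by rw [← Measure.volume_eq_prod]; exact hi.integrable_indicator hm),
    intervalIntegral.integral_of_le (by norm_num), ← integral_Icc_eq_integral_Ioc,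
    ← integral_indicator measurableSet_Icc]
  refine integral_congr_ae (Eventually.of_forall fun x => ?_)
  beta_reduce
  rw [coord_image_fdT]
  by_cases hx : x ∈ Set.Icc (-1 / 2 : ℝ) (1 / 2)
  · rw [Set.indicator_of_mem hx, intervalIntegral.integral_of_le ((arc_le_one x).trans hT),
      ← integral_Icc_eq_integral_Ioc, ← integral_indicator measurableSet_Icc]
    refine integral_congr_ae (Eventually.of_forall fun y => ?_)
    have hx' : x ∈ Set.Icc (-1 / 2 : ℝ) (1 / 2) ↔ True := iff_true_intro hx
    simp only [Set.indicator, Set.mem_ofPred_eq, hx', true_and]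
    simp
  · rw [Set.indicator_of_notMem hx]
    refine (integral_congr_ae (Eventually.of_forall fun y => ?_)).trans (integral_zero _ _)
    exact Set.indicator_of_notMem (fun h => hx h.1) _

lemma coord_image_strip {T : ℝ} : coord '' (fdT T ∩ {z | 1 < z.im}) =
    Set.Icc (-1 / 2 : ℝ) (1 / 2) ×ˢ Set.Ioc 1 T := by
  ext p
  constructor
  · rintro ⟨z, ⟨⟨hz, hT⟩, h1⟩, rfl⟩
    exact ⟨(mem_fd_iff.mp hz).1, h1, hT⟩
  · rintro ⟨h1, h2, h3⟩
    exact ⟨⟨⟨p.1, p.2⟩, zero_lt_one.trans h2⟩, ⟨⟨mem_fd_iff.mpr ⟨h1, (arc_le_one _).trans h2.le⟩, h3⟩,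
      h2⟩, rfl⟩

lemma measurableSet_one_lt_im : MeasurableSet {z : ℍ | 1 < z.im} :=
  (isOpen_lt continuous_const continuous_im).measurableSet

theorem setIntegral_strip {h : ℂ → ℂ} (hc : ContinuousOn h {z | 0 < z.im}) {T : ℝ} (hT : 1 ≤ T) :
    ∫ z in fdT T ∩ {z | 1 < z.im}, h z =
      ∫ y in (1 : ℝ)..T, ∫ x in (-1 / 2 : ℝ)..(1 / 2), ((y ^ 2)⁻¹ : ℝ) * h ⟨x, y⟩ := by
  have hcz : Continuous fun z : ℍ => h z := hc.comp_continuous continuous_coe fun z => z.im_pos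
  have hm0 := (measurableSet_fdT T).inter measurableSet_one_lt_im
  have hi := (integrableOn_coord hm0 fun p => h ⟨p.1, p.2⟩).mp
    ((hcz.continuousOn.integrableOn_compact (isCompact_fdT T)).mono_set Set.inter_subset_left)
  refine (setIntegral_coord hm0 fun p => h ⟨p.1, p.2⟩).trans ?_
  rw [coord_image_strip] at hi ⊢
  rw [Measure.volume_eq_prod] at hi ⊢
  rw [← Measure.prod_restrict, integral_prod_symm _ (by rw [Measure.prod_restrict]; exact hi),
    intervalIntegral.integral_of_le hT]
  refine integral_congr_ae (Eventually.of_forall fun y => ?_)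
  beta_reduce
  rw [intervalIntegral.integral_of_le (by norm_num), ← integral_Icc_eq_integral_Ioc]
  simp

theorem volume_fd_lt_top : volume ModularGroup.fd < ⊤ := by
  have h1 : IntegrableOn (fun _ : ℍ => (1 : ℂ)) ModularGroup.fd := by
    refine (integrableOn_coord measurableSet_fd fun _ => 1).mpr ?_
    have h2 : IntegrableOn (fun p : ℝ × ℝ => ((p.2 ^ 2)⁻¹ : ℝ) • (1 : ℂ))
        (Set.Icc (-1 / 2 : ℝ) (1 / 2) ×ˢ Set.Ioi (1 / 2)) := by
      rw [IntegrableOn, Measure.volume_eq_prod, ← Measure.prod_restrict]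
      have h3 : IntegrableOn (fun y : ℝ => ((y ^ 2)⁻¹ : ℝ) • (1 : ℂ)) (Set.Ioi (1 / 2)) := by
        refine Integrable.smul_const ?_ 1
        refine (integrableOn_Ioi_rpow_of_lt (a := -2) (by norm_num) (by norm_num)).congr_fun
          (fun y hy => ?_) measurableSet_Ioi
        have hy' : (0 : ℝ) < y := lt_trans (by norm_num) hy
        simp only
        rw [Real.rpow_neg hy'.le]
        norm_num
      exact Integrable.comp_snd h3 _
    refine h2.mono_set ?_
    rintro _ ⟨z, hz, rfl⟩
    exact ⟨(mem_fd_iff.mp hz).1, half_lt_im hz⟩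
  have h4 := (integrableOn_const_iff (by simp)).mp h1
  simpa using h4

lemma fdT_eq (T : ℝ) : fdT T = ModularGroup.fd ∩ {z | z.im ≤ T} := rfl

lemma iUnion_fdT : ⋃ T, fdT T = ModularGroup.fd := by
  ext z
  simp only [Set.mem_iUnion, fdT_eq]
  exact ⟨fun ⟨_, h⟩ => h.1, fun h => ⟨z.im, h, le_refl z.im⟩⟩

theorem tendsto_setIntegral_fdT {h : ℍ → ℂ} (hi : IntegrableOn h ModularGroup.fd) :
    Tendsto (fun T => ∫ z in fdT T, h z) atTop (𝓝 (∫ z in ModularGroup.fd, h z)) := by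
  have h1 := tendsto_setIntegral_of_monotone (s := fdT) (f := h) (μ := volume) measurableSet_fdT
    (fun a b hab z hz => ⟨hz.1, hz.2.trans hab⟩) (by rwa [iUnion_fdT])
  rwa [iUnion_fdT] at h1

lemma volume_re_eq (c : ℝ) : volume {z : ℍ | z.re = c} = 0 := by
  rw [volume_eq_lintegral]
  refine setLIntegral_measure_zero _ _ ?_
  refine measure_mono_null (t := Complex.measurableEquivRealProd ⁻¹' ({c} ×ˢ Set.univ)) ?_ ?_
  · rintro _ ⟨z, hz, rfl⟩
    exact ⟨hz, trivial⟩
  · rw [Complex.volume_preserving_equiv_real_prod.measure_preimage_equiv, Measure.volume_eq_prod,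
      Measure.prod_prod]
    simp

/-- The integral over the translates of the truncated fundamental domain. -/
theorem setIntegral_truncDomain {h : ℍ → ℂ} (hc : Continuous h) (a : ℕ) (T : ℝ) :
    ∫ z in truncDomain a T, h z =
      ∑ j : Fin a, ∫ z in fdT T, h (ModularGroup.T ^ ((j : ℕ) : ℤ) • z) := by
  have hT : ∀ (j : ℕ) (z : ℍ), ModularGroup.T ^ (j : ℤ) • z = (j : ℝ) +ᵥ z := fun j z => by
    simpa using modular_T_zpow_smul z j
  have himg : truncDomain a T =
      ⋃ j : Fin a, (fun z : ℍ => ModularGroup.T ^ ((j : ℕ) : ℤ) • z) '' fdT T := by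
    ext z
    simp only [truncDomain, Set.mem_ofPred_eq, Set.mem_iUnion, Finset.mem_range, hT]
    constructor
    · rintro ⟨⟨j, hj, w, hw, rfl⟩, hT⟩
      exact ⟨⟨j, hj⟩, w, ⟨hw, by simpa using hT⟩, rfl⟩
    · rintro ⟨j, w, hw, rfl⟩
      exact ⟨⟨j, j.2, w, hw.1, rfl⟩, by simpa using hw.2⟩
  have hemb : ∀ g : SL(2, ℤ), MeasurableEmbedding fun z : ℍ => g • z := fun g =>
    (Homeomorph.smul (g : GL (Fin 2) ℝ)).measurableEmbedding
  have hpres : ∀ g : SL(2, ℤ), MeasurePreserving fun z : ℍ => g • z := fun g =>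
    measurePreserving_smul (g : GL (Fin 2) ℝ) volume
  have hcpt : ∀ g : SL(2, ℤ), IsCompact ((fun z : ℍ => g • z) '' fdT T) := fun g =>
    (isCompact_fdT T).image (Homeomorph.smul (g : GL (Fin 2) ℝ)).continuous
  rw [himg, integral_iUnion_ae, tsum_fintype]
  · exact Finset.sum_congr rfl fun j _ => (hpres _).setIntegral_image_emb (hemb _) _ _
  · exact fun j => (hcpt _).isClosed.measurableSet.nullMeasurableSet
  · intro j k hjk
    wlog hlt : j < k generalizing j k
    · exact (this hjk.symm (lt_of_le_of_ne (not_lt.mp hlt) hjk.symm)).symm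
    -- For `j < k` the real parts on the translate by `j` are at most `j + 1/2`, and those on the
    -- translate by `k` are at least `k - 1/2 ≥ j + 1/2`. The overlap lies on a vertical line.
    refine measure_mono_null (t := {z : ℍ | z.re = (j : ℕ) + 1 / 2}) ?_ (volume_re_eq _)
    rintro z ⟨⟨w, hw, rfl⟩, w', hw', e⟩
    have h1 := (mem_fd_iff.mp hw.1).1.2
    have h2 := (mem_fd_iff.mp hw'.1).1.1
    have h3 := congrArg UpperHalfPlane.re e
    simp only [hT, UpperHalfPlane.vadd_re] at h3
    have h4 : ((j : ℕ) : ℝ) + 1 ≤ (k : ℕ) := by exact_mod_cast hlt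
    simp only [Set.mem_ofPred_eq, hT, UpperHalfPlane.vadd_re]
    linarith
  · exact hc.continuousOn.integrableOn_compact (isCompact_iUnion fun j => hcpt _)

end

end ThetaLift

end

noncomputable section

namespace ThetaLift

/-! ### The Green identity for a family of functions on the tiles -/

section

/-- If a function tends to zero and its derivative converges, then the limit of the derivative
is zero. -/
lemma eq_zero_of_tendsto_deriv {D D' : ℝ → ℂ} {c : ℂ} (hD : ∀ t, 1 ≤ t → HasDerivAt D (D' t) t)
    (h0 : Tendsto D atTop (𝓝 0)) (hc : Tendsto D' atTop (𝓝 c)) : c = 0 := by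
  rw [← norm_le_zero_iff]
  refine le_of_forall_pos_le_add fun ε hε => ?_
  rw [zero_add]
  obtain ⟨T, hT⟩ := (eventually_atTop.mp ((hc.eventually (Metric.ball_mem_nhds c hε)).and
    (eventually_ge_atTop (1 : ℝ))))
  have h1 : Tendsto (fun t => ‖D (t + 1) - D t - c‖) atTop (𝓝 ‖(0 : ℂ) - 0 - c‖) :=
    (((h0.comp (tendsto_atTop_add_const_right atTop (1 : ℝ) tendsto_id)).sub h0).sub_const c).norm
  rw [sub_zero, zero_sub, norm_neg] at h1
  refine le_of_tendsto h1 (eventually_atTop.mpr ⟨T, fun t ht => ?_⟩)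
  -- The mean value inequality for `D u - u c` on an interval of length one bounds `D (t + 1) - D t
  -- - c` by `ε`; the left side tends to `-c`.
  have h2 : ∀ u ∈ Set.Icc t (t + 1), HasDerivWithinAt (fun u : ℝ => D u - (u : ℂ) * c) (D' u - c)
      (Set.Icc t (t + 1)) u := fun u hu => by
    have h3 := (hD u (hT u (ht.trans hu.1)).2).sub ((hasDerivAt_id u).ofReal_comp.mul_const c)
    rw [Complex.ofReal_one, one_mul] at h3
    exact h3.hasDerivWithinAt
  have h4 := (convex_Icc t (t + 1)).norm_image_sub_le_of_norm_hasDerivWithin_le h2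
    (fun u hu => (mem_ball_iff_norm.mp (hT u (ht.trans hu.1)).1).le)
    (Set.left_mem_Icc.mpr (by linarith)) (Set.right_mem_Icc.mpr (by linarith))
  have e : D (t + 1) - ((t + 1 : ℝ) : ℂ) * c - (D t - (t : ℂ) * c) = D (t + 1) - D t - c := by
    push_cast
    ring
  rw [e, add_sub_cancel_left, norm_one, mul_one] at h4
  exact h4

variable {F G : ℂ → ℂ} {U : Set ℂ}

lemma hasLineDerivAt_of_contDiffOn (hU : IsOpen U) (hF : ContDiffOn ℝ ∞ F U) {z : ℂ} (hz : z ∈ U)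
    (e : ℂ) : HasLineDerivAt ℝ F (lineDeriv ℝ F z e) z e :=
  ((hF.differentiableOn (by simp)).differentiableAt (hU.mem_nhds hz)).lineDifferentiableAt.hasLineDerivAt

/-- The Wronskian of two functions with respect to the derivation in the direction `e`. -/
def wronskian (F G : ℂ → ℂ) (e z : ℂ) : ℂ := F z * lineDeriv ℝ G z e - G z * lineDeriv ℝ F z e

lemma contDiffOn_lineDeriv (hU : IsOpen U) (hF : ContDiffOn ℝ ∞ F U) (e : ℂ) :
    ContDiffOn ℝ ∞ (fun z => lineDeriv ℝ F z e) U :=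
  ((contDiffOn_fderiv hU hF).clm_apply contDiffOn_const).congr (lineDeriv_eq_fderiv hU hF e)

lemma contDiffOn_wronskian (hU : IsOpen U) (hF : ContDiffOn ℝ ∞ F U) (hG : ContDiffOn ℝ ∞ G U)
    (e : ℂ) : ContDiffOn ℝ ∞ (wronskian F G e) U :=
  (hF.mul (contDiffOn_lineDeriv hU hG e)).sub (hG.mul (contDiffOn_lineDeriv hU hF e))

/-- The products of first derivatives cancel. So the field of Wronskians in the directions `1` and
`I` has divergence `F` times the Laplacian of `G` minus `G` times that of `F`. -/
lemma hasLineDerivAt_wronskian (hU : IsOpen U) (hF : ContDiffOn ℝ ∞ F U) (hG : ContDiffOn ℝ ∞ G U)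
    {z : ℂ} (hz : z ∈ U) (e : ℂ) : HasLineDerivAt ℝ (wronskian F G e)
      (F z * lineDeriv ℝ (fun w => lineDeriv ℝ G w e) z e -
        G z * lineDeriv ℝ (fun w => lineDeriv ℝ F w e) z e) z e := by
  have h1 := hasLineDerivAt_of_contDiffOn hU hF hz e
  have h2 := hasLineDerivAt_of_contDiffOn hU hG hz e
  have h3 := hasLineDerivAt_of_contDiffOn hU (contDiffOn_lineDeriv hU hF e) hz e
  have h4 := hasLineDerivAt_of_contDiffOn hU (contDiffOn_lineDeriv hU hG e) hz e
  unfold HasLineDerivAt at *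
  refine ((h1.mul h4).sub (h2.mul h3)).congr_deriv ?_
  simp only [zero_smul, add_zero]
  ring

variable {ι : Type*} [Fintype ι] {s' : ℂ}

/-- Functions `F i`, `G i` on the tiles of a fundamental domain, where the `F i` are eigenfunctions
of the Laplacian, the `G i` are up to rapidly decreasing functions multiples of `Im z`, and the
sums of their Wronskians respect the side pairings of the fundamental domain. -/
structure TileData (s' : ℂ) (F G R : ι → ℂ → ℂ) (κ : ι → ℂ) (A B : ℂ) (K C ρ : ℝ) : Prop where
  smooth_left : ∀ i, ContDiffOn ℝ ∞ (F i) {z | 0 < z.im}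
  smooth_right : ∀ i, ContDiffOn ℝ ∞ (G i) {z | 0 < z.im}
  smooth_rem : ∀ i, ContDiffOn ℝ ∞ (R i) {z | 0 < z.im}
  eigen : ∀ i z, 0 < z.im → lap 0 (F i) z = s' * (1 - s') * F i z
  eq_add : ∀ i z, 0 < z.im → G i z = z.im * κ i + R i z
  side : ∀ y : ℝ, 0 < y → ∑ i, wronskian (F i) (G i) 1 ⟨1 / 2, y⟩ =
    ∑ i, wronskian (F i) (G i) 1 ⟨-1 / 2, y⟩
  arc_symm : ∀ x : ℝ, x ^ 2 < 1 → ∑ i, wronskian (F i) (G i) ⟨-x, arc x⟩ ⟨-x, arc x⟩ =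
    -∑ i, wronskian (F i) (G i) ⟨x, arc x⟩ ⟨x, arc x⟩
  nonneg : 0 ≤ K
  pos : 0 < ρ
  growth : ∀ i, ∀ x ∈ Set.Icc (-1 / 2 : ℝ) (1 / 2), ∀ y : ℝ, 1 ≤ y →
    ‖F i ⟨x, y⟩‖ ≤ K * Real.exp (C * y)
  decay : ∀ i, ∀ x ∈ Set.Icc (-1 / 2 : ℝ) (1 / 2), ∀ y : ℝ, 1 ≤ y →
    ‖R i ⟨x, y⟩‖ ≤ K * Real.exp (-ρ * y ^ 2) ∧ ‖dIm (R i) ⟨x, y⟩‖ ≤ K * Real.exp (-ρ * y ^ 2)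
  const : ∀ y : ℝ, 0 < y → ∑ i, κ i * ∫ x in (-1 / 2 : ℝ)..(1 / 2), F i ⟨x, y⟩ =
    A * (y : ℂ) ^ s' + B * (y : ℂ) ^ (1 - s')

namespace TileData

variable {F G R : ι → ℂ → ℂ} {κ : ι → ℂ} {A B : ℂ} {K C ρ : ℝ}

/-- The remainder, with the leading term split off only above height `1`. -/
def cutRem (G R : ℂ → ℂ) (z : ℂ) : ℂ := if 1 < z.im then R z else G z

lemma lap_zero (G : ℂ → ℂ) (z : ℂ) :
    lap 0 G z = -(z.im : ℂ) ^ 2 * (dRe (dRe G) z + dIm (dIm G) z) := by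
  simp [lap]

lemma continuousOn_lap {G : ℂ → ℂ} (hG : ContDiffOn ℝ ∞ G {z | 0 < z.im}) :
    ContinuousOn (lap 0 G) {z | 0 < z.im} := by
  have h1 := (contDiffOn_dRe isOpen_im_pos (contDiffOn_dRe isOpen_im_pos hG)).continuousOn
  have h2 := (contDiffOn_dIm isOpen_im_pos (contDiffOn_dIm isOpen_im_pos hG)).continuousOn
  have h3 : ContinuousOn (fun z : ℂ => -(z.im : ℂ) ^ 2) {z | 0 < z.im} := by fun_prop
  exact (h3.mul (h1.add h2)).congr fun z _ => lap_zero G z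

/-- Linearity in the direction; on the unit circle the direction `⟨x, arc x⟩` is the outer normal,
which links the radial Wronskian to the flux through the arc. -/
lemma wronskian_mk {F G : ℂ → ℂ} (hF : ContDiffOn ℝ ∞ F {z | 0 < z.im})
    (hG : ContDiffOn ℝ ∞ G {z | 0 < z.im}) (x y : ℝ) {z : ℂ} (hz : 0 < z.im) :
    wronskian F G ⟨x, y⟩ z = x * wronskian F G 1 z + y * wronskian F G Complex.I z := by
  have e : (⟨x, y⟩ : ℂ) = x • (1 : ℂ) + y • Complex.I := by
    simp [Complex.mk_eq_add_mul_I]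
  have key : ∀ {H : ℂ → ℂ}, ContDiffOn ℝ ∞ H {z | 0 < z.im} → lineDeriv ℝ H z ⟨x, y⟩ =
      x * lineDeriv ℝ H z 1 + y * lineDeriv ℝ H z Complex.I := by
    intro H hH
    have h := fun e => lineDeriv_eq_fderiv isOpen_im_pos hH e hz
    simp only at h
    rw [h, h, h, e, map_add, map_smul, map_smul, Complex.real_smul, Complex.real_smul]
  unfold wronskian
  rw [key hF, key hG]
  ring

variable (h : TileData s' F G R κ A B K C ρ)

include h

/-- By the eigenvalue equation, the integrand is `-y²` times the divergence of the Wronskian field,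
and `y²` cancels the hyperbolic density. The sum over the tiles is formed before Green's formula is
used, since only the sum respects the side pairings; the top segment is all that remains. -/
lemma green {T : ℝ} (hT : 1 ≤ T) :
    (∑ i, ∫ z in fdT T, F i z * lap 0 (G i) z) - s' * (1 - s') * ∑ i, ∫ z in fdT T, F i z * G i z =
      -∑ i, ∫ x in (-1 / 2 : ℝ)..(1 / 2), wronskian (F i) (G i) Complex.I ⟨x, T⟩ := by
  have hU := isOpen_im_pos
  have hF := h.smooth_left
  have hG := h.smooth_right
  set P : ℂ → ℂ := fun z => ∑ i, wronskian (F i) (G i) 1 z with hPdef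
  set Q : ℂ → ℂ := fun z => ∑ i, wronskian (F i) (G i) Complex.I z with hQdef
  have hP : ContDiffOn ℝ ∞ P {z | 0 < z.im} :=
    ContDiffOn.sum fun i _ => contDiffOn_wronskian hU (hF i) (hG i) 1
  have hQ : ContDiffOn ℝ ∞ Q {z | 0 < z.im} :=
    ContDiffOn.sum fun i _ => contDiffOn_wronskian hU (hF i) (hG i) Complex.I
  have hsum : ∀ e z : ℂ, 0 < z.im → lineDeriv ℝ (fun z => ∑ i, wronskian (F i) (G i) e z) z e =
      ∑ i, (F i z * lineDeriv ℝ (fun w => lineDeriv ℝ (G i) w e) z e -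
        G i z * lineDeriv ℝ (fun w => lineDeriv ℝ (F i) w e) z e) := by
    intro e z hz
    refine HasLineDerivAt.lineDeriv ?_
    unfold HasLineDerivAt
    exact HasDerivAt.fun_sum fun i _ => hasLineDerivAt_wronskian hU (hF i) (hG i) hz e
  have hpt : ∀ z : ℂ, 0 < z.im →
      ∑ i, (F i z * lap 0 (G i) z - s' * (1 - s') * (F i z * G i z)) =
        -(z.im : ℂ) ^ 2 * (dRe P z + dIm Q z) := by
    intro z hz
    have e1 : dRe P z = _ := hsum 1 z hz
    have e2 : dIm Q z = _ := hsum Complex.I z hz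
    rw [e1, e2, ← Finset.sum_add_distrib, Finset.mul_sum]
    refine Finset.sum_congr rfl fun i _ => ?_
    have h1 := h.eigen i z hz
    rw [lap_zero] at h1 ⊢
    have d1 : ∀ H, dRe H = fun w => lineDeriv ℝ H w 1 := fun _ => rfl
    have d2 : ∀ H, dIm H = fun w => lineDeriv ℝ H w Complex.I := fun _ => rfl
    simp only [d1, d2] at h1 ⊢
    linear_combination G i z * h1
  have hc1 : ∀ i, ContinuousOn (fun z => F i z * lap 0 (G i) z) {z | 0 < z.im} := fun i =>
    (hF i).continuousOn.mul (continuousOn_lap (hG i))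
  have hc2 : ∀ i, ContinuousOn (fun z => F i z * G i z) {z | 0 < z.im} := fun i =>
    (hF i).continuousOn.mul (hG i).continuousOn
  have hint : ∀ {H : ℂ → ℂ}, ContinuousOn H {z | 0 < z.im} →
      IntegrableOn (fun z : ℍ => H z) (fdT T) := fun hH =>
    (hH.comp_continuous UpperHalfPlane.continuous_coe fun z : ℍ => z.im_pos).continuousOn.integrableOn_compact
      (isCompact_fdT T)
  have hQx : Continuous fun x : ℝ => (⟨x, T⟩ : ℂ) := by
    simp only [Complex.mk_eq_add_mul_I]
    fun_prop
  have e1 : (∑ i, ∫ z in fdT T, F i z * lap 0 (G i) z) -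
      s' * (1 - s') * ∑ i, ∫ z in fdT T, F i z * G i z = ∫ z in fdT T,
        ∑ i, (F i z * lap 0 (G i) z - s' * (1 - s') * (F i z * G i z)) := by
    have hi : ∀ i, IntegrableOn (fun z : ℍ => F i z * lap 0 (G i) z - s' * (1 - s') * (F i z * G i z))
        (fdT T) := fun i => (hint (hc1 i)).sub ((hint (hc2 i)).const_mul _)
    rw [integral_finsetSum _ fun i _ => hi i, Finset.mul_sum, ← Finset.sum_sub_distrib]
    refine Finset.sum_congr rfl fun i _ => ?_
    rw [integral_sub (hint (hc1 i)) ((hint (hc2 i)).const_mul _), integral_const_mul]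
  have hWi : ∀ i, IntervalIntegrable (fun x => wronskian (F i) (G i) Complex.I ⟨x, T⟩) volume
      (-1 / 2 : ℝ) (1 / 2) := fun i => ((contDiffOn_wronskian hU (hF i) (hG i)
    Complex.I).continuousOn.comp_continuous hQx fun x => zero_lt_one.trans_le hT).intervalIntegrable _ _
  rw [e1, setIntegral_fdT (h := fun z => ∑ i, (F i z * lap 0 (G i) z - s' * (1 - s') * (F i z * G i z)))
    (continuousOn_finsetSum _ fun i _ => (hc1 i).sub (continuousOn_const.mul (hc2 i))) hT,
    ← intervalIntegral.integral_finsetSum fun i _ => hWi i, ← green_fd_of_symm hP hQ hT h.side, ← intervalIntegral.integral_neg]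
  · refine intervalIntegral.integral_congr fun x hx => ?_
    rw [Set.uIcc_of_le (by norm_num)] at hx
    rw [← intervalIntegral.integral_neg]
    refine intervalIntegral.integral_congr fun y hy => ?_
    rw [Set.uIcc_of_le ((arc_le_one x).trans hT)] at hy
    have hy0 : 0 < y := (arc_pos (sq_lt_one_of_mem hx)).trans_le hy.1
    have hy' : (y : ℂ) ≠ 0 := by exact_mod_cast hy0.ne'
    rw [hpt ⟨x, y⟩ hy0]
    push_cast
    field_simp
  · intro x hx
    have ha := arc_pos hx
    have h1 := h.arc_symm x hx
    simp only [hPdef, hQdef, Finset.mul_sum, ← Finset.sum_add_distrib]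
    refine Eq.trans ?_ (h1.trans ?_)
    · refine Finset.sum_congr rfl fun i _ => ?_
      rw [wronskian_mk (hF i) (hG i) (-x) (arc x) ha]
      push_cast
      rfl
    · refine congrArg _ (Finset.sum_congr rfl fun i _ => ?_)
      exact wronskian_mk (hF i) (hG i) x (arc x) ha

omit h in
lemma cpow_sub_one {x : ℂ} (w : ℂ) (hx : x ≠ 0) : x ^ (w - 1) = x ^ w / x := by
  rw [Complex.cpow_sub _ _ hx, Complex.cpow_one]

omit h in
lemma continuous_mk (T : ℝ) : Continuous fun x : ℝ => (⟨x, T⟩ : ℂ) := by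
  simp only [Complex.mk_eq_add_mul_I]
  fun_prop

omit h in
lemma intervalIntegrable_mk {H : ℂ → ℂ} (hH : ContinuousOn H {z | 0 < z.im}) {T : ℝ} (hT : 0 < T) :
    IntervalIntegrable (fun x : ℝ => H ⟨x, T⟩) volume (-1 / 2) (1 / 2) :=
  (hH.comp_continuous (continuous_mk T) fun _ => hT).intervalIntegrable _ _

/-- The derivative with respect to the height of the sum of the constant terms. -/
lemma sum_integral_dIm {T : ℝ} (hT : 0 < T) :
    ∑ i, κ i * ∫ x in (-1 / 2 : ℝ)..(1 / 2), dIm (F i) ⟨x, T⟩ =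
      s' * A * (T : ℂ) ^ (s' - 1) + (1 - s') * B * (T : ℂ) ^ (-s') := by
  have h1 : HasDerivAt (fun y : ℝ => ∑ i, κ i * ∫ x in (-1 / 2 : ℝ)..(1 / 2), F i ⟨x, y⟩)
      (∑ i, κ i * ∫ x in (-1 / 2 : ℝ)..(1 / 2), dIm (F i) ⟨x, T⟩) T :=
    HasDerivAt.fun_sum fun i _ => (hasDerivAt_integral_segment (h.smooth_left i) hT).const_mul _
  have h2 : ∀ w : ℂ, HasDerivAt (fun y : ℝ => (y : ℂ) ^ w) (w * (T : ℂ) ^ (w - 1)) T := fun w => by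
    have h3 := (hasDerivAt_id (T : ℂ)).cpow_const (c := w) (Or.inl (by simpa using hT))
    simpa using h3.comp_ofReal
  have h4 := ((h2 s').const_mul A).add ((h2 (1 - s')).const_mul B)
  have h5 := h1.unique (h4.congr_of_eventuallyEq ?_)
  · rw [h5, show 1 - s' - 1 = -s' by ring]
    ring
  · filter_upwards [lt_mem_nhds hT] with y hy
    exact h.const y hy

-- The antiderivative of `s' (1 - s') A y^{s' - 1}` is taken as `(1 - s') A y^{s'}`, and similarly
-- for `B`. Keeping the factor `s' (1 - s')` avoids any division, so `s' = 0` and `s' = 1` need no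
-- separate treatment.
omit [Fintype ι] h in
lemma integral_const {T : ℝ} (hT : 1 ≤ T) :
    s' * (1 - s') * ∫ y in (1 : ℝ)..T, ((y⁻¹ : ℝ) : ℂ) * (A * (y : ℂ) ^ s' + B * (y : ℂ) ^ (1 - s')) =
      (1 - s') * A * ((T : ℂ) ^ s' - 1) + s' * B * ((T : ℂ) ^ (1 - s') - 1) := by
  have h2 : ∀ w : ℂ, ∀ y : ℝ, 0 < y →
      HasDerivAt (fun y : ℝ => (y : ℂ) ^ w) (w * (y : ℂ) ^ w / y) y := fun w y hy => by
    have h3 := ((hasDerivAt_id (y : ℂ)).cpow_const (c := w) (Or.inl (by simpa using hy))).comp_ofReal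
    refine h3.congr_deriv ?_
    rw [id, cpow_sub_one _ (by exact_mod_cast hy.ne'), mul_one, mul_div_assoc]
  rw [← intervalIntegral.integral_const_mul, intervalIntegral.integral_eq_sub_of_hasDerivAt
    (f := fun y : ℝ => (1 - s') * A * (y : ℂ) ^ s' + s' * B * (y : ℂ) ^ (1 - s'))]
  · simp only [Complex.ofReal_one, Complex.one_cpow]
    ring
  · intro y hy
    rw [Set.uIcc_of_le hT] at hy
    have hy0 : 0 < y := zero_lt_one.trans_le hy.1
    refine (((h2 s' y hy0).const_mul _).add ((h2 (1 - s') y hy0).const_mul _)).congr_deriv ?_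
    push_cast
    ring
  · refine ContinuousOn.intervalIntegrable ?_
    rw [Set.uIcc_of_le hT]
    have h3 : ∀ w : ℂ, ContinuousOn (fun y : ℝ => (y : ℂ) ^ w) (Set.Icc 1 T) := fun w y hy =>
      (h2 w y (zero_lt_one.trans_le hy.1)).continuousAt.continuousWithinAt
    have h4 : ContinuousOn (fun y : ℝ => ((y⁻¹ : ℝ) : ℂ)) (Set.Icc 1 T) :=
      Complex.continuous_ofReal.comp_continuousOn
        (continuousOn_inv₀.mono fun y hy => (zero_lt_one.trans_le hy.1).ne')
    exact continuousOn_const.mul (h4.mul ((continuousOn_const.mul (h3 _)).add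
      (continuousOn_const.mul (h3 _))))

lemma lineDeriv_right (i : ι) {z : ℂ} (hz : 0 < z.im) : dIm (G i) z = κ i + dIm (R i) z := by
  have h1 := hasLineDerivAt_of_contDiffOn isOpen_im_pos (h.smooth_rem i) hz Complex.I
  have h2 : HasLineDerivAt ℝ (fun z : ℂ => (z.im : ℂ) * κ i + R i z) (κ i + dIm (R i) z) z
      Complex.I := by
    unfold HasLineDerivAt at h1 ⊢
    refine HasDerivAt.add ?_ h1
    have h3 : HasDerivAt (fun t : ℝ => ((z.im + t : ℝ) : ℂ) * κ i) ((1 : ℝ) * κ i) 0 :=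
      (((hasDerivAt_id (0 : ℝ)).const_add _).ofReal_comp).mul_const _
    simpa using h3
  exact (dIm_congr isOpen_im_pos (h.eq_add i) hz).trans h2.lineDeriv

-- The term `y κ` is split off only above height `1`, where the domain is a rectangle and the
-- integral over `x` can be carried out first; `y⁻²` and `y` combine to `y⁻¹`. The factor `φ` is `1`
-- in Green's identity and `y^{-s}` in the continuation.
omit [Fintype ι] h in
lemma integral_mul_cutRem_eq {F G R : ℂ → ℂ} {κ : ℂ} {φ : ℝ → ℂ}
    (hF : ContinuousOn F {z | 0 < z.im}) (hG : ContinuousOn G {z | 0 < z.im})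
    (hφ : ContinuousOn φ (Set.Ioi 0)) (he : ∀ z, 0 < z.im → G z = z.im * κ + R z)
    {T : ℝ} (hT : 1 ≤ T) :
    ∫ z in fdT T, F z * G z * φ z.im = (∫ z in fdT T, F z * cutRem G R z * φ z.im) +
      κ * ∫ y in (1 : ℝ)..T, ((y⁻¹ : ℝ) : ℂ) * φ y * ∫ x in (-1 / 2 : ℝ)..(1 / 2), F ⟨x, y⟩ := by
  have hint : ∀ {H : ℂ → ℂ}, ContinuousOn H {z | 0 < z.im} →
      IntegrableOn (fun z : ℍ => H z) (fdT T) := fun hH =>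
    (hH.comp_continuous UpperHalfPlane.continuous_coe fun z : ℍ => z.im_pos).continuousOn.integrableOn_compact
      (isCompact_fdT T)
  have hφ' : ContinuousOn (fun z : ℂ => φ z.im) {z | 0 < z.im} :=
    hφ.comp Complex.continuous_im.continuousOn fun _ hz => hz
  have hc1 : ContinuousOn (fun z => F z * ((z.im : ℂ) * κ) * φ z.im) {z | 0 < z.im} :=
    (hF.mul (by fun_prop)).mul hφ'
  have hi1 := (hint hc1).indicator measurableSet_one_lt_im
  have hi2 : IntegrableOn (fun z : ℍ => F z * G z * φ z.im) (fdT T) := hint ((hF.mul hG).mul hφ')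
  have e : ∀ z : ℍ, F z * cutRem G R z * φ z.im = F z * G z * φ z.im -
      Set.indicator {z : ℍ | 1 < z.im} (fun z : ℍ => F z * (((z : ℂ).im : ℂ) * κ) * φ (z : ℂ).im) z := by
    intro z
    by_cases hz : 1 < z.im
    · have hz' : 1 < (z : ℂ).im := hz
      rw [Set.indicator_of_mem (by exact hz), cutRem, if_pos hz', he z z.im_pos]
      simp only [UpperHalfPlane.coe_im]
      ring
    · have hz' : ¬ 1 < (z : ℂ).im := hz
      rw [Set.indicator_of_notMem (by exact hz), cutRem, if_neg hz', sub_zero]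
  simp only [e]
  rw [integral_sub hi2 hi1, setIntegral_indicator measurableSet_one_lt_im,
    setIntegral_strip hc1 hT, sub_add_eq_add_sub, eq_sub_iff_add_eq]
  congr 1
  rw [← intervalIntegral.integral_const_mul]
  refine intervalIntegral.integral_congr fun y hy => ?_
  rw [Set.uIcc_of_le hT] at hy
  have hy0 : (y : ℂ) ≠ 0 := by exact_mod_cast (zero_lt_one.trans_le hy.1).ne'
  rw [← intervalIntegral.integral_const_mul, ← intervalIntegral.integral_const_mul]
  refine intervalIntegral.integral_congr fun x _ => ?_
  push_cast
  field_simp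

omit [Fintype ι] h in
lemma intervalIntegrable_segment {F : ℂ → ℂ} {φ : ℝ → ℂ} (hF : ContDiffOn ℝ ∞ F {z | 0 < z.im})
    (hφ : ContinuousOn φ (Set.Ioi 0)) {T : ℝ} (hT : 1 ≤ T) :
    IntervalIntegrable (fun y : ℝ => ((y⁻¹ : ℝ) : ℂ) * φ y *
      ∫ x in (-1 / 2 : ℝ)..(1 / 2), F ⟨x, y⟩) volume 1 T := by
  refine ContinuousOn.intervalIntegrable ?_
  rw [Set.uIcc_of_le hT]
  have h1 : ∀ y ∈ Set.Icc 1 T, 0 < y := fun y hy => zero_lt_one.trans_le hy.1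
  refine ((Complex.continuous_ofReal.comp_continuousOn
    (continuousOn_inv₀.mono fun y hy => (h1 y hy).ne')).mul (hφ.mono h1)).mul fun y hy => ?_
  exact (hasDerivAt_integral_segment hF (h1 y hy)).continuousAt.continuousWithinAt

lemma integral_mul_cutRem {T : ℝ} (hT : 1 ≤ T) :
    (∑ i, ∫ z in fdT T, F i z * G i z) = (∑ i, ∫ z in fdT T, F i z * cutRem (G i) (R i) z) +
      ∫ y in (1 : ℝ)..T, ((y⁻¹ : ℝ) : ℂ) * (A * (y : ℂ) ^ s' + B * (y : ℂ) ^ (1 - s')) := by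
  have h1 := fun i => integral_mul_cutRem_eq (φ := fun _ => 1) (h.smooth_left i).continuousOn
    (h.smooth_right i).continuousOn continuousOn_const (h.eq_add i) hT
  have h2 := fun i => (intervalIntegrable_segment (φ := fun _ => 1) (h.smooth_left i)
    continuousOn_const hT).const_mul (κ i)
  simp only [mul_one] at h1 h2
  rw [Finset.sum_congr rfl fun i _ => (h1 i).trans
      (by rw [← intervalIntegral.integral_const_mul (κ i)]), Finset.sum_add_distrib,
    ← intervalIntegral.integral_finsetSum fun i _ => h2 i]
  congr 1
  refine intervalIntegral.integral_congr fun y hy => ?_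
  rw [Set.uIcc_of_le hT] at hy
  simp only [mul_left_comm (κ _)]
  rw [← Finset.mul_sum, h.const y (zero_lt_one.trans_le hy.1)]

/-- The Wronskian of `F` and `y κ` in the vertical direction is `κ (F - y ∂_y F)`. On the constant
terms, `1 - y ∂_y` multiplies `y^{s'}` by `1 - s'` and `y^{1 - s'}` by `s'`. -/
lemma integral_wronskian {T : ℝ} (hT : 0 < T) :
    ∑ i, ∫ x in (-1 / 2 : ℝ)..(1 / 2), wronskian (F i) (G i) Complex.I ⟨x, T⟩ =
      ((1 - s') * A * (T : ℂ) ^ s' + s' * B * (T : ℂ) ^ (1 - s')) +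
        ∑ i, ∫ x in (-1 / 2 : ℝ)..(1 / 2), wronskian (F i) (R i) Complex.I ⟨x, T⟩ := by
  have hU := isOpen_im_pos
  have h1 : ∀ i, ∫ x in (-1 / 2 : ℝ)..(1 / 2), wronskian (F i) (G i) Complex.I ⟨x, T⟩ =
      (κ i * ∫ x in (-1 / 2 : ℝ)..(1 / 2), F i ⟨x, T⟩) -
        T * (κ i * ∫ x in (-1 / 2 : ℝ)..(1 / 2), dIm (F i) ⟨x, T⟩) +
        ∫ x in (-1 / 2 : ℝ)..(1 / 2), wronskian (F i) (R i) Complex.I ⟨x, T⟩ := by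
    intro i
    have i1 := intervalIntegrable_mk (h.smooth_left i).continuousOn hT
    have i2 := intervalIntegrable_mk (contDiffOn_dIm hU (h.smooth_left i)).continuousOn hT
    have i3 := intervalIntegrable_mk
      (contDiffOn_wronskian hU (h.smooth_left i) (h.smooth_rem i) Complex.I).continuousOn hT
    rw [← intervalIntegral.integral_const_mul, ← intervalIntegral.integral_const_mul,
      ← intervalIntegral.integral_const_mul, ← intervalIntegral.integral_sub (i1.const_mul _)
      ((i2.const_mul _).const_mul _), ← intervalIntegral.integral_add
      ((i1.const_mul _).sub ((i2.const_mul _).const_mul _)) i3]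
    refine intervalIntegral.integral_congr fun x _ => ?_
    have e1 := h.lineDeriv_right i (z := ⟨x, T⟩) hT
    have e2 := h.eq_add i ⟨x, T⟩ hT
    unfold dIm at e1 ⊢
    simp only [wronskian]
    rw [e1, e2]
    ring
  have hT' : (T : ℂ) ≠ 0 := by exact_mod_cast hT.ne'
  rw [Finset.sum_congr rfl fun i _ => h1 i, Finset.sum_add_distrib, Finset.sum_sub_distrib,
    ← Finset.mul_sum, h.const T hT, h.sum_integral_dIm hT, cpow_sub_one _ hT',
    show (T : ℂ) ^ (-s') = (T : ℂ) ^ (1 - s') / T by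
      rw [← cpow_sub_one _ hT']; congr 1; ring]
  field_simp
  ring

/-- The Green identity on the truncated domain. -/
lemma green_rem {T : ℝ} (hT : 1 ≤ T) :
    (∑ i, ∫ z in fdT T, F i z * lap 0 (G i) z) -
      s' * (1 - s') * ∑ i, ∫ z in fdT T, F i z * cutRem (G i) (R i) z =
    -((1 - s') * A + s' * B) -
      ∑ i, ∫ x in (-1 / 2 : ℝ)..(1 / 2), wronskian (F i) (R i) Complex.I ⟨x, T⟩ := by
  have h1 := h.green hT
  rw [h.integral_mul_cutRem hT, h.integral_wronskian (zero_lt_one.trans_le hT)] at h1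
  -- The powers of `T` in the boundary term cancel against those from the integral of the constant
  -- term; only the contribution of the lower limit `1` is left.
  have h2 := integral_const (s' := s') (A := A) (B := B) hT
  linear_combination h1 + h2

omit h in
lemma tendsto_growth_decay (K C : ℝ) {ρ : ℝ} (hρ : 0 < ρ) :
    Tendsto (fun T : ℝ => K * Real.exp (C * T) * (K * Real.exp (-ρ * T ^ 2))) atTop (𝓝 0) := by
  have h1 : ∀ T : ℝ, K * Real.exp (C * T) * (K * Real.exp (-ρ * T ^ 2)) =
      K * K * Real.exp (-(T * (ρ * T - C))) := fun T => by
    rw [mul_mul_mul_comm, ← Real.exp_add]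
    congr 2
    ring
  simp only [h1]
  rw [← mul_zero (K * K)]
  refine Tendsto.const_mul _ (Real.tendsto_exp_neg_atTop_nhds_zero.comp ?_)
  exact tendsto_id.atTop_mul_atTop₀
    (tendsto_atTop_add_const_right _ _ (tendsto_id.const_mul_atTop hρ))

lemma tendsto_integral_mul {H : ι → ℂ → ℂ} (hH : ∀ i, ∀ x ∈ Set.Icc (-1 / 2 : ℝ) (1 / 2),
    ∀ y : ℝ, 1 ≤ y → ‖H i ⟨x, y⟩‖ ≤ K * Real.exp (-ρ * y ^ 2)) :
    Tendsto (fun T : ℝ => ∑ i, ∫ x in (-1 / 2 : ℝ)..(1 / 2), F i ⟨x, T⟩ * H i ⟨x, T⟩) atTop (𝓝 0) := by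
  suffices hs : ∀ i, Tendsto (fun T : ℝ => ∫ x in (-1 / 2 : ℝ)..(1 / 2), F i ⟨x, T⟩ * H i ⟨x, T⟩)
      atTop (𝓝 0) by
    simpa using tendsto_finsetSum Finset.univ fun i _ => hs i
  intro i
  refine squeeze_zero_norm' ?_ (tendsto_growth_decay K C h.pos)
  filter_upwards [eventually_ge_atTop (1 : ℝ)] with T hT
  have h1 := intervalIntegral.norm_integral_le_of_norm_le_const
    (f := fun x : ℝ => F i ⟨x, T⟩ * H i ⟨x, T⟩) (a := -1 / 2) (b := 1 / 2)
    (C := K * Real.exp (C * T) * (K * Real.exp (-ρ * T ^ 2))) fun x hx => by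
      rw [Set.uIoc_of_le (by norm_num)] at hx
      have hx' := Set.Ioc_subset_Icc_self hx
      rw [norm_mul]
      exact mul_le_mul (h.growth i x hx' T hT) (hH i x hx' T hT) (norm_nonneg _)
        (mul_nonneg h.nonneg (Real.exp_pos _).le)
  refine h1.trans_eq ?_
  norm_num

/-- The Green identity. -/
theorem identity (h1 : ∀ i, IntegrableOn (fun z : ℍ => F i z * lap 0 (G i) z) ModularGroup.fd)
    (h2 : ∀ i, IntegrableOn (fun z : ℍ => F i z * cutRem (G i) (R i) z) ModularGroup.fd) :
    (∑ i, ∫ z in ModularGroup.fd, F i z * lap 0 (G i) z) =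
      s' * (1 - s') * (∑ i, ∫ z in ModularGroup.fd, F i z * cutRem (G i) (R i) z) -
        ((1 - s') * A + s' * B) := by
  have hU := isOpen_im_pos
  set E : ℂ := (∑ i, ∫ z in ModularGroup.fd, F i z * lap 0 (G i) z) -
    s' * (1 - s') * ∑ i, ∫ z in ModularGroup.fd, F i z * cutRem (G i) (R i) z with hE
  have hlim : Tendsto (fun T : ℝ => (∑ i, ∫ z in fdT T, F i z * lap 0 (G i) z) -
      s' * (1 - s') * ∑ i, ∫ z in fdT T, F i z * cutRem (G i) (R i) z) atTop (𝓝 E) :=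
    (tendsto_finsetSum _ fun i _ => tendsto_setIntegral_fdT (h1 i)).sub
      ((tendsto_finsetSum _ fun i _ => tendsto_setIntegral_fdT (h2 i)).const_mul _)
  -- No bound on the derivatives of `F` is available, so the boundary term cannot be estimated
  -- directly. It does converge, because everything else in `green_rem` does.
  have hW : Tendsto (fun T : ℝ =>
      ∑ i, ∫ x in (-1 / 2 : ℝ)..(1 / 2), wronskian (F i) (R i) Complex.I ⟨x, T⟩) atTop
      (𝓝 (-((1 - s') * A + s' * B) - E)) := by
    refine (tendsto_const_nhds.sub hlim).congr' ?_
    filter_upwards [eventually_ge_atTop (1 : ℝ)] with T hT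
    rw [h.green_rem hT]
    ring
  have hD0 := h.tendsto_integral_mul fun i x hx y hy => (h.decay i x hx y hy).1
  have hD1 := h.tendsto_integral_mul fun i x hx y hy => (h.decay i x hx y hy).2
  -- The integral of `F R` over the segment at height `T` tends to zero, and its derivative is twice
  -- the integral of `F ∂_y R`, which tends to zero, minus the boundary term. Hence the limit of the
  -- boundary term is zero.
  have hD : ∀ T : ℝ, 1 ≤ T → HasDerivAt
      (fun T : ℝ => ∑ i, ∫ x in (-1 / 2 : ℝ)..(1 / 2), F i ⟨x, T⟩ * R i ⟨x, T⟩)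
      (2 * (∑ i, ∫ x in (-1 / 2 : ℝ)..(1 / 2), F i ⟨x, T⟩ * dIm (R i) ⟨x, T⟩) -
        ∑ i, ∫ x in (-1 / 2 : ℝ)..(1 / 2), wronskian (F i) (R i) Complex.I ⟨x, T⟩) T := by
    intro T hT
    have hT0 : 0 < T := zero_lt_one.trans_le hT
    have h3 : HasDerivAt
        (fun T : ℝ => ∑ i, ∫ x in (-1 / 2 : ℝ)..(1 / 2), F i ⟨x, T⟩ * R i ⟨x, T⟩) _ T :=
      HasDerivAt.fun_sum fun i _ => hasDerivAt_integral_segment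
        ((h.smooth_left i).mul (h.smooth_rem i)) hT0
    refine h3.congr_deriv ?_
    rw [Finset.mul_sum, ← Finset.sum_sub_distrib]
    refine Finset.sum_congr rfl fun i _ => ?_
    have i1 : IntervalIntegrable (fun x : ℝ => F i ⟨x, T⟩ * dIm (R i) ⟨x, T⟩) volume
        (-1 / 2) (1 / 2) := intervalIntegrable_mk ((h.smooth_left i).continuousOn.mul
      (contDiffOn_dIm hU (h.smooth_rem i)).continuousOn) hT0
    have i3 := intervalIntegrable_mk
      (contDiffOn_wronskian hU (h.smooth_left i) (h.smooth_rem i) Complex.I).continuousOn hT0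
    rw [← intervalIntegral.integral_const_mul, ← intervalIntegral.integral_sub (i1.const_mul 2) i3]
    refine intervalIntegral.integral_congr fun x _ => ?_
    have l1 := hasLineDerivAt_of_contDiffOn hU (h.smooth_left i) (z := ⟨x, T⟩) hT0 Complex.I
    have l2 := hasLineDerivAt_of_contDiffOn hU (h.smooth_rem i) (z := ⟨x, T⟩) hT0 Complex.I
    have l3 : HasLineDerivAt ℝ (F i * R i) (lineDeriv ℝ (F i) ⟨x, T⟩ Complex.I * R i ⟨x, T⟩ +
        F i ⟨x, T⟩ * lineDeriv ℝ (R i) ⟨x, T⟩ Complex.I) ⟨x, T⟩ Complex.I := by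
      unfold HasLineDerivAt at *
      refine (l1.mul l2).congr_deriv ?_
      simp only [zero_smul, add_zero]
    refine l3.lineDeriv.trans ?_
    simp only [wronskian, dIm]
    ring
  have h0 := eq_zero_of_tendsto_deriv hD hD0 ((hD1.const_mul 2).sub hW)
  rw [hE] at h0
  linear_combination h0

end TileData

end

end ThetaLift

end

noncomputable section

namespace ThetaLift

/-! ### The tiles of a fundamental domain -/

section

open ModularGroup (T S)
open UpperHalfPlane (ofComplex)

lemma lineDeriv_translate_mul_T (f : ℍ → ℂ) (g : SL(2, ℤ)) {z : ℂ} (hz : 0 < z.im) (e : ℂ) :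
    lineDeriv ℝ (translate f (g * T)) z e = lineDeriv ℝ (translate f g) (z + 1) e := by
  have h : Set.EqOn (translate f (g * T)) (fun z => translate f g (z + 1)) {z | 0 < z.im} :=
    fun z hz => by simpa using translate_mul_T f g 1 hz
  have h1 := lineDeriv_congr_of_eqOn isOpen_im_pos h e hz
  simp only at h1
  rw [h1]
  simp only [lineDeriv, add_right_comm]

/-- Stretching `z` by `1 + t` shrinks `-1/z` by the same factor, so `S` reverses the radial
direction. -/
lemma lineDeriv_translate_mul_S {f : ℍ → ℂ} (hf : IsSmooth f) (g : SL(2, ℤ)) {z : ℂ}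
    (hz : 0 < z.im) : lineDeriv ℝ (translate f (g * S)) z z =
      -lineDeriv ℝ (translate f g) (-z)⁻¹ (-z)⁻¹ := by
  have h : Set.EqOn (translate f (g * S)) (fun z => translate f g (-z)⁻¹) {z | 0 < z.im} :=
    fun z hz => translate_mul_S f g hz
  have h1 := lineDeriv_congr_of_eqOn isOpen_im_pos h z hz
  simp only at h1
  rw [h1]
  have hw : 0 < ((-z)⁻¹).im := (⟨z, hz⟩ : ℍ).im_inv_neg_coe_pos
  have hz0 : z ≠ 0 := fun h => by simp [h] at hz
  have h2 : HasFDerivAt (translate f g) (fderiv ℝ (translate f g) (-z)⁻¹) (-z)⁻¹ :=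
    (((contDiffOn_translate hf g).differentiableOn (by simp)).differentiableAt
      (isOpen_im_pos.mem_nhds hw)).hasFDerivAt
  have h3 : HasDerivAt (fun t : ℝ => (-(z + t • z))⁻¹) (-(-z)⁻¹) 0 := by
    have h4 : HasDerivAt (fun t : ℝ => -(z + t • z)) (-((1 : ℝ) • z)) 0 :=
      (((hasDerivAt_id (0 : ℝ)).smul_const z).const_add z).neg
    have h5 := h4.inv (by simpa using hz0)
    refine h5.congr_deriv ?_
    simp only [one_smul, zero_smul, add_zero]
    field_simp
  have h6 : HasLineDerivAt ℝ (fun z => translate f g (-z)⁻¹)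
      (fderiv ℝ (translate f g) (-z)⁻¹ (-(-z)⁻¹)) z z := by
    unfold HasLineDerivAt
    exact HasFDerivAt.comp_hasDerivAt (l := translate f g) (0 : ℝ) (by simpa using h2) h3
  rw [h6.lineDeriv, map_neg, (h2.hasLineDerivAt _).lineDeriv]

variable {N : ℕ} {L : AddSubgroup V} {Γ : Subgroup SL(2, ℤ)} {f θ : ℍ → ℂ}
  {σ : Cusp N Γ → SL(2, ℤ)}

section

variable (hΓ : CongruenceSubgroup.IsCongruenceSubgroup Γ)
  (hσ : ∀ c, (Quotient.mk (cuspSetoid N Γ) (lineOf N (σ c)) : Cusp N Γ) = c)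
  [Fintype (Tile N Γ σ)] (hf : ∀ γ ∈ Γ, ∀ z, f (γ • z) = f z) (hθ : ∀ γ ∈ Γ, ∀ z, θ (γ • z) = θ z)

include hΓ hσ hf hθ

lemma sum_wronskian_tile_mul (e z : ℂ) (h : SL(2, ℤ)) :
    ∑ i, wronskian (translate f (tileMat σ i * h)) (translate θ (tileMat σ i * h)) e z =
      ∑ i, wronskian (translate f (tileMat σ i)) (translate θ (tileMat σ i)) e z :=
  sum_tile_mul hΓ σ hσ (Ψ := fun g => wronskian (translate f g) (translate θ g) e z)
    (fun γ hγ g => by rw [translate_mul (hf γ hγ), translate_mul (hθ γ hγ)])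
    (fun g => by rw [translate_neg, translate_neg]) h

/-- `T` carries the left side to the right side, and right translation by `T` does not change the
sum over the tiles. -/
lemma sum_wronskian_side {y : ℝ} (hy : 0 < y) :
    ∑ i, wronskian (translate f (tileMat σ i)) (translate θ (tileMat σ i)) 1 ⟨1 / 2, y⟩ =
      ∑ i, wronskian (translate f (tileMat σ i)) (translate θ (tileMat σ i)) 1 ⟨-1 / 2, y⟩ := by
  rw [← sum_wronskian_tile_mul hΓ hσ hf hθ 1 ⟨-1 / 2, y⟩ T]
  refine Finset.sum_congr rfl fun i _ => ?_
  have hz : 0 < (⟨-1 / 2, y⟩ : ℂ).im := hy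
  have e : (⟨-1 / 2, y⟩ : ℂ) + 1 = ⟨1 / 2, y⟩ := by
    apply Complex.ext <;> norm_num
  have e2 : ∀ f : ℍ → ℂ, translate f (tileMat σ i * T) ⟨-1 / 2, y⟩ =
      translate f (tileMat σ i) ⟨1 / 2, y⟩ := fun f => by
    have := translate_mul_T f (tileMat σ i) 1 hz
    rwa [zpow_one, Int.cast_one, e] at this
  simp only [wronskian]
  rw [lineDeriv_translate_mul_T _ _ hz, lineDeriv_translate_mul_T _ _ hz, e, e2, e2]

/-- On the unit circle `-1/z` is the reflection of `z` in the imaginary axis. Right translation by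
`S` preserves the sum over the tiles, and the sign comes from the reversal of the radial direction.
-/
lemma sum_wronskian_arc (sf : IsSmooth f) (sθ : IsSmooth θ) {x : ℝ} (hx : x ^ 2 < 1) :
    ∑ i, wronskian (translate f (tileMat σ i)) (translate θ (tileMat σ i))
        ⟨-x, arc x⟩ ⟨-x, arc x⟩ =
      -∑ i, wronskian (translate f (tileMat σ i)) (translate θ (tileMat σ i))
        ⟨x, arc x⟩ ⟨x, arc x⟩ := by
  rw [← sum_wronskian_tile_mul hΓ hσ hf hθ ⟨x, arc x⟩ ⟨x, arc x⟩ S, ← Finset.sum_neg_distrib]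
  refine Finset.sum_congr rfl fun i _ => ?_
  have hz : 0 < (⟨x, arc x⟩ : ℂ).im := arc_pos hx
  have e : (-(⟨x, arc x⟩ : ℂ))⁻¹ = ⟨-x, arc x⟩ := by
    have h1 := arc_sq hx.le
    refine inv_eq_of_mul_eq_one_right ?_
    apply Complex.ext <;> simp <;> nlinarith
  simp only [wronskian]
  rw [lineDeriv_translate_mul_S sf _ hz, lineDeriv_translate_mul_S sθ _ hz, translate_mul_S _ _ hz,
    translate_mul_S _ _ hz, e]
  ring

end

/-- A weak Maass form grows at most exponentially on the tiles. -/
lemma IsWeakMaassForm.growth_translate {lam : ℂ} (h : IsWeakMaassForm Γ lam f) {ι : Type*}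
    [Fintype ι] (g : ι → SL(2, ℤ)) : ∃ K C : ℝ, 0 ≤ K ∧ ∀ i, ∀ z : ℂ, 1 / 2 ≤ z.im → |z.re| ≤ 1 / 2 →
      ‖translate f (g i) z‖ ≤ K * Real.exp (C * z.im) := by
  obtain ⟨C, hC, hg⟩ := h.growth
  choose K Y hK using fun i => hg (g i)
  -- The growth condition only controls `f` above some height; below it, the part of the strip with
  -- `1/2 ≤ y` is compact.
  have hc : ∀ i, ∃ M, ∀ z ∈ Set.Icc (-1 / 2 : ℝ) (1 / 2) ×ℂ Set.Icc (1 / 2 : ℝ) (Y i),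
      ‖translate f (g i) z‖ ≤ M := fun i =>
    (isCompact_Icc.reProdIm isCompact_Icc).exists_bound_of_continuousOn
      ((contDiffOn_translate h.smooth (g i)).continuousOn.mono fun z hz =>
        (by norm_num : (0 : ℝ) < 1 / 2).trans_le hz.2.1)
  choose M hM using hc
  refine ⟨∑ i, (|K i| + |M i|), C, Finset.sum_nonneg fun i _ => by positivity, fun i z hz hx => ?_⟩
  have hz0 : 0 < z.im := (by norm_num : (0 : ℝ) < 1 / 2).trans_le hz
  have h1 : |K i| + |M i| ≤ ∑ i, (|K i| + |M i|) :=
    Finset.single_le_sum (f := fun i => |K i| + |M i|) (fun i _ => by positivity) (Finset.mem_univ i)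
  have h2 : 1 ≤ Real.exp (C * z.im) := Real.one_le_exp (by positivity)
  refine le_trans ?_ (mul_le_mul_of_nonneg_right h1 (Real.exp_pos _).le)
  rcases le_total (Y i) z.im with hy | hy
  · have h3 := hK i ⟨z, hz0⟩ hy
    rw [← translate_coe f] at h3
    refine h3.trans (mul_le_mul_of_nonneg_right ?_ (Real.exp_pos _).le)
    exact (le_abs_self _).trans (le_add_of_nonneg_right (abs_nonneg _))
  · have h3 := hM i z ⟨by rw [Set.mem_preimage, neg_div]; exact abs_le.mp hx, hz, hy⟩
    calc ‖translate f (g i) z‖ ≤ |M i| * 1 := by rw [mul_one]; exact h3.trans (le_abs_self _)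
      _ ≤ (|K i| + |M i|) * Real.exp (C * z.im) := by gcongr; exact le_add_of_nonneg_left (abs_nonneg _)

/-- The constant term as a sum of integrals over the tiles. -/
lemma sum_integral_tile (hΓ : CongruenceSubgroup.IsCongruenceSubgroup Γ) (hs : IsSmooth f)
    (hf : ∀ γ ∈ Γ, ∀ z, f (γ • z) = f z) (g : SL(2, ℤ)) {y : ℝ} (hy : 0 < y) :
    ∑ j : Fin (cuspWidth Γ g), ∫ x in (-1 / 2 : ℝ)..(1 / 2),
      translate f (g * T ^ ((j : ℕ) : ℤ)) ⟨x, y⟩ = cuspWidth Γ g * constTerm Γ g f y := by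
  obtain ⟨h0, hmem⟩ := cuspWidth_mem hΓ g
  set a := cuspWidth Γ g with ha
  set F : ℝ → ℂ := fun x => translate f g ⟨x, y⟩ with hF
  have hFc : Continuous F := (contDiffOn_translate hs g).continuousOn.comp_continuous
    (TileData.continuous_mk y) fun _ => hy
  -- Translation by the width is conjugate under `g` to an element of `±Γ`.
  have hper : Function.Periodic F a := by
    intro x
    have h1 : translate f (g * T ^ (a : ℤ)) = translate f g := by
      have e : g * T ^ (a : ℤ) = g * T ^ a * g⁻¹ * g := by
        rw [zpow_natCast, inv_mul_cancel_right]
      rcases hmem with hm | hm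
      · rw [e, translate_mul (hf _ hm)]
      · rw [e, ← translate_neg, ← neg_mul, translate_mul (hf _ hm)]
    have h2 := translate_mul_T f g a (z := ⟨x, y⟩) hy
    rw [h1] at h2
    simp only [hF]
    rw [h2]
    congr 1
    apply Complex.ext <;> simp
  have h2 : ∀ j : ℕ, ∫ x in (-1 / 2 : ℝ)..(1 / 2), translate f (g * T ^ (j : ℤ)) ⟨x, y⟩ =
      ∫ x in ((j : ℕ) : ℝ) - 1 / 2..((j + 1 : ℕ) : ℝ) - 1 / 2, F x := by
    intro j
    have h3 := intervalIntegral.integral_comp_add_right (a := -1 / 2) (b := 1 / 2) F (j : ℝ)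
    have e1 : (-1 / 2 : ℝ) + j = j - 1 / 2 := by ring
    have e2 : (1 / 2 : ℝ) + j = ((j + 1 : ℕ) : ℝ) - 1 / 2 := by push_cast; ring
    rw [e1, e2] at h3
    rw [← h3]
    refine intervalIntegral.integral_congr fun x _ => ?_
    simp only [hF]
    rw [translate_mul_T f g j (z := ⟨x, y⟩) hy]
    congr 1
    apply Complex.ext <;> simp
  simp only [h2]
  rw [Fin.sum_univ_eq_sum_range (fun j : ℕ =>
    ∫ x in ((j : ℕ) : ℝ) - 1 / 2..((j + 1 : ℕ) : ℝ) - 1 / 2, F x),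
    intervalIntegral.sum_integral_adjacent_intervals (a := fun j : ℕ => (j : ℝ) - 1 / 2)
      fun j _ => hFc.intervalIntegrable _ _]
  have h4 := hper.intervalIntegral_add_eq (-1 / 2) 0
  have e3 : (-1 / 2 : ℝ) + a = a - 1 / 2 := by ring
  have e4 : (-1 / 2 : ℝ) = ((0 : ℕ) : ℝ) - 1 / 2 := by norm_num
  rw [e3, zero_add] at h4
  rw [← e4, h4, constTerm, ← ha, ← mul_assoc,
    mul_one_div_cancel (Nat.cast_ne_zero.mpr h0.ne'), one_mul]
  refine intervalIntegral.integral_congr fun x _ => ?_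
  simp only [hF, translate, Complex.mk_eq_add_mul_I]

end

end ThetaLift

end

noncomputable section

namespace ThetaLift

/-! ### Integrals over a single tile -/

section

lemma ae_restrict_fd_of_forall {p : ℂ → Prop} (h : ∀ z : ℂ, 1 / 2 ≤ z.im → |z.re| ≤ 1 / 2 → p z) :
    ∀ᵐ z : ℍ ∂volume.restrict ModularGroup.fd, p z :=
  (ae_restrict_iff' measurableSet_fd).mpr
    (Eventually.of_forall fun z hz => h z (half_lt_im hz).le hz.2)

instance isFiniteMeasure_restrict_fd : IsFiniteMeasure ((volume : Measure ℍ).restrict ModularGroup.fd) :=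
  ⟨by rw [Measure.restrict_apply_univ]; exact volume_fd_lt_top⟩

lemma abs_log_le {y : ℝ} (hy : 1 / 2 ≤ y) : |Real.log y| ≤ y + 1 := by
  have hy0 : 0 < y := by linarith
  refine abs_le.mpr ⟨?_, by linarith [Real.log_le_sub_one_of_pos hy0]⟩
  have h1 := Real.log_le_sub_one_of_pos (inv_pos.mpr hy0)
  rw [Real.log_inv] at h1
  have h2 : y⁻¹ ≤ 2 := by
    rw [inv_le_comm₀ hy0 two_pos]
    linarith
  linarith

lemma exp_growth_decay_le {C ρ y : ℝ} (hρ : 0 < ρ) :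
    Real.exp (C * y) * Real.exp (-ρ * y ^ 2) ≤ Real.exp (C ^ 2 / (4 * ρ)) := by
  rw [← Real.exp_add, Real.exp_le_exp, le_div_iff₀ (by positivity)]
  nlinarith [sq_nonneg (C - 2 * ρ * y)]

/-- The integral of a rapidly decreasing function against `y ^ (-s)` is an entire function
of `s`. -/
theorem differentiable_integral_cpow {H : ℂ → ℂ} {K C ρ : ℝ} (hρ : 0 < ρ) (hK : 0 ≤ K)
    (hm : AEStronglyMeasurable (fun z : ℍ => H z) (volume.restrict ModularGroup.fd))
    (hb : ∀ z : ℂ, 1 / 2 ≤ z.im → |z.re| ≤ 1 / 2 →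
      ‖H z‖ ≤ K * (Real.exp (C * z.im) * Real.exp (-ρ * z.im ^ 2))) :
    (∀ s : ℂ, IntegrableOn (fun z : ℍ => H z * (z.im : ℂ) ^ (-s)) ModularGroup.fd) ∧
    Differentiable ℂ fun s : ℂ => ∫ z : ℍ in ModularGroup.fd, H z * (z.im : ℂ) ^ (-s) := by
  -- As `y^{-s} = exp (-s log y)`, this is an exponential family in the complex parameter `s`. Over
  -- the field `ℂ` the general result yields complex differentiability.
  have h : ExpDominated Set.univ (volume.restrict ModularGroup.fd)
      (fun (_ : Unit) (z : ℍ) => (-Real.log z.im : ℂ)) (fun _ s => s) (fun z : ℍ => H z) :=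
    { meas := hm
      bound := fun p _ => by
        refine ⟨Metric.ball p 1, Metric.ball_mem_nhds p one_pos, fun n => ?_⟩
        -- Since `|log y| ≤ y + 1`, the `n`-th power of the coefficient and the factor `y^{-s}` with
        -- `s` near `p` together grow at most like `exp (M (y + 1))`.
        set M : ℝ := n + (‖p‖ + 1) with hM
        refine ⟨fun _ => K * (Real.exp ((C + M) ^ 2 / (4 * ρ)) * Real.exp M), integrable_const _,
          ae_restrict_fd_of_forall (p := fun z => ∀ q ∈ Metric.ball p 1, ‖H z‖ *
            (1 + ∑ _i : Unit, ‖(-Real.log z.im : ℂ)‖) ^ n *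
            ‖Complex.exp (∑ _i : Unit, (-Real.log z.im : ℂ) * q)‖ ≤ _) fun z hz hx q hq => ?_⟩
        have hl := abs_log_le hz
        have h1 : ‖(-Real.log z.im : ℂ)‖ = |Real.log z.im| := by
          rw [norm_neg, Complex.norm_real, Real.norm_eq_abs]
        have hq' : ‖q‖ ≤ ‖p‖ + 1 := by
          have := norm_add_le p (q - p)
          rw [add_sub_cancel] at this
          linarith [mem_ball_iff_norm.mp hq]
        have h2 : (1 + |Real.log z.im|) ^ n ≤ Real.exp (n * (z.im + 1)) := by
          rw [Real.exp_nat_mul]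
          gcongr
          exact (add_comm _ _).trans_le ((Real.add_one_le_exp _).trans (Real.exp_le_exp.mpr hl))
        have h3 : ‖Complex.exp ((-Real.log z.im : ℂ) * q)‖ ≤ Real.exp ((‖p‖ + 1) * (z.im + 1)) := by
          refine (Complex.norm_exp_le_exp_norm _).trans (Real.exp_le_exp.mpr ?_)
          rw [norm_mul, h1, mul_comm]
          gcongr
        simp only [Finset.univ_unique, Finset.sum_singleton, h1]
        calc _ ≤ K * (Real.exp (C * z.im) * Real.exp (-ρ * z.im ^ 2)) *
              Real.exp (n * (z.im + 1)) * Real.exp ((‖p‖ + 1) * (z.im + 1)) := by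
              gcongr
              exact hb z hz hx
          _ = K * (Real.exp ((C + M) * z.im) * Real.exp (-ρ * z.im ^ 2) * Real.exp M) := by
              have e : Real.exp ((C + M) * z.im) * Real.exp M = Real.exp (C * z.im) *
                  Real.exp (n * (z.im + 1)) * Real.exp ((‖p‖ + 1) * (z.im + 1)) := by
                rw [← Real.exp_add, ← Real.exp_add, ← Real.exp_add, hM]
                ring_nf
              linear_combination (-K * Real.exp (-ρ * z.im ^ 2)) * e
          _ ≤ _ := by
              gcongr
              exact exp_growth_decay_le hρ }
  have hk : ∀ _i : Unit, AEStronglyMeasurable (fun z : ℍ => (-Real.log z.im : ℂ))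
      (volume.restrict ModularGroup.fd) := fun _ => by
    have h1 : Measurable fun z : ℍ => Real.log z.im :=
      Real.measurable_log.comp UpperHalfPlane.continuous_im.measurable
    exact (Complex.measurable_ofReal.comp h1).neg.aestronglyMeasurable
  have e : ∀ (s : ℂ) (z : ℍ), H z * Complex.exp (∑ _i : Unit, (-Real.log z.im : ℂ) * s) =
      H z * (z.im : ℂ) ^ (-s) := fun s z => by
    rw [Complex.cpow_def_of_ne_zero (Complex.ofReal_ne_zero.mpr z.im_pos.ne'),
      ← Complex.ofReal_log z.im_pos.le]
    simp
  constructor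
  · intro s
    have h1 := h.integrable hk (Set.mem_univ s)
    simp only [e] at h1
    exact h1
  · have h1 := (h.contDiffOn (𝕜 := ℂ) hk isOpen_univ fun _ => contDiffOn_id).differentiableOn (by simp)
    rw [differentiableOn_univ] at h1
    have e2 : expInt (volume.restrict ModularGroup.fd) (fun (_ : Unit) (z : ℍ) => (-Real.log z.im : ℂ))
        (fun _ s => s) (fun z : ℍ => H z) =
        fun s : ℂ => ∫ z : ℍ in ModularGroup.fd, H z * (z.im : ℂ) ^ (-s) := by
      funext s
      simp only [expInt, e]
    rwa [← e2]

variable {ν δ β : ℝ} {w : ℤ × ℤ × ℤ → ℂ} {t : ℂ}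

open TileData (cutRem)

/-- The theta series, with the constant term removed above height `1`. -/
def cutSeries (ν δ β : ℝ) (w : ℤ × ℤ × ℤ → ℂ) (t : ℂ) : ℂ → ℂ :=
  cutRem (thetaSeries ν δ β w t) (thetaSeries ν δ β (remWeight w) t)

/-- The weights of `cutSeries`. -/
def cutWeight (w : ℤ × ℤ × ℤ → ℂ) (m : ℤ × ℤ × ℤ) (z : ℍ) : ℂ :=
  if 1 < z.im then remWeight w m else w m

lemma tsum_cutWeight (ν δ β : ℝ) (w : ℤ × ℤ × ℤ → ℂ) (t : ℂ) (z : ℍ) :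
    ∑' m, cutWeight w m z * thetaTerm ν δ β m t z = cutSeries ν δ β w t z := by
  by_cases hz : 1 < z.im
  · have hz' : 1 < (z : ℂ).im := hz
    simp only [cutWeight, cutSeries, cutRem, if_pos hz, if_pos hz', thetaSeries]
  · have hz' : ¬ 1 < (z : ℂ).im := hz
    simp only [cutWeight, cutSeries, cutRem, if_neg hz, if_neg hz', thetaSeries]

variable (hν : 0 < ν) (hδ : 0 < δ) (hβ : 0 < β) (ht : 0 < t.im) (hw : ∀ m, ‖w m‖ ≤ 1)

include hν hδ hβ ht hw

/-- The terms removed above height `1` are annihilated by the Laplacian in `z`, so the cut-off is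
invisible here and the result is the Laplacian of the smooth, uncut series. -/
lemma tsum_cutWeight_symbolZ (z : ℍ) :
    ∑' m, cutWeight w m z * (symbolZ ν δ β t m z * thetaTerm ν δ β m t z) =
      lap 0 (thetaSeries ν δ β w t) z := by
  rw [(lap_thetaSeries hν hδ hβ ht hw z.im_pos).2]
  refine tsum_congr fun m => ?_
  by_cases hm : m.2 = 0
  · rw [show m = (m.1, 0, 0) from Prod.ext rfl hm, symbolZ_eq_zero _ _ _ _ _ z.im_pos]
    simp
  · simp [cutWeight, remWeight, hm]

lemma norm_cutSeries_le : ∃ K ρ : ℝ, 0 ≤ K ∧ 0 < ρ ∧ ∀ z : ℂ, 1 / 2 ≤ z.im → |z.re| ≤ 1 / 2 →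
    ‖cutSeries ν δ β w t z‖ ≤ K * Real.exp (-ρ * z.im ^ 2) := by
  obtain ⟨K, ρ, hK, hρ, hd⟩ := thetaSeries_decay hν hδ hβ ht hw (1 / 2) (y₁ := 1 / 2) (by norm_num)
  -- Below height `1` the constant term is still present; there `y ≤ 1` and `exp (-ρ y²) ≥ exp
  -- (-ρ)`, whence the factor `exp ρ`.
  refine ⟨K + ‖thetaConst ν δ β w t‖ * Real.exp ρ, ρ, by positivity, hρ, fun z hz hx => ?_⟩
  have h1 := (hd z hz hx).1
  have hz0 : 0 < z.im := by linarith
  rw [add_mul]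
  unfold cutSeries cutRem
  split_ifs with hy
  · exact h1.trans (le_add_of_nonneg_right (by positivity))
  · rw [thetaSeries_eq_add hν hδ hβ ht hw hz0, add_comm (K * _)]
    refine (norm_add_le _ _).trans (add_le_add ?_ h1)
    rw [norm_mul, Complex.norm_real, Real.norm_of_nonneg hz0.le, mul_comm, mul_assoc, ← Real.exp_add]
    gcongr
    exact (not_lt.mp hy).trans (Real.one_le_exp (by
      nlinarith [mul_nonneg hρ.le (by nlinarith [not_lt.mp hy] : 0 ≤ 1 - z.im ^ 2)]))

lemma measurable_cutSeries : Measurable fun z : ℍ => cutSeries ν δ β w t z := by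
  have h1 : ∀ {w : ℤ × ℤ × ℤ → ℂ}, (∀ m, ‖w m‖ ≤ 1) →
      Measurable fun z : ℍ => thetaSeries ν δ β w t z := fun hw =>
    ((contDiffOn_thetaSeries hν hδ hβ ht hw).continuousOn.comp_continuous
      UpperHalfPlane.continuous_coe fun z : ℍ => z.im_pos).measurable
  exact Measurable.ite measurableSet_one_lt_im (h1 (norm_remWeight_le hw)) (h1 hw)

omit hν hδ hβ ht in
lemma thetaData_tile {F : ℂ → ℂ} {K C : ℝ} (hF : ContinuousOn F {z | 0 < z.im})
    (hb : ∀ z : ℂ, 1 / 2 ≤ z.im → |z.re| ≤ 1 / 2 → ‖F z‖ ≤ K * Real.exp (C * z.im)) :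
    ThetaData (volume.restrict ModularGroup.fd) (fun z : ℍ => F z) (cutWeight w) (1 / 2) (1 / 2) K C where
  y_pos := by norm_num
  meas := (hF.comp_continuous UpperHalfPlane.continuous_coe
    fun z : ℍ => z.im_pos).aestronglyMeasurable
  weight_meas m := Measurable.ite measurableSet_one_lt_im measurable_const measurable_const
  weight_le m z := by
    unfold cutWeight
    split_ifs
    exacts [norm_remWeight_le hw m, hw m]
  support m z hz := by
    by_contra! h
    exact hz (by simp [cutWeight, remWeight, h.1, h.2])
  strip := ae_restrict_fd_of_forall (p := fun z => 1 / 2 ≤ z.im ∧ |z.re| ≤ 1 / 2 ∧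
    ‖F z‖ ≤ K * Real.exp (C * z.im)) fun z hz hx => ⟨hz, hx, hb z hz hx⟩

lemma differentiable_integral_cutSeries {F : ℂ → ℂ} {K C : ℝ} (hK : 0 ≤ K)
    (hF : ContinuousOn F {z | 0 < z.im})
    (hb : ∀ z : ℂ, 1 / 2 ≤ z.im → |z.re| ≤ 1 / 2 → ‖F z‖ ≤ K * Real.exp (C * z.im)) :
    (∀ s : ℂ, IntegrableOn (fun z : ℍ => F z * cutSeries ν δ β w t z * (z.im : ℂ) ^ (-s))
      ModularGroup.fd) ∧
    Differentiable ℂ fun s : ℂ =>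
      ∫ z : ℍ in ModularGroup.fd, F z * cutSeries ν δ β w t z * (z.im : ℂ) ^ (-s) := by
  obtain ⟨K', ρ, hK', hρ, hc⟩ := norm_cutSeries_le hν hδ hβ ht hw
  refine differentiable_integral_cpow (H := fun z => F z * cutSeries ν δ β w t z) (K := K * K')
    (C := C) hρ (mul_nonneg hK hK') ?_ fun z hz hx => ?_
  · exact (thetaData_tile hw hF hb).meas.mul
      (measurable_cutSeries hν hδ hβ ht hw).aestronglyMeasurable
  · rw [norm_mul, mul_mul_mul_comm]
    exact mul_le_mul (hb z hz hx) (hc z hz hx) (norm_nonneg _) (by positivity)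

end

/-! ### Integrals of the constant terms up the cusp -/

section

/-- The integrals of the terms `y ^ a` which grow at a cusp. -/
lemma tendsto_integral_cpow {a s : ℂ} (hs : a.re < s.re) :
    Tendsto (fun T : ℝ => ∫ y in (1 : ℝ)..T, ((y⁻¹ : ℝ) : ℂ) * (y : ℂ) ^ (-s) * (y : ℂ) ^ a) atTop
      (𝓝 (1 / (s - a))) := by
  have hne : a - s ≠ 0 := fun h => by
    rw [sub_eq_zero] at h
    simp [h] at hs
  have h1 : ∀ᶠ T : ℝ in atTop, ((T : ℂ) ^ (a - s) - 1) / (a - s) =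
      ∫ y in (1 : ℝ)..T, ((y⁻¹ : ℝ) : ℂ) * (y : ℂ) ^ (-s) * (y : ℂ) ^ a := by
    filter_upwards [eventually_ge_atTop (1 : ℝ)] with T hT
    have h2 := integral_cpow (a := 1) (b := T) (r := a - s - 1) (Or.inr ⟨fun h => hne (by
      linear_combination h), fun h => by
        rw [Set.uIcc_of_le hT] at h; exact absurd h.1 (by norm_num)⟩)
    rw [sub_add_cancel, Complex.ofReal_one, Complex.one_cpow] at h2
    rw [← h2]
    refine intervalIntegral.integral_congr fun y hy => ?_
    rw [Set.uIcc_of_le hT] at hy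
    have hy0 : (y : ℂ) ≠ 0 := by exact_mod_cast (zero_lt_one.trans_le hy.1).ne'
    simp only [Complex.ofReal_inv]
    rw [TileData.cpow_sub_one _ hy0, sub_eq_add_neg, Complex.cpow_add _ _ hy0]
    ring
  refine Tendsto.congr' h1 ?_
  have h3 : Tendsto (fun T : ℝ => (T : ℂ) ^ (a - s)) atTop (𝓝 0) := by
    rw [tendsto_zero_iff_norm_tendsto_zero]
    refine (tendsto_rpow_neg_atTop (y := s.re - a.re) (by linarith)).congr' ?_
    filter_upwards [eventually_gt_atTop (0 : ℝ)] with T hT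
    rw [Complex.norm_cpow_eq_rpow_re_of_pos hT, Complex.sub_re, neg_sub]
  have h4 := (h3.sub_const 1).div_const (a - s)
  rwa [zero_sub, neg_div, ← one_div_neg_eq_neg_one_div, neg_sub] at h4

lemma continuousOn_ofReal_cpow (a : ℂ) : ContinuousOn (fun y : ℝ => (y : ℂ) ^ a) (Set.Ioi 0) :=
  fun y hy => ((Complex.continuousAt_ofReal_cpow_const y a (Or.inr (ne_of_gt hy)))).continuousWithinAt

lemma tendsto_integral_const {A B s' s : ℂ} (h1 : s'.re < s.re) (h2 : (1 - s').re < s.re) :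
    Tendsto (fun T : ℝ => ∫ y in (1 : ℝ)..T, ((y⁻¹ : ℝ) : ℂ) * (y : ℂ) ^ (-s) *
      (A * (y : ℂ) ^ s' + B * (y : ℂ) ^ (1 - s'))) atTop
      (𝓝 (A / (s - s') + B / (s - (1 - s')))) := by
  have h3 := ((tendsto_integral_cpow h1).const_mul A).add ((tendsto_integral_cpow h2).const_mul B)
  rw [mul_one_div, mul_one_div] at h3
  refine h3.congr' ?_
  filter_upwards [eventually_ge_atTop (1 : ℝ)] with T hT
  have hi : ∀ a : ℂ, IntervalIntegrable (fun y : ℝ => ((y⁻¹ : ℝ) : ℂ) * (y : ℂ) ^ (-s) * (y : ℂ) ^ a)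
      volume 1 T := fun a => by
    refine ContinuousOn.intervalIntegrable ?_
    rw [Set.uIcc_of_le hT]
    have hp : ∀ y ∈ Set.Icc 1 T, 0 < y := fun y hy => zero_lt_one.trans_le hy.1
    exact ((Complex.continuous_ofReal.comp_continuousOn
      (continuousOn_inv₀.mono fun y hy => (hp y hy).ne')).mul
      ((continuousOn_ofReal_cpow _).mono hp)).mul ((continuousOn_ofReal_cpow _).mono hp)
  rw [← intervalIntegral.integral_const_mul, ← intervalIntegral.integral_const_mul,
    ← intervalIntegral.integral_add ((hi _).const_mul _) ((hi _).const_mul _)]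
  refine intervalIntegral.integral_congr fun y _ => ?_
  ring

end

/-! ### Calculus of constant terms of Laurent expansions -/

section

lemma HasLaurentConstTerm.add {H H' : ℂ → ℂ} {s₀ c c' : ℂ} (h : HasLaurentConstTerm H s₀ c)
    (h' : HasLaurentConstTerm H' s₀ c') :
    HasLaurentConstTerm (fun s => H s + H' s) s₀ (c + c') := by
  obtain ⟨P, hP, g, hg, hc, e⟩ := h
  obtain ⟨P', hP', g', hg', hc', e'⟩ := h'
  refine ⟨P + P', by simp [hP, hP'], fun s => g s + g' s, hg.add hg', by simp only [hc, hc'], ?_⟩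
  filter_upwards [e, e'] with s h1 h2
  rw [h1, h2, Polynomial.eval_add]
  ring

lemma HasLaurentConstTerm.of_analyticAt {H : ℂ → ℂ} {s₀ : ℂ} (h : AnalyticAt ℂ H s₀) :
    HasLaurentConstTerm H s₀ (H s₀) :=
  ⟨0, by simp, H, h, rfl, by simp⟩

/-- The constant term at `0` of `a / (s - p)`; for `p = 0` it is zero. -/
lemma hasLaurentConstTerm_div (a p : ℂ) : HasLaurentConstTerm (fun s => a / (s - p)) 0 (-(a / p)) := by
  by_cases hp : p = 0
  · subst hp
    refine ⟨Polynomial.C a * Polynomial.X, by simp, fun _ => 0, analyticAt_const, by simp, ?_⟩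
    exact Eventually.of_forall fun s => by simp [div_eq_mul_inv]
  · have h : AnalyticAt ℂ (fun s => a / (s - p)) 0 :=
      analyticAt_const.div (analyticAt_id.sub analyticAt_const) (by simpa using hp)
    have := HasLaurentConstTerm.of_analyticAt h
    simpa [div_neg] using this

end

end ThetaLift

end

noncomputable section

namespace ThetaLift

/-! ### The regularized theta lift as a sum of integrals over the tiles -/

section

variable {ι : Type*} [Fintype ι] {F : ι → ℂ → ℂ}

lemma lineDeriv_sum_mul (c : ι → ℂ) (hF : ∀ i, ContDiffOn ℝ ∞ (F i) {z | 0 < z.im}) (e : ℂ) :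
    Set.EqOn (fun z => lineDeriv ℝ (fun z => ∑ i, c i * F i z) z e)
      (fun z => ∑ i, c i * lineDeriv ℝ (F i) z e) {z | 0 < z.im} := fun z hz => by
  refine HasLineDerivAt.lineDeriv ?_
  have h := fun i => hasLineDerivAt_of_contDiffOn isOpen_im_pos (hF i) hz e
  unfold HasLineDerivAt at *
  exact HasDerivAt.fun_sum fun i _ => (h i).const_mul _

lemma lap_sum_mul (k : ℝ) (c : ι → ℂ) (hF : ∀ i, ContDiffOn ℝ ∞ (F i) {z | 0 < z.im}) {t : ℂ}
    (ht : 0 < t.im) : lap k (fun z => ∑ i, c i * F i z) t = ∑ i, c i * lap k (F i) t := by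
  have h2 : ∀ e : ℂ, lineDeriv ℝ (fun z => lineDeriv ℝ (fun z => ∑ i, c i * F i z) z e) t e =
      ∑ i, c i * lineDeriv ℝ (fun z => lineDeriv ℝ (F i) z e) t e := fun e =>
    (lineDeriv_congr_of_eqOn isOpen_im_pos (lineDeriv_sum_mul c hF e) e ht).trans
      (lineDeriv_sum_mul c (fun i => contDiffOn_lineDeriv isOpen_im_pos (hF i) e) e ht)
  have h1 := fun e => lineDeriv_sum_mul c hF e ht
  simp only at h1
  unfold lap
  have d1 : ∀ H, dRe H = fun w => lineDeriv ℝ H w 1 := fun _ => rfl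
  have d2 : ∀ H, dIm H = fun w => lineDeriv ℝ H w Complex.I := fun _ => rfl
  simp only [d1, d2, h1, h2, Finset.mul_sum, ← Finset.sum_add_distrib]
  refine Finset.sum_congr rfl fun i _ => ?_
  ring

end

/-! ### Theta expansions on the tiles and the hypotheses of Green's identity -/

open UpperHalfPlane (ofComplex)
open TileData (cutRem)

/-- An expansion of the theta function at the cusp `g ∞`. -/
structure IsThetaExpansion (N : ℕ) (L : AddSubgroup V) (d : Disc N L) (g : SL(2, ℤ)) (δ : ℝ)
    (w : ℤ × ℤ × ℤ → ℂ) : Prop where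
  pos : 0 < δ
  pos_beta : 0 < cuspBeta L g
  norm_le : ∀ m, ‖w m‖ ≤ 1
  theta_eq : ∀ τ z : ℍ, theta N L d τ (g • z) =
    1 / (cuspBeta L g * √N) * thetaSeries N δ (cuspBeta L g) w τ z
  tildeTheta_eq : ∀ τ : ℍ, tildeTheta N L (lineOf N g) d τ = thetaConst N δ (cuspBeta L g) w τ

lemma exists_isThetaExpansion {N : ℕ} (hN : 0 < N) {L : AddSubgroup V} (hL : IsEvenLattice N L)
    (d : Disc N L) (g : SL(2, ℤ)) : ∃ δ w, IsThetaExpansion N L d g δ w := by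
  obtain ⟨h0, δ, w, h1, h2, h3, h4⟩ := exists_thetaSeries hN hL g d
  exact ⟨δ, w, h1, h0, h2, h3, h4⟩

/-- The function `f(g z)`, with the factor which occurs in the expansion of the theta function. -/
def tileForm (N : ℕ) (L : AddSubgroup V) (f : ℍ → ℂ) (g : SL(2, ℤ)) (z : ℂ) : ℂ :=
  1 / (cuspBeta L g * √N) * translate f g z

section

variable {N : ℕ} {L : AddSubgroup V} {d : Disc N L} {g : SL(2, ℤ)} {δ : ℝ} {w : ℤ × ℤ × ℤ → ℂ}
  {f : ℍ → ℂ} {τ : ℍ}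

lemma contDiffOn_tileForm (hf : IsSmooth f) (g : SL(2, ℤ)) :
    ContDiffOn ℝ ∞ (tileForm N L f g) {z | 0 < z.im} :=
  contDiffOn_const.mul (contDiffOn_translate hf g)

lemma lineDeriv_const_mul' (c : ℂ) (F : ℂ → ℂ) (z e : ℂ) :
    lineDeriv ℝ (fun z => c * F z) z e = c * lineDeriv ℝ F z e :=
  deriv_const_mul_field c

variable (hN : 0 < N) (h : IsThetaExpansion N L d g δ w)

include h

lemma IsThetaExpansion.translate_theta {z : ℂ} (hz : 0 < z.im) : translate (theta N L d τ) g z =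
    1 / (cuspBeta L g * √N) * thetaSeries N δ (cuspBeta L g) w τ z := by
  rw [translate, h.theta_eq, UpperHalfPlane.ofComplex_apply_of_im_pos hz]

lemma IsThetaExpansion.mul_theta (z : ℍ) : f (g • z) * theta N L d τ (g • z) =
    tileForm N L f g z * thetaSeries N δ (cuspBeta L g) w τ z := by
  rw [h.theta_eq, tileForm, translate_coe f]
  ring

lemma IsThetaExpansion.wronskian_eq {z : ℂ} (hz : 0 < z.im) (e : ℂ) :
    wronskian (tileForm N L f g) (thetaSeries N δ (cuspBeta L g) w τ) e z =
      wronskian (translate f g) (translate (theta N L d τ) g) e z := by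
  have h1 := lineDeriv_congr_of_eqOn isOpen_im_pos
    (fun z hz => h.translate_theta (τ := τ) (z := z) hz) e hz
  simp only [lineDeriv_const_mul'] at h1
  have h2 : lineDeriv ℝ (tileForm N L f g) z e = _ := lineDeriv_const_mul' _ _ z e
  rw [wronskian, wronskian, h1, h2, h.translate_theta hz, tileForm]
  ring

include hN in
lemma IsThetaExpansion.contDiffOn_thetaSeries :
    ContDiffOn ℝ ∞ (thetaSeries N δ (cuspBeta L g) w τ) {z | 0 < z.im} :=
  ThetaLift.contDiffOn_thetaSeries (Nat.cast_pos.mpr hN) h.pos h.pos_beta τ.im_pos h.norm_le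

omit h in
include hN in
lemma isSmooth_theta (hL : IsEvenLattice N L) (d : Disc N L) (τ : ℍ) :
    IsSmooth (theta N L d τ) := by
  obtain ⟨δ, w, h⟩ := exists_isThetaExpansion hN hL d 1
  refine ((contDiffOn_const (c := (1 / (cuspBeta L 1 * √N) : ℂ))).mul
    (h.contDiffOn_thetaSeries hN (τ := τ))).congr fun z hz => ?_
  rw [← h.translate_theta hz, translate, one_smul, Function.comp_apply]

end

section

variable {N : ℕ} {L : AddSubgroup V} {Γ : Subgroup SL(2, ℤ)} {σ : Cusp N Γ → SL(2, ℤ)}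
  {s' : ℂ} {f : ℍ → ℂ} {A B : Cusp N Γ → ℂ} {d : Disc N L} {δ : Tile N Γ σ → ℝ}
  {w : Tile N Γ σ → ℤ × ℤ × ℤ → ℂ}

lemma cuspBeta_tileMat (i : Tile N Γ σ) : cuspBeta L (tileMat σ i) = cuspBeta L (σ i.1) :=
  cuspBeta_mul_T L _ _

lemma lineOf_tileMat (i : Tile N Γ σ) : lineOf N (tileMat σ i) = lineOf N (σ i.1) :=
  lineOf_mul_T _ _

/-- The integrals of the form over the horizontal sections of the tiles of a cusp. -/
lemma sum_integral_tileForm (hΓ : CongruenceSubgroup.IsCongruenceSubgroup Γ) (hs : IsSmooth f)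
    (hf : ∀ γ ∈ Γ, ∀ z, f (γ • z) = f z) (c : Cusp N Γ) {y : ℝ} (hy : 0 < y) :
    ∑ j : Fin (cuspWidth Γ (σ c)), ∫ x in (-1 / 2 : ℝ)..(1 / 2),
      tileForm N L f (tileMat σ ⟨c, j⟩) ⟨x, y⟩ =
        cuspEps L Γ (σ c) / √N * constTerm Γ (σ c) f y := by
  simp only [tileForm, cuspBeta_tileMat, intervalIntegral.integral_const_mul]
  rw [← Finset.mul_sum]
  simp only [tileMat]
  rw [sum_integral_tile hΓ hs hf (σ c) hy, cuspEps]
  push_cast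
  rw [div_div]
  ring

variable (hN : 0 < N) (hL : IsEvenLattice N L) (hΓ : CongruenceSubgroup.IsCongruenceSubgroup Γ)
  (hΓL : ActsTriviallyOnDisc N L Γ)
  (hσ : ∀ c, (Quotient.mk (cuspSetoid N Γ) (lineOf N (σ c)) : Cusp N Γ) = c)
  (hf : IsWeakMaassForm Γ (s' * (1 - s')) f)
  (hAB : ∀ c, ∀ y : ℝ, 0 < y →
    constTerm Γ (σ c) f y = A c * (y : ℂ) ^ s' + B c * (y : ℂ) ^ (1 - s'))
  (hw : ∀ i, IsThetaExpansion N L d (tileMat σ i) (δ i) (w i))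

include hf in
lemma growth_tileForm [Fintype (Cusp N Γ)] : ∃ K C : ℝ, 0 ≤ K ∧ ∀ i : Tile N Γ σ, ∀ z : ℂ,
    1 / 2 ≤ z.im → |z.re| ≤ 1 / 2 →
      ‖tileForm N L f (tileMat σ i) z‖ ≤ K * Real.exp (C * z.im) := by
  obtain ⟨K, C, hK, h⟩ := hf.growth_translate (tileMat σ)
  set D : Tile N Γ σ → ℝ := fun i => ‖(1 / (cuspBeta L (tileMat σ i) * √N) : ℂ)‖ with hD
  have hD0 : ∀ i, 0 ≤ D i := fun i => norm_nonneg _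
  refine ⟨(∑ i, D i) * K, C, mul_nonneg (Finset.sum_nonneg fun i _ => hD0 i) hK,
    fun i z hz hx => ?_⟩
  rw [tileForm, norm_mul, mul_assoc]
  exact mul_le_mul (Finset.single_le_sum (fun i _ => hD0 i) (Finset.mem_univ i)) (h i z hz hx)
    (norm_nonneg _) (Finset.sum_nonneg fun i _ => hD0 i)

include hN hw in
lemma decay_tile [Fintype (Cusp N Γ)] (τ : ℍ) : ∃ K ρ : ℝ, 0 ≤ K ∧ 0 < ρ ∧ ∀ i : Tile N Γ σ,
    ∀ z : ℂ, 1 / 2 ≤ z.im → |z.re| ≤ 1 / 2 →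
      ‖thetaSeries N (δ i) (cuspBeta L (tileMat σ i)) (remWeight (w i)) τ z‖ ≤
        K * Real.exp (-ρ * z.im ^ 2) ∧
      ‖dIm (thetaSeries N (δ i) (cuspBeta L (tileMat σ i)) (remWeight (w i)) τ) z‖ ≤
        K * Real.exp (-ρ * z.im ^ 2) := by
  choose K ρ hK hρ h using fun i => thetaSeries_decay (Nat.cast_pos.mpr hN) (hw i).pos
    (hw i).pos_beta τ.im_pos (hw i).norm_le (1 / 2) (y₁ := 1 / 2) (by norm_num)
  -- There are finitely many tiles, so the smallest exponent serves for all of them.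
  obtain ⟨ρ', hρ', hle⟩ : ∃ ρ' : ℝ, 0 < ρ' ∧ ∀ i, ρ' ≤ ρ i := by
    rcases isEmpty_or_nonempty (Tile N Γ σ) with he | hne
    · exact ⟨1, one_pos, fun i => he.elim i⟩
    · obtain ⟨i, hi⟩ := Finite.exists_min ρ
      exact ⟨ρ i, hρ i, hi⟩
  refine ⟨∑ i, K i, ρ', Finset.sum_nonneg fun i _ => (hK i).le, hρ', fun i z hz hx => ?_⟩
  have h1 : K i * Real.exp (-ρ i * z.im ^ 2) ≤ (∑ i, K i) * Real.exp (-ρ' * z.im ^ 2) := by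
    refine mul_le_mul (Finset.single_le_sum (fun i _ => (hK i).le) (Finset.mem_univ i)) ?_
      (Real.exp_pos _).le (Finset.sum_nonneg fun i _ => (hK i).le)
    rw [Real.exp_le_exp, neg_mul, neg_mul, neg_le_neg_iff]
    exact mul_le_mul_of_nonneg_right (hle i) (sq_nonneg _)
  exact ⟨(h i z hz hx).1.trans h1, (h i z hz hx).2.trans h1⟩

-- The coefficient of `y` depends only on the cusp, since `T` fixes `u₀`. Hence the tiles of one
-- cusp assemble to the constant term of `f` there, with factor `ε / √N`. The side and arc
-- conditions come from the `Γ`-invariance of `f` and of the theta function.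
include hN hL hΓ hΓL hσ hf hAB hw in
theorem exists_tileData [Fintype (Cusp N Γ)] (τ : ℍ) : ∃ K C ρ : ℝ, TileData s'
    (fun i : Tile N Γ σ => tileForm N L f (tileMat σ i))
    (fun i => thetaSeries N (δ i) (cuspBeta L (tileMat σ i)) (w i) τ)
    (fun i => thetaSeries N (δ i) (cuspBeta L (tileMat σ i)) (remWeight (w i)) τ)
    (fun i => tildeTheta N L (lineOf N (σ i.1)) d τ)
    (∑ c, A c * cuspEps L Γ (σ c) / √N * tildeTheta N L (lineOf N (σ c)) d τ)
    (∑ c, B c * cuspEps L Γ (σ c) / √N * tildeTheta N L (lineOf N (σ c)) d τ) K C ρ := by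
  obtain ⟨K, C, hK, hg⟩ := growth_tileForm (L := L) (σ := σ) hf
  obtain ⟨K', ρ, hK', hρ, hd⟩ := decay_tile hN hw τ
  have hN' : (0 : ℝ) < N := Nat.cast_pos.mpr hN
  have hstrip : ∀ x ∈ Set.Icc (-1 / 2 : ℝ) (1 / 2), |x| ≤ 1 / 2 := fun x hx =>
    abs_le.mpr ⟨by linarith [hx.1], hx.2⟩
  have hle : ∀ {a b : ℝ}, a ≤ K' * Real.exp b → a ≤ (K + K') * Real.exp b := fun h =>
    h.trans (mul_le_mul_of_nonneg_right (le_add_of_nonneg_left hK) (Real.exp_pos _).le)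
  have hinv : ∀ γ ∈ Γ, ∀ z, theta N L d τ (γ • z) = theta N L d τ z := fun γ hγ z =>
    theta_smul hΓL d τ z hγ
  refine ⟨K + K', C, ρ,
    { smooth_left := fun i => contDiffOn_tileForm hf.smooth _
      smooth_right := fun i => (hw i).contDiffOn_thetaSeries hN
      smooth_rem := fun i => contDiffOn_thetaSeries hN' (hw i).pos (hw i).pos_beta τ.im_pos
        (norm_remWeight_le (hw i).norm_le)
      eigen := fun i z hz => ?_
      eq_add := fun i z hz => ?_
      side := fun y hy => ?_
      arc_symm := fun x hx => ?_
      nonneg := add_nonneg hK hK'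
      pos := hρ
      growth := fun i x hx y hy => (hg i ⟨x, y⟩ (by simp only; linarith) (hstrip x hx)).trans
        (mul_le_mul_of_nonneg_right (le_add_of_nonneg_right hK') (Real.exp_pos _).le)
      decay := fun i x hx y hy => by
        have := hd i ⟨x, y⟩ (by simp only; linarith) (hstrip x hx)
        exact ⟨hle this.1, hle this.2⟩
      const := fun y hy => ?_ }⟩
  · have h1 := lap_sum_mul 0 (ι := Unit) (F := fun _ => translate f (tileMat σ i))
      (fun _ => 1 / (cuspBeta L (tileMat σ i) * √N)) (fun _ => contDiffOn_translate hf.smooth _) hz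
    simp only [Finset.univ_unique, Finset.sum_singleton] at h1
    have h2 := hf.eigen (tileMat σ i • ofComplex z)
    rw [← lap_translate hf.smooth _ hz] at h2
    refine h1.trans ?_
    rw [h2, tileForm, translate]
    ring
  · rw [thetaSeries_eq_add hN' (hw i).pos (hw i).pos_beta τ.im_pos (hw i).norm_le hz,
      ← (hw i).tildeTheta_eq, lineOf_tileMat]
  · rw [Finset.sum_congr rfl fun i _ => (hw i).wronskian_eq (f := f) (τ := τ) (z := ⟨1 / 2, y⟩) hy 1,
      Finset.sum_congr rfl fun i _ => (hw i).wronskian_eq (f := f) (τ := τ) (z := ⟨-1 / 2, y⟩) hy 1]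
    exact sum_wronskian_side hΓ hσ hf.invariant hinv hy
  · have ha := arc_pos hx
    rw [Finset.sum_congr rfl fun i _ => (hw i).wronskian_eq (f := f) (τ := τ) (z := ⟨-x, arc x⟩) ha _,
      Finset.sum_congr rfl fun i _ => (hw i).wronskian_eq (f := f) (τ := τ) (z := ⟨x, arc x⟩) ha _]
    exact sum_wronskian_arc hΓ hσ hf.invariant hinv hf.smooth (isSmooth_theta hN hL d τ) hx
  · rw [Fintype.sum_sigma, Finset.sum_mul, Finset.sum_mul, ← Finset.sum_add_distrib]
    refine Finset.sum_congr rfl fun c _ => ?_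
    simp only
    rw [← Finset.mul_sum, sum_integral_tileForm hΓ hf.smooth hf.invariant c hy, hAB c y hy]
    ring

end

end ThetaLift

end

noncomputable section

namespace ThetaLift

/-! ### The continuation of the regularized integral -/

section

lemma HasLaurentConstTerm.sum {ι : Type*} (S : Finset ι) {H : ι → ℂ → ℂ} {s₀ : ℂ} {c : ι → ℂ}
    (h : ∀ i ∈ S, HasLaurentConstTerm (H i) s₀ (c i)) :
    HasLaurentConstTerm (fun s => ∑ i ∈ S, H i s) s₀ (∑ i ∈ S, c i) := by
  classical
  induction S using Finset.induction_on with
  | empty => simpa using HasLaurentConstTerm.of_analyticAt (H := fun _ => 0) (s₀ := s₀) analyticAt_const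
  | insert a S ha ih =>
    simp only [Finset.sum_insert ha]
    exact (h a (Finset.mem_insert_self a S)).add (ih fun i hi => h i (Finset.mem_insert_of_mem hi))

variable {N : ℕ} {L : AddSubgroup V} {Γ : Subgroup SL(2, ℤ)} {σ : Cusp N Γ → SL(2, ℤ)}
  {s' : ℂ} {f : ℍ → ℂ} {A B : Cusp N Γ → ℂ} {d : Disc N L} {δ : Tile N Γ σ → ℝ}
  {w : Tile N Γ σ → ℤ × ℤ × ℤ → ℂ}

/-- The integral over a tile of the form against the theta function, with the leading term of the
latter removed above height `1`. -/
def tileIntegral (N : ℕ) (L : AddSubgroup V) (f : ℍ → ℂ) (g : SL(2, ℤ)) (δ : ℝ)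
    (w : ℤ × ℤ × ℤ → ℂ) (τ : ℍ) (s : ℂ) : ℂ :=
  ∫ z : ℍ in ModularGroup.fd,
    tileForm N L f g z * cutSeries N δ (cuspBeta L g) w τ z * (z.im : ℂ) ^ (-s)

/-- The limit of the truncated integrals at the cusp `c`. -/
def cuspIntegral (L : AddSubgroup V) (σ : Cusp N Γ → SL(2, ℤ)) (f : ℍ → ℂ) (s' : ℂ)
    (A B : Cusp N Γ → ℂ) (d : Disc N L) (δ : Tile N Γ σ → ℝ) (w : Tile N Γ σ → ℤ × ℤ × ℤ → ℂ)
    (τ : ℍ) (c : Cusp N Γ) (s : ℂ) : ℂ :=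
  (∑ j : Fin (cuspWidth Γ (σ c)),
    tileIntegral N L f (tileMat σ ⟨c, j⟩) (δ ⟨c, j⟩) (w ⟨c, j⟩) τ s) +
  cuspEps L Γ (σ c) / √N * tildeTheta N L (lineOf N (σ c)) d τ *
    (A c / (s - s') + B c / (s - (1 - s')))

variable (hN : 0 < N) (hL : IsEvenLattice N L) (hΓ : CongruenceSubgroup.IsCongruenceSubgroup Γ)
  (hf : IsWeakMaassForm Γ (s' * (1 - s')) f)
  (hAB : ∀ c, ∀ y : ℝ, 0 < y →
    constTerm Γ (σ c) f y = A c * (y : ℂ) ^ s' + B c * (y : ℂ) ^ (1 - s'))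
  (hw : ∀ i, IsThetaExpansion N L d (tileMat σ i) (δ i) (w i))

include hN hf hw

lemma tileIntegral_properties [Fintype (Cusp N Γ)] (τ : ℍ) (i : Tile N Γ σ) :
    (∀ s : ℂ, IntegrableOn (fun z : ℍ => tileForm N L f (tileMat σ i) z *
      cutSeries N (δ i) (cuspBeta L (tileMat σ i)) (w i) τ z * (z.im : ℂ) ^ (-s)) ModularGroup.fd) ∧
    Differentiable ℂ (tileIntegral N L f (tileMat σ i) (δ i) (w i) τ) := by
  obtain ⟨K, C, hK, hg⟩ := growth_tileForm (L := L) (σ := σ) hf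
  exact differentiable_integral_cutSeries (Nat.cast_pos.mpr hN) (hw i).pos (hw i).pos_beta τ.im_pos
    (hw i).norm_le hK (contDiffOn_tileForm hf.smooth _).continuousOn (hg i)

include hL hΓ hAB

/-- On each tile the constant term of the theta function is split off above height `1`. Summed over
the tiles of the cusp, the split parts contain `f` only through its constant term, which is known
explicitly. -/
lemma truncIntegral_eq (τ : ℍ) (c : Cusp N Γ) (s : ℂ) {T : ℝ} (hT : 1 ≤ T) :
    truncIntegral N L Γ (σ c) f d τ s T =
      (∑ j : Fin (cuspWidth Γ (σ c)), ∫ z in fdT T, tileForm N L f (tileMat σ ⟨c, j⟩) z *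
        cutSeries N (δ ⟨c, j⟩) (cuspBeta L (tileMat σ ⟨c, j⟩)) (w ⟨c, j⟩) τ z * (z.im : ℂ) ^ (-s)) +
      cuspEps L Γ (σ c) / √N * tildeTheta N L (lineOf N (σ c)) d τ *
        ∫ y in (1 : ℝ)..T, ((y⁻¹ : ℝ) : ℂ) * (y : ℂ) ^ (-s) *
          (A c * (y : ℂ) ^ s' + B c * (y : ℂ) ^ (1 - s')) := by
  have hN' : (0 : ℝ) < N := Nat.cast_pos.mpr hN
  have hc : ∀ {H : ℍ → ℂ}, IsSmooth H → Continuous fun z : ℍ => H (σ c • z) := fun hH => by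
    refine ((contDiffOn_translate hH (σ c)).continuousOn.comp_continuous
      UpperHalfPlane.continuous_coe fun z : ℍ => z.im_pos).congr fun z => ?_
    rw [Function.comp_apply, translate_coe]
  have hcy : Continuous fun z : ℍ => (z.im : ℂ) ^ (-s) :=
    (continuousOn_ofReal_cpow (-s)).comp_continuous UpperHalfPlane.continuous_im fun z => z.im_pos
  have h1 : ∀ j : Fin (cuspWidth Γ (σ c)), ∫ z in fdT T,
      f (σ c • ModularGroup.T ^ ((j : ℕ) : ℤ) • z) *
        theta N L d τ (σ c • ModularGroup.T ^ ((j : ℕ) : ℤ) • z) *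
        ((ModularGroup.T ^ ((j : ℕ) : ℤ) • z : ℍ).im : ℂ) ^ (-s) =
      (∫ z in fdT T, tileForm N L f (tileMat σ ⟨c, j⟩) z *
        cutSeries N (δ ⟨c, j⟩) (cuspBeta L (tileMat σ ⟨c, j⟩)) (w ⟨c, j⟩) τ z * (z.im : ℂ) ^ (-s)) +
      tildeTheta N L (lineOf N (σ c)) d τ * ∫ y in (1 : ℝ)..T, ((y⁻¹ : ℝ) : ℂ) * (y : ℂ) ^ (-s) *
        ∫ x in (-1 / 2 : ℝ)..(1 / 2), tileForm N L f (tileMat σ ⟨c, j⟩) ⟨x, y⟩ := by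
    intro j
    have hi := hw ⟨c, j⟩
    rw [← lineOf_tileMat ⟨c, j⟩, hi.tildeTheta_eq]
    refine Eq.trans ?_ (TileData.integral_mul_cutRem_eq (φ := fun y : ℝ => (y : ℂ) ^ (-s))
      (contDiffOn_tileForm hf.smooth _).continuousOn
      (hi.contDiffOn_thetaSeries hN (τ := τ)).continuousOn (continuousOn_ofReal_cpow _)
      (fun z hz => thetaSeries_eq_add hN' hi.pos hi.pos_beta τ.im_pos hi.norm_le hz) hT)
    refine integral_congr_ae (Eventually.of_forall fun z => ?_)
    have e := hi.mul_theta (f := f) (τ := τ) z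
    have h2 : tileMat σ ⟨c, j⟩ • z = σ c • ModularGroup.T ^ ((j : ℕ) : ℤ) • z := mul_smul _ _ _
    have h3 : (ModularGroup.T ^ ((j : ℕ) : ℤ) • z : ℍ).im = z.im := by
      rw [UpperHalfPlane.modular_T_zpow_smul, UpperHalfPlane.vadd_im]
    rw [h2] at e
    simp only [e, h3]
  rw [truncIntegral, setIntegral_truncDomain (h := fun z => f (σ c • z) *
    theta N L d τ (σ c • z) * (z.im : ℂ) ^ (-s)) (((hc hf.smooth).mul
    (hc (isSmooth_theta hN hL d τ))).mul hcy), Finset.sum_congr rfl fun j _ => h1 j,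
    Finset.sum_add_distrib, ← Finset.mul_sum, ← intervalIntegral.integral_finsetSum fun j _ =>
      TileData.intervalIntegrable_segment (contDiffOn_tileForm hf.smooth _)
        (continuousOn_ofReal_cpow _) hT]
  congr 1
  rw [mul_comm (cuspEps L Γ (σ c) / √N : ℂ), mul_assoc, ← intervalIntegral.integral_const_mul
    (cuspEps L Γ (σ c) / √N : ℂ)]
  congr 1
  refine intervalIntegral.integral_congr fun y hy => ?_
  rw [Set.uIcc_of_le hT] at hy
  have hy0 := zero_lt_one.trans_le hy.1
  rw [← Finset.mul_sum, sum_integral_tileForm hΓ hf.smooth hf.invariant c hy0, hAB c y hy0]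
  ring

lemma tendsto_truncIntegral [Fintype (Cusp N Γ)] (τ : ℍ) (c : Cusp N Γ) {s : ℂ}
    (h1 : s'.re < s.re) (h2 : (1 - s').re < s.re) :
    Tendsto (truncIntegral N L Γ (σ c) f d τ s) atTop
      (𝓝 (cuspIntegral L σ f s' A B d δ w τ c s)) := by
  refine Tendsto.congr' ((eventually_ge_atTop (1 : ℝ)).mono fun T hT =>
    (truncIntegral_eq hN hL hΓ hf hAB hw τ c s hT).symm) ?_
  exact (tendsto_finsetSum _ fun j _ => tendsto_setIntegral_fdT
    ((tileIntegral_properties hN hf hw τ ⟨c, j⟩).1 s)).add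
      ((tendsto_integral_const h1 h2).const_mul _)

/-- The tile integrals are entire in `s`, and the rest is rational with possible poles at `s'` and
`1 - s'`; the limits exist to the right of both points. Division by zero being zero agrees with the
constant term at `0` of `a / s`, so one formula covers all `s'`. -/
theorem isRegLiftValue [Fintype (Cusp N Γ)] (τ : ℍ) : IsRegLiftValue N L Γ σ f d τ
    ((∑ i, tileIntegral N L f (tileMat σ i) (δ i) (w i) τ 0) -
      ∑ c, cuspEps L Γ (σ c) / √N * tildeTheta N L (lineOf N (σ c)) d τ *
        (A c / s' + B c / (1 - s'))) := by
  have ha : ∀ (i : Tile N Γ σ) s, AnalyticAt ℂ (tileIntegral N L f (tileMat σ i) (δ i) (w i) τ) s :=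
    fun i s => (tileIntegral_properties hN hf hw τ i).2.analyticAt s
  refine ⟨fun s => ∑ c, cuspIntegral L σ f s' A B d δ w τ c s, ⟨fun s => ?_,
    max s'.re (1 - s').re, fun s hs => ⟨fun c => cuspIntegral L σ f s' A B d δ w τ c s, fun c =>
      tendsto_truncIntegral hN hL hΓ hf hAB hw τ c ((le_max_left _ _).trans_lt hs)
        ((le_max_right _ _).trans_lt hs), (finsum_eq_sum_of_fintype _).symm⟩⟩, ?_⟩
  · refine MeromorphicAt.fun_sum fun c _ => ?_
    refine MeromorphicAt.fun_add (MeromorphicAt.fun_sum fun j _ => (ha ⟨c, j⟩ s).meromorphicAt) ?_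
    fun_prop
  · rw [Fintype.sum_sigma, ← Finset.sum_sub_distrib]
    refine HasLaurentConstTerm.sum _ fun c _ => ?_
    rw [sub_eq_add_neg]
    refine (HasLaurentConstTerm.sum _ fun j _ =>
      HasLaurentConstTerm.of_analyticAt (ha ⟨c, j⟩ 0)).add ?_
    have h1 := (hasLaurentConstTerm_div (cuspEps L Γ (σ c) / √N *
      tildeTheta N L (lineOf N (σ c)) d τ * A c) s').add (hasLaurentConstTerm_div
        (cuspEps L Γ (σ c) / √N * tildeTheta N L (lineOf N (σ c)) d τ * B c) (1 - s'))
    convert h1 using 1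
    · funext s
      ring
    · ring

end

end ThetaLift

end

noncomputable section

namespace ThetaLift

/-! ### The Laplacian of the regularized theta lift -/

section

variable {N : ℕ} {L : AddSubgroup V} {Γ : Subgroup SL(2, ℤ)} {σ : Cusp N Γ → SL(2, ℤ)}
  {s' : ℂ} {f : ℍ → ℂ} {A B : Cusp N Γ → ℂ} {d : Disc N L}

lemma tileIntegral_zero (N : ℕ) (L : AddSubgroup V) (f : ℍ → ℂ) (g : SL(2, ℤ)) (δ : ℝ)
    (w : ℤ × ℤ × ℤ → ℂ) (τ : ℍ) : tileIntegral N L f g δ w τ 0 =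
      ∫ z : ℍ in ModularGroup.fd, tileForm N L f g z * cutSeries N δ (cuspBeta L g) w τ z := by
  simp [tileIntegral]

lemma tileIntegral_zero_eq (N : ℕ) (L : AddSubgroup V) (f : ℍ → ℂ) (g : SL(2, ℤ)) (δ : ℝ)
    (w : ℤ × ℤ × ℤ → ℂ) (τ : ℍ) : tileIntegral N L f g δ w τ 0 =
      thetaIntegral N δ (cuspBeta L g) (volume.restrict ModularGroup.fd)
        (fun z => tileForm N L f g z) (cutWeight w) τ := by
  simp only [tileIntegral_zero, thetaIntegral, tsum_cutWeight]

variable (hN : 0 < N) (hL : IsEvenLattice N L) (hΓ : CongruenceSubgroup.IsCongruenceSubgroup Γ)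
  (hΓL : ActsTriviallyOnDisc N L Γ)
  (hσ : ∀ c, (Quotient.mk (cuspSetoid N Γ) (lineOf N (σ c)) : Cusp N Γ) = c)
  (hf : IsWeakMaassForm Γ (s' * (1 - s')) f)
  (hAB : ∀ c, ∀ y : ℝ, 0 < y →
    constTerm Γ (σ c) f y = A c * (y : ℂ) ^ s' + B c * (y : ℂ) ^ (1 - s'))

include hN hL hΓ hΓL hσ hf hAB

/-- `I` is the sum of the tile integrals at `s = 0`. The correction by unary theta functions is
smooth and annihilated by the Laplacian, so the Laplacian of the lift is that of `I`, and Green's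
identity computes it. The formula keeps `I` in place of the lift so that it holds for every `s'`. -/
theorem regLift_properties [Fintype (Cusp N Γ)] (d : Disc N L) : ∃ I : ℍ → ℂ,
    (∀ τ, IsRegLiftValue N L Γ σ f d τ (I τ - ∑ c, cuspEps L Γ (σ c) / √N *
      tildeTheta N L (lineOf N (σ c)) d τ * (A c / s' + B c / (1 - s')))) ∧
    IsSmooth (regLift N L Γ σ f d) ∧
    ∀ τ, 4 * hypLaplacian (1 / 2) (regLift N L Γ σ f d) τ = s' * (1 - s') * I τ -
      ((1 - s') * (∑ c, A c * cuspEps L Γ (σ c) / √N * tildeTheta N L (lineOf N (σ c)) d τ) +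
        s' * ∑ c, B c * cuspEps L Γ (σ c) / √N * tildeTheta N L (lineOf N (σ c)) d τ) := by
  have hN' : (0 : ℝ) < N := Nat.cast_pos.mpr hN
  choose δ w hw using fun i : Tile N Γ σ => exists_isThetaExpansion hN hL d (tileMat σ i)
  choose δ' w' hw' using fun c : Cusp N Γ => exists_isThetaExpansion hN hL d (σ c)
  obtain ⟨K, C, hK, hg⟩ := growth_tileForm (L := L) (σ := σ) hf
  have hdata := fun i : Tile N Γ σ => thetaData_tile (hw i).norm_le
    (contDiffOn_tileForm hf.smooth (tileMat σ i)).continuousOn (hg i)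
  set q : Cusp N Γ → ℂ := fun c => cuspEps L Γ (σ c) / √N * (A c / s' + B c / (1 - s')) with hq
  -- The lift is a finite linear combination of functions of `τ`: one integral for each tile and one
  -- unary theta function for each cusp. The latter use expansions at the matrices `σ c` themselves.
  set P : Tile N Γ σ ⊕ Cusp N Γ → ℂ → ℂ := Sum.elim
    (fun i => thetaIntegral N (δ i) (cuspBeta L (tileMat σ i)) (volume.restrict ModularGroup.fd)
      (fun z => tileForm N L f (tileMat σ i) z) (cutWeight (w i)))
    (fun c => thetaConst N (δ' c) (cuspBeta L (σ c)) (w' c)) with hP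
  set a : Tile N Γ σ ⊕ Cusp N Γ → ℂ := Sum.elim (fun _ => 1) (fun c => -q c) with ha
  have hPs : ∀ k, ContDiffOn ℝ ∞ (P k) {t | 0 < t.im} := by
    rintro (i | c)
    · exact (hdata i).contDiffOn hN' (hw i).pos (hw i).pos_beta
    · exact (thetaConst_lap hN' (hw' c).pos (hw' c).pos_beta (hw' c).norm_le).1
  have hval : ∀ τ : ℍ, (∑ i, tileIntegral N L f (tileMat σ i) (δ i) (w i) τ 0) -
      ∑ c, cuspEps L Γ (σ c) / √N * tildeTheta N L (lineOf N (σ c)) d τ *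
        (A c / s' + B c / (1 - s')) = ∑ k, a k * P k τ := by
    intro τ
    rw [Fintype.sum_sum_type, sub_eq_add_neg, ← Finset.sum_neg_distrib]
    congr 1
    · exact Finset.sum_congr rfl fun i _ => by simp [ha, hP, tileIntegral_zero_eq]
    · refine Finset.sum_congr rfl fun c _ => ?_
      simp only [ha, hP, Sum.elim_inr, hq, (hw' c).tildeTheta_eq]
      ring
  have hreg : ∀ τ : ℍ, regLift N L Γ σ f d τ = ∑ k, a k * P k τ := fun τ =>
    (regLift_eq (isRegLiftValue hN hL hΓ hf hAB hw τ)).trans (hval τ)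
  have heq : Set.EqOn (regLift N L Γ σ f d ∘ UpperHalfPlane.ofComplex) (fun t => ∑ k, a k * P k t)
      {t | 0 < t.im} := fun t ht => by
    rw [Function.comp_apply, hreg, UpperHalfPlane.ofComplex_apply_of_im_pos ht]
  refine ⟨fun τ => ∑ i, tileIntegral N L f (tileMat σ i) (δ i) (w i) τ 0,
    fun τ => isRegLiftValue hN hL hΓ hf hAB hw τ,
    (ContDiffOn.sum fun k _ => contDiffOn_const.mul (hPs k)).congr heq, fun τ => ?_⟩
  have hl : ∀ i, 4 * lap (1 / 2) (P (Sum.inl i)) τ = ∫ z : ℍ in ModularGroup.fd,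
      tileForm N L f (tileMat σ i) z *
        lap 0 (thetaSeries N (δ i) (cuspBeta L (tileMat σ i)) (w i) τ) z := fun i => by
    have h1 := ((hdata i).lap_eq hN' (hw i).pos (hw i).pos_beta τ.im_pos).2
    simp only [tsum_cutWeight_symbolZ hN' (hw i).pos (hw i).pos_beta τ.im_pos (hw i).norm_le] at h1
    exact h1
  have hr : ∀ c, lap (1 / 2) (P (Sum.inr c)) τ = 0 := fun c =>
    (thetaConst_lap hN' (hw' c).pos (hw' c).pos_beta (hw' c).norm_le).2 τ τ.im_pos
  obtain ⟨K', C', ρ, htile⟩ := exists_tileData hN hL hΓ hΓL hσ hf hAB hw τ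
  rw [hypLaplacian_eq_lap, lap_congr _ heq τ.im_pos, lap_sum_mul _ a hPs τ.im_pos,
    Fintype.sum_sum_type]
  simp only [hr, mul_zero, Finset.sum_const_zero, add_zero, ha, Sum.elim_inl, one_mul,
    Finset.mul_sum, hl]
  simp only [← Finset.mul_sum, tileIntegral_zero]
  refine htile.identity (fun i => ?_) fun i => ?_
  · have h1 := ((hdata i).lap_eq hN' (hw i).pos (hw i).pos_beta τ.im_pos).1
    simp only [tsum_cutWeight_symbolZ hN' (hw i).pos (hw i).pos_beta τ.im_pos (hw i).norm_le] at h1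
    exact h1
  · have h1 := (tileIntegral_properties hN hf hw τ i).1 0
    simp only [neg_zero, Complex.cpow_zero, mul_one] at h1
    exact h1

end

end ThetaLift

end

/-! ### The differential equation of the lift -/

open ThetaLift in
theorem mainTheorem6 (N : ℕ) (hN : 0 < N) (L : AddSubgroup V) (hL : IsEvenLattice N L)
    (Γ : Subgroup SL(2, ℤ)) (hΓ : CongruenceSubgroup.IsCongruenceSubgroup Γ)
    (hΓL : ActsTriviallyOnDisc N L Γ)
    (σ : Cusp N Γ → SL(2, ℤ))
    (hσ : ∀ c, (Quotient.mk (cuspSetoid N Γ) (lineOf N (σ c)) : Cusp N Γ) = c)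
    (s' : ℂ) (f : ℍ → ℂ) (hf : IsWeakMaassForm Γ (s' * (1 - s')) f)
    (A B : Cusp N Γ → ℂ)
    (hAB : ∀ c, ∀ y : ℝ, 0 < y →
      constTerm Γ (σ c) f y = A c * (y : ℂ) ^ s' + B c * (y : ℂ) ^ (1 - s')) :
    (∀ h τ, ∃ b, IsRegLiftValue N L Γ σ f h τ b) ∧
    (∀ h, IsSmooth (regLift N L Γ σ f h)) ∧
    (s' ≠ 0 → s' ≠ 1 → ∀ h τ,
      4 * hypLaplacian (1 / 2) (regLift N L Γ σ f h) τ =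
        s' * (1 - s') * regLift N L Γ σ f h τ) ∧
    (s' = 0 → ∀ h τ,
      4 * hypLaplacian (1 / 2) (regLift N L Γ σ f h) τ =
        -∑ᶠ c, A c * cuspEps L Γ (σ c) / (√(N : ℝ) : ℂ) *
          tildeTheta N L (lineOf N (σ c)) h τ) ∧
    (s' = 1 → ∀ h τ,
      4 * hypLaplacian (1 / 2) (regLift N L Γ σ f h) τ =
        -∑ᶠ c, B c * cuspEps L Γ (σ c) / (√(N : ℝ) : ℂ) *
          tildeTheta N L (lineOf N (σ c)) h τ) := by
  have := (tile_finite hΓ σ hσ).2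
  have := Fintype.ofFinite (Cusp N Γ)
  have key := regLift_properties hN hL hΓ hΓL hσ hf hAB
  choose I hI hs hl using key
  refine ⟨fun h τ => ⟨_, hI h τ⟩, hs, fun h0 h1 h τ => ?_, ?_, ?_⟩
  · have h1' : 1 - s' ≠ 0 := sub_ne_zero.mpr h1.symm
    rw [hl, regLift_eq (hI h τ), mul_sub (s' * (1 - s')), Finset.mul_sum, Finset.mul_sum, Finset.mul_sum,
      ← Finset.sum_add_distrib]
    congr 1
    refine Finset.sum_congr rfl fun c _ => ?_
    field_simp
  -- The eigenvalue and the factor of `B` vanish; only the sum of the `A` survives.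
  · rintro rfl h τ
    rw [hl, finsum_eq_sum_of_fintype]
    ring
  · rintro rfl h τ
    rw [hl, finsum_eq_sum_of_fintype]
    ring
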